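/- Let $G=(V,E)$ be an undirected graph with $n$ vertices, $m$ edges (parallel edges and loops allowed) and non-negative integer edge weights at most $w_{\max}$. For $S\subseteq V$ let $\delta(S)$ be the total weight of the edges with exactly one endpoint in $S$. A set $S$ is \emph{extreme} if it is a singleton, or if $\emptyset\ne S\subsetneq V$ and $\delta(U)>\delta(S)$ for every nonempty proper subset $U$ of $S$. A family of nonempty vertex sets is \emph{laminar} if any two members are disjoint or nested. A laminar family $\mathcal F$ is given by a rooted tree with parent pointers, in which every vertex of $V$ is associated with exactly one node (a node may have no associated vertices); the set of a node consists of all vertices associated with nodes of its subtree, and the non-root nodes correspond one-to-one to the members of $\mathcal F$. A \emph{bough} of $\mathcal F$ is a path of its tree that starts at a leaf, goes toward the root and stops before the first node with more than one child. A set $U$ is \emph{consistent} with $\mathcal F$ if $\delta(U\setminus W)>\delta(U)$ for every $W\in\mathcal F$ with $U\cap W\neq\emptyset$ and $U\setminus W\neq\emptyset$. For laminar families $\mathcal X,\mathcal Y$, the procedure $\mathrm{Verify}(\mathcal X,\mathcal Y)$ starts with empty output and repeats the following until $\mathcal X$ is empty: choose a bough of the current $\mathcal X$, add its members that are consistent with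 $\mathcal Y$ to the output, and remove the bough from $\mathcal X$. \textbf{Lemma.} Let $\mathcal X,\mathcal Y$ be laminar families of nonempty subsets of $V$. In whatever order the boughs are processed, $\mathrm{Verify}(\mathcal X,\mathcal Y)$ returns exactly $$\mathcal X^*=\{U\in\mathcal X:\ U\text{ is consistent with }\mathcal Y\},$$ and $\mathrm{Verify}(\mathcal Y,\mathcal X)$ returns exactly $\mathcal Y^*=\{U\in\mathcal Y: U\text{ is consistent with }\mathcal X\}$. The family $R=\mathcal X^*\cup\mathcal Y^*\subseteq\mathcal X\cup\mathcal Y$ is laminar and contains every extreme set that belongs to $\mathcal X\cup\mathcal Y$. Moreover $R$ can be computed in $\tilde O(n+m)$ time (which is $\tilde O(m)$ when $G$ is connected): there are a single program for a random access machine with integer variables and arrays and with logarithmic cost (every handled integer is charged its bit length), and absolute constants $C,k$, such that for all $G,\mathcal X,\mathcal Y$ and all trees representing $\mathcal X$ and $\mathcal Y$, the program, given the edge list of $G$ and the two trees, halts after time at most $$C\,(n+m+1)\,\bigl\lfloor\log_2(n+m+w_{\max}+2)\bigr\rfloor^{k}$$ and outputs a tree that represents $R$. -/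

import Mathlib

namespace LaminarMerge

/-! ## Weighted graphs, cuts, extreme sets -/

/-- A weighted undirected edge on the vertex set `{0, …, n - 1}`. -/
structure WEdge (n : ℕ) where
  src : Fin n
  tgt : Fin n
  wt : ℕ

/-- A weighted undirected graph with vertex set `Fin n`, given by its list of edges
(parallel edges and loops are allowed). -/
structure WGraph (n : ℕ) where
  edges : List (WEdge n)

/-- The number of edges. -/
def WGraph.m {n : ℕ} (G : WGraph n) : ℕ := G.edges.length

/-- The cut value `δ(S)`: the total weight of the edges with exactly one endpoint in `S`. -/
def WGraph.cut {n : ℕ} (G : WGraph n) (S : Finset (Fin n)) : ℕ :=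
  ((G.edges.filter (fun e => (e.src ∈ S ∧ e.tgt ∉ S) ∨ (e.src ∉ S ∧ e.tgt ∈ S))).map
    WEdge.wt).sum

/-- `S` is extreme: it is a singleton, or it is a nonempty proper subset of the vertex set all of
whose nonempty proper subsets have a strictly larger cut value. -/
def WGraph.IsExtreme {n : ℕ} (G : WGraph n) (S : Finset (Fin n)) : Prop :=
  S.card = 1 ∨
    (S.Nonempty ∧ S ≠ Finset.univ ∧
      ∀ U : Finset (Fin n), U.Nonempty → U ⊂ S → G.cut S < G.cut U)

/-! ## Laminar families, boughs, and the set-level algorithm -/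

/-- A laminar family of nonempty vertex sets. -/
def IsLaminar {n : ℕ} (F : Finset (Finset (Fin n))) : Prop :=
  (∀ A ∈ F, A.Nonempty) ∧ ∀ A ∈ F, ∀ B ∈ F, Disjoint A B ∨ A ⊆ B ∨ B ⊆ A

/-- The children of `U` in the tree of the family `F`: the maximal members of `F` that are
proper subsets of `U`. -/
def children {n : ℕ} (F : Finset (Finset (Fin n))) (U : Finset (Fin n)) :
    Finset (Finset (Fin n)) :=
  F.filter (fun Z => Z ⊂ U ∧ ∀ Z' ∈ F, Z ⊂ Z' → ¬ Z' ⊂ U)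

/-- `B` is a bough of `F`: the path that starts at a leaf `L`, goes toward the root, and stops
before the first node with more than one child. -/
def IsBough {n : ℕ} (F B : Finset (Finset (Fin n))) : Prop :=
  ∃ L ∈ F, children F L = ∅ ∧
    B = F.filter (fun U => L ⊆ U ∧ ∀ Z ∈ F, L ⊆ Z → Z ⊆ U → (children F Z).card ≤ 1)

/-- `U` is consistent with the family `Y`: every member `W` of `Y` which meets `U` and does not
contain `U` satisfies `δ(U ∖ W) > δ(U)`. -/
def WGraph.Consistent {n : ℕ} (G : WGraph n) (U : Finset (Fin n))
    (Y : Finset (Finset (Fin n))) : Prop :=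
  ∀ W ∈ Y, (U ∩ W).Nonempty → (U \ W).Nonempty → G.cut U < G.cut (U \ W)

instance {n : ℕ} (G : WGraph n) (U : Finset (Fin n)) (Y : Finset (Finset (Fin n))) :
    Decidable (G.Consistent U Y) := by
  unfold WGraph.Consistent; infer_instance

/-- The prescribed output of `Verify(X, Y)`: the members of `X` that are consistent with `Y`. -/
def WGraph.verify {n : ℕ} (G : WGraph n) (X Y : Finset (Finset (Fin n))) :
    Finset (Finset (Fin n)) :=
  X.filter (fun U => G.Consistent U Y)

/-- One iteration of the loop of `Verify( · , Y)`. The state is a pair (current family,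
collected output). Some bough `B` of the current family is removed from it, and the members of `B`
that are consistent with `Y` are added to the output. -/
def WGraph.VerifyStep {n : ℕ} (G : WGraph n) (Y : Finset (Finset (Fin n)))
    (p q : Finset (Finset (Fin n)) × Finset (Finset (Fin n))) : Prop :=
  ∃ B, IsBough p.1 B ∧ q.1 = p.1 \ B ∧ q.2 = p.2 ∪ B.filter (fun U => G.Consistent U Y)

/-- The loop of `Verify(X, Y)`, started with the family `X` and empty output, can reach the empty
family with output `A` (for some choice of the order in which boughs are processed). -/
def WGraph.VerifyReturns {n : ℕ} (G : WGraph n) (X Y A : Finset (Finset (Fin n))) : Prop :=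
  Relation.ReflTransGen (G.VerifyStep Y) (X, ∅) (∅, A)

/-! ## Linear-size tree representation of laminar families -/

/-- A rooted tree with non-root nodes `Fin size`: `parent i = none` means that the parent of `i` is
the root. Each vertex `v` is associated with exactly one node, `home v` (`none` is the root). -/
structure LTree (n : ℕ) where
  size : ℕ
  parent : Fin size → Option (Fin size)
  home : Fin n → Option (Fin size)

/-- `T.Below i j`: the node `i` lies in the subtree rooted at the node `j`. -/
def LTree.Below {n : ℕ} (T : LTree n) : Fin T.size → Fin T.size → Prop :=
  Relation.ReflTransGen (fun a b => T.parent a = some b)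

open Classical in
/-- The vertex set of node `i`: all vertices associated with a node of the subtree of `i`. -/
noncomputable def LTree.nodeSet {n : ℕ} (T : LTree n) (i : Fin T.size) : Finset (Fin n) :=
  Finset.univ.filter (fun v => ∃ a, T.home v = some a ∧ T.Below a i)

/-- `T` represents the family `F`: parent pointers have no cycle, and the non-root nodes
correspond one-to-one to the members of `F`. -/
structure LTree.Represents {n : ℕ} (T : LTree n) (F : Finset (Finset (Fin n))) : Prop where
  acyclic : ∀ i, ¬ Relation.TransGen (fun a b => T.parent a = some b) i i
  injective : Function.Injective T.nodeSet
  range_eq : Set.range T.nodeSet = (F : Set (Finset (Fin n)))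

/-! ## A random access machine with logarithmic cost -/

/-- A memory: integer variables and integer arrays, both named by natural numbers. A program
mentions only finitely many of them. -/
structure Mem where
  var : ℕ → ℤ
  arr : ℕ → ℤ → ℤ

/-- Arithmetic expressions; `get a i` reads the entry with index `i` of array `a`. -/
inductive Expr where
  | const (z : ℤ)
  | var (x : ℕ)
  | get (a : ℕ) (i : Expr)
  | add (e f : Expr)
  | sub (e f : Expr)
  | mul (e f : Expr)
  | div (e f : Expr)

/-- The value of an expression (`div` is integer division, with value `0` on divisor `0`). -/
def Expr.eval (s : Mem) : Expr → ℤ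
  | .const z => z
  | .var x => s.var x
  | .get a i => s.arr a (i.eval s)
  | .add e f => e.eval s + f.eval s
  | .sub e f => e.eval s - f.eval s
  | .mul e f => e.eval s * f.eval s
  | .div e f => e.eval s / f.eval s

/-- The cost of handling one integer: its length in bits, plus one. -/
def bits (z : ℤ) : ℕ := z.natAbs.size + 1

/-- The logarithmic cost of evaluating an expression: the sum of the bit lengths of the values of
all its subexpressions. -/
def Expr.cost (s : Mem) : Expr → ℕ
  | .const z => bits z
  | .var x => bits (s.var x)
  | .get a i => i.cost s + bits (s.arr a (i.eval s))
  | .add e f => e.cost s + f.cost s + bits (e.eval s + f.eval s)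
  | .sub e f => e.cost s + f.cost s + bits (e.eval s - f.eval s)
  | .mul e f => e.cost s + f.cost s + bits (e.eval s * f.eval s)
  | .div e f => e.cost s + f.cost s + bits (e.eval s / f.eval s)

/-- Tests. -/
inductive Cond where
  | le (e f : Expr)
  | neg (c : Cond)
  | conj (c d : Cond)

def Cond.Holds (s : Mem) : Cond → Prop
  | .le e f => e.eval s ≤ f.eval s
  | .neg c => ¬ c.Holds s
  | .conj c d => c.Holds s ∧ d.Holds s

def Cond.cost (s : Mem) : Cond → ℕ
  | .le e f => e.cost s + f.cost s + 1
  | .neg c => c.cost s + 1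
  | .conj c d => c.cost s + d.cost s + 1

/-- Programs. -/
inductive Prog where
  | skip
  | assign (x : ℕ) (e : Expr)
  | put (a : ℕ) (i e : Expr)
  | seq (p q : Prog)
  | ite (c : Cond) (p q : Prog)
  | loop (c : Cond) (p : Prog)

/-- `x := z`. -/
def Mem.setVar (s : Mem) (x : ℕ) (z : ℤ) : Mem :=
  { s with var := Function.update s.var x z }

/-- `a[i] := z`. -/
def Mem.setArr (s : Mem) (a : ℕ) (i z : ℤ) : Mem :=
  { s with arr := Function.update s.arr a (Function.update (s.arr a) i z) }

/-- `Exec p s s' t`: the program `p`, started in memory `s`, halts in memory `s'` after time `t`. -/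
inductive Exec : Prog → Mem → Mem → ℕ → Prop
  | skip (s : Mem) : Exec .skip s s 1
  | assign (s : Mem) (x : ℕ) (e : Expr) :
      Exec (.assign x e) s (s.setVar x (e.eval s)) (e.cost s + 1)
  | put (s : Mem) (a : ℕ) (i e : Expr) :
      Exec (.put a i e) s (s.setArr a (i.eval s) (e.eval s)) (i.cost s + e.cost s + 1)
  | seq {p q : Prog} {s s' s'' : Mem} {t t' : ℕ} :
      Exec p s s' t → Exec q s' s'' t' → Exec (.seq p q) s s'' (t + t')
  | iteTrue {c : Cond} {p q : Prog} {s s' : Mem} {t : ℕ} :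
      c.Holds s → Exec p s s' t → Exec (.ite c p q) s s' (c.cost s + t + 1)
  | iteFalse {c : Cond} {p q : Prog} {s s' : Mem} {t : ℕ} :
      ¬ c.Holds s → Exec q s s' t → Exec (.ite c p q) s s' (c.cost s + t + 1)
  | loopDone {c : Cond} {p : Prog} {s : Mem} :
      ¬ c.Holds s → Exec (.loop c p) s s (c.cost s + 1)
  | loopStep {c : Cond} {p : Prog} {s s' s'' : Mem} {t t' : ℕ} :
      c.Holds s → Exec p s s' t → Exec (.loop c p) s' s'' t' →
        Exec (.loop c p) s s'' (c.cost s + t + t' + 1)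

/-! ## Input and output conventions -/

/-- A node as an integer; the root is `-1`. -/
def code {k : ℕ} : Option (Fin k) → ℤ
  | none => -1
  | some i => ((i : ℕ) : ℤ)

/-- The array with entries `l[0], l[1], …`, and `0` elsewhere. -/
def arrayOf (l : List ℤ) : ℤ → ℤ := fun i => if 0 ≤ i then l.getD i.toNat 0 else 0

/-- The initial memory on input a graph and two trees. Variables `0, 1, 2, 3` hold the numbers of
vertices, of edges, and of non-root nodes of the two trees. Arrays `0, 1, 2` hold the edge list,
arrays `3, 4` and `5, 6` the parent and home pointers of the two trees. All else is `0`. -/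
def inputMem {n : ℕ} (G : WGraph n) (S T : LTree n) : Mem where
  var
    | 0 => (n : ℤ)
    | 1 => (G.m : ℤ)
    | 2 => (S.size : ℤ)
    | 3 => (T.size : ℤ)
    | _ => 0
  arr
    | 0 => arrayOf (G.edges.map (fun e => ((e.src : ℕ) : ℤ)))
    | 1 => arrayOf (G.edges.map (fun e => ((e.tgt : ℕ) : ℤ)))
    | 2 => arrayOf (G.edges.map (fun e => (e.wt : ℤ)))
    | 3 => arrayOf (List.ofFn (fun i => code (S.parent i)))
    | 4 => arrayOf (List.ofFn (fun v => code (S.home v)))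
    | 5 => arrayOf (List.ofFn (fun i => code (T.parent i)))
    | 6 => arrayOf (List.ofFn (fun v => code (T.home v)))
    | _ => fun _ => 0

/-- The memory `s` contains the tree `R` as output: variable `4` holds the number of non-root nodes,
and arrays `7, 8` hold the parent and home pointers. -/
def HasOutput {n : ℕ} (s : Mem) (R : LTree n) : Prop :=
  s.var 4 = (R.size : ℤ) ∧
    (∀ i : Fin R.size, s.arr 7 ((i : ℕ) : ℤ) = code (R.parent i)) ∧
    ∀ v : Fin n, s.arr 8 ((v : ℕ) : ℤ) = code (R.home v)

end LaminarMerge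

namespace LaminarMerge

/-! ## Uniform cost bounds for programs on bounded memories -/

/-! The set-level claims rest on two facts about cuts. The first is `cut_sdiff_add_cut_sdiff_le`:
δ(U∖W) + δ(W∖U) ≤ δ(U) + δ(W). If U ∈ X and W ∈ Y met without being nested, their consistency would
give δ(U∖W) > δ(U) and δ(W∖U) > δ(W), against this inequality; hence the union of the two outputs is
laminar. The second: if U is extreme and W meets U without containing it, then U∖W is a nonempty
proper subset of U, so U is consistent with every family (`IsExtreme.consistent`). The order of the
boughs is irrelevant because members are tested against a family that never changes: the output so
far together with the consistent members still waiting is an invariant (`verifyStep_invariant`), and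
the loop ends because boughs are nonempty.

The program therefore need not follow boughs. It decides consistency for all nodes U of X at once,
from the minimum over the nodes W of Y of one integer `cval`, which is nonnegative exactly when W
does not refute U. This integer combines |U ∩ W|, the difference δ(U∖W) − δ(U) and the indicator of
U ⊆ W. The first two are sums, over vertices and edges, of products of indicators of v ∈ U and v ∈
W, and v ∈ U means that U lies on the path from the home of v to the root. The third has the same
shape once the smallest superset z(U) of U in Y is known: U ⊆ W iff W lies on the root path of z(U).
The map z comes from an earlier minimisation, of `zval`, in which intersection size, set size and
node number are packed into one integer (`smallest_superset`).

Both minimisations use the same data structure. Heavy paths number the nodes so that every root path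
is a disjoint union of at most L intervals of positions, L being logarithmic
(`Chains.sum_intervals`). A product of root path indicators then becomes a sum of L^4 rectangles in
the plane with coordinates (position of U, position of W). A rectangle is four point events
(`addRect_spec`), and the wanted values are two-dimensional prefix sums. A sweep along the first
coordinate, with a segment tree that keeps block sums and minimal prefix sums over the second,
yields the minimum of every row (`sweep_spec`). Subtree sizes and tops of heavy paths are found by
pointer doubling (`jump_spec`, `Forest.reachCount_succ`), so no traversal order of the trees is
needed.

Finally the consistent nodes are merged. A node of Y whose set also survives in X is dropped, and a
pointer leads to the smaller of two candidates, the nearest surviving ancestors in the two trees. By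
laminarity of the result the candidates are nested (`pick_smallest`), so pointers lead to smallest
supersets, and such pointers represent the family (`nodeSet_eq_of_smallest`).

Time is tracked by the total correctness calculus `WP`. Its bound is a product of a constant read
off the program text, a budget for loop iterations, and the bit length of a uniform bound on all
stored integers. With Z linear in the input magnitudes the integers stay below Z^12, so this bit
length is logarithmic. There are O((n + m) L^4) events, each processed by O(L) operations, and the
trees have at most 2n nodes by `IsLaminar.card_le`. Together with the bit length this gives the
exponent 6. -/

/-- Every stored integer has absolute value at most `B`. -/
def Bdd (B : ℕ) (s : Mem) : Prop :=
  (∀ x, |s.var x| ≤ (B : ℤ)) ∧ ∀ a i, |s.arr a i| ≤ (B : ℤ)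

/-- The bit cost of an integer of absolute value at most `B`. -/
def bitBound (B : ℕ) : ℕ := B.size + 1

theorem bits_le_bitBound {B : ℕ} {z : ℤ} (h : |z| ≤ (B : ℤ)) : bits z ≤ bitBound B := by
  unfold bits bitBound
  have : z.natAbs ≤ B := by rw [Int.abs_eq_natAbs] at h; exact_mod_cast h
  have := Nat.size_le_size this
  omega

theorem one_le_bitBound (B : ℕ) : 1 ≤ bitBound B := by unfold bitBound; omega

theorem size_add_le (a b : ℕ) : (a + b).size ≤ a.size + b.size + 1 := by
  rw [Nat.size_le]
  have ha := Nat.lt_size_self a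
  have hb := Nat.lt_size_self b
  have h1 : 2 ^ a.size ≤ 2 ^ (a.size + b.size) := Nat.pow_le_pow_right (by norm_num) (by omega)
  have h2 : 2 ^ b.size ≤ 2 ^ (a.size + b.size) := Nat.pow_le_pow_right (by norm_num) (by omega)
  rw [pow_succ]
  omega

theorem size_mul_le (a b : ℕ) : (a * b).size ≤ a.size + b.size := by
  rw [Nat.size_le, pow_add]
  exact Nat.mul_lt_mul'' (Nat.lt_size_self a) (Nat.lt_size_self b)

theorem bits_add_le (a b : ℤ) : bits (a + b) ≤ bits a + bits b := by
  unfold bits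
  have := Nat.size_le_size (Int.natAbs_add_le a b)
  have := size_add_le a.natAbs b.natAbs
  omega

theorem bits_neg (a : ℤ) : bits (-a) = bits a := by
  unfold bits; rw [Int.natAbs_neg]

theorem bits_sub_le (a b : ℤ) : bits (a - b) ≤ bits a + bits b := by
  have := bits_add_le a (-b)
  rwa [bits_neg, ← sub_eq_add_neg] at this

theorem bits_mul_le (a b : ℤ) : bits (a * b) ≤ bits a + bits b := by
  unfold bits
  rw [Int.natAbs_mul]
  have := size_mul_le a.natAbs b.natAbs
  omega

theorem bits_div_le (a b : ℤ) : bits (a / b) ≤ bits a := by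
  unfold bits
  have := Nat.size_le_size (Int.natAbs_ediv_le_natAbs a b)
  omega

/-- A coefficient for the bit length of the value of an expression. -/
def Expr.lv : Expr → ℕ
  | .const z => bits z
  | .var _ => 1
  | .get _ _ => 1
  | .add e f => e.lv + f.lv
  | .sub e f => e.lv + f.lv
  | .mul e f => e.lv + f.lv
  | .div e _ => e.lv

/-- A coefficient for the cost of an expression. -/
def Expr.ct : Expr → ℕ
  | .const z => bits z
  | .var _ => 1
  | .get _ i => i.ct + 1
  | .add e f => e.ct + f.ct + (e.lv + f.lv)
  | .sub e f => e.ct + f.ct + (e.lv + f.lv)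
  | .mul e f => e.ct + f.ct + (e.lv + f.lv)
  | .div e f => e.ct + f.ct + e.lv

/-- A coefficient for the cost of a test. -/
def Cond.ct : Cond → ℕ
  | .le e f => e.ct + f.ct + 1
  | .neg c => c.ct + 1
  | .conj c d => c.ct + d.ct + 1

/-- A coefficient for the cost of a program, each loop body being counted once. -/
def Prog.ct : Prog → ℕ
  | .skip => 1
  | .assign _ e => e.ct + 1
  | .put _ i e => i.ct + e.ct + 1
  | .seq p q => p.ct + q.ct
  | .ite c p q => c.ct + (p.ct + q.ct) + 1
  | .loop c p => c.ct + p.ct + 1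

/-- Bit lengths are subadditive under sum, difference and product and do not grow under division. So
intermediate values need no bound of their own: a coefficient that depends only on the expression
suffices. -/
theorem Expr.bits_eval_le {B : ℕ} {s : Mem} (hs : Bdd B s) (e : Expr) :
    bits (e.eval s) ≤ e.lv * bitBound B := by
  have hβ := one_le_bitBound B
  induction e with
  | const z => exact Nat.le_mul_of_pos_right _ hβ
  | var x => simpa [Expr.lv, Expr.eval] using bits_le_bitBound (hs.1 x)
  | get a i _ => simpa [Expr.lv, Expr.eval] using bits_le_bitBound (hs.2 a _)
  | add e f he hf =>
      have := bits_add_le (e.eval s) (f.eval s)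
      simp only [Expr.lv, Expr.eval, add_mul]; omega
  | sub e f he hf =>
      have := bits_sub_le (e.eval s) (f.eval s)
      simp only [Expr.lv, Expr.eval, add_mul]; omega
  | mul e f he hf =>
      have := bits_mul_le (e.eval s) (f.eval s)
      simp only [Expr.lv, Expr.eval, add_mul]; omega
  | div e f he hf =>
      have := bits_div_le (e.eval s) (f.eval s)
      simp only [Expr.lv, Expr.eval]; omega

theorem Expr.cost_le {B : ℕ} {s : Mem} (hs : Bdd B s) (e : Expr) :
    e.cost s ≤ e.ct * bitBound B := by
  have hβ := one_le_bitBound B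
  induction e with
  | const z => exact Nat.le_mul_of_pos_right _ hβ
  | var x => simpa [Expr.ct, Expr.cost] using bits_le_bitBound (hs.1 x)
  | get a i hi =>
      have := bits_le_bitBound (hs.2 a (i.eval s))
      simp only [Expr.cost, Expr.ct, add_mul, one_mul]; omega
  | add e f he hf =>
      have := Expr.bits_eval_le hs (.add e f)
      simp only [Expr.lv, Expr.eval, Expr.cost, Expr.ct, add_mul] at *; omega
  | sub e f he hf =>
      have := Expr.bits_eval_le hs (.sub e f)
      simp only [Expr.lv, Expr.eval, Expr.cost, Expr.ct, add_mul] at *; omega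
  | mul e f he hf =>
      have := Expr.bits_eval_le hs (.mul e f)
      simp only [Expr.lv, Expr.eval, Expr.cost, Expr.ct, add_mul] at *; omega
  | div e f he hf =>
      have := Expr.bits_eval_le hs (.div e f)
      simp only [Expr.lv, Expr.eval, Expr.cost, Expr.ct, add_mul] at *; omega

theorem Cond.cost_le {B : ℕ} {s : Mem} (hs : Bdd B s) (c : Cond) :
    c.cost s ≤ c.ct * bitBound B := by
  have hβ := one_le_bitBound B
  induction c with
  | le e f =>
      have := e.cost_le hs
      have := f.cost_le hs
      simp only [Cond.cost, Cond.ct, add_mul, one_mul]; omega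
  | neg c hc => simp only [Cond.cost, Cond.ct, add_mul, one_mul]; omega
  | conj c d hc hd => simp only [Cond.cost, Cond.ct, add_mul, one_mul]; omega

/-! ## Variables and arrays written by a program -/

/-- The variables assigned by a program. -/
def Prog.wv : Prog → List ℕ
  | .skip => []
  | .assign x _ => [x]
  | .put _ _ _ => []
  | .seq p q => p.wv ++ q.wv
  | .ite _ p q => p.wv ++ q.wv
  | .loop _ p => p.wv

/-- The arrays written by a program. -/
def Prog.wa : Prog → List ℕ
  | .skip => []
  | .assign _ _ => []
  | .put a _ _ => [a]
  | .seq p q => p.wa ++ q.wa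
  | .ite _ p q => p.wa ++ q.wa
  | .loop _ p => p.wa

/-- `s'` agrees with `s` outside the variables `V` and the arrays `A`. -/
def Agree (V A : List ℕ) (s s' : Mem) : Prop :=
  (∀ x, x ∉ V → s'.var x = s.var x) ∧ ∀ a, a ∉ A → s'.arr a = s.arr a

theorem Agree.refl (V A : List ℕ) (s : Mem) : Agree V A s s := ⟨fun _ _ => rfl, fun _ _ => rfl⟩

theorem Agree.trans {V A : List ℕ} {s s' s'' : Mem} (h : Agree V A s s') (h' : Agree V A s' s'') :
    Agree V A s s'' :=
  ⟨fun x hx => (h'.1 x hx).trans (h.1 x hx), fun a ha => (h'.2 a ha).trans (h.2 a ha)⟩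

theorem Agree.mono {V A V' A' : List ℕ} {s s' : Mem} (h : Agree V A s s') (hV : V ⊆ V')
    (hA : A ⊆ A') : Agree V' A' s s' :=
  ⟨fun x hx => h.1 x fun hx' => hx (hV hx'), fun a ha => h.2 a fun ha' => ha (hA ha')⟩

@[simp] theorem Mem.setVar_arr (s : Mem) (x : ℕ) (z : ℤ) : (s.setVar x z).arr = s.arr := rfl
@[simp] theorem Mem.setArr_var (s : Mem) (a : ℕ) (i z : ℤ) : (s.setArr a i z).var = s.var := rfl
@[simp] theorem Mem.setVar_var (s : Mem) (x y : ℕ) (z : ℤ) :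
    (s.setVar x z).var y = if y = x then z else s.var y := by
  simp [Mem.setVar, Function.update_apply]
@[simp] theorem Mem.setArr_arr (s : Mem) (a b : ℕ) (i z : ℤ) :
    (s.setArr a i z).arr b = if b = a then Function.update (s.arr a) i z else s.arr b := by
  simp [Mem.setArr, Function.update_apply]

/-- The frame rule. Since `wv` and `wa` are computable, each later use reduces to a list membership
settled by `decide`. -/
theorem Exec.agree {p : Prog} {s s' : Mem} {t : ℕ} (h : Exec p s s' t) :
    Agree p.wv p.wa s s' := by
  induction h with
  | skip s => exact Agree.refl _ _ _
  | assign s x e =>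
      refine ⟨fun y hy => ?_, fun a _ => rfl⟩
      simp only [Prog.wv, List.mem_singleton] at hy
      simp [hy]
  | put s a i e =>
      refine ⟨fun y _ => rfl, fun b hb => ?_⟩
      simp only [Prog.wa, List.mem_singleton] at hb
      simp [hb]
  | seq _ _ h1 h2 =>
      exact (h1.mono (List.subset_append_left _ _) (List.subset_append_left _ _)).trans
        (h2.mono (List.subset_append_right _ _) (List.subset_append_right _ _))
  | iteTrue _ _ h => exact h.mono (List.subset_append_left _ _) (List.subset_append_left _ _)
  | iteFalse _ _ h => exact h.mono (List.subset_append_right _ _) (List.subset_append_right _ _)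
  | loopDone _ => exact Agree.refl _ _ _
  | loopStep _ _ _ h1 h2 => exact Agree.trans h1 h2

/-! ## Total correctness with time bounds -/

/-- Started in `s`, the program halts, all values stay bounded by `B`, the time is at most
`p.ct * Y` bit costs, and the final memory satisfies `Q`. -/
def WP (B Y : ℕ) (p : Prog) (s : Mem) (Q : Mem → Prop) : Prop :=
  Bdd B s → ∃ s' t, Exec p s s' t ∧ t ≤ p.ct * Y * bitBound B ∧ Bdd B s' ∧ Q s'

/-- The consequence rule, with the frame supplied for free. Specifications therefore mention only
what a program changes, and everything else is recovered from the `Agree` hypothesis. -/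
theorem WP.mono {B Y : ℕ} {p : Prog} {s : Mem} {Q Q' : Mem → Prop} (h : WP B Y p s Q)
    (hQ : ∀ s', Agree p.wv p.wa s s' → Q s' → Q' s') : WP B Y p s Q' := fun hs => by
  obtain ⟨s', t, he, ht, hb, hq⟩ := h hs
  exact ⟨s', t, he, ht, hb, hQ s' he.agree hq⟩

/-- Exposes the boundedness that `WP` assumes of the initial memory. It is needed whenever a program
copies an entry about which nothing else is known. -/
theorem WP.of_bdd {B Y : ℕ} {p : Prog} {s : Mem} {Q : Mem → Prop} (h : Bdd B s → WP B Y p s Q) :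
    WP B Y p s Q := fun hs => h hs hs

theorem WP.skip {B Y : ℕ} (hY : 1 ≤ Y) {s : Mem} {Q : Mem → Prop} (hQ : Q s) :
    WP B Y .skip s Q := fun hs =>
  ⟨s, 1, .skip s, by
    have := one_le_bitBound B
    simpa [Prog.ct] using Nat.mul_le_mul hY this, hs, hQ⟩

theorem Bdd.setVar {B : ℕ} {s : Mem} (hs : Bdd B s) {x : ℕ} {z : ℤ} (hz : |z| ≤ (B : ℤ)) :
    Bdd B (s.setVar x z) := by
  refine ⟨fun y => ?_, hs.2⟩
  rw [Mem.setVar_var]; split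
  · exact hz
  · exact hs.1 y

theorem Bdd.setArr {B : ℕ} {s : Mem} (hs : Bdd B s) {a : ℕ} {i z : ℤ} (hz : |z| ≤ (B : ℤ)) :
    Bdd B (s.setArr a i z) := by
  refine ⟨hs.1, fun b j => ?_⟩
  rw [Mem.setArr_arr]; split
  · rw [Function.update_apply]; split
    · exact hz
    · exact hs.2 _ _
  · exact hs.2 _ _

theorem WP.assign {B Y : ℕ} (hY : 1 ≤ Y) {x : ℕ} {e : Expr} {s : Mem} {Q : Mem → Prop}
    (hb : |e.eval s| ≤ (B : ℤ)) (hQ : Q (s.setVar x (e.eval s))) :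
    WP B Y (.assign x e) s Q := fun hs =>
  ⟨_, _, .assign s x e, by
    have := one_le_bitBound B
    have := e.cost_le hs
    calc e.cost s + 1 ≤ (e.ct + 1) * 1 * bitBound B := by rw [mul_one, add_mul]; omega
      _ ≤ _ := by simp only [Prog.ct]; gcongr, hs.setVar hb, hQ⟩

theorem WP.put {B Y : ℕ} (hY : 1 ≤ Y) {a : ℕ} {i e : Expr} {s : Mem} {Q : Mem → Prop}
    (hb : |e.eval s| ≤ (B : ℤ)) (hQ : Q (s.setArr a (i.eval s) (e.eval s))) :
    WP B Y (.put a i e) s Q := fun hs =>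
  ⟨_, _, .put s a i e, by
    have := one_le_bitBound B
    have := e.cost_le hs
    have := i.cost_le hs
    calc i.cost s + e.cost s + 1 ≤ (i.ct + e.ct + 1) * 1 * bitBound B := by
          rw [mul_one, add_mul, add_mul]; omega
      _ ≤ _ := by simp only [Prog.ct]; gcongr, hs.setArr hb, hQ⟩

theorem WP.seq {B Y : ℕ} {p q : Prog} {s : Mem} {Q : Mem → Prop}
    (h : WP B Y p s fun s' => WP B Y q s' Q) : WP B Y (.seq p q) s Q := fun hs => by
  obtain ⟨s', t, he, ht, hb, hq⟩ := h hs
  obtain ⟨s'', t', he', ht', hb', hq'⟩ := hq hb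
  refine ⟨s'', t + t', .seq he he', ?_, hb', hq'⟩
  simp only [Prog.ct, add_mul]; omega

theorem WP.ite {B Y : ℕ} (hY : 1 ≤ Y) {c : Cond} {p q : Prog} {s : Mem} {Q : Mem → Prop}
    (h1 : c.Holds s → WP B Y p s Q) (h2 : ¬ c.Holds s → WP B Y q s Q) :
    WP B Y (.ite c p q) s Q := fun hs => by
  have hβ := one_le_bitBound B
  have hc := c.cost_le hs
  have h3 : c.ct * bitBound B ≤ c.ct * Y * bitBound B := by
    calc c.ct * bitBound B = c.ct * 1 * bitBound B := by ring
      _ ≤ _ := by gcongr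
  have h4 : 1 ≤ 1 * Y * bitBound B := by nlinarith
  by_cases h : c.Holds s
  · obtain ⟨s', t, he, ht, hb, hq⟩ := h1 h hs
    refine ⟨s', _, .iteTrue h he, ?_, hb, hq⟩
    simp only [Prog.ct, add_mul]; omega
  · obtain ⟨s', t, he, ht, hb, hq⟩ := h2 h hs
    refine ⟨s', _, .iteFalse h he, ?_, hb, hq⟩
    simp only [Prog.ct, add_mul]; omega

/-- Each of at most `μ s` rounds is charged one unit of the budget `Y`, and one more unit pays for
the final failing test. Nested loops thus multiply budgets while the textual constant `ct` only adds
up. -/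
theorem WP.loop {B Y Y' : ℕ} (hY : 1 ≤ Y) {c : Cond} {p : Prog} {s : Mem} {Q : Mem → Prop}
    (I : Mem → Prop) (μ : Mem → ℕ) (h0 : I s)
    (hstep : ∀ s', Agree p.wv p.wa s s' → I s' → c.Holds s' →
      WP B Y p s' fun s'' => I s'' ∧ μ s'' < μ s')
    (hY' : (μ s + 1) * Y ≤ Y') (hQ : ∀ s', I s' → ¬ c.Holds s' → Q s') :
    WP B Y' (.loop c p) s Q := fun hs => by
  have hβ := one_le_bitBound B
  suffices H : ∀ m s1, Agree p.wv p.wa s s1 → I s1 → Bdd B s1 → μ s1 ≤ m →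
      ∃ s' t, Exec (.loop c p) s1 s' t ∧
        t ≤ (c.ct + p.ct + 1) * ((m + 1) * Y) * bitBound B ∧ Bdd B s' ∧ Q s' by
    obtain ⟨s', t, he, ht, hb, hq⟩ := H (μ s) s (Agree.refl _ _ _) h0 hs le_rfl
    refine ⟨s', t, he, ht.trans ?_, hb, hq⟩
    simp only [Prog.ct]
    gcongr
  intro m
  induction m with
  | zero =>
      intro s1 ha hI hb hm
      have hc := c.cost_le hb
      by_cases h : c.Holds s1
      · obtain ⟨s', t, he, ht, hb', hI', hlt⟩ := hstep s1 ha hI h hb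
        omega
      · refine ⟨s1, _, .loopDone h, ?_, hb, hQ s1 hI h⟩
        calc c.cost s1 + 1 ≤ (c.ct + 1) * (1 * 1) * bitBound B := by
              rw [mul_one, mul_one, add_mul]; omega
          _ ≤ (c.ct + p.ct + 1) * ((0 + 1) * Y) * bitBound B := by gcongr; omega
  | succ m ih =>
      intro s1 ha hI hb hm
      have hc := c.cost_le hb
      by_cases h : c.Holds s1
      · obtain ⟨s', t, he, ht, hb', hI', hlt⟩ := hstep s1 ha hI h hb
        obtain ⟨s'', t', he', ht', hb'', hq⟩ := ih s' (ha.trans he.agree) hI' hb' (by omega)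
        refine ⟨s'', _, .loopStep h he he', ?_, hb'', hq⟩
        have h1 : c.cost s1 + 1 ≤ (c.ct + 1) * Y * bitBound B := by
          calc c.cost s1 + 1 ≤ (c.ct + 1) * 1 * bitBound B := by
                rw [mul_one, add_mul]; omega
            _ ≤ _ := by gcongr
        calc c.cost s1 + t + t' + 1
            ≤ (c.ct + 1) * Y * bitBound B + p.ct * Y * bitBound B
              + (c.ct + p.ct + 1) * ((m + 1) * Y) * bitBound B := by omega
          _ = _ := by ring
      · refine ⟨s1, _, .loopDone h, ?_, hb, hQ s1 hI h⟩
        calc c.cost s1 + 1 ≤ (c.ct + 1) * (1 * 1) * bitBound B := by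
              rw [mul_one, mul_one, add_mul]; omega
          _ ≤ (c.ct + p.ct + 1) * ((m + 1 + 1) * Y) * bitBound B := by gcongr <;> omega

/-- `e < f`. -/
def Cond.lt (e f : Expr) : Cond := .le (.add e (.const 1)) f

@[simp] theorem Cond.holds_lt (s : Mem) (e f : Expr) :
    (Cond.lt e f).Holds s ↔ e.eval s < f.eval s := by
  simp [Cond.lt, Cond.Holds, Expr.eval]

/-- `for x := 0 to y - 1 do p`. -/
def Prog.forTo (x y : ℕ) (p : Prog) : Prog :=
  .seq (.assign x (.const 0)) (.loop (.lt (.var x) (.var y))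
    (.seq p (.assign x (.add (.var x) (.const 1)))))

/-- The invariant for `k + 1` is required after the counter has been incremented, which is why the
postcondition of the body speaks of a memory with `x` already set. The body may write neither the
counter nor the bound. -/
theorem WP.forTo {B Y Y' : ℕ} (hY : 1 ≤ Y) {x y : ℕ} {p : Prog} {s : Mem} {Q : Mem → Prop}
    (N : ℕ) (hy : s.var y = N) (hN : N ≤ B) (hxp : x ∉ p.wv) (hyp : y ∉ p.wv) (hxy : y ≠ x)
    (I : ℕ → Mem → Prop) (h0 : I 0 (s.setVar x 0))
    (hstep : ∀ k < N, ∀ s', Agree (x :: p.wv) p.wa s s' → s'.var x = k → I k s' →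
      WP B Y p s' fun s'' => I (k + 1) (s''.setVar x ((k : ℤ) + 1)))
    (hY' : (N + 1) * Y ≤ Y')
    (hQ : ∀ s', Agree (x :: p.wv) p.wa s s' → s'.var x = N → I N s' → Q s') :
    WP B Y' (Prog.forTo x y p) s Q := by
  have hN' : (N : ℤ) ≤ (B : ℤ) := by exact_mod_cast hN
  have hY1 : 1 ≤ Y' := le_trans (by nlinarith) hY'
  refine WP.seq (WP.assign hY1 (by simp [Expr.eval]) ?_)
  have hag : Agree (x :: p.wv) p.wa s (s.setVar x 0) :=
    ⟨fun z hz => by simp only [List.mem_cons, not_or] at hz; simp [hz.1], fun _ _ => rfl⟩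
  refine WP.loop (Y := Y) hY
    (fun s' => Agree (x :: p.wv) p.wa s s' ∧ ∃ k : ℕ, k ≤ N ∧ s'.var x = k ∧ I k s')
    (fun s' => N - (s'.var x).toNat) ⟨hag, 0, by omega, by simp [Expr.eval], h0⟩ ?_ ?_ ?_
  · rintro s' - ⟨ha, k, hk, hx, hI⟩ hc
    have hyN : s'.var y = N := by
      rw [ha.1 y (by simp [hxy, hyp]), hy]
    simp only [Cond.holds_lt, Expr.eval, hx, hyN] at hc
    have hkN : k < N := by exact_mod_cast hc
    refine WP.seq ((hstep k hkN s' ha hx hI).mono fun s'' ha'' hI'' => ?_)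
    have hx'' : s''.var x = k := by rw [ha''.1 x hxp, hx]
    refine WP.assign hY ?_ ?_
    · simp only [Expr.eval, hx'']
      rw [abs_of_nonneg (by positivity)]; omega
    · simp only [Expr.eval, hx'']
      refine ⟨⟨?_, k + 1, hkN, by simp, hI''⟩, ?_⟩
      · have h1 := ha.trans (ha''.mono (List.subset_cons_self x _) (List.Subset.refl _))
        refine ⟨fun z hz => ?_, h1.2⟩
        rw [← h1.1 z hz]
        simp only [List.mem_cons, not_or] at hz
        simp [hz.1]
      · simp [hx]; omega
  · simpa [Expr.eval] using hY'
  · rintro s' ⟨ha, k, hk, hx, hI⟩ hc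
    have hyN : s'.var y = N := by
      rw [ha.1 y (by simp [hxy, hyp]), hy]
    simp only [Cond.holds_lt, Expr.eval, hx, hyN] at hc
    have : k = N := by omega
    subst this
    exact hQ s' ha hx hI

/-- `for x := 0 to y - 1 do a[x] := e`. -/
def Prog.mapTo (x y a : ℕ) (e : Expr) : Prog := .forTo x y (.put a (.var x) e)

theorem WP.mapTo {B Y' : ℕ} {x y a : ℕ} {e : Expr} {s : Mem} {Q : Mem → Prop}
    (N : ℕ) (hy : s.var y = N) (hN : N ≤ B) (hxy : y ≠ x) (g : ℤ → ℤ)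
    (hg : ∀ k < N, ∀ s', Agree [x] [a] s s' → s'.var x = k →
      (∀ j, s'.arr a j = if 0 ≤ j ∧ j < k then g j else s.arr a j) →
      e.eval s' = g k ∧ |g k| ≤ (B : ℤ))
    (hY' : N + 1 ≤ Y')
    (hQ : ∀ s', Agree [x] [a] s s' →
      (∀ j, s'.arr a j = if 0 ≤ j ∧ j < N then g j else s.arr a j) → Q s') :
    WP B Y' (Prog.mapTo x y a e) s Q := by
  refine WP.forTo (Y := 1) le_rfl N hy hN (by simp [Prog.wv]) (by simp [Prog.wv]) hxy
    (fun k s' => ∀ j, s'.arr a j = if 0 ≤ j ∧ j < k then g j else s.arr a j) ?_ ?_ (by simpa) ?_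
  · intro j; rw [if_neg (by omega)]; rfl
  · intro k hk s' ha hx hI
    obtain ⟨h1, h2⟩ := hg k hk s' ha hx hI
    refine WP.put le_rfl (by rw [h1]; exact h2) ?_
    intro j
    simp only [Expr.eval, hx, h1, Mem.setVar_arr, Mem.setArr_arr, if_true, Function.update_apply]
    by_cases hj : j = k
    · subst hj; rw [if_pos rfl, if_pos ⟨by omega, by push_cast; omega⟩]
    · rw [if_neg hj, hI j]
      refine if_congr ?_ rfl rfl
      push_cast; omega
  · intro s' ha _ hI
    exact hQ s' ha hI

/-! ## Renaming arrays -/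

def Expr.rename (ρ : ℕ → ℕ) : Expr → Expr
  | .const z => .const z
  | .var x => .var x
  | .get a i => .get (ρ a) (i.rename ρ)
  | .add e f => .add (e.rename ρ) (f.rename ρ)
  | .sub e f => .sub (e.rename ρ) (f.rename ρ)
  | .mul e f => .mul (e.rename ρ) (f.rename ρ)
  | .div e f => .div (e.rename ρ) (f.rename ρ)

def Cond.rename (ρ : ℕ → ℕ) : Cond → Cond
  | .le e f => .le (e.rename ρ) (f.rename ρ)
  | .neg c => .neg (c.rename ρ)
  | .conj c d => .conj (c.rename ρ) (d.rename ρ)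

def Prog.rename (ρ : ℕ → ℕ) : Prog → Prog
  | .skip => .skip
  | .assign x e => .assign x (e.rename ρ)
  | .put a i e => .put (ρ a) (i.rename ρ) (e.rename ρ)
  | .seq p q => .seq (p.rename ρ) (q.rename ρ)
  | .ite c p q => .ite (c.rename ρ) (p.rename ρ) (q.rename ρ)
  | .loop c p => .loop (c.rename ρ) (p.rename ρ)

/-- The memory as seen by a program whose arrays are renamed by `ρ`. -/
def Mem.view (ρ : ℕ → ℕ) (s : Mem) : Mem where
  var := s.var
  arr := fun a => s.arr (ρ a)

@[simp] theorem Mem.view_var (ρ : ℕ → ℕ) (s : Mem) : (s.view ρ).var = s.var := rfl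

@[simp] theorem Mem.view_arr (ρ : ℕ → ℕ) (s : Mem) (a : ℕ) : (s.view ρ).arr a = s.arr (ρ a) := rfl

theorem Expr.eval_rename (ρ : ℕ → ℕ) (s : Mem) (e : Expr) :
    (e.rename ρ).eval s = e.eval (s.view ρ) := by
  induction e with
  | const z => rfl
  | var x => rfl
  | get a i hi => simp [Expr.rename, Expr.eval, hi]
  | _ e f he hf => simp [Expr.rename, Expr.eval, he, hf]

theorem Expr.cost_rename (ρ : ℕ → ℕ) (s : Mem) (e : Expr) :
    (e.rename ρ).cost s = e.cost (s.view ρ) := by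
  induction e with
  | const z => rfl
  | var x => rfl
  | get a i hi => simp [Expr.rename, Expr.cost, hi, Expr.eval_rename]
  | _ e f he hf => simp [Expr.rename, Expr.cost, he, hf, Expr.eval_rename]

theorem Cond.holds_rename (ρ : ℕ → ℕ) (s : Mem) (c : Cond) :
    (c.rename ρ).Holds s ↔ c.Holds (s.view ρ) := by
  induction c with
  | le e f => simp [Cond.rename, Cond.Holds, Expr.eval_rename]
  | neg c hc => simp [Cond.rename, Cond.Holds, hc]
  | conj c d hc hd => simp [Cond.rename, Cond.Holds, hc, hd]

theorem Cond.cost_rename (ρ : ℕ → ℕ) (s : Mem) (c : Cond) :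
    (c.rename ρ).cost s = c.cost (s.view ρ) := by
  induction c with
  | le e f => simp [Cond.rename, Cond.cost, Expr.cost_rename]
  | neg c hc => simp [Cond.rename, Cond.cost, hc]
  | conj c d hc hd => simp [Cond.rename, Cond.cost, hc, hd]

theorem Mem.view_setArr {ρ : ℕ → ℕ} (hρ : Function.Injective ρ) (s : Mem) (a : ℕ) (i z : ℤ) :
    (s.setArr (ρ a) i z).view ρ = (s.view ρ).setArr a i z := by
  unfold Mem.view Mem.setArr
  congr 1
  funext b
  by_cases h : b = a
  · subst h; simp
  · simp [h, hρ.ne h]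

/-- A simulation: the renamed program on `s` does what the original does on the view of `s`, at the
same cost, since costs depend on values and not on names. Injectivity keeps a write to one array
from showing up in another. -/
theorem Exec.rename {ρ : ℕ → ℕ} (hρ : Function.Injective ρ) {p : Prog} {s0 s1 : Mem} {t : ℕ}
    (h : Exec p s0 s1 t) : ∀ s, s.view ρ = s0 →
      ∃ s', Exec (p.rename ρ) s s' t ∧ s'.view ρ = s1 := by
  induction h with
  | skip s0 => exact fun s hs => ⟨s, .skip s, hs⟩
  | assign s0 x e =>
      rintro s rfl
      have := Exec.assign s x (e.rename ρ)
      rw [Expr.cost_rename, Expr.eval_rename] at this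
      exact ⟨_, this, rfl⟩
  | put s0 a i e =>
      rintro s rfl
      have := Exec.put s (ρ a) (i.rename ρ) (e.rename ρ)
      rw [Expr.cost_rename, Expr.eval_rename, Expr.cost_rename, Expr.eval_rename] at this
      exact ⟨_, this, Mem.view_setArr hρ _ _ _ _⟩
  | seq _ _ h1 h2 =>
      intro s hs
      obtain ⟨s', he, hs'⟩ := h1 s hs
      obtain ⟨s'', he', hs''⟩ := h2 s' hs'
      exact ⟨s'', .seq he he', hs''⟩
  | iteTrue hc _ h =>
      rintro s rfl
      obtain ⟨s', he, hs'⟩ := h s rfl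
      rw [← Cond.cost_rename]
      exact ⟨s', .iteTrue ((Cond.holds_rename _ _ _).2 hc) he, hs'⟩
  | iteFalse hc _ h =>
      rintro s rfl
      obtain ⟨s', he, hs'⟩ := h s rfl
      rw [← Cond.cost_rename]
      exact ⟨s', .iteFalse (mt (Cond.holds_rename _ _ _).1 hc) he, hs'⟩
  | loopDone hc =>
      rintro s rfl
      rw [← Cond.cost_rename]
      exact ⟨s, .loopDone (mt (Cond.holds_rename _ _ _).1 hc), rfl⟩
  | loopStep hc _ _ h1 h2 =>
      rintro s rfl
      obtain ⟨s', he, hs'⟩ := h1 s rfl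
      obtain ⟨s'', he', hs''⟩ := h2 s' hs'
      rw [← Cond.cost_rename]
      exact ⟨s'', .loopStep ((Cond.holds_rename _ _ _).2 hc) he he', hs''⟩

theorem Expr.lv_rename (ρ : ℕ → ℕ) (e : Expr) : (e.rename ρ).lv = e.lv := by
  induction e <;> simp_all [Expr.rename, Expr.lv]

theorem Expr.ct_rename (ρ : ℕ → ℕ) (e : Expr) : (e.rename ρ).ct = e.ct := by
  induction e <;> simp_all [Expr.rename, Expr.ct, Expr.lv_rename]

theorem Cond.ct_rename (ρ : ℕ → ℕ) (c : Cond) : (c.rename ρ).ct = c.ct := by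
  induction c <;> simp_all [Cond.rename, Cond.ct, Expr.ct_rename]

theorem Prog.ct_rename (ρ : ℕ → ℕ) (p : Prog) : (p.rename ρ).ct = p.ct := by
  induction p <;> simp_all [Prog.rename, Prog.ct, Expr.ct_rename, Cond.ct_rename]

theorem Prog.wv_rename (ρ : ℕ → ℕ) (p : Prog) : (p.rename ρ).wv = p.wv := by
  induction p <;> simp_all [Prog.rename, Prog.wv]

theorem Prog.wa_rename (ρ : ℕ → ℕ) (p : Prog) : (p.rename ρ).wa = p.wa.map ρ := by
  induction p <;> simp_all [Prog.rename, Prog.wa]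

theorem WP.rename {B Y : ℕ} {ρ : ℕ → ℕ} (hρ : Function.Injective ρ) {p : Prog} {s : Mem}
    {Q Q' : Mem → Prop} (h : WP B Y p (s.view ρ) Q)
    (hQ : ∀ s', Agree p.wv (p.wa.map ρ) s s' → Q (s'.view ρ) → Q' s') :
    WP B Y (p.rename ρ) s Q' := fun hs => by
  obtain ⟨s1, t, he, ht, hb, hq⟩ := h ⟨hs.1, fun a i => hs.2 _ i⟩
  obtain ⟨s', he', rfl⟩ := he.rename hρ s rfl
  have hag := he'.agree
  rw [Prog.wv_rename, Prog.wa_rename] at hag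
  refine ⟨s', t, he', by rwa [Prog.ct_rename], ⟨hb.1, fun a i => ?_⟩, hQ s' hag hq⟩
  -- The view controls only arrays in the image of `ρ`; an array that is not written keeps its old,
  -- bounded entries.
  by_cases ha : a ∈ p.wa.map ρ
  · obtain ⟨b, -, rfl⟩ := List.mem_map.1 ha
    exact hb.2 b i
  · rw [hag.2 a ha]; exact hs.2 a i

/-- The renaming that sends `0, 1, …` to the entries of `l` and shifts all other names by `c`. -/
def relabel (l : List ℕ) (c : ℕ) (a : ℕ) : ℕ := if h : a < l.length then l[a] else a + c

theorem relabel_injective {l : List ℕ} {c : ℕ} (hl : l.Nodup) (hc : ∀ x ∈ l, x < c) :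
    Function.Injective (relabel l c) := by
  intro a b h
  unfold relabel at h
  split at h <;> split at h
  · exact (hl.getElem_inj_iff).1 h
  · have := hc _ (List.getElem_mem ‹a < l.length›); omega
  · have := hc _ (List.getElem_mem ‹b < l.length›); omega
  · omega

/-! ## Forests given by parent pointers on integers -/

open Classical in
/-- The indicator of a proposition. -/
noncomputable def ind (P : Prop) : ℤ := if P then 1 else 0

theorem ind_true {P : Prop} (h : P) : ind P = 1 := if_pos h
theorem ind_false {P : Prop} (h : ¬ P) : ind P = 0 := if_neg h
theorem ind_nonneg (P : Prop) : 0 ≤ ind P := by unfold ind; split <;> norm_num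
theorem ind_le_one (P : Prop) : ind P ≤ 1 := by unfold ind; split <;> norm_num
theorem ind_congr {P Q : Prop} (h : P ↔ Q) : ind P = ind Q := by rw [propext h]
theorem ind_and (P Q : Prop) : ind (P ∧ Q) = ind P * ind Q := by
  by_cases hP : P <;> by_cases hQ : Q <;> simp [ind, hP, hQ]

/-- Parent pointers `p` on the nodes `0, …, N - 1` (the root is `-1`) with sizes `sz`. -/
structure Forest (n N : ℕ) (p sz : ℤ → ℤ) : Prop where
  root : p (-1) = -1
  range : ∀ i : ℤ, 0 ≤ i → i < N → -1 ≤ p i ∧ p i < N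
  sz_pos : ∀ i : ℤ, 0 ≤ i → i < N → 1 ≤ sz i
  sz_le : ∀ i : ℤ, 0 ≤ i → i < N → sz i ≤ n
  sz_lt : ∀ i : ℤ, 0 ≤ i → i < N → 0 ≤ p i → sz i < sz (p i)
  sz_add : ∀ i j : ℤ, 0 ≤ i → i < N → 0 ≤ j → j < N → i ≠ j → p i = p j → 0 ≤ p i →
    sz i + sz j ≤ sz (p i)

/-- `j` is reached from `i` by following the pointers `p`. -/
def Anc (p : ℤ → ℤ) (i j : ℤ) : Prop := ∃ k : ℕ, p^[k] i = j

theorem Anc.refl (p : ℤ → ℤ) (i : ℤ) : Anc p i i := ⟨0, rfl⟩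

theorem anc_iff {p : ℤ → ℤ} {i j : ℤ} : Anc p i j ↔ j = i ∨ Anc p (p i) j := by
  constructor
  · rintro ⟨k, hk⟩
    cases k with
    | zero => exact Or.inl hk.symm
    | succ k => exact Or.inr ⟨k, by simpa using hk⟩
  · rintro (rfl | ⟨k, hk⟩)
    · exact Anc.refl _ _
    · exact ⟨k + 1, by simpa using hk⟩

theorem Anc.trans {p : ℤ → ℤ} {i j k : ℤ} (h : Anc p i j) (h' : Anc p j k) : Anc p i k := by
  obtain ⟨a, rfl⟩ := h
  obtain ⟨b, rfl⟩ := h'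
  exact ⟨b + a, by rw [Function.iterate_add_apply]⟩

theorem Anc.comparable {p : ℤ → ℤ} {i j k : ℤ} (h : Anc p i j) (h' : Anc p i k) :
    Anc p j k ∨ Anc p k j := by
  obtain ⟨a, rfl⟩ := h
  obtain ⟨b, rfl⟩ := h'
  rcases le_total a b with hab | hab
  · left
    exact ⟨b - a, by rw [← Function.iterate_add_apply, Nat.sub_add_cancel hab]⟩
  · right
    exact ⟨a - b, by rw [← Function.iterate_add_apply, Nat.sub_add_cancel hab]⟩

section Forest

variable {n N : ℕ} {p sz : ℤ → ℤ}

theorem Forest.iterate_root (hF : Forest n N p sz) (k : ℕ) : p^[k] (-1) = -1 :=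
  Function.iterate_fixed hF.root k

theorem Forest.anc_root (hF : Forest n N p sz) {j : ℤ} (h : Anc p (-1) j) : j = -1 := by
  obtain ⟨k, rfl⟩ := h
  exact hF.iterate_root k

theorem Forest.iterate_range (hF : Forest n N p sz) {i : ℤ} (h0 : -1 ≤ i) (h1 : i < N) (k : ℕ) :
    -1 ≤ p^[k] i ∧ p^[k] i < N := by
  induction k with
  | zero => exact ⟨h0, h1⟩
  | succ k ih =>
      rw [Function.iterate_succ_apply']
      rcases eq_or_lt_of_le ih.1 with h | h
      · rw [← h, hF.root]; exact ⟨le_rfl, by omega⟩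
      · exact hF.range _ (by omega) ih.2

/-- Every nonroot node on the way to the root is larger. -/
theorem Forest.sz_iterate (hF : Forest n N p sz) {i : ℤ} (h0 : -1 ≤ i) (h1 : i < N) (k : ℕ)
    (hk : 0 ≤ p^[k] i) : sz i + k ≤ sz (p^[k] i) := by
  induction k with
  | zero => simp
  | succ k ih =>
      rw [Function.iterate_succ_apply'] at hk ⊢
      have hr := hF.iterate_range h0 h1 k
      have h2 : 0 ≤ p^[k] i := by
        by_contra h
        have h3 : p^[k] i = -1 := by omega
        rw [h3, hF.root] at hk
        omega
      have := hF.sz_lt _ h2 hr.2 hk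
      have := ih h2
      push_cast; omega

theorem Forest.anc_sz (hF : Forest n N p sz) {i j : ℤ} (h0 : -1 ≤ i) (h1 : i < N) (hj : 0 ≤ j)
    (h : Anc p i j) : sz i ≤ sz j := by
  obtain ⟨k, rfl⟩ := h
  have := hF.sz_iterate h0 h1 k hj
  omega

/-- Sizes lie between `1` and `n` and grow with every step, so `n` steps lead from any node to the
root. -/
theorem Forest.iterate_ne (hF : Forest n N p sz) {i : ℤ} (h0 : -1 ≤ i) (h1 : i < N) {k : ℕ}
    (hk : n ≤ k) : p^[k] i = -1 := by
  have hr := hF.iterate_range h0 h1 k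
  by_contra h
  have h2 : 0 ≤ i := by
    by_contra h3
    have : i = -1 := by omega
    rw [this, hF.iterate_root] at h
    exact h rfl
  have h3 : 0 ≤ p^[k] i := by omega
  have := hF.sz_iterate h0 h1 k h3
  have := hF.sz_pos i h2 h1
  have := hF.sz_le _ h3 hr.2
  omega

/-- Sizes grow strictly along the path, so a proper node is visited at most once, and only within
the first `n` steps. The root has to be excluded because the path stays there. -/
theorem Forest.sum_ind_iterate (hF : Forest n N p sz) {i j : ℤ} (h0 : -1 ≤ i) (h1 : i < N)
    (hj : 0 ≤ j) {K : ℕ} (hK : n ≤ K) :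
    ∑ k ∈ Finset.range K, ind (p^[k] i = j) = ind (Anc p i j) := by
  by_cases h : Anc p i j
  · obtain ⟨k, hk⟩ := h
    have hkK : k < K := by
      by_contra hc
      rw [hF.iterate_ne h0 h1 (by omega)] at hk
      omega
    rw [ind_true ⟨k, hk⟩, Finset.sum_eq_single_of_mem k (Finset.mem_range.2 hkK), ind_true hk]
    intro b _ hb
    refine ind_false fun hbj => ?_
    rcases lt_or_gt_of_ne hb with hlt | hlt
    · have e : p^[k - b] j = j := by
        rw [← hbj, ← Function.iterate_add_apply, Nat.sub_add_cancel hlt.le, hk, hbj]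
      have hr := hF.iterate_range h0 h1 k
      rw [hk] at hr
      have := hF.sz_iterate hr.1 hr.2 (k - b) (by rw [e]; exact hj)
      rw [e] at this
      omega
    · have e : p^[b - k] j = j := by
        rw [← hk, ← Function.iterate_add_apply, Nat.sub_add_cancel hlt.le, hbj, hk]
      have hr := hF.iterate_range h0 h1 k
      rw [hk] at hr
      have := hF.sz_iterate hr.1 hr.2 (b - k) (by rw [e]; exact hj)
      rw [e] at this
      omega
  · rw [ind_false h]
    exact Finset.sum_eq_zero fun k _ => ind_false fun hk => h ⟨k, hk⟩

/-- The number of vertices whose home reaches `j` in fewer than `2 ^ k` steps. -/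
noncomputable def reachCount (n : ℕ) (p home : ℤ → ℤ) (k : ℕ) (j : ℤ) : ℤ :=
  ∑ v ∈ Finset.range n, ∑ i ∈ Finset.range (2 ^ k), ind (p^[i] (home v) = j)

theorem sum_ind_eq_mul {N : ℕ} {a : ℤ} (h0 : 0 ≤ a) (h1 : a < N) (f : ℤ → ℤ) :
    ∑ i ∈ Finset.range N, ind (a = (i : ℤ)) * f i = f a := by
  lift a to ℕ using h0
  rw [Finset.sum_eq_single_of_mem a (by simpa using h1)]
  · rw [ind_true rfl, one_mul]
  · intro b _ hb
    rw [ind_false (by exact_mod_cast hb.symm), zero_mul]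

/-- The doubling step. An ancestor at distance `2 ^ k + a` with `a < 2 ^ k` is the `2 ^ k`-th
ancestor of the node at distance `a`; grouping by that middle node gives the second sum. Paths that
have already reached the root contribute nothing, as `j` is a proper node. -/
theorem Forest.reachCount_succ (hF : Forest n N p sz) {home : ℤ → ℤ}
    (hh : ∀ v : ℕ, v < n → -1 ≤ home v ∧ home v < N) (k : ℕ) {j : ℤ} (hj : 0 ≤ j) :
    reachCount n p home (k + 1) j = reachCount n p home k j +
      ∑ i ∈ Finset.range N, ind (p^[2 ^ k] (i : ℤ) = j) * reachCount n p home k i := by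
  have h1 : ∀ i ∈ Finset.range N, ind (p^[2 ^ k] (i : ℤ) = j) * reachCount n p home k i
      = ∑ v ∈ Finset.range n, ∑ a ∈ Finset.range (2 ^ k),
        ind (p^[a] (home v) = i) * ind (p^[2 ^ k] (i : ℤ) = j) := by
    intro i _
    rw [reachCount, Finset.mul_sum]
    refine Finset.sum_congr rfl fun v _ => ?_
    rw [Finset.mul_sum]
    exact Finset.sum_congr rfl fun a _ => mul_comm _ _
  rw [Finset.sum_congr rfl h1, Finset.sum_comm, reachCount, reachCount, ← Finset.sum_add_distrib]
  refine Finset.sum_congr rfl fun v hv => ?_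
  rw [pow_succ, mul_two, Finset.sum_range_add]
  congr 1
  rw [Finset.sum_comm]
  refine Finset.sum_congr rfl fun a _ => ?_
  obtain ⟨h2, h3⟩ := hh v (Finset.mem_range.1 hv)
  have hr := hF.iterate_range h2 h3 a
  rw [Function.iterate_add_apply]
  rcases eq_or_lt_of_le hr.1 with h | h
  · rw [← h, hF.iterate_root, ind_false (by omega)]
    symm
    refine Finset.sum_eq_zero fun i _ => ?_
    rw [ind_false (by omega), zero_mul]
  · rw [sum_ind_eq_mul (by omega) hr.2 fun i => ind (p^[2 ^ k] i = j)]

theorem Forest.reachCount_eq (hF : Forest n N p sz) {home : ℤ → ℤ}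
    (hh : ∀ v : ℕ, v < n → -1 ≤ home v ∧ home v < N) {k : ℕ} (hk : n ≤ 2 ^ k) {j : ℤ}
    (hj : 0 ≤ j) :
    reachCount n p home k j = ∑ v ∈ Finset.range n, ind (Anc p (home v) j) := by
  refine Finset.sum_congr rfl fun v hv => ?_
  obtain ⟨h2, h3⟩ := hh v (Finset.mem_range.1 hv)
  exact hF.sum_ind_iterate h2 h3 hj hk

theorem reachCount_nonneg (n : ℕ) (p home : ℤ → ℤ) (k : ℕ) (j : ℤ) :
    0 ≤ reachCount n p home k j :=
  Finset.sum_nonneg fun _ _ => Finset.sum_nonneg fun _ _ => ind_nonneg _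

theorem Forest.reachCount_le (hF : Forest n N p sz) {home : ℤ → ℤ}
    (hh : ∀ v : ℕ, v < n → -1 ≤ home v ∧ home v < N) (k : ℕ) {j : ℤ} (hj : 0 ≤ j) :
    reachCount n p home k j ≤ n := by
  have : reachCount n p home k j ≤ ∑ v ∈ Finset.range n, 1 := by
    refine Finset.sum_le_sum fun v hv => ?_
    obtain ⟨h2, h3⟩ := hh v (Finset.mem_range.1 hv)
    -- Extending the range beyond `n` turns the inner sum into a single indicator, so each vertex
    -- counts at most once at every stage.
    calc ∑ i ∈ Finset.range (2 ^ k), ind (p^[i] (home v) = j)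
        ≤ ∑ i ∈ Finset.range (2 ^ k + n), ind (p^[i] (home v) = j) :=
          Finset.sum_le_sum_of_subset_of_nonneg (Finset.range_mono (Nat.le_add_right _ _))
            fun _ _ _ => ind_nonneg _
      _ = ind (Anc p (home v) j) := hF.sum_ind_iterate h2 h3 hj (Nat.le_add_left _ _)
      _ ≤ 1 := ind_le_one _
  simpa using this

/-! ## Heavy paths -/

/-- The node `i` makes up more than half of its parent. -/
def Heavy (p sz : ℤ → ℤ) (i : ℤ) : Prop := 0 ≤ i ∧ 0 ≤ p i ∧ sz (p i) < 2 * sz i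

open Classical in
/-- One step up along a heavy path. -/
noncomputable def heavyStep (p sz : ℤ → ℤ) (i : ℤ) : ℤ := if Heavy p sz i then p i else i

theorem heavyStep_pos {i : ℤ} (h : Heavy p sz i) : heavyStep p sz i = p i := if_pos h
theorem heavyStep_neg {i : ℤ} (h : ¬ Heavy p sz i) : heavyStep p sz i = i := if_neg h

/-- Induction from the root downwards: a parent is larger than its child, so `n - sz i` decreases on
passing to the parent. -/
theorem Forest.induct (hF : Forest n N p sz) {C : ℤ → Prop}
    (h : ∀ i : ℤ, 0 ≤ i → i < N → (0 ≤ p i → C (p i)) → C i) : ∀ i : ℤ, 0 ≤ i → i < N → C i := by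
  suffices H : ∀ m : ℕ, ∀ i : ℤ, 0 ≤ i → i < N → n - sz i ≤ m → C i from
    fun i h0 h1 => H (n - sz i).toNat i h0 h1 (by omega)
  intro m
  induction m with
  | zero =>
      intro i h0 h1 hm
      refine h i h0 h1 fun hp => ?_
      have := hF.sz_lt i h0 h1 hp
      have := hF.sz_le _ hp (hF.range i h0 h1).2
      omega
  | succ m ih =>
      intro i h0 h1 hm
      refine h i h0 h1 fun hp => ?_
      have := hF.sz_lt i h0 h1 hp
      exact ih _ hp (hF.range i h0 h1).2 (by push_cast at hm; omega)

theorem Forest.not_heavy_iterate (hF : Forest n N p sz) {k : ℕ} : ∀ i : ℤ, 0 ≤ i → i < N →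
    n - sz i ≤ k → ¬ Heavy p sz ((heavyStep p sz)^[k] i) := by
  induction k with
  | zero =>
      intro i h0 h1 hk hH
      replace hH : Heavy p sz i := hH
      have h2 := hF.sz_lt i h0 h1 hH.2.1
      have := hF.sz_le _ hH.2.1 (hF.range i h0 h1).2
      push_cast at hk
      omega
  | succ k ih =>
      intro i h0 h1 hk
      by_cases hH : Heavy p sz i
      · rw [Function.iterate_succ_apply, heavyStep_pos hH]
        have := hF.sz_lt i h0 h1 hH.2.1
        exact ih _ hH.2.1 (hF.range i h0 h1).2 (by push_cast at hk; omega)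
      · rwa [Function.iterate_fixed (heavyStep_neg hH)]

/-- The equations that determine the topmost node of the heavy path of a node and the distance to
that node. -/
structure Chains (N : ℕ) (p sz head dep : ℤ → ℤ) : Prop where
  light : ∀ i : ℤ, 0 ≤ i → i < N → ¬ Heavy p sz i → head i = i ∧ dep i = 0
  heavy : ∀ i : ℤ, 0 ≤ i → i < N → Heavy p sz i → head i = head (p i) ∧ dep i = dep (p i) + 1

/-- The top of a heavy path is a fixed point of `heavyStep`, so all sufficiently long iterations
agree. With `K > n` the path above `p i` is exhausted before the last step, hence starting one node
lower shifts the iteration by one and adds exactly one to the count. -/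
theorem Forest.chains (hF : Forest n N p sz) {K : ℕ} (hK : n < K) :
    Chains N p sz (fun i => (heavyStep p sz)^[K] i)
      (fun i => ∑ k ∈ Finset.range K, ind (Heavy p sz ((heavyStep p sz)^[k] i))) := by
  constructor
  · intro i h0 h1 hH
    have := Function.iterate_fixed (heavyStep_neg hH)
    refine ⟨this K, Finset.sum_eq_zero fun k _ => ?_⟩
    rw [this k, ind_false hH]
  · intro i h0 h1 hH
    obtain ⟨K, rfl⟩ : ∃ K', K = K' + 1 := ⟨K - 1, by omega⟩
    have hp := (hF.range i h0 h1).2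
    have h2 := hF.sz_pos _ hH.2.1 hp
    have hn : ¬ Heavy p sz ((heavyStep p sz)^[K] (p i)) :=
      hF.not_heavy_iterate _ hH.2.1 hp (by omega)
    constructor
    · rw [Function.iterate_succ_apply, heavyStep_pos hH, Function.iterate_succ_apply',
        heavyStep_neg hn]
    · rw [Finset.sum_range_succ', Finset.sum_range_succ]
      simp only [Function.iterate_succ_apply, heavyStep_pos hH, Function.iterate_zero, id_eq,
        ind_true hH, ind_false hn, add_zero]

/-! ### Heavy paths as intervals of positions -/

section Chains

variable {head dep : ℤ → ℤ}

theorem Chains.facts (hC : Chains N p sz head dep) (hF : Forest n N p sz) :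
    ∀ i : ℤ, 0 ≤ i → i < N → (0 ≤ head i ∧ head i < N ∧ ¬ Heavy p sz (head i) ∧ sz i ≤ sz (head i) ∧
      0 ≤ dep i) := by
  refine hF.induct fun i h0 h1 ih => ?_
  by_cases hH : Heavy p sz i
  · obtain ⟨e1, e2⟩ := hC.heavy i h0 h1 hH
    obtain ⟨a, b, c, d, e⟩ := ih hH.2.1
    have := hF.sz_lt i h0 h1 hH.2.1
    rw [e1, e2]
    exact ⟨a, b, c, by omega, by omega⟩
  · obtain ⟨e1, e2⟩ := hC.light i h0 h1 hH
    rw [e1, e2]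
    exact ⟨h0, h1, hH, le_rfl, le_rfl⟩

/-- Two distinct children cannot both make up more than half of their parent, by `sz_add`. So a node
has at most one heavy child, and by induction from the top a heavy path has one node at each depth.
-/
theorem Chains.inj (hC : Chains N p sz head dep) (hF : Forest n N p sz) :
    ∀ i : ℤ, 0 ≤ i → i < N → ∀ j : ℤ, 0 ≤ j → j < N → head i = head j → dep i = dep j → i = j := by
  refine hF.induct fun i h0 h1 ih j hj0 hj1 h2 h3 => ?_
  by_cases hi : Heavy p sz i <;> by_cases hj : Heavy p sz j
  · obtain ⟨e1, e2⟩ := hC.heavy i h0 h1 hi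
    obtain ⟨e3, e4⟩ := hC.heavy j hj0 hj1 hj
    have e := ih hi.2.1 (p j) hj.2.1 (hF.range j hj0 hj1).2 (by rw [← e1, ← e3, h2]) (by omega)
    by_contra hne
    have := hF.sz_add i j h0 h1 hj0 hj1 hne e hi.2.1
    have h5 := hi.2.2
    have h6 := hj.2.2
    rw [← e] at h6
    omega
  · obtain ⟨e1, e2⟩ := hC.heavy i h0 h1 hi
    obtain ⟨e3, e4⟩ := hC.light j hj0 hj1 hj
    have := (hC.facts hF (p i) hi.2.1 (hF.range i h0 h1).2).2.2.2.2
    omega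
  · obtain ⟨e1, e2⟩ := hC.light i h0 h1 hi
    obtain ⟨e3, e4⟩ := hC.heavy j hj0 hj1 hj
    have := (hC.facts hF (p j) hj.2.1 (hF.range j hj0 hj1).2).2.2.2.2
    omega
  · rw [← (hC.light i h0 h1 hi).1, ← (hC.light j hj0 hj1 hj).1, h2]

/-- The number of nodes of the heavy path with topmost node `h`. -/
noncomputable def chainLen (N : ℕ) (head : ℤ → ℤ) (h : ℤ) : ℤ :=
  ∑ i ∈ Finset.range N, ind (head i = h)

theorem chainLen_nonneg (N : ℕ) (head : ℤ → ℤ) (h : ℤ) : 0 ≤ chainLen N head h :=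
  Finset.sum_nonneg fun _ _ => ind_nonneg _

/-- The total length of the heavy paths with topmost node less than `i`. -/
noncomputable def chainOff (N : ℕ) (head : ℤ → ℤ) (i : ℕ) : ℤ :=
  ∑ h ∈ Finset.range i, chainLen N head h

theorem chainOff_mono (N : ℕ) (head : ℤ → ℤ) {i j : ℕ} (h : i ≤ j) :
    chainOff N head i ≤ chainOff N head j :=
  Finset.sum_le_sum_of_subset_of_nonneg (Finset.range_mono h) fun _ _ _ => chainLen_nonneg _ _ _

/-- The nodes from `i` up to the top are `dep i + 1` distinct nodes of one heavy path. The count is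
restricted to depths at most `dep i` to let the induction see that `i` itself is new. -/
theorem Chains.dep_lt (hC : Chains N p sz head dep) (hF : Forest n N p sz) :
    ∀ i : ℤ, 0 ≤ i → i < N → dep i < chainLen N head (head i) := by
  suffices H : ∀ i : ℤ, 0 ≤ i → i < N →
      dep i + 1 ≤ ∑ j ∈ Finset.range N, ind (head j = head i ∧ dep j ≤ dep i) by
    intro i h0 h1
    refine Int.add_one_le_iff.1 ((H i h0 h1).trans (Finset.sum_le_sum fun j _ => ?_))
    rw [ind_and]
    have := ind_nonneg (head (j : ℤ) = head i)
    have := ind_le_one (dep (j : ℤ) ≤ dep i)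
    nlinarith
  refine hF.induct fun i h0 h1 ih => ?_
  have hs : ∑ j ∈ Finset.range N, ind (i = (j : ℤ)) = 1 := by
    simpa using sum_ind_eq_mul h0 h1 fun _ => 1
  by_cases hH : Heavy p sz i
  · obtain ⟨e1, e2⟩ := hC.heavy i h0 h1 hH
    have h3 := ih hH.2.1
    rw [e2]
    calc dep (p i) + 1 + 1
        ≤ ∑ j ∈ Finset.range N, ind (head j = head (p i) ∧ dep j ≤ dep (p i)) +
          ∑ j ∈ Finset.range N, ind (i = (j : ℤ)) := by rw [hs]; omega
      _ = ∑ j ∈ Finset.range N, (ind (head j = head (p i) ∧ dep j ≤ dep (p i)) +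
          ind (i = (j : ℤ))) := Finset.sum_add_distrib.symm
      _ ≤ _ := by
          refine Finset.sum_le_sum fun j _ => ?_
          by_cases hj : i = (j : ℤ)
          · rw [ind_true hj, ← hj, ind_false (by omega), ind_true ⟨rfl, by omega⟩]
            norm_num
          · rw [ind_false hj, add_zero]
            by_cases hj' : head j = head (p i) ∧ dep j ≤ dep (p i)
            · rw [ind_true hj', ind_true ⟨by rw [hj'.1, e1], by omega⟩]
            · rw [ind_false hj']; exact ind_nonneg _
  · obtain ⟨e1, e2⟩ := hC.light i h0 h1 hH
    calc dep i + 1 = ∑ j ∈ Finset.range N, ind (i = (j : ℤ)) := by rw [hs, e2]; rfl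
      _ ≤ _ := by
          refine Finset.sum_le_sum fun j _ => ?_
          by_cases hj : i = (j : ℤ)
          · rw [ind_true hj, ← hj, ind_true ⟨rfl, le_rfl⟩]
          · rw [ind_false hj]; exact ind_nonneg _

/-- Double counting: every node belongs to the path of exactly one head. -/
theorem Chains.chainOff_top (hC : Chains N p sz head dep) (hF : Forest n N p sz) :
    chainOff N head N = N := by
  unfold chainOff chainLen
  rw [Finset.sum_comm]
  have : ∀ i ∈ Finset.range N, ∑ h ∈ Finset.range N, ind (head (i : ℤ) = (h : ℤ)) = 1 := by
    intro i hi
    have hi' := Finset.mem_range.1 hi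
    obtain ⟨a, b, -⟩ := hC.facts hF i (by omega) (by omega)
    simpa using sum_ind_eq_mul a b fun _ => 1
  rw [Finset.sum_congr rfl this]
  simp

/-- The position of a node: heavy paths are contiguous and ordered from the top. -/
noncomputable def position (N : ℕ) (head dep : ℤ → ℤ) (i : ℤ) : ℤ :=
  chainOff N head (head i).toNat + dep i

theorem Chains.position_range (hC : Chains N p sz head dep) (hF : Forest n N p sz) {i : ℤ}
    (h0 : 0 ≤ i) (h1 : i < N) :
    chainOff N head (head i).toNat ≤ position N head dep i ∧
      position N head dep i < chainOff N head ((head i).toNat + 1) ∧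
      0 ≤ chainOff N head (head i).toNat ∧ position N head dep i < N := by
  obtain ⟨a, b, -, -, e⟩ := hC.facts hF i h0 h1
  have h2 := hC.dep_lt hF i h0 h1
  have h3 : position N head dep i < chainOff N head ((head i).toNat + 1) := by
    rw [chainOff, Finset.sum_range_succ, position, ← chainOff, Int.toNat_of_nonneg a]
    omega
  refine ⟨by unfold position; omega, h3, ?_, ?_⟩
  · simpa [chainOff] using chainOff_mono N head (Nat.zero_le (head i).toNat)
  · have := chainOff_mono N head (show (head i).toNat + 1 ≤ N by omega)
    rw [hC.chainOff_top hF] at this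
    omega

/-- The paths occupy disjoint consecutive blocks, each listed from its top. The start of the block
of `c` up to `c` itself thus holds exactly those ancestors of `c` that share its heavy path. -/
theorem Chains.mem_interval (hC : Chains N p sz head dep) (hF : Forest n N p sz) {c j : ℤ}
    (hc0 : 0 ≤ c) (hc1 : c < N) (hj0 : 0 ≤ j) (hj1 : j < N) :
    (chainOff N head (head c).toNat ≤ position N head dep j ∧
      position N head dep j < position N head dep c + 1) ↔ (head j = head c ∧ dep j ≤ dep c) := by
  obtain ⟨a1, a2, a3, a4⟩ := hC.position_range hF hc0 hc1
  obtain ⟨b1, b2, b3, b4⟩ := hC.position_range hF hj0 hj1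
  obtain ⟨c1, c2, -, -, c3⟩ := hC.facts hF c hc0 hc1
  obtain ⟨d1, d2, -, -, d3⟩ := hC.facts hF j hj0 hj1
  constructor
  · rintro ⟨h1, h2⟩
    have h3 : head j = head c := by
      rcases lt_trichotomy (head j) (head c) with h | h | h
      · have := chainOff_mono N head (show (head j).toNat + 1 ≤ (head c).toNat by omega)
        omega
      · exact h
      · have := chainOff_mono N head (show (head c).toNat + 1 ≤ (head j).toNat by omega)
        omega
    refine ⟨h3, ?_⟩
    unfold position at h2
    rw [h3] at h2
    omega
  · rintro ⟨h1, h2⟩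
    rw [← h1]
    refine ⟨b1, ?_⟩
    unfold position
    rw [h1]
    omega

theorem Chains.position_inj (hC : Chains N p sz head dep) (hF : Forest n N p sz) {i j : ℤ}
    (hi0 : 0 ≤ i) (hi1 : i < N) (hj0 : 0 ≤ j) (hj1 : j < N)
    (h : position N head dep i = position N head dep j) : i = j := by
  obtain ⟨h1, h2⟩ := (hC.mem_interval hF hi0 hi1 hj0 hj1).1
    ⟨by rw [← h]; exact (hC.position_range hF hi0 hi1).1, by omega⟩
  obtain ⟨h3, h4⟩ := (hC.mem_interval hF hj0 hj1 hi0 hi1).1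
    ⟨by rw [h]; exact (hC.position_range hF hj0 hj1).1, by omega⟩
  exact hC.inj hF i hi0 hi1 j hj0 hj1 h3 (by omega)

theorem Chains.anc_iff_chain (hC : Chains N p sz head dep) (hF : Forest n N p sz) {j : ℤ}
    (hj0 : 0 ≤ j) (hj1 : j < N) : ∀ c : ℤ, 0 ≤ c → c < N →
      (Anc p c j ↔ (head j = head c ∧ dep j ≤ dep c) ∨ Anc p (p (head c)) j) := by
  refine hF.induct fun c h0 h1 ih => ?_
  have d3 := (hC.facts hF j hj0 hj1).2.2.2.2
  rw [anc_iff]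
  by_cases hH : Heavy p sz c
  · obtain ⟨e1, e2⟩ := hC.heavy c h0 h1 hH
    rw [ih hH.2.1, e1, e2, ← or_assoc]
    refine or_congr_left ⟨?_, ?_⟩
    · rintro (rfl | ⟨h3, h4⟩)
      · exact ⟨e1, e2.le⟩
      · exact ⟨h3, by omega⟩
    · rintro ⟨h3, h4⟩
      by_cases h5 : dep j = dep c
      · exact Or.inl (hC.inj hF j hj0 hj1 c h0 h1 (by rw [h3, e1]) h5)
      · exact Or.inr ⟨h3, by omega⟩
  · obtain ⟨e1, e2⟩ := hC.light c h0 h1 hH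
    rw [e1, e2]
    refine or_congr_left ⟨?_, ?_⟩
    · rintro rfl
      exact ⟨e1, e2.le⟩
    · rintro ⟨h3, h4⟩
      exact hC.inj hF j hj0 hj1 c h0 h1 (by rw [h3, e1]) (by omega)

/-- Sizes separate the two parts of a root path: nodes on a heavy path are no larger than its top,
and nodes above the top are strictly larger. -/
theorem Chains.chain_disjoint (hC : Chains N p sz head dep) (hF : Forest n N p sz) {c j : ℤ}
    (hj0 : 0 ≤ j) (hj1 : j < N) (hc0 : 0 ≤ c) (hc1 : c < N) (h : head j = head c) :
    ¬ Anc p (p (head c)) j := by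
  obtain ⟨c1, c2, -⟩ := hC.facts hF c hc0 hc1
  obtain ⟨d1, d2, -, d4, -⟩ := hC.facts hF j hj0 hj1
  intro hA
  have hr := hF.range _ c1 c2
  rcases eq_or_lt_of_le hr.1 with h2 | h2
  · rw [← h2] at hA
    have := hF.anc_root hA
    omega
  · have := hF.anc_sz hr.1 hr.2 hj0 hA
    have := hF.sz_lt _ c1 c2 (by omega)
    rw [h] at d4
    omega

/-- The path from `c` to the root is a disjoint union of few intervals of positions. -/
theorem Chains.sum_intervals (hC : Chains N p sz head dep) (hF : Forest n N p sz) {j : ℤ}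
    (hj0 : 0 ≤ j) (hj1 : j < N) {st en : ℤ → ℤ}
    (hst : ∀ c : ℤ, 0 ≤ c → c < N → st c = chainOff N head (head c).toNat)
    (hen : ∀ c : ℤ, 0 ≤ c → c < N → en c = position N head dep c + 1)
    (hen' : en (-1) = 0) (hhead : head (-1) = -1) (T : ℕ) : ∀ c : ℤ, -1 ≤ c → c < N →
      (0 ≤ c → n < sz c * 2 ^ T) →
      ∑ t ∈ Finset.range T, ind (st ((fun i => p (head i))^[t] c) ≤ position N head dep j ∧
        position N head dep j < en ((fun i => p (head i))^[t] c)) = ind (Anc p c j) := by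
  have hpos := hC.position_range hF hj0 hj1
  induction T with
  | zero =>
      intro c hc hc1 hT
      have hn : c = -1 := by
        by_contra h
        have h1 := hT (by omega)
        have := hF.sz_le c (by omega) hc1
        rw [pow_zero, mul_one] at h1
        omega
      rw [Finset.sum_range_zero, hn, ind_false]
      intro h
      have := hF.anc_root h
      omega
  | succ T ih =>
      intro c hc hc1 hT
      rw [Finset.sum_range_succ']
      simp only [Function.iterate_succ_apply, Function.iterate_zero, id_eq]
      rcases eq_or_lt_of_le hc with h | h
      -- At the root the interval is empty because `en (-1) = 0`, so rounds left over after reaching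
      -- the root add nothing.
      · rw [← h, hhead, hF.root, hen', ind_false (P := _ ∧ _) (by omega), add_zero]
        exact ih (-1) le_rfl (by omega) (by omega)
      · have h0 : 0 ≤ c := by omega
        obtain ⟨c1, c2, c3, c4, -⟩ := hC.facts hF c h0 hc1
        have hr := hF.range _ c1 c2
        rw [ih _ hr.1 hr.2, hst c h0 hc1, hen c h0 hc1, ind_congr (hC.mem_interval hF h0 hc1 hj0 hj1),
          ind_congr (hC.anc_iff_chain hF hj0 hj1 c h0 hc1)]
        · by_cases hch : head j = head c ∧ dep j ≤ dep c
          · rw [ind_true hch, ind_true (Or.inl hch),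
              ind_false (hC.chain_disjoint hF hj0 hj1 h0 hc1 hch.1)]
            rfl
          · rw [ind_false hch, add_zero]
            exact ind_congr (by tauto)
        · intro hp
          -- The top of a heavy path is light, so its parent is at least twice as large. This pays
          -- for the exponent of two lost in the induction.
          have h5 : 2 * sz (head c) ≤ sz (p (head c)) := by
            by_contra h6
            exact c3 ⟨c1, hp, by omega⟩
          have h6 := hT h0
          have h7 : (0 : ℤ) < 2 ^ T := by positivity
          rw [pow_succ] at h6
          nlinarith

end Chains

end Forest

/-- Following pointers that stop at the nodes with property `K` finds the nearest such node. -/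
theorem Forest.nearest {n N : ℕ} {p sz g : ℤ → ℤ} (hF : Forest n N p sz) {K : ℤ → Prop}
    (hgK : ∀ i : ℤ, 0 ≤ i → i < N → K i → g i = i) (hg : ∀ i : ℤ, 0 ≤ i → i < N → ¬ K i → g i = p i)
    (hroot : g (-1) = -1) {T : ℕ} (hT : n ≤ T) {c : ℤ} (hc : -1 ≤ c) (hc1 : c < N) :
    (g^[T] c = -1 ∧ ∀ j : ℤ, 0 ≤ j → K j → ¬ Anc p c j) ∨
      (0 ≤ g^[T] c ∧ g^[T] c < N ∧ K (g^[T] c) ∧ Anc p c (g^[T] c) ∧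
        ∀ j : ℤ, 0 ≤ j → K j → Anc p c j → Anc p (g^[T] c) j) := by
  suffices H : ∀ T : ℕ, ∀ c : ℤ, -1 ≤ c → c < N → (0 ≤ c → n - sz c < T) →
      ((g^[T] c = -1 ∧ ∀ j : ℤ, 0 ≤ j → K j → ¬ Anc p c j) ∨
      (0 ≤ g^[T] c ∧ g^[T] c < N ∧ K (g^[T] c) ∧ Anc p c (g^[T] c) ∧
        ∀ j : ℤ, 0 ≤ j → K j → Anc p c j → Anc p (g^[T] c) j)) by
    refine H T c hc hc1 fun h0 => ?_
    have := hF.sz_pos c h0 hc1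
    omega
  intro T
  induction T with
  | zero =>
      intro c hc hc1 h
      have h2 : ¬ 0 ≤ c := fun h0 => by
        have := h h0
        have := hF.sz_le c h0 hc1
        push_cast at *
        omega
      have h3 : c = -1 := by omega
      left
      refine ⟨h3, fun j hj _ hA => ?_⟩
      rw [h3] at hA
      have := hF.anc_root hA
      omega
  | succ T ih =>
      intro c hc hc1 h
      rw [Function.iterate_succ_apply]
      rcases eq_or_lt_of_le hc with h2 | h2
      · rw [← h2, hroot]
        exact ih (-1) le_rfl (by omega) (by omega)
      · have h0 : 0 ≤ c := by omega
        by_cases hK : K c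
        · have h4 := hgK c h0 hc1 hK
          rw [h4, Function.iterate_fixed h4]
          exact Or.inr ⟨h0, hc1, hK, Anc.refl _ _, fun j _ _ hA => hA⟩
        · rw [hg c h0 hc1 hK]
          have hr := hF.range c h0 hc1
          have key : ∀ j, K j → (Anc p c j ↔ Anc p (p c) j) := fun j hj => by
            rw [anc_iff]
            refine or_iff_right ?_
            rintro rfl
            exact hK hj
          rcases ih (p c) hr.1 hr.2 fun hp => by
            have := hF.sz_lt c h0 hc1 hp
            have := h h0
            push_cast at this
            omega
            with ⟨e, h5⟩ | ⟨e1, e2, e3, e4, e5⟩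
          · exact Or.inl ⟨e, fun j hj hKj => by rw [key j hKj]; exact h5 j hj hKj⟩
          · exact Or.inr ⟨e1, e2, e3, anc_iff.2 (Or.inr e4),
              fun j hj hKj hA => e5 j hj hKj ((key j hKj).1 hA)⟩

/-! ### Notation for expressions and accumulating loops -/

instance : Add Expr := ⟨Expr.add⟩
instance : Sub Expr := ⟨Expr.sub⟩
instance : Mul Expr := ⟨Expr.mul⟩
instance : Div Expr := ⟨Expr.div⟩

@[simp] theorem Expr.eval_hadd (s : Mem) (e f : Expr) : (e + f).eval s = e.eval s + f.eval s := rfl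
@[simp] theorem Expr.eval_hsub (s : Mem) (e f : Expr) : (e - f).eval s = e.eval s - f.eval s := rfl
@[simp] theorem Expr.eval_hmul (s : Mem) (e f : Expr) : (e * f).eval s = e.eval s * f.eval s := rfl
@[simp] theorem Expr.eval_hdiv (s : Mem) (e f : Expr) : (e / f).eval s = e.eval s / f.eval s := rfl
@[simp] theorem Expr.eval_var (s : Mem) (x : ℕ) : (Expr.var x).eval s = s.var x := rfl
@[simp] theorem Expr.eval_const (s : Mem) (z : ℤ) : (Expr.const z).eval s = z := rfl
@[simp] theorem Expr.eval_get (s : Mem) (a : ℕ) (i : Expr) :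
    (Expr.get a i).eval s = s.arr a (i.eval s) := rfl

infixr:60 " ;; " => Prog.seq

/-- `for x := 0 to y - 1 do a[i] := a[i] + e`. -/
def Prog.scatterTo (x y a : ℕ) (i e : Expr) : Prog := .forTo x y (.put a i (.get a i + e))

theorem WP.scatterTo {B Y' : ℕ} {x y a : ℕ} {i e : Expr} {s : Mem} {Q : Mem → Prop}
    (N : ℕ) (hy : s.var y = N) (hN : N ≤ B) (hxy : y ≠ x) (κ ω : ℕ → ℤ)
    (hg : ∀ k < N, ∀ s', Agree [x] [a] s s' → s'.var x = k → i.eval s' = κ k ∧ e.eval s' = ω k)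
    (hB : ∀ k < N,
      |s.arr a (κ k) + ∑ l ∈ Finset.range (k + 1), ind (κ l = κ k) * ω l| ≤ (B : ℤ))
    (hY' : N + 1 ≤ Y')
    (hQ : ∀ s', Agree [x] [a] s s' →
      (∀ j, s'.arr a j = s.arr a j + ∑ l ∈ Finset.range N, ind (κ l = j) * ω l) → Q s') :
    WP B Y' (Prog.scatterTo x y a i e) s Q := by
  refine WP.forTo (Y := 1) le_rfl N hy hN (by simp [Prog.wv]) (by simp [Prog.wv]) hxy
    (fun k s' => ∀ j, s'.arr a j = s.arr a j + ∑ l ∈ Finset.range k, ind (κ l = j) * ω l)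
    ?_ ?_ (by simpa) ?_
  · intro j; simp
  · intro k hk s' ha hx hI
    obtain ⟨h1, h2⟩ := hg k hk s' ha hx
    have h3 : s'.arr a (κ k) + ω k =
        s.arr a (κ k) + ∑ l ∈ Finset.range (k + 1), ind (κ l = κ k) * ω l := by
      rw [hI, Finset.sum_range_succ, ind_true rfl, one_mul, add_assoc]
    refine WP.put le_rfl ?_ ?_
    · rw [Expr.eval_hadd, Expr.eval_get, h1, h2, h3]
      exact hB k hk
    · intro j
      simp only [Expr.eval_hadd, Expr.eval_get, h1, h2, h3, Mem.setVar_arr, Mem.setArr_arr,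
        if_true, Function.update_apply]
      split
      · next h => rw [h]
      · next h =>
        rw [hI, Finset.sum_range_succ, ind_false (fun h' => h h'.symm), zero_mul, add_zero]
  · intro s' ha _ hI
    exact hQ s' ha hI

/-- `for x := 0 to y - 1 do a[x + 1] := a[x] + e`. -/
def Prog.scanTo (x y a : ℕ) (e : Expr) : Prog :=
  .forTo x y (.put a (.var x + .const 1) (.get a (.var x) + e))

theorem WP.scanTo {B Y' : ℕ} {x y a : ℕ} {e : Expr} {s : Mem} {Q : Mem → Prop}
    (N : ℕ) (hy : s.var y = N) (hN : N ≤ B) (hxy : y ≠ x) (ω : ℕ → ℤ)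
    (hg : ∀ k < N, ∀ s', Agree [x] [a] s s' → s'.var x = k → e.eval s' = ω k)
    (hB : ∀ k ≤ N, |s.arr a 0 + ∑ l ∈ Finset.range k, ω l| ≤ (B : ℤ))
    (hY' : N + 1 ≤ Y')
    (hQ : ∀ s', Agree [x] [a] s s' → (∀ k : ℕ, k ≤ N →
      s'.arr a k = s.arr a 0 + ∑ l ∈ Finset.range k, ω l) →
      (∀ j : ℤ, j < 0 → s'.arr a j = s.arr a j) → Q s') :
    WP B Y' (Prog.scanTo x y a e) s Q := by
  refine WP.forTo (Y := 1) le_rfl N hy hN (by simp [Prog.wv]) (by simp [Prog.wv]) hxy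
    (fun k s' => (∀ l : ℕ, l ≤ k → s'.arr a l = s.arr a 0 + ∑ i ∈ Finset.range l, ω i) ∧
      ∀ j : ℤ, j < 0 → s'.arr a j = s.arr a j)
    ?_ ?_ (by simpa) ?_
  · refine ⟨fun l hl => ?_, fun j _ => rfl⟩
    obtain rfl : l = 0 := by omega
    simp
  · intro k hk s' ha hx hI
    have h2 := hg k hk s' ha hx
    have h3 : s'.arr a k + ω k = s.arr a 0 + ∑ l ∈ Finset.range (k + 1), ω l := by
      rw [hI.1 k le_rfl, Finset.sum_range_succ, add_assoc]
    refine WP.put le_rfl ?_ ⟨fun l hl => ?_, fun j hj => ?_⟩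
    · rw [Expr.eval_hadd, Expr.eval_get, Expr.eval_var, hx, h2, h3]
      exact hB (k + 1) hk
    · simp only [Expr.eval_hadd, Expr.eval_get, Expr.eval_var, Expr.eval_const, hx, h2, h3,
        Mem.setVar_arr, Mem.setArr_arr, if_true, Function.update_apply]
      split
      · next h =>
        obtain rfl : l = k + 1 := by exact_mod_cast h
        rfl
      · next h => exact hI.1 l (by
          have : l ≠ k + 1 := fun h' => h (by rw [h']; push_cast; rfl)
          omega)
    · simp only [Expr.eval_hadd, Expr.eval_var, Expr.eval_const, hx,
        Mem.setVar_arr, Mem.setArr_arr, if_true, Function.update_apply]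
      rw [if_neg (by omega), hI.2 j hj]
  · intro s' ha _ hI
    exact hQ s' ha hI.1 hI.2

/-! ## Pointer doubling -/

/-- Replaces the pointers in array `0` by their iterates of order `2 ^ L` and sums the values in
array `1` along the way (`L` is variable `5`, the number of nodes is variable `10`). -/
def jump : Prog :=
  .forTo 11 5 (
    .mapTo 12 10 2 (.get 0 (.get 0 (.var 12))) ;;
    .mapTo 12 10 3 (.get 1 (.var 12) + .get 1 (.get 0 (.var 12))) ;;
    .mapTo 12 10 0 (.get 2 (.var 12)) ;;
    .mapTo 12 10 1 (.get 3 (.var 12)))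

theorem iterate_range_of {N : ℕ} {f : ℤ → ℤ}
    (hf : ∀ j : ℤ, -1 ≤ j → j < N → -1 ≤ f j ∧ f j < N) (k : ℕ) :
    ∀ j : ℤ, -1 ≤ j → j < N → -1 ≤ f^[k] j ∧ f^[k] j < N := by
  induction k with
  | zero => exact fun j h0 h1 => ⟨h0, h1⟩
  | succ k ih =>
      intro j h0 h1
      rw [Function.iterate_succ_apply]
      exact ih _ (hf j h0 h1).1 (hf j h0 h1).2

theorem abs_le_of_range {B N : ℕ} {z : ℤ} (hN : N ≤ B) (h1B : 1 ≤ B) (h0 : -1 ≤ z) (h1 : z < N) :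
    |z| ≤ (B : ℤ) := by
  rw [abs_le]; constructor <;> omega

/-- After `k` rounds the arrays hold the iterate of order `2 ^ k` and the sum over the first `2 ^ k`
iterates. The loops only write indices `0, …, N - 1`; the sentinel at `-1` stays correct since `f`
fixes `-1` and `d` vanishes there. -/
theorem jump_spec {B Y N L : ℕ} {s : Mem} {f d : ℤ → ℤ} (hL : s.var 5 = L) (hN : s.var 10 = N)
    (hLB : 2 ^ L ≤ B) (hNB : N ≤ B)
    (hf : ∀ j : ℤ, -1 ≤ j → j < N → -1 ≤ f j ∧ f j < N) (hf1 : f (-1) = -1)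
    (hd : ∀ j : ℤ, -1 ≤ j → j < N → 0 ≤ d j ∧ d j ≤ 1) (hd1 : d (-1) = 0)
    (h0 : ∀ j : ℤ, -1 ≤ j → j < N → s.arr 0 j = f j)
    (h1 : ∀ j : ℤ, -1 ≤ j → j < N → s.arr 1 j = d j) (hY : (L + 1) * (N + 1) ≤ Y) :
    WP B Y jump s fun s' =>
      (∀ j : ℤ, -1 ≤ j → j < N → s'.arr 0 j = f^[2 ^ L] j) ∧
      ∀ j : ℤ, -1 ≤ j → j < N → s'.arr 1 j = ∑ k ∈ Finset.range (2 ^ L), d (f^[k] j) := by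
  have hB1 : 1 ≤ B := le_trans Nat.one_le_two_pow hLB
  have hLB' : L ≤ B := le_trans (Nat.lt_two_pow_self).le hLB
  refine WP.forTo (Y := N + 1) (by omega) L hL hLB' (by decide) (by decide) (by decide)
    (fun k s' => (∀ j : ℤ, -1 ≤ j → j < N → s'.arr 0 j = f^[2 ^ k] j) ∧
      ∀ j : ℤ, -1 ≤ j → j < N → s'.arr 1 j = ∑ i ∈ Finset.range (2 ^ k), d (f^[i] j)) ?_ ?_ hY
    (fun s' _ _ h => h)
  · exact ⟨fun j a b => by simpa using h0 j a b, fun j a b => by simpa using h1 j a b⟩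
  · rintro k hk s1 ha - ⟨i0, i1⟩
    have hN1 : s1.var 10 = N := by rw [ha.1 10 (by decide), hN]
    have hr := iterate_range_of hf (2 ^ k)
    have hr' := iterate_range_of hf (2 ^ (k + 1))
    have e0 : ∀ j : ℤ, -1 ≤ j → j < N → f^[2 ^ k] (f^[2 ^ k] j) = f^[2 ^ (k + 1)] j :=
      fun j _ _ => by rw [← Function.iterate_add_apply, pow_succ, mul_two]
    have e1 : ∀ j : ℤ, -1 ≤ j → j < N → ∑ i ∈ Finset.range (2 ^ k), d (f^[i] j) +
        ∑ i ∈ Finset.range (2 ^ k), d (f^[i] (f^[2 ^ k] j)) =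
          ∑ i ∈ Finset.range (2 ^ (k + 1)), d (f^[i] j) := fun j _ _ => by
      rw [pow_succ, mul_two, Finset.sum_range_add]
      congr 1
      refine Finset.sum_congr rfl fun i _ => ?_
      rw [← Function.iterate_add_apply, add_comm]
    have hs : ∀ j : ℤ, -1 ≤ j → j < N →
        |∑ i ∈ Finset.range (2 ^ (k + 1)), d (f^[i] j)| ≤ (B : ℤ) := fun j a b => by
      have hh : ∀ i, 0 ≤ d (f^[i] j) ∧ d (f^[i] j) ≤ 1 := fun i =>
        hd _ (iterate_range_of hf i j a b).1 (iterate_range_of hf i j a b).2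
      rw [abs_of_nonneg (Finset.sum_nonneg fun i _ => (hh i).1)]
      have h2 : ∑ i ∈ Finset.range (2 ^ (k + 1)), d (f^[i] j) ≤
          ∑ i ∈ Finset.range (2 ^ (k + 1)), 1 := Finset.sum_le_sum fun i _ => (hh i).2
      have h3 : 2 ^ (k + 1) ≤ B := le_trans (Nat.pow_le_pow_right (by norm_num) hk) hLB
      simp only [Finset.sum_const, Finset.card_range, nsmul_eq_mul, mul_one] at h2
      exact h2.trans (by exact_mod_cast h3)
    have hf1' := Function.iterate_fixed hf1
    refine WP.seq (WP.mapTo N hN1 hNB (by decide) (f^[2 ^ (k + 1)]) ?_ le_rfl ?_)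
    · intro i hi s' ha' hx _
      have := hr i (by omega) (by omega)
      have := hr' i (by omega) (by omega)
      refine ⟨?_, abs_le_of_range hNB hB1 this.1 this.2⟩
      simp only [Expr.eval_get, Expr.eval_var, hx, ha'.2 0 (by decide)]
      rw [i0 i (by omega) (by omega), i0 _ (by omega) (by omega), e0 i (by omega) (by omega)]
    intro s2 ha2 h2
    refine WP.seq (WP.mapTo N (by rw [ha2.1 10 (by decide), hN1]) hNB (by decide)
      (fun j => ∑ i ∈ Finset.range (2 ^ (k + 1)), d (f^[i] j)) ?_ le_rfl ?_)
    · intro i hi s' ha' hx _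
      have := hr i (by omega) (by omega)
      refine ⟨?_, hs i (by omega) (by omega)⟩
      simp only [Expr.eval_hadd, Expr.eval_get, Expr.eval_var, hx, ha'.2 0 (by decide),
        ha'.2 1 (by decide), ha2.2 0 (by decide), ha2.2 1 (by decide)]
      rw [i0 i (by omega) (by omega), i1 _ (by omega) (by omega), i1 _ (by omega) (by omega),
        e1 i (by omega) (by omega)]
    intro s3 ha3 h3
    refine WP.seq (WP.mapTo N (by rw [ha3.1 10 (by decide), ha2.1 10 (by decide), hN1]) hNB
      (by decide) (f^[2 ^ (k + 1)]) ?_ le_rfl ?_)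
    · intro i hi s' ha' hx _
      have := hr' i (by omega) (by omega)
      refine ⟨?_, abs_le_of_range hNB hB1 this.1 this.2⟩
      simp only [Expr.eval_get, Expr.eval_var, hx, ha'.2 2 (by decide), ha3.2 2 (by decide)]
      rw [h2, if_pos (by omega)]
    intro s4 ha4 h4
    refine WP.mapTo N (by rw [ha4.1 10 (by decide), ha3.1 10 (by decide), ha2.1 10 (by decide),
      hN1]) hNB (by decide) (fun j => ∑ i ∈ Finset.range (2 ^ (k + 1)), d (f^[i] j)) ?_ le_rfl ?_
    · intro i hi s' ha' hx _
      refine ⟨?_, hs i (by omega) (by omega)⟩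
      simp only [Expr.eval_get, Expr.eval_var, hx, ha'.2 3 (by decide), ha4.2 3 (by decide)]
      rw [h3, if_pos (by omega)]
    intro s5 ha5 h5
    refine ⟨fun j a b => ?_, fun j a b => ?_⟩
    · rw [Mem.setVar_arr, ha5.2 0 (by decide), h4]
      split
      · rfl
      · obtain rfl : j = -1 := by omega
        rw [ha3.2 0 (by decide), ha2.2 0 (by decide), i0 _ a b, hf1', hf1']
    · rw [Mem.setVar_arr, h5]
      split
      · rfl
      · obtain rfl : j = -1 := by omega
        rw [ha4.2 1 (by decide), ha3.2 1 (by decide), ha2.2 1 (by decide), i1 _ a b]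
        simp [hf1', hd1]

/-! ## Layout of a tree: subtree sizes, heavy paths, positions, root path intervals -/

/-- Copies the parent pointers (array `0`) to the arrays `2` and `3`, with a sentinel at `-1`. -/
def copyParents : Prog :=
  .mapTo 12 10 2 (.get 0 (.var 12)) ;;
  .put 2 (.const (-1)) (.const (-1)) ;;
  .mapTo 12 10 3 (.get 0 (.var 12)) ;;
  .put 3 (.const (-1)) (.const (-1))

/-- Computes in array `4` the number of vertices below every node. -/
def computeSizes : Prog :=
  .scatterTo 12 0 4 (.get 1 (.var 12)) (.const 1) ;;
  .forTo 11 5 (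
    .mapTo 12 10 6 (.get 4 (.var 12)) ;;
    .put 6 (.const (-1)) (.const 0) ;;
    .scatterTo 12 10 6 (.get 3 (.var 12)) (.get 4 (.var 12)) ;;
    .mapTo 12 10 4 (.get 6 (.var 12)) ;;
    .mapTo 12 10 5 (.get 3 (.get 3 (.var 12))) ;;
    .mapTo 12 10 3 (.get 5 (.var 12))) ;;
  -- The size of the root is set above twice the size of any node. This makes the heaviness quotient
  -- vanish at children of the root and lets every proper node win a size comparison with the root.
  .put 4 (.const (-1)) (.const 2 * .var 0 + .const 2)

/-- Computes the topmost node of the heavy path (array `7`) and the distance to it (array `8`). -/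
def computeChains : Prog :=
  -- For a proper parent the quotient of `2 sz i` by `sz (p i) + 1` is exactly the indicator of
  -- heaviness: it is below `2` because `sz i < sz (p i)`, and it is at least `1` iff `2 sz i > sz
  -- (p i)`.
  .mapTo 12 10 8 ((.const 2 * .get 4 (.var 12)) / (.get 4 (.get 2 (.var 12)) + .const 1)) ;;
  .mapTo 12 10 7 (.var 12 + .get 8 (.var 12) * (.get 2 (.var 12) - .var 12)) ;;
  .put 7 (.const (-1)) (.const (-1)) ;;
  jump.rename (relabel [7, 8, 5, 6] 100)

/-- Computes the positions of the nodes in array `12`. -/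
def computePositions : Prog :=
  .scatterTo 12 10 10 (.get 7 (.var 12)) (.const 1) ;;
  .scanTo 12 10 11 (.get 10 (.var 12)) ;;
  .mapTo 12 10 12 (.get 11 (.get 7 (.var 12)) + .get 8 (.var 12)) ;;
  .put 12 (.const (-1)) (.const (-1))

/-- Computes the intervals that make up the path from every node to the root. -/
def computeIntervals : Prog :=
  .forTo 11 10 (
    .assign 14 (.var 11) ;;
    .forTo 13 5 (
      .put 13 (.var 11 * .var 5 + .var 13) (.get 11 (.get 7 (.var 14))) ;;
      .put 14 (.var 11 * .var 5 + .var 13) (.get 12 (.var 14) + .const 1) ;;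
      .assign 14 (.get 2 (.get 7 (.var 14)))))

def layout : Prog :=
  copyParents ;; computeSizes ;; computeChains ;; computePositions ;; computeIntervals

section Layout

variable {B Y Z n N L : ℕ} {p sz home : ℤ → ℤ} {s : Mem}

theorem copyParents_spec (hF : Forest n N p sz) (hN : s.var 10 = N) (hNB : N ≤ B) (hB1 : 1 ≤ B)
    (h0 : ∀ j : ℤ, 0 ≤ j → j < N → s.arr 0 j = p j) (hY : N + 1 ≤ Y) :
    WP B Y copyParents s fun s' => (∀ j : ℤ, -1 ≤ j → j < N → s'.arr 2 j = p j) ∧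
      ∀ j : ℤ, -1 ≤ j → j < N → s'.arr 3 j = p j := by
  have hB1' : (1 : ℤ) ≤ B := by exact_mod_cast hB1
  refine WP.seq (WP.mapTo N hN hNB (by decide) p ?_ hY ?_)
  · intro i hi s' ha hx _
    have := hF.range i (by omega) (by omega)
    refine ⟨?_, abs_le_of_range hNB hB1 this.1 this.2⟩
    simp only [Expr.eval_get, Expr.eval_var, hx, ha.2 0 (by decide)]
    exact h0 i (by omega) (by omega)
  intro s2 ha2 h2
  refine WP.seq (WP.put (by omega) (by simpa using hB1') ?_)
  refine WP.seq (WP.mapTo N (by simp [ha2.1 10 (by decide), hN]) hNB (by decide) p ?_ hY ?_)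
  · intro i hi s' ha hx _
    have := hF.range i (by omega) (by omega)
    refine ⟨?_, abs_le_of_range hNB hB1 this.1 this.2⟩
    simp only [Expr.eval_get, Expr.eval_var, hx, ha.2 0 (by decide)]
    simp [ha2.2 0 (by decide)]
    exact h0 i (by omega) (by omega)
  intro s3 ha3 h3
  refine WP.put (by omega) (by simpa using hB1') ⟨fun j a b => ?_, fun j a b => ?_⟩
  · simp only [Mem.setArr_arr, Nat.reduceEqDiff, if_false,
      ha3.2 2 (by decide), if_true, Function.update_apply, Expr.eval_const, h2]
    split
    · next h => rw [h, hF.root]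
    · rw [if_pos (by omega)]
  · simp only [Mem.setArr_arr, if_true, Function.update_apply, Expr.eval_const, h3]
    split
    · next h => rw [h, hF.root]
    · rw [if_pos (by omega)]

theorem abs_sum_ind_le (k : ℕ) (P : ℕ → Prop) (ω : ℕ → ℤ) (c : ℕ)
    (hω : ∀ l < k, 0 ≤ ω l ∧ ω l ≤ c) :
    0 ≤ ∑ l ∈ Finset.range k, ind (P l) * ω l ∧
      ∑ l ∈ Finset.range k, ind (P l) * ω l ≤ k * c := by
  constructor
  · exact Finset.sum_nonneg fun l hl =>
      mul_nonneg (ind_nonneg _) (hω l (Finset.mem_range.1 hl)).1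
  · have : ∑ l ∈ Finset.range k, ind (P l) * ω l ≤ ∑ l ∈ Finset.range k, (c : ℤ) := by
      refine Finset.sum_le_sum fun l hl => ?_
      have h1 := hω l (Finset.mem_range.1 hl)
      have h2 := ind_nonneg (P l)
      have h3 := ind_le_one (P l)
      nlinarith
    simpa using this

/-- Array `4` runs through the values `reachCount` and array `3` through the iterated pointers.
Entry `-1` of the scratch array `6` absorbs the contributions of pointers that have reached the
root; it is cleared in every round only to keep it bounded. -/
theorem computeSizes_spec (hF : Forest n N p sz) (hn : s.var 0 = n) (hN : s.var 10 = N)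
    (hL : s.var 5 = L) (hnL : n < 2 ^ L) (hZ : n + N + 2 ^ L + 10 ≤ Z) (hZB : Z ^ 2 ≤ B)
    (hh : ∀ v : ℕ, v < n → -1 ≤ home v ∧ home v < N)
    (hsz : ∀ j : ℤ, 0 ≤ j → j < N → sz j = ∑ v ∈ Finset.range n, ind (Anc p (home v) j))
    (h1 : ∀ v : ℕ, v < n → s.arr 1 v = home v)
    (h3 : ∀ j : ℤ, -1 ≤ j → j < N → s.arr 3 j = p j)
    (h4 : ∀ j, s.arr 4 j = 0) (hY : (n + 1) + (L + 1) * (N + 1) ≤ Y) :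
    WP B Y computeSizes s fun s' => (∀ j : ℤ, 0 ≤ j → j < N → s'.arr 4 j = sz j) ∧
      s'.arr 4 (-1) = 2 * n + 2 := by
  have hZ2 : (n + 1) * (N + 1) + Z ≤ B := by nlinarith
  have hZB' : Z ≤ B := by omega
  have hNB : N ≤ B := by omega
  have hLlt := (Nat.lt_two_pow_self (n := L))
  have hr : ∀ k, ∀ j : ℤ, -1 ≤ j → j < N → -1 ≤ p^[k] j ∧ p^[k] j < N :=
    fun k j a b => hF.iterate_range a b k
  refine WP.seq (WP.scatterTo n hn (by omega) (by decide) (fun v => home v) (fun _ => 1) ?_ ?_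
    (by nlinarith) ?_)
  · intro v hv s' ha hx
    simp only [Expr.eval_get, Expr.eval_var, hx, ha.2 1 (by decide), Expr.eval_const]
    exact ⟨h1 v hv, trivial⟩
  · intro v hv
    have := abs_sum_ind_le (v + 1) (fun l : ℕ => home l = home v) (fun _ => 1) 1 (by simp)
    rw [h4, zero_add, abs_of_nonneg this.1]
    push_cast at this
    omega
  intro s1 ha1 hs1
  refine WP.seq (WP.forTo (Y := N + 1) (by omega) L (by rw [ha1.1 5 (by decide), hL]) (by omega)
    (by decide) (by decide) (by decide)
    (fun k s' => (∀ j : ℤ, 0 ≤ j → j < N → s'.arr 4 j = reachCount n p home k j) ∧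
      ∀ j : ℤ, -1 ≤ j → j < N → s'.arr 3 j = p^[2 ^ k] j) ?_ ?_ (by omega) ?_)
  · refine ⟨fun j a b => ?_, fun j a b => ?_⟩
    · simp [hs1, h4, reachCount]
    · simp [ha1.2 3 (by decide), h3 j a b]
  · rintro k hk s2 ha2 - ⟨i4, i3⟩
    have hN2 : s2.var 10 = N := by rw [ha2.1 10 (by decide), ha1.1 10 (by decide), hN]
    have hrc : ∀ k, ∀ j : ℤ, 0 ≤ j → j < N →
        0 ≤ reachCount n p home k j ∧ reachCount n p home k j ≤ n :=
      fun k j a _ => ⟨reachCount_nonneg _ _ _ _ _, hF.reachCount_le hh k a⟩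
    have hrc' : ∀ k, ∀ j : ℤ, 0 ≤ j → j < N → |reachCount n p home k j| ≤ (B : ℤ) :=
      fun k j a b => by
        have := hrc k j a b
        rw [abs_of_nonneg this.1]; omega
    refine WP.seq (WP.mapTo N hN2 hNB (by decide) (reachCount n p home k) ?_ le_rfl ?_)
    · intro i hi s' ha hx _
      simp only [Expr.eval_get, Expr.eval_var, hx, ha.2 4 (by decide)]
      exact ⟨i4 i (by omega) (by omega), hrc' k i (by omega) (by omega)⟩
    intro s3 ha3 h3
    refine WP.seq (WP.put (by omega) (by simp) ?_)
    refine WP.seq (WP.scatterTo N (by simp [ha3.1 10 (by decide), hN2]) hNB (by decide)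
      (fun i => p^[2 ^ k] i) (fun i => reachCount n p home k i) ?_ ?_ le_rfl ?_)
    · intro i hi s' ha hx
      simp only [Expr.eval_get, Expr.eval_var, hx, ha.2 3 (by decide), ha.2 4 (by decide)]
      simp [ha3.2 3 (by decide), ha3.2 4 (by decide)]
      exact ⟨i3 i (by omega) (by omega), i4 i (by omega) (by omega)⟩
    · intro i hi
      have h5 := abs_sum_ind_le (i + 1) (fun l : ℕ => p^[2 ^ k] l = p^[2 ^ k] i)
        (fun l => reachCount n p home k l) n fun l hl => hrc k l (by omega) (by omega)
      have h6 : 0 ≤ (s3.setArr 6 (-1) 0).arr 6 (p^[2 ^ k] i) ∧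
          (s3.setArr 6 (-1) 0).arr 6 (p^[2 ^ k] i) ≤ n := by
        have := hr (2 ^ k) i (by omega) (by omega)
        simp only [Mem.setArr_arr, if_true, Function.update_apply, h3]
        split
        · omega
        · rw [if_pos (by omega)]
          exact hrc k _ (by omega) this.2
      have h7 : ((i + 1 : ℕ) : ℤ) * n ≤ N * n := by gcongr; omega
      have h8 : (N : ℤ) * n + n ≤ B := by
        have : N * n + n ≤ B := by nlinarith
        exact_mod_cast this
      simp only [Expr.eval_const]
      rw [abs_of_nonneg (by omega)]
      omega
    intro s4 ha4 h4
    have h4' : ∀ j : ℤ, 0 ≤ j → j < N → s4.arr 6 j = reachCount n p home (k + 1) j := by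
      intro j a b
      rw [h4, hF.reachCount_succ hh k a]
      simp only [Mem.setArr_arr, if_true, Expr.eval_const, Function.update_apply, h3]
      rw [if_neg (by omega), if_pos (by omega)]
    have hN4 : s4.var 10 = N := by rw [ha4.1 10 (by decide), Mem.setArr_var,
      ha3.1 10 (by decide), hN2]
    have h43 : ∀ j : ℤ, -1 ≤ j → j < N → s4.arr 3 j = p^[2 ^ k] j := by
      intro j a b
      rw [ha4.2 3 (by decide), Mem.setArr_arr, if_neg (by decide), ha3.2 3 (by decide), i3 j a b]
    refine WP.seq (WP.mapTo N hN4 hNB (by decide) (reachCount n p home (k + 1)) ?_ le_rfl ?_)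
    · intro i hi s' ha hx _
      simp only [Expr.eval_get, Expr.eval_var, hx, ha.2 6 (by decide)]
      exact ⟨h4' i (by omega) (by omega), hrc' _ i (by omega) (by omega)⟩
    intro s5 ha5 h5
    have hN5 : s5.var 10 = N := by rw [ha5.1 10 (by decide), hN4]
    have e0 : ∀ j, p^[2 ^ k] (p^[2 ^ k] j) = p^[2 ^ (k + 1)] j :=
      fun j => by rw [← Function.iterate_add_apply, pow_succ, mul_two]
    refine WP.seq (WP.mapTo N hN5 hNB (by decide) (p^[2 ^ (k + 1)]) ?_ le_rfl ?_)
    · intro i hi s' ha hx _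
      have := hr (2 ^ k) i (by omega) (by omega)
      have := hr (2 ^ (k + 1)) i (by omega) (by omega)
      refine ⟨?_, abs_le_of_range hNB (by omega) this.1 this.2⟩
      simp only [Expr.eval_get, Expr.eval_var, hx, ha.2 3 (by decide), ha5.2 3 (by decide)]
      rw [h43 i (by omega) (by omega), h43 _ (by omega) (by omega), e0]
    intro s6 ha6 h6
    refine WP.mapTo N (by rw [ha6.1 10 (by decide), hN5]) hNB (by decide) (p^[2 ^ (k + 1)]) ?_
      le_rfl ?_
    · intro i hi s' ha hx _
      have := hr (2 ^ (k + 1)) i (by omega) (by omega)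
      refine ⟨?_, abs_le_of_range hNB (by omega) this.1 this.2⟩
      simp only [Expr.eval_get, Expr.eval_var, hx, ha.2 5 (by decide)]
      rw [h6, if_pos (by omega)]
    intro s7 ha7 h7
    refine ⟨fun j a b => ?_, fun j a b => ?_⟩
    · rw [Mem.setVar_arr, ha7.2 4 (by decide), ha6.2 4 (by decide), h5, if_pos (by omega)]
    · rw [Mem.setVar_arr, h7]
      split
      · rfl
      · obtain rfl : j = -1 := by omega
        rw [ha6.2 3 (by decide), ha5.2 3 (by decide), h43 _ a b, hF.iterate_root, hF.iterate_root]
  · rintro s2 ha2 - ⟨i4, -⟩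
    have hn2 : s2.var 0 = n := by rw [ha2.1 0 (by decide), ha1.1 0 (by decide), hn]
    refine WP.put (by omega) ?_ ⟨fun j a b => ?_, ?_⟩
    · simp only [Expr.eval_hadd, Expr.eval_hmul, Expr.eval_const, Expr.eval_var, hn2]
      rw [abs_of_nonneg (by omega)]
      nlinarith
    · simp only [Mem.setArr_arr, if_true, Expr.eval_const, Function.update_apply]
      rw [if_neg (by omega), i4 j a b, hF.reachCount_eq hh hnL.le a, hsz j a b]
    · simp [hn2]

theorem computeChains_spec (hF : Forest n N p sz) (hN : s.var 10 = N)
    (hL : s.var 5 = L) (hnL : n < 2 ^ L) (hZ : n + N + 2 ^ L + 10 ≤ Z) (hZB : Z ^ 2 ≤ B)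
    (h2 : ∀ j : ℤ, -1 ≤ j → j < N → s.arr 2 j = p j)
    (h4 : ∀ j : ℤ, 0 ≤ j → j < N → s.arr 4 j = sz j) (h41 : s.arr 4 (-1) = 2 * n + 2)
    (h8 : s.arr 8 (-1) = 0) (hY : (L + 1) * (N + 1) ≤ Y) :
    WP B Y computeChains s fun s' => ∃ head dep : ℤ → ℤ, Chains N p sz head dep ∧
      head (-1) = -1 ∧ (∀ j : ℤ, -1 ≤ j → j < N → s'.arr 7 j = head j) ∧
      ∀ j : ℤ, 0 ≤ j → j < N → s'.arr 8 j = dep j := by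
  have hZB' : Z ≤ B := by nlinarith
  have h2L := Nat.one_le_two_pow (n := L)
  have hNB : N ≤ B := by omega
  have hBN : (N : ℤ) ≤ B := by exact_mod_cast hNB
  have hB1 : (1 : ℤ) ≤ B := by omega
  have hY' : N + 1 ≤ Y := by nlinarith
  have hroot : ¬ Heavy p sz (-1) := fun h => by have := h.1; omega
  refine WP.seq (WP.mapTo N hN hNB (by decide) (fun i => ind (Heavy p sz i)) ?_ hY' ?_)
  · intro i hi s' ha hx _
    have hr := hF.range i (by omega) (by omega)
    have hp := hF.sz_pos i (by omega) (by omega)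
    have hle := hF.sz_le i (by omega) (by omega)
    constructor
    · simp only [Expr.eval_hdiv, Expr.eval_hmul, Expr.eval_hadd, Expr.eval_const, Expr.eval_get,
        Expr.eval_var, hx, ha.2 2 (by decide), ha.2 4 (by decide)]
      rw [h4 i (by omega) (by omega), h2 i (by omega) (by omega)]
      rcases eq_or_lt_of_le hr.1 with h | h
      · rw [← h, h41, ind_false (fun hH => by have := hH.2.1; omega)]
        exact Int.ediv_eq_zero_of_lt (by omega) (by omega)
      · rw [h4 _ (by omega) hr.2]
        have := hF.sz_lt i (by omega) (by omega) (by omega)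
        by_cases hH : Heavy p sz i
        · have := hH.2.2
          rw [ind_true hH]
          refine le_antisymm ?_ ?_
          · exact Int.le_of_lt_add_one ((Int.ediv_lt_iff_lt_mul (by omega)).2 (by omega))
          · exact (Int.le_ediv_iff_mul_le (by omega)).2 (by omega)
        · rw [ind_false hH]
          refine Int.ediv_eq_zero_of_lt (by omega) ?_
          by_contra h5
          exact hH ⟨by omega, by omega, by omega⟩
    · have := ind_nonneg (Heavy p sz i)
      have := ind_le_one (Heavy p sz i)
      rw [abs_le]; constructor <;> omega
  intro s1 ha1 hs1
  have hrs : ∀ i : ℤ, -1 ≤ i → i < N → -1 ≤ heavyStep p sz i ∧ heavyStep p sz i < N := by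
    intro i a b
    by_cases hH : Heavy p sz i
    · rw [heavyStep_pos hH]; exact hF.range i hH.1 b
    · rw [heavyStep_neg hH]; exact ⟨a, b⟩
  refine WP.seq (WP.mapTo N (by rw [ha1.1 10 (by decide), hN]) hNB (by decide)
    (heavyStep p sz) ?_ hY' ?_)
  · intro i hi s' ha hx _
    have := hrs i (by omega) (by omega)
    refine ⟨?_, abs_le_of_range hNB (by omega) this.1 this.2⟩
    simp only [Expr.eval_hsub, Expr.eval_hmul, Expr.eval_hadd, Expr.eval_get,
      Expr.eval_var, hx, ha.2 2 (by decide), ha.2 8 (by decide), ha1.2 2 (by decide), hs1]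
    rw [if_pos (by omega), h2 i (by omega) (by omega)]
    by_cases hH : Heavy p sz i
    · rw [heavyStep_pos hH, ind_true hH]; ring
    · rw [heavyStep_neg hH, ind_false hH]; ring
  intro s2 ha2 hs2
  refine WP.seq (WP.put (by omega) (by simpa using hB1) ?_)
  refine WP.rename (relabel_injective (by decide) (by decide))
    (jump_spec (N := N) (L := L) (f := heavyStep p sz) (d := fun i => ind (Heavy p sz i))
    ?_ ?_ (by omega) hNB hrs (heavyStep_neg hroot)
    (fun j _ _ => ⟨ind_nonneg _, ind_le_one _⟩) (ind_false hroot) ?_ ?_ hY) ?_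
  · simp [ha2.1 5 (by decide), ha1.1 5 (by decide), hL]
  · simp [ha2.1 10 (by decide), ha1.1 10 (by decide), hN]
  · intro j a b
    simp only [Mem.view_arr, relabel, List.length_cons, List.length_nil, Nat.reduceAdd,
      Nat.ofNat_pos, dite_true, List.getElem_cons_zero, Mem.setArr_arr, if_true,
      Function.update_apply, Expr.eval_const, hs2]
    split
    · next h => rw [h, heavyStep_neg hroot]
    · rw [if_pos (by omega)]
  · intro j a b
    change ((s2.setArr 7 (-1) (-1)).arr 8) j = _
    simp only [Mem.setArr_arr, Nat.reduceEqDiff, if_false, ha2.2 8 (by decide), hs1]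
    split
    · rfl
    · obtain rfl : j = -1 := by omega
      rw [h8, ind_false hroot]
  · rintro s3 ha3 ⟨q0, q1⟩
    exact ⟨_, _, hF.chains hnL, Function.iterate_fixed (heavyStep_neg hroot) _,
      q0, fun j a b => q1 j (by omega) b⟩

theorem computePositions_spec (hF : Forest n N p sz) (hN : s.var 10 = N)
    (hZ : n + N + 2 ^ L + 10 ≤ Z) (hZB : Z ^ 2 ≤ B)
    {head dep : ℤ → ℤ} (hC : Chains N p sz head dep)
    (h7 : ∀ j : ℤ, -1 ≤ j → j < N → s.arr 7 j = head j)
    (h8 : ∀ j : ℤ, 0 ≤ j → j < N → s.arr 8 j = dep j)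
    (h10 : ∀ j, s.arr 10 j = 0) (h11 : ∀ j, s.arr 11 j = 0) (hY : N + 1 ≤ Y) :
    WP B Y computePositions s fun s' =>
      (∀ j : ℤ, 0 ≤ j → j < N → s'.arr 11 j = chainOff N head j.toNat) ∧ s'.arr 11 (-1) = 0 ∧
      (∀ j : ℤ, 0 ≤ j → j < N → s'.arr 12 j = position N head dep j) ∧ s'.arr 12 (-1) = -1 := by
  have hZB' : Z ≤ B := by nlinarith
  have h2L := Nat.one_le_two_pow (n := L)
  have hNB : N ≤ B := by omega
  have hBN : (N : ℤ) ≤ B := by exact_mod_cast hNB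
  have hB1 : (1 : ℤ) ≤ B := by omega
  refine WP.seq (WP.scatterTo N hN hNB (by decide) (fun i => head i) (fun _ => 1) ?_ ?_ hY ?_)
  · intro i hi s' ha hx
    simp only [Expr.eval_get, Expr.eval_var, hx, ha.2 7 (by decide), Expr.eval_const]
    exact ⟨h7 i (by omega) (by omega), trivial⟩
  · intro i hi
    have := abs_sum_ind_le (i + 1) (fun l : ℕ => head l = head i) (fun _ => 1) 1 (by simp)
    rw [h10, zero_add, abs_of_nonneg this.1]
    push_cast at this
    omega
  intro s1 ha1 hs1
  have hs1' : ∀ j, s1.arr 10 j = chainLen N head j := fun j => by simp [hs1, h10, chainLen]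
  have hoff : ∀ k ≤ N, 0 ≤ chainOff N head k ∧ chainOff N head k ≤ N := fun k hk => by
    have h1 := chainOff_mono N head (Nat.zero_le k)
    have h2 := chainOff_mono N head hk
    rw [hC.chainOff_top hF] at h2
    exact ⟨by simpa [chainOff] using h1, h2⟩
  refine WP.seq (WP.scanTo N (by rw [ha1.1 10 (by decide), hN]) hNB (by decide)
    (fun i => chainLen N head i) ?_ ?_ hY ?_)
  · intro i hi s' ha hx
    simp only [Expr.eval_get, Expr.eval_var, hx, ha.2 10 (by decide), hs1']
  · intro k hk
    have := hoff k hk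
    rw [ha1.2 11 (by decide), h11, zero_add, ← chainOff, abs_of_nonneg this.1]
    omega
  intro s2 ha2 hs2 hs2'
  have hs2o : ∀ j : ℤ, 0 ≤ j → j < N → s2.arr 11 j = chainOff N head j.toNat := fun j a b => by
    lift j to ℕ using a
    rw [hs2 j (by omega), ha1.2 11 (by decide), h11, zero_add, ← chainOff, Int.toNat_natCast]
  refine WP.seq (WP.mapTo N (by rw [ha2.1 10 (by decide), ha1.1 10 (by decide), hN]) hNB
    (by decide) (position N head dep) ?_ hY ?_)
  · intro i hi s' ha hx _
    have hf := hC.facts hF i (by omega) (by omega)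
    have hp := hC.position_range hF (i := i) (by omega) (by omega)
    refine ⟨?_, ?_⟩
    · simp only [Expr.eval_hadd, Expr.eval_get, Expr.eval_var, hx, ha.2 7 (by decide),
        ha.2 8 (by decide), ha.2 11 (by decide), ha2.2 7 (by decide), ha2.2 8 (by decide),
        ha1.2 7 (by decide), ha1.2 8 (by decide)]
      rw [h7 i (by omega) (by omega), h8 i (by omega) (by omega), hs2o _ hf.1 hf.2.1]
      rfl
    · rw [abs_le]; constructor <;> omega
  intro s3 ha3 hs3
  refine WP.put (by omega) (by simpa using hB1) ⟨fun j a b => ?_, ?_, fun j a b => ?_, ?_⟩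
  · simp [ha3.2 11 (by decide), hs2o j a b]
  · simp [ha3.2 11 (by decide), hs2' (-1) (by omega), ha1.2 11 (by decide), h11]
  · simp only [Mem.setArr_arr, if_true, Expr.eval_const, Function.update_apply]
    rw [if_neg (by omega), hs3, if_pos (by omega)]
  · simp

theorem computeIntervals_spec (hF : Forest n N p sz) (hN : s.var 10 = N) (hL : s.var 5 = L)
    (hZ : n + N + 2 ^ L + 10 ≤ Z) (hZB : Z ^ 2 ≤ B)
    {head : ℤ → ℤ} (hhead : ∀ j : ℤ, -1 ≤ j → j < N → -1 ≤ head j ∧ head j < N)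
    (h2 : ∀ j : ℤ, -1 ≤ j → j < N → s.arr 2 j = p j)
    (h7 : ∀ j : ℤ, -1 ≤ j → j < N → s.arr 7 j = head j)
    (h11 : ∀ j : ℤ, -1 ≤ j → j < N → 0 ≤ s.arr 11 j ∧ s.arr 11 j ≤ N)
    (h12 : ∀ j : ℤ, -1 ≤ j → j < N → -1 ≤ s.arr 12 j ∧ s.arr 12 j < N)
    (h13 : ∀ j, s.arr 13 j = 0) (h14 : ∀ j, s.arr 14 j = 0) (hY : (N + 1) * (L + 1) ≤ Y) :
    WP B Y computeIntervals s fun s' =>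
      (∀ j, s'.arr 13 j = if 0 ≤ j ∧ j < N * L then
        s.arr 11 (head ((fun i => p (head i))^[(j % L).toNat] (j / L))) else 0) ∧
      (∀ j, s'.arr 14 j = if 0 ≤ j ∧ j < N * L then
        s.arr 12 ((fun i => p (head i))^[(j % L).toNat] (j / L)) + 1 else 0) := by
  have hZB' : Z ≤ B := by nlinarith
  have h2L := Nat.one_le_two_pow (n := L)
  have hNB : N ≤ B := by omega
  have hBN : (N : ℤ) ≤ B := by exact_mod_cast hNB
  have hB1 : (1 : ℤ) ≤ B := by omega
  have hLlt := (Nat.lt_two_pow_self (n := L))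
  have hnx : ∀ j : ℤ, -1 ≤ j → j < N → -1 ≤ p (head j) ∧ p (head j) < N := fun j a b =>
    hF.iterate_range (hhead j a b).1 (hhead j a b).2 1
  have hit := iterate_range_of hnx
  refine WP.forTo (Y := L + 1) (by omega) N hN hNB (by decide) (by decide) (by decide)
    (fun c s' => (∀ j, s'.arr 13 j = if 0 ≤ j ∧ j < c * L then
        s.arr 11 (head ((fun i => p (head i))^[(j % L).toNat] (j / L))) else 0) ∧
      (∀ j, s'.arr 14 j = if 0 ≤ j ∧ j < c * L then
        s.arr 12 ((fun i => p (head i))^[(j % L).toNat] (j / L)) + 1 else 0)) ?_ ?_ hY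
    fun s' _ _ h => h
  · refine ⟨fun j => ?_, fun j => ?_⟩
    · rw [Mem.setVar_arr, h13, if_neg (by push_cast; omega)]
    · rw [Mem.setVar_arr, h14, if_neg (by push_cast; omega)]
  rintro c hc s1 ha1 hx1 ⟨i13, i14⟩
  refine WP.seq (WP.assign (by omega) (by
    rw [Expr.eval_var, hx1, abs_of_nonneg (by omega)]; omega) ?_)
  refine WP.forTo (Y := 1) le_rfl L (by simp [ha1.1 5 (by decide), hL]) (by omega) (by decide)
    (by decide) (by decide)
    (fun t s' => s'.var 14 = (fun i => p (head i))^[t] c ∧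
      (∀ j, s'.arr 13 j = if 0 ≤ j ∧ j < c * L + t then
        s.arr 11 (head ((fun i => p (head i))^[(j % L).toNat] (j / L))) else 0) ∧
      (∀ j, s'.arr 14 j = if 0 ≤ j ∧ j < c * L + t then
        s.arr 12 ((fun i => p (head i))^[(j % L).toNat] (j / L)) + 1 else 0)) ?_ ?_ (by omega) ?_
  · exact ⟨by simp [hx1], fun j => by simpa using i13 j, fun j => by simpa using i14 j⟩
  · rintro t ht s2 ha2 hx2 ⟨i0, j13, j14⟩
    have hr := hit t c (by omega) (by omega)
    have hr' := hhead _ hr.1 hr.2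
    have hr'' := hnx _ hr.1 hr.2
    have hs := h11 _ hr'.1 hr'.2
    have hs' := h12 _ hr.1 hr.2
    have v11 : s2.var 11 = c := by rw [ha2.1 11 (by decide)]; simp [hx1]
    have v5 : s2.var 5 = L := by rw [ha2.1 5 (by decide)]; simp [ha1.1 5 (by decide), hL]
    have hidx : ((c : ℤ) * L + t) / L = c ∧ ((c : ℤ) * L + t) % L = t := by
      have hL0 : (L : ℤ) ≠ 0 := by omega
      constructor
      · rw [add_comm, Int.add_mul_ediv_right _ _ hL0, Int.ediv_eq_zero_of_lt (by omega) (by omega),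
          zero_add]
      · rw [add_comm, Int.add_mul_emod_self_right]
        exact Int.emod_eq_of_lt (by omega) (by omega)
    have a2 : ∀ a, a ∉ [13, 14] → s2.arr a = s.arr a := fun a ha => by
      rw [ha2.2 a (by simpa [Prog.wa] using ha), Mem.setVar_arr,
        ha1.2 a (by simpa [Prog.wa, Prog.forTo] using ha)]
    have hpos : 0 ≤ (c : ℤ) * L := by positivity
    refine WP.seq (WP.put le_rfl ?_ ?_)
    · simp only [Expr.eval_get, Expr.eval_var, i0, a2 7 (by decide), a2 11 (by decide)]
      rw [h7 _ hr.1 hr.2, abs_of_nonneg hs.1]; omega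
    refine WP.seq (WP.put le_rfl ?_ ?_)
    · simp [i0, a2 12 (by decide)]
      rw [abs_of_nonneg (by omega)]; omega
    refine WP.assign le_rfl ?_ ⟨?_, fun j => ?_, fun j => ?_⟩
    · simp [i0, a2 7 (by decide), a2 2 (by decide)]
      rw [h7 _ hr.1 hr.2, h2 _ hr'.1 hr'.2]
      exact abs_le_of_range hNB (by omega) hr''.1 hr''.2
    · simp [i0, a2 7 (by decide), a2 2 (by decide), -Function.iterate_succ,
        Function.iterate_succ_apply']
      rw [h7 _ hr.1 hr.2, h2 _ hr'.1 hr'.2]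
    · simp [i0, a2 7 (by decide), a2 11 (by decide), Function.update_apply, v11, v5, hx2]
      rw [h7 _ hr.1 hr.2]
      by_cases hj : j = c * L + t
      · rw [if_pos hj, if_pos (by omega), hj, hidx.1, hidx.2, Int.toNat_natCast]
      · rw [if_neg hj, j13]
        exact if_congr (by omega) rfl rfl
    · simp [i0, a2 12 (by decide), Function.update_apply, v11, v5, hx2]
      by_cases hj : j = c * L + t
      · rw [if_pos hj, if_pos (by omega), hj, hidx.1, hidx.2, Int.toNat_natCast]
      · rw [if_neg hj, j14]
        exact if_congr (by omega) rfl rfl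
  · rintro s3 ha3 - ⟨-, j13, j14⟩
    refine ⟨fun j => ?_, fun j => ?_⟩
    · rw [Mem.setVar_arr, j13]
      exact if_congr (by push_cast; rw [add_one_mul]) rfl rfl
    · rw [Mem.setVar_arr, j14]
      exact if_congr (by push_cast; rw [add_one_mul]) rfl rfl

/-- The properties of the tables computed by `layout`: `pos` numbers the nodes, and the path from a
node `c` to the root consists of the nodes with positions in the `L` intervals of `c`. -/
structure IsLayout (N L : ℕ) (p pos st en : ℤ → ℤ) : Prop where
  pos_nonneg : ∀ j : ℤ, 0 ≤ j → j < N → 0 ≤ pos j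
  pos_lt : ∀ j : ℤ, 0 ≤ j → j < N → pos j < N
  pos_inj : ∀ i j : ℤ, 0 ≤ i → i < N → 0 ≤ j → j < N → pos i = pos j → i = j
  sum_ind : ∀ c j : ℤ, -1 ≤ c → c < N → 0 ≤ j → j < N →
    ∑ t ∈ Finset.range L, ind (st (c * L + t) ≤ pos j ∧ pos j < en (c * L + t)) = ind (Anc p c j)
  st_range : ∀ i, 0 ≤ st i ∧ st i ≤ N
  en_range : ∀ i, 0 ≤ en i ∧ en i ≤ N

theorem layout_spec (hF : Forest n N p sz) (hn : s.var 0 = n) (hN : s.var 10 = N)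
    (hL : s.var 5 = L) (hnL : n < 2 ^ L) (hZ : n + N + 2 ^ L + 10 ≤ Z) (hZB : Z ^ 2 ≤ B)
    (hh : ∀ v : ℕ, v < n → -1 ≤ home v ∧ home v < N)
    (hsz : ∀ j : ℤ, 0 ≤ j → j < N → sz j = ∑ v ∈ Finset.range n, ind (Anc p (home v) j))
    (h0 : ∀ j : ℤ, 0 ≤ j → j < N → s.arr 0 j = p j)
    (h1 : ∀ v : ℕ, v < n → s.arr 1 v = home v)
    (hz : ∀ a, 2 ≤ a → a ≤ 14 → ∀ j, s.arr a j = 0)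
    (hY : (n + N + 2) * (L + 2) ≤ Y) :
    WP B Y layout s fun s' => (∀ j : ℤ, -1 ≤ j → j < N → s'.arr 2 j = p j) ∧
      (∀ j : ℤ, 0 ≤ j → j < N → s'.arr 4 j = sz j) ∧ s'.arr 4 (-1) = 2 * n + 2 ∧
      IsLayout N L p (s'.arr 12) (s'.arr 13) (s'.arr 14) := by
  have hZB' : Z ≤ B := by nlinarith
  have hY2 : (N + 1) * (L + 1) ≤ Y := by nlinarith
  have hY3 : (L + 1) * (N + 1) ≤ Y := by nlinarith
  have hY4 : N + 1 ≤ Y := by nlinarith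
  have hY5 : (n + 1) + (L + 1) * (N + 1) ≤ Y := by nlinarith
  refine WP.seq ((copyParents_spec hF hN (by omega) (by omega) h0 hY4).mono ?_)
  rintro s1 ha1 ⟨p2, p3⟩
  refine WP.seq ((computeSizes_spec hF (by rw [ha1.1 0 (by decide), hn])
    (by rw [ha1.1 10 (by decide), hN]) (by rw [ha1.1 5 (by decide), hL]) hnL hZ hZB hh hsz
    (fun v hv => by rw [ha1.2 1 (by decide), h1 v hv]) p3
    (fun j => by rw [ha1.2 4 (by decide), hz 4 (by omega) (by omega)]) hY5).mono ?_)
  rintro s2 ha2 ⟨p4, p41⟩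
  have e2 : ∀ j : ℤ, -1 ≤ j → j < N → s2.arr 2 j = p j :=
    fun j a b => by rw [ha2.2 2 (by decide), p2 j a b]
  refine WP.seq ((computeChains_spec hF (by rw [ha2.1 10 (by decide), ha1.1 10 (by decide), hN])
    (by rw [ha2.1 5 (by decide), ha1.1 5 (by decide), hL]) hnL hZ hZB e2 p4 p41
    (by rw [ha2.2 8 (by decide), ha1.2 8 (by decide), hz 8 (by omega) (by omega)]) hY3).mono ?_)
  rintro s3 ha3 ⟨head, dep, hC, hhead, p7, p8⟩
  refine WP.seq ((computePositions_spec hF (by rw [ha3.1 10 (by decide), ha2.1 10 (by decide),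
    ha1.1 10 (by decide), hN]) hZ hZB hC p7 p8
    (fun j => by rw [ha3.2 10 (by decide), ha2.2 10 (by decide), ha1.2 10 (by decide),
      hz 10 (by omega) (by omega)])
    (fun j => by rw [ha3.2 11 (by decide), ha2.2 11 (by decide), ha1.2 11 (by decide),
      hz 11 (by omega) (by omega)]) hY4).mono ?_)
  rintro s4 ha4 ⟨p11, p11', p12, p12'⟩
  have e2' : ∀ j : ℤ, -1 ≤ j → j < N → s4.arr 2 j = p j :=
    fun j a b => by rw [ha4.2 2 (by decide), ha3.2 2 (by decide), e2 j a b]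
  have r11 : ∀ j : ℤ, -1 ≤ j → j < N → 0 ≤ s4.arr 11 j ∧ s4.arr 11 j ≤ N := by
    intro j a b
    rcases eq_or_lt_of_le a with h | h
    · rw [← h, p11']; omega
    · rw [p11 j (by omega) b]
      have h1 := chainOff_mono N head (Nat.zero_le j.toNat)
      have h2 := chainOff_mono N head (show j.toNat ≤ N by omega)
      rw [hC.chainOff_top hF] at h2
      exact ⟨by simpa [chainOff] using h1, h2⟩
  have r12' : ∀ j : ℤ, 0 ≤ j → j < N → 0 ≤ s4.arr 12 j ∧ s4.arr 12 j < N := by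
    intro j a b
    rw [p12 j a b]
    have := hC.position_range hF a b
    omega
  have r12 : ∀ j : ℤ, -1 ≤ j → j < N → -1 ≤ s4.arr 12 j ∧ s4.arr 12 j < N := by
    intro j a b
    rcases eq_or_lt_of_le a with h | h
    · rw [← h, p12']; omega
    · have := r12' j (by omega) b
      omega
  have rh : ∀ j : ℤ, -1 ≤ j → j < N → -1 ≤ head j ∧ head j < N := by
    intro j a b
    rcases eq_or_lt_of_le a with h | h
    · rw [← h, hhead]; omega
    · have := hC.facts hF j (by omega) b
      omega
  have hit := iterate_range_of (f := fun i => p (head i)) (N := N)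
    fun j a b => hF.iterate_range (rh j a b).1 (rh j a b).2 1
  refine (computeIntervals_spec hF (by rw [ha4.1 10 (by decide), ha3.1 10 (by decide),
    ha2.1 10 (by decide), ha1.1 10 (by decide), hN]) (by rw [ha4.1 5 (by decide),
    ha3.1 5 (by decide), ha2.1 5 (by decide), ha1.1 5 (by decide), hL]) hZ hZB rh e2'
    (fun j a b => by rw [ha4.2 7 (by decide), p7 j a b]) r11 r12
    (fun j => by rw [ha4.2 13 (by decide), ha3.2 13 (by decide), ha2.2 13 (by decide),
      ha1.2 13 (by decide), hz 13 (by omega) (by omega)])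
    (fun j => by rw [ha4.2 14 (by decide), ha3.2 14 (by decide), ha2.2 14 (by decide),
      ha1.2 14 (by decide), hz 14 (by omega) (by omega)]) hY2).mono ?_
  rintro s5 ha5 ⟨q13, q14⟩
  have e12 := ha5.2 12 (by decide)
  have rdiv : ∀ j : ℤ, 0 ≤ j → j < N * L → -1 ≤ j / L ∧ j / L < N := by
    intro j a b
    have h1 : 0 < (L : ℤ) := by
      rcases Nat.eq_zero_or_pos L with h | h
      · subst h; simp at b; omega
      · exact_mod_cast h
    have := Int.ediv_nonneg a h1.le
    exact ⟨by omega, (Int.ediv_lt_iff_lt_mul h1).2 b⟩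
  refine ⟨fun j a b => by rw [ha5.2 2 (by decide), e2' j a b],
    fun j a b => by rw [ha5.2 4 (by decide), ha4.2 4 (by decide), ha3.2 4 (by decide), p4 j a b],
    by rw [ha5.2 4 (by decide), ha4.2 4 (by decide), ha3.2 4 (by decide), p41],
    ⟨fun j a b => ?_, fun j a b => ?_, fun i j a b c d h => ?_, fun c j a b hj0 hj1 => ?_,
      fun j => ?_, fun j => ?_⟩⟩
  · rw [e12]; exact (r12' j a b).1
  · rw [e12]; exact (r12' j a b).2
  · rw [e12, p12 i a b, p12 j c d] at h
    exact hC.position_inj hF a b c d h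
  · rw [e12]
    rcases eq_or_lt_of_le a with h | h
    -- For the root the table indices are negative and the entries read there are `0`, so all its
    -- intervals are empty.
    · rw [← h, ind_false fun h => by have := hF.anc_root h; omega]
      refine Finset.sum_eq_zero fun t ht => ind_false ?_
      have := Finset.mem_range.1 ht
      rw [q14, if_neg (by omega)]
      have := r12' j hj0 hj1
      omega
    · rw [p12 j hj0 hj1]
      rw [← hC.sum_intervals hF hj0 hj1 (st := fun c => s4.arr 11 (head c))
        (en := fun c => s4.arr 12 c + 1) (fun c a b => ?_) (fun c a b => by rw [p12 c a b])
        (by rw [p12']; rfl) hhead L c a b ?_]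
      · refine Finset.sum_congr rfl fun t ht => ?_
        have ht' := Finset.mem_range.1 ht
        have hL0 : (L : ℤ) ≠ 0 := by omega
        have d1 : (c * L + t) / L = c := by
          rw [add_comm, Int.add_mul_ediv_right _ _ hL0,
            Int.ediv_eq_zero_of_lt (by omega) (by omega), zero_add]
        have d2 : (c * L + t) % L = t := by
          rw [add_comm, Int.add_mul_emod_self_right]
          exact Int.emod_eq_of_lt (by omega) (by omega)
        have d3 : 0 ≤ c * L := mul_nonneg (by omega) (by omega)
        have d4 : (c + 1) * L ≤ N * L := by gcongr; omega
        rw [q13, q14, if_pos ⟨by omega, by rw [add_one_mul] at d4; omega⟩,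
          if_pos ⟨by omega, by rw [add_one_mul] at d4; omega⟩, d1, d2, Int.toNat_natCast]
      · intro hc0
        have h1 := hF.sz_pos c hc0 b
        have h2 : (n : ℤ) < 2 ^ L := by exact_mod_cast hnL
        have h3 : (0 : ℤ) < 2 ^ L := by positivity
        nlinarith
      · have := hC.facts hF c a b
        exact p11 _ this.1 this.2.1
  · rw [q13]
    split
    · next h =>
      have h1 := rdiv j h.1 h.2
      have h2 := hit (j % L).toNat _ h1.1 h1.2
      have h3 := rh _ h2.1 h2.2
      exact r11 _ h3.1 h3.2
    · omega
  · rw [q14]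
    split
    · next h =>
      have h1 := rdiv j h.1 h.2
      have h2 := hit (j % L).toNat _ h1.1 h1.2
      have h3 := r12 _ h2.1 h2.2
      omega
    · omega

end Layout

/-! ## Point events, stored in linked lists by time

Array `20` holds the heads of the lists, `21` the links, `22`, `23`, `24` the slots, the values and
the times of the events, which are numbered from `1`; variable `20` is their number. -/

/-- `j` is the last index below `i` at which `tm` equals `τ`, or `0` if there is none. -/
def IsLast (tm : ℤ → ℤ) (i : ℕ) (τ j : ℤ) : Prop :=
  (0 ≤ j ∧ j < i) ∧ (j ≠ 0 → tm j = τ) ∧ ∀ k : ℤ, j < k → k < i → tm k ≠ τ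

/-- The sum of the first `c` events of time at most `τ` and slot at most `σ`. -/
noncomputable def eventSum (tm sl vl : ℤ → ℤ) (c : ℕ) (τ σ : ℤ) : ℤ :=
  ∑ i ∈ Finset.range c, ind (tm (i + 1) ≤ τ ∧ sl (i + 1) ≤ σ) * vl (i + 1)

/-- The memory stores `c` events with slots at most `S` and values at most `V` whose sums are given
by `F`. -/
structure Store (S V c : ℕ) (F : ℤ → ℤ → ℤ) (s : Mem) : Prop where
  count : s.var 20 = c
  next : ∀ i : ℕ, 1 ≤ i → i ≤ c → IsLast (s.arr 24) i (s.arr 24 i) (s.arr 21 i)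
  head : ∀ τ, IsLast (s.arr 24) (c + 1) τ (s.arr 20 τ)
  slot : ∀ i : ℕ, 1 ≤ i → i ≤ c → 0 ≤ s.arr 22 i ∧ s.arr 22 i ≤ S
  value : ∀ i : ℕ, 1 ≤ i → i ≤ c → |s.arr 23 i| ≤ V
  time : ∀ i : ℕ, 1 ≤ i → i ≤ c → 0 ≤ s.arr 24 i
  sum : ∀ τ σ, F τ σ = eventSum (s.arr 24) (s.arr 22) (s.arr 23) c τ σ

/-- `Store` with at most `k` events. -/
def Stored (S V k : ℕ) (F : ℤ → ℤ → ℤ) (s : Mem) : Prop := ∃ c ≤ k, Store S V c F s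

theorem Stored.mono {S V k k' : ℕ} {F F' : ℤ → ℤ → ℤ} {s : Mem} (h : Stored S V k F s)
    (hk : k ≤ k') (hF : ∀ τ σ, F τ σ = F' τ σ) : Stored S V k' F' s := by
  obtain rfl : F = F' := funext fun τ => funext fun σ => hF τ σ
  obtain ⟨c, hc, h⟩ := h
  exact ⟨c, hc.trans hk, h⟩

theorem Stored.congr {S V k : ℕ} {F : ℤ → ℤ → ℤ} {s s' : Mem} (h : Stored S V k F s)
    (hv : s'.var 20 = s.var 20) (ha : ∀ a, 20 ≤ a → a ≤ 24 → s'.arr a = s.arr a) :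
    Stored S V k F s' := by
  obtain ⟨c, hc, h1, h2, h3, h4, h5, h6, h7⟩ := h
  refine ⟨c, hc, ?_, ?_, ?_, ?_, ?_, ?_, ?_⟩
  all_goals
    simpa only [hv, ha 20 (by decide) (by decide), ha 21 (by decide) (by decide),
      ha 22 (by decide) (by decide), ha 23 (by decide) (by decide),
      ha 24 (by decide) (by decide)]

theorem Stored.setVar {S V k : ℕ} {F : ℤ → ℤ → ℤ} {s : Mem} (h : Stored S V k F s) {x : ℕ} {z : ℤ}
    (hx : x ≠ 20) : Stored S V k F (s.setVar x z) :=
  h.congr (by simp [hx.symm]) fun _ _ _ => rfl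

theorem Stored.zero {S V : ℕ} {s : Mem} (hv : s.var 20 = 0) (h20 : ∀ j, s.arr 20 j = 0) :
    Stored S V 0 (fun _ _ => 0) s :=
  ⟨0, le_rfl, by simpa using hv, fun i h1 h2 => by omega,
    fun τ => ⟨by rw [h20]; simp, fun h => absurd (h20 τ) h, fun k h1 h2 => by
      rw [h20] at h1; push_cast at h2; omega⟩,
    fun i h1 h2 => by omega, fun i h1 h2 => by omega, fun i h1 h2 => by omega,
    fun τ σ => by simp [eventSum]⟩

/-- Stores the event with time and slot in the variables `t` and `l` and the value of `e`. -/
def addEvent (t l : ℕ) (e : Expr) : Prog :=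
  .assign 20 (.var 20 + .const 1) ;;
  .put 22 (.var 20) (.var l) ;;
  .put 23 (.var 20) e ;;
  .put 24 (.var 20) (.var t) ;;
  .put 21 (.var 20) (.get 20 (.var t)) ;;
  .put 20 (.var t) (.var 20)

theorem IsLast.congr {tm tm' : ℤ → ℤ} {i : ℕ} {τ j : ℤ} (h : IsLast tm i τ j)
    (ht : ∀ k : ℤ, k < i → tm' k = tm k) : IsLast tm' i τ j := by
  obtain ⟨h1, h2, h3⟩ := h
  exact ⟨h1, fun hj => by rw [ht j h1.2, h2 hj], fun k a b => by rw [ht k b]; exact h3 k a b⟩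

/-- The new event becomes the head of the list of its time and links to the old head. Other links
stay valid because `IsLast` only looks at smaller indices. -/
theorem addEvent_spec {B S V k : ℕ} {F : ℤ → ℤ → ℤ} {s : Mem} {t l : ℕ} {e : Expr} {x : ℤ}
    (h : Stored S V k F s) (hkB : k + 1 ≤ B) (ht : t ≠ 20) (hl : l ≠ 20)
    (he : ∀ s', Agree [20] [20, 21, 22, 23, 24] s s' → e.eval s' = x)
    (htm : 0 ≤ s.var t) (hsl : 0 ≤ s.var l ∧ s.var l ≤ S) (hV : |x| ≤ V) (hVB : V ≤ B) :
    WP B 1 (addEvent t l e) s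
      (Stored S V (k + 1) fun τ σ => F τ σ + ind (s.var t ≤ τ ∧ s.var l ≤ σ) * x) := by
  refine WP.of_bdd fun hb => ?_
  have hVB' : (V : ℤ) ≤ B := by exact_mod_cast hVB
  obtain ⟨c, hc, h1, h2, h3, h4, h5, h6, h7⟩ := h
  have hcB : (c : ℤ) + 1 ≤ B := by exact_mod_cast (by omega : c + 1 ≤ B)
  have hc1 : (1 : ℤ) ≤ c + 1 := by omega
  refine WP.seq (WP.assign le_rfl ?_ ?_)
  · simp only [Expr.eval_hadd, Expr.eval_var, Expr.eval_const, h1]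
    rw [abs_of_nonneg (by omega)]; exact hcB
  simp only [Expr.eval_hadd, Expr.eval_var, Expr.eval_const, h1]
  have hs0 : Agree [20] [20, 21, 22, 23, 24] s (s.setVar 20 (c + 1)) :=
    ⟨fun y hy => by simp at hy; simp [hy], fun _ _ => rfl⟩
  refine WP.seq (WP.put le_rfl (by simpa [hl] using hb.1 l) ?_)
  have hs1 : Agree [20] [20, 21, 22, 23, 24] s ((s.setVar 20 (c + 1)).setArr 22 (c + 1) (s.var l)) :=
    hs0.trans ⟨fun y _ => rfl, fun a ha => by simp at ha; simp [ha]⟩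
  simp only [Expr.eval_var, Mem.setVar_var, if_true, hl, if_false]
  refine WP.seq (WP.put le_rfl (by rw [he _ hs1]; exact hV.trans hVB') ?_)
  rw [he _ hs1]
  refine WP.seq (WP.put le_rfl (by simpa [ht] using hb.1 t) ?_)
  refine WP.seq (WP.put le_rfl (by simpa [ht] using hb.2 20 _) ?_)
  refine WP.put le_rfl (by simp; rw [abs_of_nonneg (by omega)]; exact hcB) ?_
  simp only [Expr.eval_var, Mem.setArr_var, Mem.setVar_var, if_true, ht, if_false, Expr.eval_get,
    Mem.setArr_arr, Nat.reduceEqDiff, Mem.setVar_arr]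
  set T := s.var t
  set l' := s.var l
  have u24 : ∀ k : ℤ, k ≠ c + 1 → Function.update (s.arr 24) ((c : ℤ) + 1) T k = s.arr 24 k :=
    fun k hk => Function.update_of_ne hk _ _
  have hcong : ∀ k : ℤ, k < (c + 1 : ℕ) →
      Function.update (s.arr 24) ((c : ℤ) + 1) T k = s.arr 24 k :=
    fun k hk => u24 k (by push_cast at hk; omega)
  refine ⟨c + 1, by omega, ?_, ?_, ?_, ?_, ?_, ?_, ?_⟩
  · simp
  · intro i a b
    simp only [Mem.setArr_arr, Nat.reduceEqDiff, if_false, if_true, Mem.setVar_arr]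
    rcases Nat.lt_or_ge c i with hi | hi
    · obtain rfl : i = c + 1 := by omega
      push_cast
      simp only [Function.update_self]
      exact (h3 T).congr hcong
    · rw [u24 i (by omega), Function.update_of_ne (by omega)]
      exact (h2 i a hi).congr fun k hk => u24 k (by omega)
  · intro τ
    simp only [Mem.setArr_arr, Nat.reduceEqDiff, if_false, if_true, Mem.setVar_arr]
    by_cases hτ : τ = T
    · rw [hτ, Function.update_self]
      exact ⟨by push_cast; omega, fun _ => Function.update_self _ _ _, fun k a b => by
        push_cast at b; omega⟩
    · rw [Function.update_of_ne hτ]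
      obtain ⟨q1, q2, q3⟩ := (h3 τ).congr hcong
      refine ⟨by push_cast at q1 ⊢; omega, q2, fun k a b => ?_⟩
      by_cases hk : k = c + 1
      · rw [hk, Function.update_self]; exact fun h => hτ h.symm
      · exact q3 k a (by push_cast at b ⊢; omega)
  · intro i a b
    simp only [Mem.setArr_arr, Nat.reduceEqDiff, if_false, if_true, Mem.setVar_arr]
    rcases Nat.lt_or_ge c i with hi | hi
    · obtain rfl : i = c + 1 := by omega
      push_cast
      rw [Function.update_self]; exact hsl
    · rw [Function.update_of_ne (by omega)]; exact h4 i a hi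
  · intro i a b
    simp only [Mem.setArr_arr, Nat.reduceEqDiff, if_false, if_true, Mem.setVar_arr]
    rcases Nat.lt_or_ge c i with hi | hi
    · obtain rfl : i = c + 1 := by omega
      push_cast
      rw [Function.update_self]; exact hV
    · rw [Function.update_of_ne (by omega)]; exact h5 i a hi
  · intro i a b
    simp only [Mem.setArr_arr, Nat.reduceEqDiff, if_false, if_true, Mem.setVar_arr]
    rcases Nat.lt_or_ge c i with hi | hi
    · obtain rfl : i = c + 1 := by omega
      push_cast
      rw [Function.update_self]; exact htm
    · rw [Function.update_of_ne (by omega)]; exact h6 i a hi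
  · intro τ σ
    simp only [Mem.setArr_arr, Nat.reduceEqDiff, if_false, if_true, Mem.setVar_arr]
    rw [h7, eventSum, eventSum, Finset.sum_range_succ]
    congr 1
    · refine Finset.sum_congr rfl fun i hi => ?_
      have := Finset.mem_range.1 hi
      rw [Function.update_of_ne (by omega), Function.update_of_ne (by omega),
        Function.update_of_ne (by omega)]
    · simp only [Function.update_self]

/-- Adds `x` (variable `25`) on the rectangle of times in `[var 21, var 22)` and slots in
`[var 23, var 24)`. -/
def addRect : Prog :=
  .ite (.conj (.lt (.var 21) (.var 22)) (.lt (.var 23) (.var 24)))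
    (addEvent 21 23 (.var 25) ;; addEvent 21 24 (.const 0 - .var 25) ;;
      addEvent 22 23 (.const 0 - .var 25) ;; addEvent 22 24 (.var 25))
    .skip

theorem ind_Ico (a b x : ℤ) (h : a < b) : ind (a ≤ x ∧ x < b) = ind (a ≤ x) - ind (b ≤ x) := by
  by_cases h1 : a ≤ x <;> by_cases h2 : b ≤ x
  · rw [ind_false (by omega), ind_true h1, ind_true h2]; rfl
  · rw [ind_true (by omega), ind_true h1, ind_false h2]; rfl
  · omega
  · rw [ind_false (by omega), ind_false h1, ind_false h2]; rfl

/-- Inclusion and exclusion: the indicator of a half-open rectangle is an alternating sum of four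
quadrant indicators, and a quadrant is one point event. An empty rectangle has to be skipped, since
with reversed ends the alternating sum would not vanish. -/
theorem addRect_spec {B S V k : ℕ} {F : ℤ → ℤ → ℤ} {s : Mem} {t1 t2 s1 s2 x : ℤ}
    (h : Stored S V k F s) (hkB : k + 4 ≤ B) (h21 : s.var 21 = t1) (h22 : s.var 22 = t2)
    (h23 : s.var 23 = s1) (h24 : s.var 24 = s2) (h25 : s.var 25 = x) (ht : 0 ≤ t1) (hs : 0 ≤ s1)
    (hsS : s2 ≤ S) (hV : |x| ≤ V) (hVB : V ≤ B) :
    WP B 1 addRect s (Stored S V (k + 4) fun τ σ =>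
      F τ σ + ind (t1 ≤ τ ∧ τ < t2) * ind (s1 ≤ σ ∧ σ < s2) * x) := by
  subst h21 h22 h23 h24 h25
  refine WP.ite le_rfl (fun hc => ?_) (fun hc => ?_)
  · obtain ⟨hc1, hc2⟩ : s.var 21 < s.var 22 ∧ s.var 23 < s.var 24 := by
      simpa [Cond.Holds] using hc
    have hV' : |(0 : ℤ) - s.var 25| ≤ V := by rwa [zero_sub, abs_neg]
    refine WP.seq ((addEvent_spec (e := .var 25) (x := s.var 25) h (by omega) (by decide) (by decide)
      (fun s' ha => ha.1 25 (by decide)) ht (by omega) hV hVB).mono fun s1 ha1 q1 => ?_)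
    have v1 : ∀ y, y ≠ 20 → s1.var y = s.var y := fun y hy => ha1.1 y (by simpa [Prog.wv, addEvent])
    refine WP.seq ((addEvent_spec (x := 0 - s.var 25) q1 (by omega) (by decide) (by decide)
      (fun s' ha => by simp [ha.1 25 (by decide), v1]) (by rw [v1 _ (by decide)]; exact ht)
      (by rw [v1 _ (by decide)]; omega) hV' hVB).mono fun s2 ha2 q2 => ?_)
    have v2 : ∀ y, y ≠ 20 → s2.var y = s.var y := fun y hy => by
      rw [ha2.1 y (by simpa [Prog.wv, addEvent]), v1 y hy]
    refine WP.seq ((addEvent_spec (x := 0 - s.var 25) q2 (by omega) (by decide) (by decide)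
      (fun s' ha => by simp [ha.1 25 (by decide), v2]) (by rw [v2 _ (by decide)]; omega)
      (by rw [v2 _ (by decide)]; omega) hV' hVB).mono fun s3 ha3 q3 => ?_)
    have v3 : ∀ y, y ≠ 20 → s3.var y = s.var y := fun y hy => by
      rw [ha3.1 y (by simpa [Prog.wv, addEvent]), v2 y hy]
    refine (addEvent_spec (x := s.var 25) q3 (by omega) (by decide) (by decide)
      (fun s' ha => by simp [ha.1 25 (by decide), v3]) (by rw [v3 _ (by decide)]; omega)
      (by rw [v3 _ (by decide)]; omega) hV hVB).mono fun s4 ha4 q4 => ?_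
    refine q4.mono (by omega) fun τ σ => ?_
    rw [v1 21 (by decide), v1 24 (by decide), v2 22 (by decide), v2 23 (by decide),
      v3 22 (by decide), v3 24 (by decide), ind_Ico _ _ _ hc1, ind_Ico _ _ _ hc2, ind_and, ind_and,
      ind_and, ind_and]
    ring
  · refine WP.skip le_rfl (h.mono (by omega) fun τ σ => ?_)
    have hc' : ¬ (s.var 21 < s.var 22 ∧ s.var 23 < s.var 24) := by
      simpa [Cond.Holds] using hc
    by_cases h1 : s.var 21 < s.var 22
    · rw [ind_false (P := s.var 23 ≤ σ ∧ σ < s.var 24) (by omega)]; ring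
    · rw [ind_false (P := s.var 21 ≤ τ ∧ τ < s.var 22) (by omega)]; ring

/-- Loop rule for bodies that only add events. The body is specified for arbitrary previous sums and
event counts, so nested loops compose; `K` is the global cap that keeps event numbers bounded. -/
theorem WP.forAcc {B Y Y' S V k K e N : ℕ} {F : ℤ → ℤ → ℤ} {x y : ℕ} {p : Prog} {s : Mem}
    {Q : Mem → Prop} (hY : 1 ≤ Y) (hy : s.var y = N) (hN : N ≤ B) (hxp : x ∉ p.wv) (hyp : y ∉ p.wv)
    (hxy : y ≠ x) (hx20 : x ≠ 20) (G : ℕ → ℤ → ℤ → ℤ) (h : Stored S V k F s) (hK : k + N * e ≤ K)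
    (hstep : ∀ i < N, ∀ s', Agree (x :: p.wv) p.wa s s' → s'.var x = i → ∀ k' F',
      k' + e ≤ K → Stored S V k' F' s' →
        WP B Y p s' (Stored S V (k' + e) fun τ σ => F' τ σ + G i τ σ))
    (hY' : (N + 1) * Y ≤ Y')
    (hQ : ∀ s', Agree (x :: p.wv) p.wa s s' →
      Stored S V (k + N * e) (fun τ σ => F τ σ + ∑ i ∈ Finset.range N, G i τ σ) s' → Q s') :
    WP B Y' (Prog.forTo x y p) s Q := by
  refine WP.forTo hY N hy hN hxp hyp hxy
    (fun i s' => Stored S V (k + i * e) (fun τ σ => F τ σ + ∑ i ∈ Finset.range i, G i τ σ) s')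
    ?_ ?_ hY' fun s' ha _ h => hQ s' ha h
  · exact (h.setVar hx20).mono (by omega) fun τ σ => by simp
  · intro i hi s' ha hx hI
    have h1 : (i + 1) * e ≤ N * e := by gcongr; omega
    rw [add_one_mul] at h1
    refine (hstep i hi s' ha hx _ _ (by omega) hI).mono fun s'' _ h'' => ?_
    refine (h''.setVar hx20).mono (by rw [add_one_mul]; omega) fun τ σ => ?_
    rw [Finset.sum_range_succ, add_assoc]

/-- `x := max x e`. -/
def maxAssign (x : ℕ) (e : Expr) : Prog := .ite (.lt (.var x) e) (.assign x e) .skip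

/-- `x := min x e`. -/
def minAssign (x : ℕ) (e : Expr) : Prog := .ite (.lt e (.var x)) (.assign x e) .skip

theorem Mem.setVar_self (s : Mem) (x : ℕ) : s.setVar x (s.var x) = s := by
  unfold Mem.setVar; rw [Function.update_eq_self]

theorem WP.maxAssign {B Y : ℕ} (hY : 1 ≤ Y) {x : ℕ} {e : Expr} {s : Mem} {Q : Mem → Prop}
    (hb : |e.eval s| ≤ (B : ℤ)) (hQ : Q (s.setVar x (max (s.var x) (e.eval s)))) :
    WP B Y (maxAssign x e) s Q := by
  refine WP.ite hY (fun h => WP.assign hY hb ?_) (fun h => WP.skip hY ?_)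
  · have h' : s.var x < e.eval s := by simpa using h
    rwa [max_eq_right h'.le] at hQ
  · have h' : ¬ s.var x < e.eval s := by simpa using h
    rwa [max_eq_left (by omega), Mem.setVar_self] at hQ

theorem WP.minAssign {B Y : ℕ} (hY : 1 ≤ Y) {x : ℕ} {e : Expr} {s : Mem} {Q : Mem → Prop}
    (hb : |e.eval s| ≤ (B : ℤ)) (hQ : Q (s.setVar x (min (s.var x) (e.eval s)))) :
    WP B Y (minAssign x e) s Q := by
  refine WP.ite hY (fun h => WP.assign hY hb ?_) (fun h => WP.skip hY ?_)
  · have h' : e.eval s < s.var x := by simpa using h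
    rwa [min_eq_right h'.le] at hQ
  · have h' : ¬ e.eval s < s.var x := by simpa using h
    rwa [min_eq_left (by omega), Mem.setVar_self] at hQ

/-- The number of intervals of `c` that contain `τ`. -/
noncomputable def cover (L : ℕ) (st en : ℤ → ℤ) (c τ : ℤ) : ℤ :=
  ∑ t ∈ Finset.range L, ind (st (c * L + t) ≤ τ ∧ τ < en (c * L + t))

/-- Adds `x` (variable `25`) on the times above the nodes in the variables `26`, `27` and the slots
above the nodes in the variables `28`, `29`. -/
def addQuad : Prog :=
  .forTo 30 5 (.forTo 31 5 (
    .assign 21 (.get 6 (.var 26 * .var 5 + .var 30)) ;;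
    maxAssign 21 (.get 6 (.var 27 * .var 5 + .var 31)) ;;
    .assign 22 (.get 7 (.var 26 * .var 5 + .var 30)) ;;
    minAssign 22 (.get 7 (.var 27 * .var 5 + .var 31)) ;;
    .forTo 32 5 (.forTo 33 5 (
      .assign 23 (.get 11 (.var 28 * .var 5 + .var 32)) ;;
      maxAssign 23 (.get 11 (.var 29 * .var 5 + .var 33)) ;;
      .assign 24 (.get 12 (.var 28 * .var 5 + .var 32)) ;;
      minAssign 24 (.get 12 (.var 29 * .var 5 + .var 33)) ;;
      addRect))))

theorem ind_max_min (a b c d x : ℤ) :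
    ind (max a b ≤ x ∧ x < min c d) = ind (a ≤ x ∧ x < c) * ind (b ≤ x ∧ x < d) := by
  rw [← ind_and]
  refine ind_congr ?_
  rw [max_le_iff, lt_min_iff]
  tauto

/-- A product of two interval indicators is the indicator of the intersection, given by the larger
start and the smaller end. Expanding the four covers, each a sum of `L` intervals, thus gives `L ^
4` rectangles of at most four events. -/
theorem addQuad_spec {B S V k L : ℕ} {F : ℤ → ℤ → ℤ} {s : Mem} {p q p' q' x : ℤ}
    (h : Stored S V k F s) (hkB : k + 4 * L ^ 4 ≤ B) (hLB : L ≤ B) (hL : s.var 5 = L)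
    (h25 : s.var 25 = x)
    (h26 : s.var 26 = p) (h27 : s.var 27 = q) (h28 : s.var 28 = p') (h29 : s.var 29 = q')
    (h6 : ∀ i, 0 ≤ s.arr 6 i) (h11 : ∀ i, 0 ≤ s.arr 11 i) (h12 : ∀ i, s.arr 12 i ≤ S)
    (hV : |x| ≤ V) (hVB : V ≤ B) :
    WP B ((L + 1) ^ 4) addQuad s (Stored S V (k + 4 * L ^ 4) fun τ σ =>
      F τ σ + x * (cover L (s.arr 6) (s.arr 7) p τ * cover L (s.arr 6) (s.arr 7) q τ *
        (cover L (s.arr 11) (s.arr 12) p' σ * cover L (s.arr 11) (s.arr 12) q' σ))) := by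
  have e1 : L * (L * (L * (L * 4))) = 4 * L ^ 4 := by ring
  refine WP.forAcc (Y := (L + 1) ^ 3) (e := L * (L * (L * 4))) (K := B) (Nat.one_le_pow _ _ (by omega)) hL hLB
    (by decide) (by decide) (by decide) (by decide)
    (fun i1 τ σ => ∑ i2 ∈ Finset.range L, ∑ i3 ∈ Finset.range L, ∑ i4 ∈ Finset.range L,
      x * ind (s.arr 6 (p * L + i1) ≤ τ ∧ τ < s.arr 7 (p * L + i1)) *
      ind (s.arr 6 (q * L + i2) ≤ τ ∧ τ < s.arr 7 (q * L + i2)) *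
      ind (s.arr 11 (p' * L + i3) ≤ σ ∧ σ < s.arr 12 (p' * L + i3)) *
      ind (s.arr 11 (q' * L + i4) ≤ σ ∧ σ < s.arr 12 (q' * L + i4))) h (by omega) ?_
    (by rw [pow_succ (L + 1) 3, mul_comm]) ?_
  · intro i1 hi1 s1 ha1 hx1 k1 F1 hk1 st1
    refine WP.forAcc (Y := (L + 1) ^ 2) (e := L * (L * 4)) (K := B) (Nat.one_le_pow _ _ (by omega))
      (by rw [ha1.1 5 (by decide), hL]) hLB (by decide) (by decide) (by decide) (by decide) _ st1 hk1
      ?_ (by rw [pow_succ (L + 1) 2, mul_comm]) fun s' _ h => h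
    intro i2 hi2 s2 ha2 hx2 k2 F2 hk2 st2
    have hY2 : 1 ≤ (L + 1) ^ 2 := Nat.one_le_pow _ _ (by omega)
    have v2 : ∀ y, y = 5 ∨ y = 25 ∨ y = 26 ∨ y = 27 ∨ y = 28 ∨ y = 29 → s2.var y = s.var y := by
      rintro y (rfl | rfl | rfl | rfl | rfl | rfl) <;>
        rw [ha2.1 _ (by decide), ha1.1 _ (by decide)]
    have a2 : ∀ a, a = 6 ∨ a = 7 ∨ a = 11 ∨ a = 12 → s2.arr a = s.arr a := by
      rintro y (rfl | rfl | rfl | rfl) <;> rw [ha2.2 _ (by decide), ha1.2 _ (by decide)]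
    have x1 : s2.var 30 = i1 := by rw [ha2.1 _ (by decide), hx1]
    refine WP.of_bdd fun hb => ?_
    refine WP.seq (WP.assign hY2 (hb.2 _ _) ?_)
    refine WP.seq (WP.maxAssign hY2 (hb.2 _ _) ?_)
    refine WP.seq (WP.assign hY2 (hb.2 _ _) ?_)
    refine WP.seq (WP.minAssign hY2 (hb.2 _ _) ?_)
    simp only [Expr.eval_get, Expr.eval_hadd, Expr.eval_hmul, Expr.eval_var, Mem.setVar_arr,
      Mem.setVar_var, Nat.reduceEqDiff, if_false, if_true, a2 6 (by omega), a2 7 (by omega), v2 26,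
      v2 27, v2 5, true_or, or_true, h26, h27, hL, hx2, x1]
    refine WP.forAcc (Y := L + 1) (e := L * 4) (K := B) (by omega)
      (by simp [v2, hL]) hLB (by decide) (by decide) (by decide) (by decide) _
      ((((st2.setVar (by decide)).setVar (by decide)).setVar (by decide)).setVar (by decide)) hk2
      ?_ (by rw [sq]) fun s' _ h => h
    intro i3 hi3 s3 ha3 hx3 k3 F3 hk3 st3
    refine WP.forAcc (Y := 1) (e := 4) (K := B) le_rfl
      (by rw [ha3.1 5 (by decide)]; simp [v2, hL]) hLB (by decide) (by decide) (by decide)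
      (by decide) _ st3 hk3 ?_ (by omega) fun s' _ h => h
    intro i4 hi4 s4 ha4 hx4 k4 F4 hk4 st4
    have v4 : ∀ y, y = 5 ∨ y = 25 ∨ y = 28 ∨ y = 29 → s4.var y = s.var y := by
      rintro y (rfl | rfl | rfl | rfl) <;>
        rw [ha4.1 _ (by decide), ha3.1 _ (by decide)] <;> simp [v2]
    have a4 : ∀ a, a = 11 ∨ a = 12 → s4.arr a = s.arr a := by
      rintro y (rfl | rfl) <;> rw [ha4.2 _ (by decide), ha3.2 _ (by decide)] <;> simp [a2]
    have x3 : s4.var 32 = i3 := by rw [ha4.1 _ (by decide), hx3]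
    have w21 : s4.var 21 = max (s.arr 6 (p * L + i1)) (s.arr 6 (q * L + i2)) := by
      rw [ha4.1 _ (by decide), ha3.1 _ (by decide)]; simp
    have w22 : s4.var 22 = min (s.arr 7 (p * L + i1)) (s.arr 7 (q * L + i2)) := by
      rw [ha4.1 _ (by decide), ha3.1 _ (by decide)]; simp
    refine WP.of_bdd fun hb4 => ?_
    refine WP.seq (WP.assign le_rfl (hb4.2 _ _) ?_)
    refine WP.seq (WP.maxAssign le_rfl (hb4.2 _ _) ?_)
    refine WP.seq (WP.assign le_rfl (hb4.2 _ _) ?_)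
    refine WP.seq (WP.minAssign le_rfl (hb4.2 _ _) ?_)
    simp only [Expr.eval_get, Expr.eval_hadd, Expr.eval_hmul, Expr.eval_var, Mem.setVar_arr,
      Mem.setVar_var, Nat.reduceEqDiff, if_false, if_true, a4 11 (by omega), a4 12 (by omega), v4 28,
      v4 29, v4 5, true_or, or_true, h28, h29, hL, hx4, x3]
    refine (addRect_spec (x := x)
      ((((st4.setVar (by decide)).setVar (by decide)).setVar (by decide)).setVar (by decide))
      hk4 (by simp [w21]; rfl) (by simp [w22]; rfl) (by simp; rfl) (by simp; rfl)
      (by simp [v4, h25]) (le_max_of_le_left (h6 _)) (le_max_of_le_left (h11 _))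
      (min_le_of_left_le (h12 _)) hV hVB).mono fun s5 _ st5 => ?_
    refine st5.mono le_rfl fun τ σ => ?_
    rw [ind_max_min, ind_max_min]
    ring
  · intro s' _ h
    refine h.mono (by omega) fun τ σ => ?_
    congr 1
    simp only [← Finset.mul_sum, ← Finset.sum_mul]
    unfold cover
    ring

/-! ## Sweeping over the times with a segment tree over the slots -/

/-- The sum over the `q`-th block of length `2 ^ d`. -/
def sumBlock (g : ℕ → ℤ) : ℕ → ℕ → ℤ
  | 0, q => g q
  | d + 1, q => sumBlock g d (2 * q) + sumBlock g d (2 * q + 1)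

/-- The minimum of the sums over the nonempty initial segments of the `q`-th block. -/
def minBlock (g : ℕ → ℤ) : ℕ → ℕ → ℤ
  | 0, q => g q
  | d + 1, q => min (minBlock g d (2 * q)) (sumBlock g d (2 * q) + minBlock g d (2 * q + 1))

theorem sumBlock_eq (g : ℕ → ℤ) (d : ℕ) : ∀ q,
    sumBlock g d q = ∑ i ∈ Finset.range (2 ^ d), g (q * 2 ^ d + i) := by
  induction d with
  | zero => intro q; simp [sumBlock]
  | succ d ih =>
      intro q
      rw [sumBlock, ih, ih, pow_succ, mul_two, Finset.sum_range_add]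
      congr 1
      · refine Finset.sum_congr rfl fun i _ => ?_
        congr 1; ring
      · refine Finset.sum_congr rfl fun i _ => ?_
        congr 1; ring

/-- A nonempty initial segment of a block either ends in the left half, or consists of the whole
left half and a nonempty initial segment of the right half. -/
theorem minBlock_spec (g : ℕ → ℤ) (d : ℕ) : ∀ q,
    (∀ i < 2 ^ d, minBlock g d q ≤ ∑ l ∈ Finset.range (i + 1), g (q * 2 ^ d + l)) ∧
      ∃ i < 2 ^ d, minBlock g d q = ∑ l ∈ Finset.range (i + 1), g (q * 2 ^ d + l) := by
  induction d with
  | zero =>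
      intro q
      refine ⟨fun i hi => ?_, 0, by simp, by simp [minBlock]⟩
      obtain rfl : i = 0 := by simpa using hi
      simp [minBlock]
  | succ d ih =>
      intro q
      have e1 : ∀ l, g (2 * q * 2 ^ d + l) = g (q * 2 ^ (d + 1) + l) := fun l => by
        congr 1; ring
      have e2 : ∀ i, sumBlock g d (2 * q) +
          ∑ l ∈ Finset.range (i + 1), g ((2 * q + 1) * 2 ^ d + l) =
          ∑ l ∈ Finset.range (2 ^ d + i + 1), g (q * 2 ^ (d + 1) + l) := fun i => by
        rw [sumBlock_eq, add_assoc (2 ^ d) i 1,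
          Finset.sum_range_add (fun l => g (q * 2 ^ (d + 1) + l)) (2 ^ d) (i + 1)]
        congr 1
        · exact Finset.sum_congr rfl fun l _ => e1 l
        · refine Finset.sum_congr rfl fun l _ => ?_
          congr 1; ring
      obtain ⟨a1, i1, hi1, b1⟩ := ih (2 * q)
      obtain ⟨a2, i2, hi2, b2⟩ := ih (2 * q + 1)
      simp only [e1] at a1 b1
      rw [minBlock, pow_succ]
      constructor
      · intro i hi
        rcases Nat.lt_or_ge i (2 ^ d) with h | h
        · exact (min_le_left _ _).trans (a1 i h)
        · refine (min_le_right _ _).trans ?_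
          have := a2 (i - 2 ^ d) (by omega)
          have h3 := e2 (i - 2 ^ d)
          rw [Nat.add_sub_cancel' h] at h3
          rw [pow_succ] at h3
          rw [← h3]
          omega
      · rcases min_choice (minBlock g d (2 * q))
          (sumBlock g d (2 * q) + minBlock g d (2 * q + 1)) with h | h
        · exact ⟨i1, by omega, by rw [h, b1, pow_succ]⟩
        · exact ⟨2 ^ d + i2, by omega, by rw [h, b2, e2, pow_succ]⟩

theorem abs_sumBlock_le {g : ℕ → ℤ} {M : ℤ} (hg : ∀ i, |g i| ≤ M) (d : ℕ) : ∀ q,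
    |sumBlock g d q| ≤ 2 ^ d * M ∧ |minBlock g d q| ≤ 2 ^ d * M := by
  have hM : 0 ≤ M := (abs_nonneg _).trans (hg 0)
  induction d with
  | zero => intro q; simpa [sumBlock, minBlock] using hg q
  | succ d ih =>
      intro q
      obtain ⟨a, b⟩ := ih (2 * q)
      obtain ⟨a', b'⟩ := ih (2 * q + 1)
      have hp : 0 ≤ 2 ^ d * M := by positivity
      rw [sumBlock, minBlock, pow_succ]
      simp only [abs_le] at *
      have h1 := min_le_left (minBlock g d (2 * q)) (sumBlock g d (2 * q) + minBlock g d (2 * q + 1))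
      refine ⟨⟨by linarith, by linarith⟩, le_min (by linarith) (by linarith), by linarith⟩

theorem block_update_of_ne (g : ℕ → ℤ) (σ : ℕ) (x : ℤ) (d : ℕ) : ∀ q, q ≠ σ / 2 ^ d →
    sumBlock (Function.update g σ x) d q = sumBlock g d q ∧
      minBlock (Function.update g σ x) d q = minBlock g d q := by
  induction d with
  | zero =>
      intro q hq
      have : q ≠ σ := by simpa using hq
      simp [sumBlock, minBlock, this]
  | succ d ih =>
      intro q hq
      rw [pow_succ, ← Nat.div_div_eq_div_mul] at hq
      obtain ⟨a, b⟩ := ih (2 * q) (by omega)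
      obtain ⟨a', b'⟩ := ih (2 * q + 1) (by omega)
      simp only [sumBlock, minBlock, a, b, a', b', and_self]

theorem block_zero (d : ℕ) : ∀ q, sumBlock (fun _ => 0) d q = 0 ∧ minBlock (fun _ => 0) d q = 0 := by
  induction d with
  | zero => intro q; simp [sumBlock, minBlock]
  | succ d ih => intro q; simp [sumBlock, minBlock, ih]

/-- The arrays `25` and `26` hold the block sums and the minimal initial sums of `g`. -/
def SegTree (L : ℕ) (g : ℕ → ℤ) (s : Mem) : Prop :=
  ∀ d ≤ L, ∀ q < 2 ^ (L - d), s.arr 25 ((2 ^ (L - d) + q : ℕ) : ℤ) = sumBlock g d q ∧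
    s.arr 26 ((2 ^ (L - d) + q : ℕ) : ℤ) = minBlock g d q

/-- Adds the value of `e` at the leaf with heap index `var 36`. -/
def segUpdate (e : Expr) : Prog :=
  .put 25 (.var 36) (.get 25 (.var 36) + e) ;;
  .put 26 (.var 36) (.get 25 (.var 36)) ;;
  .forTo 37 5 (
    .assign 36 (.var 36 / .const 2) ;;
    .put 25 (.var 36) (.get 25 (.const 2 * .var 36) + .get 25 (.const 2 * .var 36 + .const 1)) ;;
    .put 26 (.var 36) (.get 26 (.const 2 * .var 36)) ;;
    .ite (.lt (.get 25 (.const 2 * .var 36) + .get 26 (.const 2 * .var 36 + .const 1))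
        (.get 26 (.var 36)))
      (.put 26 (.var 36) (.get 25 (.const 2 * .var 36) + .get 26 (.const 2 * .var 36 + .const 1)))
      .skip)

/-- Level `d` occupies the heap indices from `2 ^ (L - d)` up to the next power of two, so levels do
not overlap. -/
theorem heap_index_inj {L d d' q q' : ℕ} (hd : d ≤ L) (hd' : d' ≤ L) (hq : q < 2 ^ (L - d))
    (hq' : q' < 2 ^ (L - d')) (h : 2 ^ (L - d) + q = 2 ^ (L - d') + q') : d = d' ∧ q = q' := by
  have key : ∀ a b : ℕ, a < b → 2 * 2 ^ a ≤ 2 ^ b := fun a b hab => by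
    rw [← pow_succ']; exact Nat.pow_le_pow_right (by norm_num) hab
  rcases lt_trichotomy (L - d) (L - d') with h1 | h1 | h1
  · have := key _ _ h1; omega
  · obtain rfl : d = d' := by omega
    exact ⟨rfl, by omega⟩
  · have := key _ _ h1; omega

/-- After `k` rounds all levels up to `k` describe the updated function and the higher ones still
the old function. Only the blocks that contain `σ` need rewriting, as the update leaves all other
blocks of a level unchanged (`block_update_of_ne`). -/
theorem segUpdate_spec {B L σ : ℕ} {g : ℕ → ℤ} {s : Mem} {e : Expr} {x M : ℤ} (hL : s.var 5 = L)
    (hLB : L ≤ B) (hσ : σ < 2 ^ L) (h36 : s.var 36 = ((2 ^ L + σ : ℕ) : ℤ)) (he : e.eval s = x)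
    (hT : SegTree L g s) (hM : ∀ i, |Function.update g σ (g σ + x) i| ≤ M)
    (hMB : 2 ^ L * M ≤ B) :
    WP B (L + 1) (segUpdate e) s (SegTree L (Function.update g σ (g σ + x))) := by
  set g' := Function.update g σ (g σ + x) with hg'
  have hM0 : 0 ≤ M := (abs_nonneg _).trans (hM 0)
  have hab : ∀ d ≤ L, ∀ q, |sumBlock g' d q| ≤ B ∧ |minBlock g' d q| ≤ B := fun d hd q => by
    have h1 := abs_sumBlock_le hM d q
    have h2 : (2 : ℤ) ^ d ≤ 2 ^ L := pow_le_pow_right₀ (by norm_num) hd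
    have h3 : 2 ^ d * M ≤ 2 ^ L * M := by gcongr
    exact ⟨by omega, by omega⟩
  have h0 := (hT 0 (by omega) σ (by simpa using hσ)).1
  simp only [Nat.sub_zero, sumBlock] at h0
  have hgσ : g' σ = g σ + x := Function.update_self _ _ _
  refine WP.seq (WP.put (by omega) ?_ ?_)
  · simp only [Expr.eval_hadd, Expr.eval_get, Expr.eval_var, h36, he, h0]
    rw [← hgσ]
    exact (hab 0 (by omega) σ).1
  simp only [Expr.eval_hadd, Expr.eval_get, Expr.eval_var, h36, he, h0]
  refine WP.seq (WP.put (by omega) ?_ ?_)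
  · simp [h36]
    rw [← hgσ]
    exact (hab 0 (by omega) σ).1
  simp only [Expr.eval_get, Expr.eval_var, h36, Mem.setArr_var, Mem.setArr_arr, if_true,
    Function.update_self]
  rw [← hgσ]
  refine WP.forTo (Y := 1) le_rfl L (by simp [hL]) hLB (by decide) (by decide) (by decide)
    (fun k s' => s'.var 36 = ((2 ^ (L - k) + σ / 2 ^ k : ℕ) : ℤ) ∧
      ∀ d ≤ L, ∀ q < 2 ^ (L - d), s'.arr 25 ((2 ^ (L - d) + q : ℕ) : ℤ) =
        (if d ≤ k then sumBlock g' d q else sumBlock g d q) ∧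
      s'.arr 26 ((2 ^ (L - d) + q : ℕ) : ℤ) = (if d ≤ k then minBlock g' d q else minBlock g d q))
    ?_ ?_ (by omega) ?_
  · refine ⟨by simp [h36], fun d hd q hq => ?_⟩
    simp only [Mem.setVar_arr, Mem.setArr_arr, Nat.reduceEqDiff, if_false, if_true,
      Function.update_apply]
    obtain ⟨t1, t2⟩ := hT d hd q hq
    rw [t1, t2]
    by_cases hi : 2 ^ (L - d) + q = 2 ^ L + σ
    · obtain ⟨rfl, rfl⟩ := heap_index_inj (d' := 0) hd (Nat.zero_le L) hq (by simpa using hσ)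
        (by simpa using hi)
      have hi' := congrArg (Nat.cast (R := ℤ)) hi
      rw [if_pos hi', if_pos hi']
      simp [sumBlock, minBlock]
    · have hi' : ((2 ^ (L - d) + q : ℕ) : ℤ) ≠ ((2 ^ L + σ : ℕ) : ℤ) := fun h => hi (Nat.cast_injective h)
      rw [if_neg hi', if_neg hi']
      by_cases hd0 : d ≤ 0
      · obtain rfl : d = 0 := by omega
        have hne : q ≠ σ / 2 ^ 0 := by
          intro h
          simp only [pow_zero, Nat.div_one] at h
          exact hi (by simp [h])
        obtain ⟨a, b⟩ := block_update_of_ne g σ (g σ + x) 0 q hne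
        rw [if_pos hd0, if_pos hd0, a, b]
        exact ⟨rfl, rfl⟩
      · rw [if_neg hd0, if_neg hd0]
        exact ⟨rfl, rfl⟩
  · rintro k hk s1 ha1 hx1 ⟨i36, iT⟩
    have hpow : 2 ^ (L - k) = 2 * 2 ^ (L - (k + 1)) := by
      rw [← pow_succ']; congr 1; omega
    have hdiv : σ / 2 ^ (k + 1) = σ / 2 ^ k / 2 := by
      rw [pow_succ, Nat.div_div_eq_div_mul]
    set u := 2 ^ (L - (k + 1)) + σ / 2 ^ (k + 1) with hu
    have hu2 : ((2 ^ (L - k) + σ / 2 ^ k : ℕ) : ℤ) / 2 = u := by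
      rw [hpow]; omega
    have hq : σ / 2 ^ (k + 1) < 2 ^ (L - (k + 1)) := by
      rw [Nat.div_lt_iff_lt_mul (by positivity), ← pow_add]
      rwa [show L - (k + 1) + (k + 1) = L by omega]
    have c0 : ((2 ^ (L - k) + 2 * (σ / 2 ^ (k + 1)) : ℕ) : ℤ) = 2 * u := by rw [hpow, hu]; push_cast; ring
    have c1 : ((2 ^ (L - k) + (2 * (σ / 2 ^ (k + 1)) + 1) : ℕ) : ℤ) = 2 * u + 1 := by
      rw [hpow, hu]; push_cast; ring
    obtain ⟨l25, l26⟩ := iT k hk.le (2 * (σ / 2 ^ (k + 1))) (by rw [hpow]; omega)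
    obtain ⟨r25, r26⟩ := iT k hk.le (2 * (σ / 2 ^ (k + 1)) + 1) (by rw [hpow]; omega)
    rw [if_pos le_rfl, c0] at l25 l26
    rw [if_pos le_rfl, c1] at r25 r26
    have hu0 : 1 ≤ u := by
      have := Nat.one_le_two_pow (n := L - (k + 1)); omega
    have n1 : (2 * u : ℤ) ≠ u := by omega
    have n2 : (2 * u + 1 : ℤ) ≠ u := by omega
    have hs1 : s1.arr 25 (2 * u) + s1.arr 25 (2 * u + 1) =
        sumBlock g' (k + 1) (σ / 2 ^ (k + 1)) := by rw [l25, r25]; rfl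
    have hm1 : min (s1.arr 26 (2 * u)) (s1.arr 25 (2 * u) + s1.arr 26 (2 * u + 1)) =
        minBlock g' (k + 1) (σ / 2 ^ (k + 1)) := by rw [l25, l26, r26]; rfl
    have fin : ∀ s' : Mem, s'.var = (s1.setVar 36 u).var →
        s'.arr 25 = Function.update (s1.arr 25) u (sumBlock g' (k + 1) (σ / 2 ^ (k + 1))) →
        s'.arr 26 = Function.update (s1.arr 26) u (minBlock g' (k + 1) (σ / 2 ^ (k + 1))) →
        ((s'.setVar 37 ((k : ℤ) + 1)).var 36 = (u : ℤ) ∧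
        ∀ d ≤ L, ∀ q < 2 ^ (L - d), (s'.setVar 37 ((k : ℤ) + 1)).arr 25 ((2 ^ (L - d) + q : ℕ) : ℤ) =
          (if d ≤ k + 1 then sumBlock g' d q else sumBlock g d q) ∧
        (s'.setVar 37 ((k : ℤ) + 1)).arr 26 ((2 ^ (L - d) + q : ℕ) : ℤ) =
          (if d ≤ k + 1 then minBlock g' d q else minBlock g d q)) := by
      intro s' hv h25 h26
      refine ⟨by simp [hv], fun d hd q hq' => ?_⟩
      rw [Mem.setVar_arr, h25, h26, Function.update_apply, Function.update_apply]
      obtain ⟨t1, t2⟩ := iT d hd q hq'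
      by_cases hi : 2 ^ (L - d) + q = u
      · obtain ⟨rfl, rfl⟩ := heap_index_inj hd (by omega) hq' hq hi
        have hi' := congrArg (Nat.cast (R := ℤ)) hi
        rw [if_pos hi', if_pos hi', if_pos le_rfl, if_pos le_rfl]
        exact ⟨rfl, rfl⟩
      · have hi' : ((2 ^ (L - d) + q : ℕ) : ℤ) ≠ (u : ℤ) := fun h => hi (Nat.cast_injective h)
        rw [if_neg hi', if_neg hi', t1, t2]
        by_cases hd1 : d = k + 1
        · subst hd1
          obtain ⟨a, b⟩ := block_update_of_ne g σ (g σ + x) (k + 1) q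
            (by rintro rfl; exact hi rfl)
          have hk1 : ¬ k + 1 ≤ k := by omega
          rw [if_neg hk1, if_neg hk1, if_pos le_rfl, if_pos le_rfl, a, b]
          exact ⟨rfl, rfl⟩
        · constructor <;> exact if_congr (by omega) rfl rfl
    refine WP.of_bdd fun hb => ?_
    refine WP.seq (WP.assign le_rfl ?_ ?_)
    · have := hb.1 36
      simp only [Expr.eval_hdiv, Expr.eval_var, Expr.eval_const]
      rw [i36] at this ⊢
      rw [hu2]
      rw [abs_of_nonneg (by omega)] at *
      omega
    simp only [Expr.eval_hdiv, Expr.eval_var, Expr.eval_const, i36, hu2]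
    refine WP.seq (WP.put le_rfl ?_ ?_)
    · simp
      rw [hs1]
      exact (hab (k + 1) hk _).1
    refine WP.seq (WP.put le_rfl (by simpa using hb.2 _ _) ?_)
    refine WP.ite le_rfl (fun hc => WP.put le_rfl ?_ (fin _ ?_ ?_ ?_))
      (fun hc => WP.skip le_rfl (fin _ ?_ ?_ ?_))
    all_goals simp [n1, n2, Function.update_of_ne] at hc
    · simp [n1, n2, Function.update_of_ne]
      rw [← min_eq_right hc.le, hm1]
      exact (hab (k + 1) hk _).2
    · rfl
    · simp [hs1]
    · simp [n1, n2, Function.update_of_ne]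
      rw [← hm1, min_eq_right hc.le]
    · rfl
    · simp [hs1]
    · simp
      rw [← hm1, min_eq_left hc]
  · rintro s1 - - ⟨-, iT⟩ d hd q hq
    obtain ⟨a, b⟩ := iT d hd q hq
    rw [if_pos hd] at a b
    exact ⟨a, b⟩

/-- For every time `τ < var 38`, stores in `27[τ]` the minimum over all slots of the sums. -/
def sweep : Prog :=
  .assign 34 (.const 0) ;;
  .assign 35 (.get 20 (.const 0)) ;;
  .loop (.lt (.var 34) (.var 38))
    (.ite (.lt (.const 0) (.var 35))
      (.assign 36 (.get 22 (.var 35) + .var 6) ;;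
        segUpdate (.get 23 (.var 35)) ;;
        .assign 35 (.get 21 (.var 35)))
      (.put 27 (.var 34) (.get 26 (.const 1)) ;;
        .assign 34 (.var 34 + .const 1) ;;
        .assign 35 (.get 20 (.var 34))))

/-- The value at slot `σ` after the events with property `P` have been processed. -/
noncomputable def slotValue (sl vl : ℤ → ℤ) (c : ℕ) (P : ℤ → Prop) (σ : ℕ) : ℤ :=
  ∑ e ∈ Finset.range c, ind (P (e + 1)) * ind (sl (e + 1) = σ) * vl (e + 1)

theorem sum_range_ind_eq {a : ℤ} (ha : 0 ≤ a) (σ : ℕ) :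
    ∑ l ∈ Finset.range (σ + 1), ind (a = (l : ℤ)) = ind (a ≤ σ) := by
  by_cases h : a ≤ σ
  · have := sum_ind_eq_mul (N := σ + 1) ha (by push_cast; omega) fun _ => 1
    rw [ind_true h]
    simpa using this
  · rw [ind_false h]
    exact Finset.sum_eq_zero fun l hl => ind_false (by have := Finset.mem_range.1 hl; omega)

/-- Once exactly the events of time at most `τ` are in the tree, prefix sums of slot values are the
two-dimensional sums. Minimal prefix sums are therefore minima over `σ`. -/
theorem sum_slotValue {sl vl tm : ℤ → ℤ} {c : ℕ} (hsl : ∀ i : ℕ, 1 ≤ i → i ≤ c → 0 ≤ sl i) {τ : ℤ}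
    {P : ℤ → Prop} (hP : ∀ i : ℕ, 1 ≤ i → i ≤ c → (P i ↔ tm i ≤ τ)) (σ : ℕ) :
    ∑ l ∈ Finset.range (σ + 1), slotValue sl vl c P l = eventSum tm sl vl c τ σ := by
  unfold slotValue eventSum
  rw [Finset.sum_comm]
  refine Finset.sum_congr rfl fun e he => ?_
  have he' := Finset.mem_range.1 he
  have h1 := hsl (e + 1) (by omega) (by omega)
  have h2 := hP (e + 1) (by omega) (by omega)
  push_cast at h1 h2
  rw [ind_and, ← Finset.sum_mul, ← Finset.mul_sum, sum_range_ind_eq h1, ind_congr h2]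

theorem abs_slotValue_le {sl vl : ℤ → ℤ} {c V : ℕ} (hv : ∀ i : ℕ, 1 ≤ i → i ≤ c → |vl i| ≤ V)
    (P : ℤ → Prop) (σ : ℕ) : |slotValue sl vl c P σ| ≤ c * V := by
  have : |slotValue sl vl c P σ| ≤ ∑ e ∈ Finset.range c, (V : ℤ) := by
    refine (Finset.abs_sum_le_sum_abs _ _).trans (Finset.sum_le_sum fun e he => ?_)
    have h := hv (e + 1) (by omega) (by have := Finset.mem_range.1 he; omega)
    push_cast at h
    have h1 := ind_nonneg (P (e + 1))
    have h2 := ind_le_one (P (e + 1))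
    have h3 := ind_nonneg (sl (e + 1) = σ)
    have h4 := ind_le_one (sl (e + 1) = σ)
    rw [abs_mul, abs_mul, abs_of_nonneg h1, abs_of_nonneg h3]
    have h5 := abs_nonneg (vl (e + 1))
    nlinarith [mul_le_one₀ h2 h3 h4, mul_nonneg h1 h3]
  simpa using this

/-- Event `e` has been processed when the sweep is at time `τ` and at index `i` of its list. -/
def Processed (tm : ℤ → ℤ) (τ i e : ℤ) : Prop := tm e < τ ∨ (tm e = τ ∧ i < e)

/-- Every round either inserts one event or closes one time. When the list of time `τ` is exhausted
the tree contains precisely the events of time at most `τ`, and its root, at heap index `1`, holds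
the minimum over all `2 ^ L` nonempty prefixes. -/
theorem sweep_spec {B S V k L N : ℕ} {F : ℤ → ℤ → ℤ} {s : Mem} (h : Stored S V k F s)
    (hL : s.var 5 = L) (h6 : s.var 6 = 2 ^ L) (hN : s.var 38 = N) (hS : S < 2 ^ L)
    (hB : 2 ^ L * (k * V) ≤ B) (hLB : 2 * 2 ^ L ≤ B) (hNB : N ≤ B)
    (h25 : ∀ j, s.arr 25 j = 0) (h26 : ∀ j, s.arr 26 j = 0) {Y : ℕ}
    (hY : (N + k + 1) * (L + 1) ≤ Y) :
    WP B Y sweep s fun s' => ∀ τ : ℕ, τ < N →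
      (∀ σ : ℕ, σ < 2 ^ L → s'.arr 27 τ ≤ F τ σ) ∧ ∃ σ : ℕ, σ < 2 ^ L ∧ s'.arr 27 τ = F τ σ := by
  obtain ⟨c, hck, hv, hnx, hhd, hsl, hvl, htm, hF⟩ := h
  have hLlt := Nat.lt_two_pow_self (n := L)
  have hY1 : 1 ≤ Y := by nlinarith
  set tm := s.arr 24 with htmdef
  have hPle : ∀ i : ℕ, 1 ≤ i → i ≤ c → ∀ τ : ℤ, (Processed tm τ 0 i ↔ tm i ≤ τ) :=
    fun i a b τ => by unfold Processed; omega
  have hcV : (2 : ℤ) ^ L * (c * V) ≤ B := by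
    have h1 : 2 ^ L * (c * V) ≤ 2 ^ L * (k * V) := by gcongr
    have h2 := h1.trans hB
    exact_mod_cast h2
  have hhd' : ∀ τ, 0 ≤ s.arr 20 τ ∧ s.arr 20 τ ≤ c ∧
      (s.arr 20 τ ≠ 0 → tm (s.arr 20 τ) = τ) ∧
      ∀ e : ℕ, 1 ≤ e → e ≤ c → (Processed tm τ (s.arr 20 τ) e ↔ tm e < τ) := fun τ => by
    obtain ⟨q1, q2, q3⟩ := hhd τ
    push_cast at q1 q3
    refine ⟨q1.1, by omega, q2, fun e a b => ?_⟩
    unfold Processed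
    constructor
    · rintro (h | ⟨h, h'⟩)
      · exact h
      · exact absurd h (q3 e h' (by omega))
    · exact Or.inl
  refine WP.seq (WP.assign hY1 (by simp) ?_)
  refine WP.of_bdd fun hb => WP.seq (WP.assign hY1 (hb.2 _ _) ?_)
  simp only [Expr.eval_get, Expr.eval_const, Mem.setVar_arr]
  refine WP.loop (Y := L + 1) (by omega)
    (fun s' => s'.var 38 = N ∧ ∃ (τ i : ℕ), s'.var 34 = τ ∧ s'.var 35 = i ∧ τ ≤ N ∧ i ≤ c ∧
      (i ≠ 0 → tm i = τ) ∧ SegTree L (slotValue (s.arr 22) (s.arr 23) c (Processed tm τ i)) s' ∧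
      ∀ t : ℕ, t < τ → (∀ σ : ℕ, σ < 2 ^ L → s'.arr 27 t ≤ F t σ) ∧
        ∃ σ : ℕ, σ < 2 ^ L ∧ s'.arr 27 t = F t σ)
    -- The measure counts the times still to be closed and the events not yet inserted. Each round
    -- lowers one of the two by one and leaves the other unchanged.
    (fun s' => ((N : ℤ) - s'.var 34 +
      ∑ e ∈ Finset.range c, ind (¬ Processed tm (s'.var 34) (s'.var 35) (e + 1))).toNat)
    ?_ ?_ ?_ ?_
  · obtain ⟨q1, q2, q3, q4⟩ := hhd' 0
    refine ⟨by simp [hN], 0, (s.arr 20 0).toNat, by simp, by simp [q1], by omega, by omega, ?_, ?_,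
      fun t ht => by omega⟩
    · intro h0
      rw [Int.toNat_of_nonneg q1]
      exact q3 (by omega)
    · have : slotValue (s.arr 22) (s.arr 23) c
          (Processed tm ((0 : ℕ) : ℤ) (((s.arr 20 0).toNat : ℕ) : ℤ)) = fun _ => 0 := by
        funext σ
        refine Finset.sum_eq_zero fun e he => ?_
        have he' := Finset.mem_range.1 he
        have h1 := q4 (e + 1) (by omega) (by omega)
        have h2 := htm (e + 1) (by omega) (by omega)
        rw [Int.toNat_of_nonneg q1, Int.natCast_zero]
        push_cast at h1 h2
        rw [ind_false (fun hp => by have := h1.1 hp; omega)]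
        simp
      rw [this]
      intro d _ q _
      have := block_zero d q
      simp [this, h25, h26]
  · rintro s1 ha1 ⟨w38, τ, i, v34, v35, hτN, hic, hi, hT, hout⟩ hc
    have a1 : ∀ a, a ≠ 25 → a ≠ 26 → a ≠ 27 → s1.arr a = s.arr a := fun a h1 h2 h3 => by
      rw [ha1.2 a (by simp [Prog.wa, segUpdate, Prog.forTo, h1, h2, h3])]; rfl
    have w5 : s1.var 5 = L := by rw [ha1.1 5 (by decide)]; simp [hL]
    have w6 : s1.var 6 = 2 ^ L := by rw [ha1.1 6 (by decide)]; simp [h6]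
    have hτN' : τ < N := by
      simp only [Cond.holds_lt, Expr.eval_var, v34, w38] at hc
      exact_mod_cast hc
    have hnn : ∀ t i' : ℤ, 0 ≤ ∑ e ∈ Finset.range c, ind (¬ Processed tm t i' (e + 1)) :=
      fun t i' => Finset.sum_nonneg fun _ _ => ind_nonneg _
    refine WP.ite (by omega) (fun hc1 => ?_) (fun hc1 => ?_)
    · simp only [Cond.holds_lt, Expr.eval_var, Expr.eval_const, v35] at hc1
      have hi1 : 1 ≤ i := by omega
      have hti := hi (by omega)
      obtain ⟨q1, q2, q3⟩ := hnx i hi1 hic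
      obtain ⟨σ, hσ⟩ := Int.eq_ofNat_of_zero_le (hsl i hi1 hic).1
      have hσL : σ < 2 ^ L := by
        have := (hsl i hi1 hic).2
        omega
      obtain ⟨i', hi'⟩ := Int.eq_ofNat_of_zero_le q1.1
      rw [hi'] at q1 q2 q3
      have hii : i' < i := by exact_mod_cast q1.2
      -- Following the link from `i` to `i'` inserts event `i` and nothing else: no index strictly
      -- between the two carries the time `τ`.
      have hstep : ∀ e : ℕ, 1 ≤ e → e ≤ c →
          (Processed tm τ i' e ↔ Processed tm τ i e ∨ e = i) := by
        intro e a b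
        unfold Processed
        constructor
        · rintro (h | ⟨h, h'⟩)
          · exact Or.inl (Or.inl h)
          · rcases lt_trichotomy e i with h4 | h4 | h4
            · exact absurd (h.trans hti.symm) (q3 e h' (by exact_mod_cast h4))
            · exact Or.inr h4
            · exact Or.inl (Or.inr ⟨h, by exact_mod_cast h4⟩)
        · rintro ((h | ⟨h, h'⟩) | rfl)
          · exact Or.inl h
          · exact Or.inr ⟨h, by omega⟩
          · exact Or.inr ⟨hti, by exact_mod_cast hii⟩
      have hnP : ¬ Processed tm τ i i := by unfold Processed; omega
      have hupd : Function.update (slotValue (s.arr 22) (s.arr 23) c (Processed tm τ i)) σ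
          (slotValue (s.arr 22) (s.arr 23) c (Processed tm τ i) σ + s.arr 23 i) =
          slotValue (s.arr 22) (s.arr 23) c (Processed tm τ i') := by
        have hsum : ∀ σ' : ℕ, slotValue (s.arr 22) (s.arr 23) c (Processed tm τ i') σ' =
            slotValue (s.arr 22) (s.arr 23) c (Processed tm τ i) σ' +
            ind (s.arr 22 i = σ') * s.arr 23 i := by
          intro σ'
          have h1 := sum_ind_eq_mul (N := c) (a := (i : ℤ) - 1) (by omega) (by omega)
            fun e => ind (s.arr 22 (e + 1) = σ') * s.arr 23 (e + 1)
          rw [sub_add_cancel] at h1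
          unfold slotValue
          rw [← h1, ← Finset.sum_add_distrib]
          refine Finset.sum_congr rfl fun e he => ?_
          have he' := Finset.mem_range.1 he
          have h2 := hstep (e + 1) (by omega) (by omega)
          push_cast at h2
          rw [ind_congr h2]
          by_cases hei : e + 1 = i
          · rw [ind_true (Or.inr hei), ind_true (P := (i : ℤ) - 1 = e) (by omega),
              ind_false (P := Processed tm τ i (e + 1))]
            · ring
            · subst hei; push_cast at hnP; exact hnP
          · rw [ind_false (P := (i : ℤ) - 1 = e) (by omega),
              ind_congr (or_iff_left hei)]
            ring
        funext σ'
        rw [hsum]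
        by_cases hs : σ' = σ
        · subst hs
          rw [Function.update_self, hσ, ind_true rfl, one_mul]
        · rw [Function.update_of_ne hs, hσ, ind_false (by
            intro h; exact hs (by exact_mod_cast h.symm)), zero_mul, add_zero]
      refine WP.of_bdd fun hb1 => ?_
      refine WP.seq (WP.assign (by omega) ?_ ?_)
      · simp only [Expr.eval_hadd, Expr.eval_get, Expr.eval_var, v35, w6, a1 22 (by decide)
          (by decide) (by decide), hσ]
        have : (σ + 2 ^ L : ℕ) ≤ B := by omega
        rw [abs_of_nonneg (by positivity)]
        exact_mod_cast this
      simp only [Expr.eval_hadd, Expr.eval_get, Expr.eval_var, v35, w6, a1 22 (by decide)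
          (by decide) (by decide), hσ]
      refine WP.seq ((segUpdate_spec (s := s1.setVar 36 (σ + 2 ^ L)) (L := L) (σ := σ)
        (g := slotValue (s.arr 22) (s.arr 23) c (Processed tm τ i)) (x := s.arr 23 i) (M := c * V)
        (by simp [w5]) (by omega) hσL (by simp [add_comm])
        (by simp [v35, a1 23 (by decide) (by decide) (by decide)]) hT ?_ hcV).mono
        fun s2 ha2 hT2 => ?_)
      · rw [hupd]
        exact abs_slotValue_le hvl _
      rw [hupd] at hT2
      have a2 : ∀ a, a ≠ 25 → a ≠ 26 → s2.arr a = s1.arr a := fun a h1 h2 => by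
        rw [ha2.2 a (by simp [Prog.wa, segUpdate, Prog.forTo, h1, h2])]; rfl
      have x35 : s2.var 35 = i := by rw [ha2.1 35 (by decide)]; simp [v35]
      have x38 : s2.var 38 = N := by rw [ha2.1 38 (by decide)]; simp [w38]
      have x34 : s2.var 34 = τ := by rw [ha2.1 34 (by decide)]; simp [v34]
      refine WP.assign (by omega) ?_ ⟨⟨by simp [x38], τ, i', ?_, ?_, hτN, by omega, ?_, ?_, ?_⟩, ?_⟩
      · simp only [Expr.eval_get, Expr.eval_var, x35]
        rw [a2 21 (by decide) (by decide)]
        exact hb1.2 _ _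
      · simp [x34]
      · simp [x35, a2 21 (by decide) (by decide), a1 21 (by decide) (by decide) (by decide), hi']
      · intro h0
        rw [← hti]
        exact q2 (by exact_mod_cast h0)
      · exact hT2
      · intro t ht
        simp only [Mem.setVar_arr, a2 27 (by decide) (by decide)]
        exact hout t ht
      · simp only [Expr.eval_get, Expr.eval_var, x35, a2 21 (by decide) (by decide),
          a1 21 (by decide) (by decide) (by decide), hi', Mem.setVar_var, Nat.reduceEqDiff,
          if_false, if_true, x34, v34]
        have h1 := sum_ind_eq_mul (N := c) (a := (i : ℤ) - 1) (by omega) (by omega)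
            fun _ => 1
        have h2 : ∑ e ∈ Finset.range c, ind (¬ Processed tm τ i (e + 1)) =
            ∑ e ∈ Finset.range c, ind (¬ Processed tm τ i' (e + 1)) + 1 := by
          refine Eq.trans ?_ (congrArg (_ + ·) h1)
          rw [← Finset.sum_add_distrib]
          refine Finset.sum_congr rfl fun e he => ?_
          have he' := Finset.mem_range.1 he
          have h2 := hstep (e + 1) (by omega) (by omega)
          push_cast at h2
          rw [ind_congr (not_congr h2)]
          by_cases hei : e + 1 = i
          · rw [ind_false (P := ¬ (_ ∨ _)) (by simp [hei]),
              ind_true (P := (i : ℤ) - 1 = e) (by omega), ind_true]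
            · ring
            · subst hei; push_cast at hnP; exact hnP
          · rw [ind_false (P := (i : ℤ) - 1 = e) (by omega),
              ind_congr (not_congr (or_iff_left hei))]
            ring
        have := hnn τ i'
        omega
    · simp only [Cond.holds_lt, Expr.eval_var, Expr.eval_const, v35] at hc1
      obtain rfl : i = 0 := by omega
      obtain ⟨q1, q2, q3, q4⟩ := hhd' ((τ : ℤ) + 1)
      -- Passing to the head of the next list changes the description of the sweep state but not the
      -- set of inserted events.
      have hsame : ∀ e : ℕ, 1 ≤ e → e ≤ c →
          (Processed tm ((τ + 1 : ℕ) : ℤ) (((s.arr 20 ((τ : ℤ) + 1)).toNat : ℕ) : ℤ) e ↔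
            Processed tm τ ((0 : ℕ) : ℤ) e) := by
        intro e a b
        have h1 := q4 e a b
        have h2 := hPle e a b τ
        rw [Int.toNat_of_nonneg q1]
        push_cast
        rw [h1, h2]
        omega
      refine WP.of_bdd fun hb1 => ?_
      refine WP.seq (WP.put (by omega) (hb1.2 _ _) ?_)
      refine WP.seq (WP.assign (by omega) ?_ ?_)
      · simp [v34]
        rw [abs_of_nonneg (by omega)]
        omega
      simp only [Expr.eval_hadd, Expr.eval_get, Expr.eval_var, v34, Expr.eval_const,
        Mem.setArr_var]
      refine WP.assign (by omega) ?_ ⟨⟨by simp [w38], τ + 1, (s.arr 20 ((τ : ℤ) + 1)).toNat, ?_, ?_, hτN',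
        by omega, ?_, ?_, ?_⟩, ?_⟩
      · simpa using hb1.2 20 _
      · simp
      · simp [a1 20 (by decide) (by decide) (by decide), q1]
      · intro h0
        rw [Int.toNat_of_nonneg q1]
        push_cast
        exact q3 (by omega)
      · have : slotValue (s.arr 22) (s.arr 23) c (Processed tm ((τ + 1 : ℕ) : ℤ)
            (((s.arr 20 ((τ : ℤ) + 1)).toNat : ℕ) : ℤ)) =
            slotValue (s.arr 22) (s.arr 23) c (Processed tm τ ((0 : ℕ) : ℤ)) := by
          funext σ
          refine Finset.sum_congr rfl fun e he => ?_
          have he' := Finset.mem_range.1 he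
          have := hsame (e + 1) (by omega) (by omega)
          push_cast at this ⊢
          rw [ind_congr this]
        rw [this]
        intro d hd q hq
        simpa using hT d hd q hq
      · intro t ht
        simp only [Mem.setVar_arr, Mem.setArr_arr, if_true, Function.update_apply]
        by_cases htτ : t = τ
        · subst htτ
          rw [if_pos rfl]
          obtain ⟨r1, r2⟩ := hT L le_rfl 0 (by simp)
          simp only [Nat.sub_self, pow_zero, add_zero, Nat.cast_one] at r2
          rw [r2]
          have hm := minBlock_spec (slotValue (s.arr 22) (s.arr 23) c
            (Processed tm t ((0 : ℕ) : ℤ))) L 0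
          simp only [zero_mul, zero_add] at hm
          have hs : ∀ σ : ℕ, ∑ l ∈ Finset.range (σ + 1), slotValue (s.arr 22) (s.arr 23) c
              (Processed tm t ((0 : ℕ) : ℤ)) l = F t σ := fun σ => by
            rw [hF]
            exact sum_slotValue (fun i a b => (hsl i a b).1) (fun i a b => hPle i a b t) σ
          simp only [hs] at hm
          exact hm
        · rw [if_neg (by exact_mod_cast htτ)]
          exact hout t (by omega)
      · simp only [Mem.setVar_var, Nat.reduceEqDiff, if_false, if_true, Expr.eval_get, Expr.eval_var,
          Mem.setVar_arr, Mem.setArr_arr, Mem.setArr_var, v34, v35,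
          a1 20 (by decide) (by decide) (by decide)]
        have h2 : ∑ e ∈ Finset.range c, ind (¬ Processed tm ((τ : ℤ) + 1) (s.arr 20 ((τ : ℤ) + 1))
            (e + 1)) = ∑ e ∈ Finset.range c, ind (¬ Processed tm τ ((0 : ℕ) : ℤ) (e + 1)) := by
          refine Finset.sum_congr rfl fun e he => ?_
          have he' := Finset.mem_range.1 he
          have := hsame (e + 1) (by omega) (by omega)
          rw [Int.toNat_of_nonneg q1] at this
          push_cast at this ⊢
          exact ind_congr (not_congr this)
        rw [h2]
        have := hnn τ ((0 : ℕ) : ℤ)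
        omega
  · refine le_trans ?_ hY
    gcongr
    simp only [Mem.setVar_var, Nat.reduceEqDiff, if_false, if_true, sub_zero]
    have : ∑ e ∈ Finset.range c, ind (¬ Processed tm 0 (s.arr 20 0) (e + 1)) ≤
        ∑ e ∈ Finset.range c, 1 := Finset.sum_le_sum fun _ _ => ind_le_one _
    simp at this
    omega
  · rintro s1 ⟨w38, τ, i, v34, v35, hτN, hic, hi, hT, hout⟩ hc t ht
    simp only [Cond.holds_lt, Expr.eval_var, v34, w38] at hc
    exact hout t (by omega)

/-! ## Rooted trees with a layout -/

/-- A rooted tree with vertices attached to its nodes, and a layout of its nodes. -/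
structure Laid (n L : ℕ) where
  N : ℕ
  p : ℤ → ℤ
  sz : ℤ → ℤ
  home : ℤ → ℤ
  pos : ℤ → ℤ
  st : ℤ → ℤ
  en : ℤ → ℤ
  forest : Forest n N p sz
  home_range : ∀ v : ℕ, v < n → -1 ≤ home v ∧ home v < N
  sz_eq : ∀ j : ℤ, 0 ≤ j → j < N → sz j = ∑ v ∈ Finset.range n, ind (Anc p (home v) j)
  isLayout : IsLayout N L p pos st en

theorem Forest.anc_sz_lt {n N : ℕ} {p sz : ℤ → ℤ} (hF : Forest n N p sz) {i j : ℤ} (h0 : -1 ≤ i)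
    (h1 : i < N) (hj : 0 ≤ j) (h : Anc p i j) (hij : i ≠ j) : sz i < sz j := by
  obtain ⟨k, rfl⟩ := h
  have := hF.sz_iterate h0 h1 k hj
  have hk : k ≠ 0 := by rintro rfl; exact hij rfl
  omega

namespace Laid

variable {n L : ℕ} (X Y : Laid n L)

/-- Vertex `v` lies in the set of node `j`. -/
def Mem (v : ℕ) (j : ℤ) : Prop := Anc X.p (X.home v) j

/-- The set of node `U` of `X` is contained in the set of node `W` of `Y`. -/
def Sub (U W : ℤ) : Prop := ∀ v : ℕ, v < n → X.Mem v U → Y.Mem v W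

/-- The size of the intersection of the sets of node `U` of `X` and node `W` of `Y`. -/
noncomputable def inter (U W : ℤ) : ℤ := ∑ v ∈ Finset.range n, ind (X.Mem v U) * ind (Y.Mem v W)

/-- `pos` is an injection of the `N` nodes into `N` positions, hence onto. -/
theorem exists_pos {σ : ℕ} (hσ : σ < X.N) : ∃ j : ℕ, j < X.N ∧ X.pos j = σ := by
  have hinj : Function.Injective fun i : Fin X.N => (⟨(X.pos (i : ℕ)).toNat, by
      have h1 := X.isLayout.pos_nonneg (i : ℕ) (by omega) (by have := i.2; omega)
      have h2 := X.isLayout.pos_lt (i : ℕ) (by omega) (by have := i.2; omega)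
      omega⟩ : Fin X.N) := by
    intro i j hij
    have h1 := X.isLayout.pos_nonneg (i : ℕ) (by omega) (by have := i.2; omega)
    have h2 := X.isLayout.pos_nonneg (j : ℕ) (by omega) (by have := j.2; omega)
    have h3 : (X.pos (i : ℕ)).toNat = (X.pos (j : ℕ)).toNat := congrArg Fin.val hij
    have := X.isLayout.pos_inj (i : ℕ) (j : ℕ) (by omega) (by have := i.2; omega) (by omega)
      (by have := j.2; omega) (by omega)
    exact Fin.ext (by exact_mod_cast this)
  obtain ⟨j, hj⟩ := Finite.surjective_of_injective hinj ⟨σ, hσ⟩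
  have h1 := X.isLayout.pos_nonneg (j : ℕ) (by omega) (by have := j.2; omega)
  have h2 : (X.pos (j : ℕ)).toNat = σ := congrArg Fin.val hj
  exact ⟨j, j.2, by omega⟩

theorem cover_pos {c j : ℤ} (hc : -1 ≤ c) (hcN : c < X.N) (hj : 0 ≤ j) (hjN : j < X.N) :
    cover L X.st X.en c (X.pos j) = ind (Anc X.p c j) :=
  X.isLayout.sum_ind c j hc hcN hj hjN

theorem cover_home {v : ℕ} {j : ℤ} (hv : v < n) (hj : 0 ≤ j) (hjN : j < X.N) :
    cover L X.st X.en (X.home v) (X.pos j) = ind (X.Mem v j) :=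
  X.cover_pos (X.home_range v hv).1 (X.home_range v hv).2 hj hjN

/-- The sweep takes minima over `2 ^ L` slots although only the first `N` belong to nodes. Beyond
those all intervals have ended, so the surplus slots have value `0`. -/
theorem cover_of_le (c : ℤ) {σ : ℤ} (hσ : X.N ≤ σ) : cover L X.st X.en c σ = 0 :=
  Finset.sum_eq_zero fun t _ => ind_false (by
    have := (X.isLayout.en_range (c * L + t)).2
    omega)

theorem inter_le_left {U : ℤ} (h0 : 0 ≤ U) (hN : U < X.N) (W : ℤ) : X.inter Y U W ≤ X.sz U := by
  rw [X.sz_eq U h0 hN]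
  refine Finset.sum_le_sum fun v _ => ?_
  exact mul_le_of_le_one_right (ind_nonneg _) (ind_le_one _)

theorem inter_nonneg (U W : ℤ) : 0 ≤ X.inter Y U W :=
  Finset.sum_nonneg fun _ _ => mul_nonneg (ind_nonneg _) (ind_nonneg _)

theorem inter_eq_iff {U : ℤ} (h0 : 0 ≤ U) (hN : U < X.N) (W : ℤ) :
    X.inter Y U W = X.sz U ↔ X.Sub Y U W := by
  rw [show X.sz U = ∑ v ∈ Finset.range n, ind (X.Mem v U) from X.sz_eq U h0 hN, inter,
    Finset.sum_eq_sum_iff_of_le fun v _ =>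
    mul_le_of_le_one_right (ind_nonneg _) (ind_le_one _)]
  unfold Sub
  simp only [Finset.mem_range]
  refine forall₂_congr fun v _ => ?_
  by_cases h1 : X.Mem v U
  · by_cases h2 : Y.Mem v W
    · simp [h1, h2, ind_true]
    · simp [h1, h2, ind_true, ind_false]
  · simp [h1, ind_false]

theorem inter_eq_zero_iff {U W : ℤ} :
    X.inter Y U W = 0 ↔ ∀ v : ℕ, v < n → X.Mem v U → ¬ Y.Mem v W := by
  rw [inter, Finset.sum_eq_zero_iff_of_nonneg fun _ _ => mul_nonneg (ind_nonneg _) (ind_nonneg _)]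
  simp only [Finset.mem_range]
  refine forall₂_congr fun v _ => ?_
  by_cases h1 : X.Mem v U
  · by_cases h2 : Y.Mem v W
    · simp [h1, h2, ind_true]
    · simp [h1, h2, ind_false]
  · simp [h1, ind_false]

theorem Mem.anc {X : Laid n L} {v : ℕ} {i j : ℤ} (h : X.Mem v i) (hij : Anc X.p i j) : X.Mem v j :=
  Anc.trans h hij

theorem exists_mem {U : ℤ} (h0 : 0 ≤ U) (hN : U < X.N) : ∃ v, v < n ∧ X.Mem v U := by
  by_contra! h
  have h1 := X.forest.sz_pos U h0 hN
  rw [show X.sz U = ∑ v ∈ Finset.range n, ind (X.Mem v U) from X.sz_eq U h0 hN,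
    Finset.sum_eq_zero fun v hv => ind_false (h v (Finset.mem_range.1 hv))] at h1
  omega

/-- The weight with which node `W` of `Y` is sought as the smallest superset of node `U` of `X`. -/
noncomputable def zval (U W : ℤ) : ℤ :=
  -((n + 1) * (Y.N + 1)) * X.inter Y U W + (Y.sz W * (Y.N + 1) + W)

/-- The value `zval` orders the candidates lexicographically. The factor `(n + 1) * (Y.N + 1)` lets
a larger intersection outweigh any difference in size; among equal intersections the smaller set
wins; and the node number is the remainder modulo `Y.N + 1`. A superset attains the largest possible
intersection `X.sz U`, so if there is one, the minimiser is the smallest. The test on the quotient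
checks that the minimiser really contains `U`; its sign condition rejects the value `0` of a surplus
slot. -/
theorem smallest_superset {U a z : ℤ} (h0 : 0 ≤ U) (hN : U < X.N)
    (hle : ∀ W : ℕ, W < Y.N → a ≤ X.zval Y U W)
    (hex : a = 0 ∨ ∃ W : ℕ, W < Y.N ∧ a = X.zval Y U W)
    (hz : z = if a / (Y.N + 1) < 0 ∧
      a / (Y.N + 1) + X.sz U * (n + 1) = Y.sz (a - a / (Y.N + 1) * (Y.N + 1)) then
        a - a / (Y.N + 1) * (Y.N + 1) else -1) :
    -1 ≤ z ∧ z < Y.N ∧ ∀ W : ℤ, 0 ≤ W → W < Y.N → (Anc Y.p z W ↔ X.Sub Y U W) := by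
  have hUn := X.forest.sz_le U h0 hN
  have hU1 := X.forest.sz_pos U h0 hN
  -- Decoding works because `0 ≤ W < Y.N + 1`, so quotient and remainder separate the node number
  -- from the rest.
  have hdec : ∀ W : ℕ, W < Y.N → a = X.zval Y U W →
      a / (Y.N + 1) = -(n + 1) * X.inter Y U W + Y.sz W ∧
      a - a / (Y.N + 1) * (Y.N + 1) = W := by
    intro W hW ha
    have : a / (Y.N + 1) = -(n + 1) * X.inter Y U W + Y.sz W := by
      rw [ha, zval, show -((n + 1) * (Y.N + 1) : ℤ) * X.inter Y U W + (Y.sz W * (Y.N + 1) + W) =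
        W + (-(n + 1) * X.inter Y U W + Y.sz W) * (Y.N + 1) by ring,
        Int.add_mul_ediv_right _ _ (by omega), Int.ediv_eq_zero_of_lt (by omega) (by omega), zero_add]
    refine ⟨this, ?_⟩
    rw [this, ha, zval]; ring
  have hneg : ∀ W : ℕ, W < Y.N → X.Sub Y U W → -(n + 1) * X.inter Y U W + Y.sz W < 0 := by
    intro W hW hs
    rw [(X.inter_eq_iff Y h0 hN W).2 hs]
    have := Y.forest.sz_le W (by omega) (by omega)
    nlinarith
  have hzneg : ∀ W : ℕ, W < Y.N → X.Sub Y U W → a < 0 := by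
    intro W hW hs
    have h1 := hle W hW
    have h2 := hneg W hW hs
    have h3 : X.zval Y U W = (-(n + 1) * X.inter Y U W + Y.sz W) * (Y.N + 1) + W := by
      rw [zval]; ring
    have h4 : (-(n + 1) * X.inter Y U W + Y.sz W) * (Y.N + 1) ≤ (-1) * ((Y.N : ℤ) + 1) :=
      mul_le_mul_of_nonneg_right (by omega) (by omega)
    omega
  have hroot : ∀ W : ℤ, 0 ≤ W → ¬ Anc Y.p (-1) W := fun W hW h => by
    have := Y.forest.anc_root h; omega
  have hmain : ∀ W0 : ℕ, W0 < Y.N → a = X.zval Y U W0 → ∀ W : ℕ, W < Y.N → X.Sub Y U W →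
      X.Sub Y U W0 ∧ Anc Y.p W0 W := by
    intro W0 hW0 ha W hW hs
    have hsW := (X.inter_eq_iff Y h0 hN W).2 hs
    have hs0 : X.Sub Y U W0 := by
      rw [← X.inter_eq_iff Y h0 hN W0]
      by_contra hne
      have h1 := X.inter_le_left Y h0 hN W0
      have h2 : X.inter Y U W0 ≤ X.sz U - 1 := by omega
      have h3 := hle W hW
      rw [ha, zval, zval, hsW] at h3
      have h4 := Y.forest.sz_le W (by omega) (by omega)
      have h5 := Y.forest.sz_pos W0 (by omega) (by omega)
      have h6 : ((n : ℤ) + 1) * (Y.N + 1) * X.inter Y U W0 ≤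
        ((n : ℤ) + 1) * (Y.N + 1) * (X.sz U - 1) := mul_le_mul_of_nonneg_left h2 (by positivity)
      have h7 : Y.sz W * (Y.N + 1) ≤ (n : ℤ) * (Y.N + 1) :=
        mul_le_mul_of_nonneg_right h4 (by omega)
      have h8 : 1 * ((Y.N : ℤ) + 1) ≤ Y.sz W0 * (Y.N + 1) :=
        mul_le_mul_of_nonneg_right h5 (by omega)
      have h9 : (0 : ℤ) ≤ Y.N := by omega
      nlinarith
    refine ⟨hs0, ?_⟩
    obtain ⟨v, hv, hvU⟩ := X.exists_mem h0 hN
    -- Two nodes whose sets share a vertex are both ancestors of its home, hence comparable. The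
    -- other order would give the competitor a smaller value.
    rcases Anc.comparable (hs0 v hv hvU) (hs v hv hvU) with h | h
    · exact h
    · by_cases hWW : (W : ℤ) = W0
      · rw [hWW]; exact Anc.refl _ _
      exfalso
      have h4 := Y.forest.anc_sz_lt (i := W) (j := W0) (by omega) (by omega) (by omega) h hWW
      have h3 := hle W hW
      rw [ha, zval, zval, hsW, (X.inter_eq_iff Y h0 hN W0).2 hs0] at h3
      have h5 : (Y.sz W + 1) * (Y.N + 1) ≤ Y.sz W0 * (Y.N + 1) :=
        mul_le_mul_of_nonneg_right (by omega) (by omega)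
      have h6 : (Y.sz W + 1) * ((Y.N : ℤ) + 1) = Y.sz W * (Y.N + 1) + Y.N + 1 := by ring
      omega
  by_cases hc : ∃ W : ℕ, W < Y.N ∧ X.Sub Y U W
  · obtain ⟨W1, hW1, hs1⟩ := hc
    obtain rfl | ⟨W0, hW0, ha⟩ := hex
    · exact absurd (hzneg W1 hW1 hs1) (lt_irrefl _)
    have hs0 := (hmain W0 hW0 ha W1 hW1 hs1).1
    obtain ⟨e1, e2⟩ := hdec W0 hW0 ha
    rw [e2, e1, if_pos ⟨hneg W0 hW0 hs0, by
      rw [(X.inter_eq_iff Y h0 hN W0).2 hs0]; ring⟩] at hz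
    subst hz
    refine ⟨by omega, by omega, fun W h1 h2 => ⟨fun h v hv hvU => (hs0 v hv hvU).anc h, fun h => ?_⟩⟩
    obtain ⟨W', rfl⟩ := Int.eq_ofNat_of_zero_le h1
    exact (hmain W0 hW0 ha W' (by omega) h).2
  · have hz1 : z = -1 := by
      rw [hz, if_neg]
      rintro ⟨h1, h2⟩
      obtain rfl | ⟨W0, hW0, ha⟩ := hex
      · simp at h1
      obtain ⟨e1, e2⟩ := hdec W0 hW0 ha
      rw [e2, e1] at h2
      refine hc ⟨W0, hW0, (X.inter_eq_iff Y h0 hN W0).1 ?_⟩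
      have h3 : ((n : ℤ) + 1) * (X.sz U - X.inter Y U W0) = 0 := by linarith
      have h4 := (mul_eq_zero.1 h3).resolve_left (by omega)
      omega
    subst hz1
    refine ⟨by omega, by omega, fun W h1 h2 => ⟨fun h => absurd h (hroot W h1), fun h => ?_⟩⟩
    obtain ⟨W', rfl⟩ := Int.eq_ofNat_of_zero_le h1
    exact absurd ⟨W', by omega, h⟩ hc

end Laid

/-- The arrays from `c` on hold the homes, sizes and layout of `X`. -/
structure Loaded {n L : ℕ} (X : Laid n L) (c : ℕ) (s : Mem) : Prop where
  home : ∀ v : ℕ, v < n → s.arr c v = X.home v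
  size : ∀ j : ℤ, 0 ≤ j → j < X.N → s.arr (c + 1) j = X.sz j
  pos : ∀ j : ℤ, 0 ≤ j → j < X.N → s.arr (c + 2) j = X.pos j
  st : s.arr (c + 3) = X.st
  en : s.arr (c + 4) = X.en

theorem Loaded.congr {n L c : ℕ} {X : Laid n L} {s s' : Mem} (h : Loaded X c s)
    (ha : ∀ a, c ≤ a → a ≤ c + 4 → s'.arr a = s.arr a) : Loaded X c s' := by
  obtain ⟨h1, h2, h3, h4, h5⟩ := h
  refine ⟨?_, ?_, ?_, ?_, ?_⟩
  all_goals
    simpa only [ha c (by omega) (by omega), ha (c + 1) (by omega) (by omega),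
      ha (c + 2) (by omega) (by omega), ha (c + 3) (by omega) (by omega),
      ha (c + 4) (by omega) (by omega)]

theorem Loaded.agree {n L c : ℕ} {X : Laid n L} {s s' : Mem} {V A : List ℕ} (h : Loaded X c s)
    (hs : Agree V A s s') (hA : ∀ a ∈ A, a < c ∨ c + 4 < a) : Loaded X c s' :=
  h.congr fun a h1 h2 => hs.2 a fun ha => by have := hA a ha; omega

/-- `addQuad` with the value of `e` and the nodes given by expressions. -/
def addQuadAt (p q p' q' e : Expr) : Prog :=
  .assign 25 e ;; .assign 26 p ;; .assign 27 q ;; .assign 28 p' ;; .assign 29 q' ;; addQuad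

theorem addQuadAt_spec {n B V k L : ℕ} {F : ℤ → ℤ → ℤ} {s : Mem} {X Y : Laid n L}
    {p q p' q' e : Expr} {zp zq zp' zq' x : ℤ}
    (h : Stored Y.N V k F s) (hkB : k + 4 * L ^ 4 ≤ B) (hLB : L ≤ B) (hL : s.var 5 = L)
    (he : e.eval s = x)
    (hp : ∀ s', Agree [25, 26, 27, 28, 29] [] s s' →
      p.eval s' = zp ∧ q.eval s' = zq ∧ p'.eval s' = zp' ∧ q'.eval s' = zq')
    (hz : -1 ≤ zp ∧ zp < X.N) (hz1 : -1 ≤ zq ∧ zq < X.N) (hz2 : -1 ≤ zp' ∧ zp' < Y.N)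
    (hz3 : -1 ≤ zq' ∧ zq' < Y.N) (hXB : X.N + 1 ≤ B) (hYB : Y.N + 1 ≤ B)
    (hX : Loaded X 3 s) (hYl : Loaded Y 8 s) (hV : |x| ≤ V) (hVB : V ≤ B) :
    WP B ((L + 1) ^ 4) (addQuadAt p q p' q' e) s (Stored Y.N V (k + 4 * L ^ 4) fun τ σ =>
      F τ σ + x * (cover L X.st X.en zp τ * cover L X.st X.en zq τ *
        (cover L Y.st Y.en zp' σ * cover L Y.st Y.en zq' σ))) := by
  have hY1 : 1 ≤ (L + 1) ^ 4 := Nat.one_le_pow _ _ (by omega)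
  refine WP.seq (WP.assign hY1 (by rw [he]; omega) ?_)
  rw [he]
  have g1 : Agree [25, 26, 27, 28, 29] [] s (s.setVar 25 x) :=
    ⟨fun y hy => by simp at hy; simp [hy], fun _ _ => rfl⟩
  have e1 := (hp _ g1).1
  refine WP.seq (WP.assign hY1 (by rw [e1]; exact abs_le_of_range (by omega) (by omega) hz.1 hz.2) ?_)
  rw [e1]
  have g2 : Agree [25, 26, 27, 28, 29] [] s ((s.setVar 25 x).setVar 26 zp) :=
    ⟨fun y hy => by simp at hy; simp [hy], fun _ _ => rfl⟩
  have e2 := (hp _ g2).2.1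
  refine WP.seq (WP.assign hY1 (by rw [e2]; exact abs_le_of_range (by omega) (by omega) hz1.1 hz1.2) ?_)
  rw [e2]
  have g3 : Agree [25, 26, 27, 28, 29] [] s (((s.setVar 25 x).setVar 26 zp).setVar 27 zq) :=
    ⟨fun y hy => by simp at hy; simp [hy], fun _ _ => rfl⟩
  have e3 := (hp _ g3).2.2.1
  refine WP.seq (WP.assign hY1 (by rw [e3]; exact abs_le_of_range (by omega) (by omega) hz2.1 hz2.2) ?_)
  rw [e3]
  have g4 : Agree [25, 26, 27, 28, 29] [] s
      ((((s.setVar 25 x).setVar 26 zp).setVar 27 zq).setVar 28 zp') :=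
    ⟨fun y hy => by simp at hy; simp [hy], fun _ _ => rfl⟩
  have e4 := (hp _ g4).2.2.2
  refine WP.seq (WP.assign hY1 (by rw [e4]; exact abs_le_of_range (by omega) (by omega) hz3.1 hz3.2) ?_)
  rw [e4]
  refine (addQuad_spec (S := Y.N) (p := zp) (q := zq) (p' := zp') (q' := zq') (x := x)
    (s := (((((s.setVar 25 x).setVar 26 zp).setVar 27 zq).setVar 28 zp').setVar 29 zq'))
    (h.congr (by simp) fun _ _ _ => rfl) hkB hLB (by simpa using hL) (by simp)
    (by simp) (by simp) (by simp) (by simp) ?_ ?_ ?_ hV hVB).mono fun s' _ h' => ?_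
  · intro i; simp only [Mem.setVar_arr]; rw [hX.st]; exact (X.isLayout.st_range i).1
  · intro i; simp only [Mem.setVar_arr]; rw [hYl.st]; exact (Y.isLayout.st_range i).1
  · intro i; simp only [Mem.setVar_arr]; rw [hYl.en]; exact (Y.isLayout.en_range i).2
  · refine h'.mono le_rfl fun τ σ => ?_
    simp only [Mem.setVar_arr]
    rw [hX.st, hX.en, hYl.st, hYl.en]

/-! ## Smallest supersets -/

/-- The inputs of the passes over a pair of trees. -/
structure RunEnv {n L : ℕ} (X Y : Laid n L) (s : Mem) : Prop where
  v0 : s.var 0 = n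
  v5 : s.var 5 = L
  v6 : s.var 6 = 2 ^ L
  v7 : s.var 7 = X.N
  v8 : s.var 8 = Y.N
  left : Loaded X 3 s
  right : Loaded Y 8 s

theorem RunEnv.agree {n L : ℕ} {X Y : Laid n L} {s s' : Mem} {V A : List ℕ} (h : RunEnv X Y s)
    (hs : Agree V A s s') (hV : ∀ x ∈ [0, 5, 6, 7, 8], x ∉ V) (hA : ∀ a ∈ A, a < 3 ∨ 12 < a) :
    RunEnv X Y s' := by
  obtain ⟨h0, h5, h6, h7, h8, hl, hr⟩ := h
  refine ⟨?_, ?_, ?_, ?_, ?_, hl.agree hs fun a ha => ?_, hr.agree hs fun a ha => ?_⟩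
  · rw [hs.1 0 (hV 0 (by decide)), h0]
  · rw [hs.1 5 (hV 5 (by decide)), h5]
  · rw [hs.1 6 (hV 6 (by decide)), h6]
  · rw [hs.1 7 (hV 7 (by decide)), h7]
  · rw [hs.1 8 (hV 8 (by decide)), h8]
  · have := hA a ha; omega
  · have := hA a ha; omega

theorem RunEnv.setVar {n L : ℕ} {X Y : Laid n L} {s : Mem} (h : RunEnv X Y s) {x : ℕ} {z : ℤ}
    (hx : x ∉ [0, 5, 6, 7, 8]) : RunEnv X Y (s.setVar x z) :=
  h.agree (V := [x]) (A := []) ⟨fun y hy => by simp at hy; simp [hy], fun _ _ => rfl⟩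
    (fun y hy hyx => by simp at hyx; subst hyx; exact hx hy) (by simp)

/-- Translates from positions to nodes: slots below `Y.N` are the positions of nodes, and the
surplus slots up to `2 ^ L` form the other alternative for the place of the minimum. -/
theorem Laid.of_sweep {n L : ℕ} {X Y : Laid n L} {F : ℤ → ℤ → ℤ} {out : ℤ → ℤ}
    (h : ∀ τ : ℕ, τ < X.N →
      (∀ σ : ℕ, σ < 2 ^ L → out τ ≤ F τ σ) ∧ ∃ σ : ℕ, σ < 2 ^ L ∧ out τ = F τ σ)
    (hY : Y.N ≤ 2 ^ L) {U : ℤ} (h0 : 0 ≤ U) (hU : U < X.N) :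
    (∀ W : ℕ, W < Y.N → out (X.pos U) ≤ F (X.pos U) (Y.pos W)) ∧
      ((∃ σ : ℤ, Y.N ≤ σ ∧ out (X.pos U) = F (X.pos U) σ) ∨
        ∃ W : ℕ, W < Y.N ∧ out (X.pos U) = F (X.pos U) (Y.pos W)) := by
  obtain ⟨τ, hτ⟩ := Int.eq_ofNat_of_zero_le (X.isLayout.pos_nonneg U h0 hU)
  have hlt := X.isLayout.pos_lt U h0 hU
  obtain ⟨h1, σ, hσ, h2⟩ := h τ (by omega)
  rw [hτ]
  constructor
  · intro W hW
    obtain ⟨σ', hσ'⟩ := Int.eq_ofNat_of_zero_le (Y.isLayout.pos_nonneg W (by omega) (by omega))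
    have := Y.isLayout.pos_lt W (by omega) (by omega)
    rw [hσ']
    exact h1 σ' (by omega)
  · by_cases hc : Y.N ≤ σ
    · exact Or.inl ⟨σ, by omega, h2⟩
    · obtain ⟨W, hW, hp⟩ := Y.exists_pos (not_le.1 hc)
      exact Or.inr ⟨W, hW, by rw [hp]; exact h2⟩

/-- The sums from which the smallest supersets are read off. -/
noncomputable def Laid.zsum {n L : ℕ} (X Y : Laid n L) (τ σ : ℤ) : ℤ :=
  ∑ v ∈ Finset.range n, -((n + 1) * (Y.N + 1)) *
    (cover L X.st X.en (X.home v) τ * cover L X.st X.en (X.home v) τ *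
      (cover L Y.st Y.en (Y.home v) σ * cover L Y.st Y.en (Y.home v) σ)) +
  ∑ W ∈ Finset.range Y.N, ind (0 ≤ τ ∧ τ < X.N) * ind (Y.pos W ≤ σ ∧ σ < Y.pos W + 1) *
    (Y.sz W * (Y.N + 1) + W)

theorem ind_mul_self (P : Prop) : ind P * ind P = ind P := by
  rw [← ind_and]; exact ind_congr (and_self_iff)

/-- At node positions a cover is an indicator, so the squares forced by the four-node interface of
`addQuad` are harmless. The strip of width one at `Y.pos w` contributes only to `w` itself, by
injectivity of positions. -/
theorem Laid.zsum_pos {n L : ℕ} (X Y : Laid n L) {U W : ℤ} (h0 : 0 ≤ U) (hU : U < X.N)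
    (hW0 : 0 ≤ W) (hW : W < Y.N) : X.zsum Y (X.pos U) (Y.pos W) = X.zval Y U W := by
  unfold zsum zval inter
  congr 1
  · rw [Finset.mul_sum]
    refine Finset.sum_congr rfl fun v hv => ?_
    have hv' := Finset.mem_range.1 hv
    rw [X.cover_home hv' h0 hU, Y.cover_home hv' hW0 hW, ind_mul_self, ind_mul_self]
  · rw [← sum_ind_eq_mul hW0 hW fun w => Y.sz w * (Y.N + 1) + w]
    refine Finset.sum_congr rfl fun w hw => ?_
    have hw' := Finset.mem_range.1 hw
    rw [ind_true ⟨X.isLayout.pos_nonneg U h0 hU, X.isLayout.pos_lt U h0 hU⟩, one_mul]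
    congr 1
    refine ind_congr ⟨fun h => ?_, fun h => by subst h; omega⟩
    exact Y.isLayout.pos_inj _ _ hW0 hW (by omega) (by omega) (by omega)

theorem Laid.zsum_of_le {n L : ℕ} (X Y : Laid n L) (τ : ℤ) {σ : ℤ} (hσ : Y.N ≤ σ) :
    X.zsum Y τ σ = 0 := by
  unfold zsum
  rw [Finset.sum_eq_zero, Finset.sum_eq_zero, add_zero]
  · intro W hW
    have := Finset.mem_range.1 hW
    have := Y.isLayout.pos_lt W (by omega) (by omega)
    rw [ind_false (P := Y.pos W ≤ σ ∧ σ < Y.pos W + 1) (by omega)]; ring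
  · intro v _
    rw [Y.cover_of_le _ hσ]; ring

/-- `z` maps each node of `X` to the smallest node of `Y` whose set contains its set, or to `-1`. -/
def Laid.Supersets {n L : ℕ} (X Y : Laid n L) (z : ℤ → ℤ) : Prop :=
  ∀ U : ℤ, 0 ≤ U → U < X.N → -1 ≤ z U ∧ z U < Y.N ∧
    ∀ W : ℤ, 0 ≤ W → W < Y.N → (Anc Y.p (z U) W ↔ X.Sub Y U W)

/-! ### The programs for smallest supersets -/

def zfinish : Prog :=
  .forTo 39 7 (
    .assign 42 (.get 27 (.get 5 (.var 39))) ;;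
    .assign 43 (.var 42 / .var 41) ;;
    .assign 44 (.var 42 - .var 43 * .var 41) ;;
    .ite (.conj (.lt (.var 43) (.const 0))
        (.conj (.le (.var 43 + .get 4 (.var 39) * .var 40) (.get 9 (.var 44)))
          (.le (.get 9 (.var 44)) (.var 43 + .get 4 (.var 39) * .var 40))))
      (.put 13 (.var 39) (.var 44)) (.put 13 (.var 39) (.const (-1))))

def zevents : Prog :=
  .forTo 39 0 (addQuadAt (.get 3 (.var 39)) (.get 3 (.var 39)) (.get 8 (.var 39))
    (.get 8 (.var 39)) (.var 42)) ;;
  .forTo 39 8 (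
    .assign 21 (.const 0) ;;
    .assign 22 (.var 7) ;;
    .assign 23 (.get 10 (.var 39)) ;;
    .assign 24 (.var 23 + .const 1) ;;
    .assign 25 (.get 9 (.var 39) * .var 41 + .var 39) ;;
    addRect)

/-- Computes the smallest supersets of the first tree in the second tree in array `13`. -/
def supersets : Prog :=
  .assign 38 (.var 7) ;;
  .assign 40 (.var 0 + .const 1) ;;
  .assign 41 (.var 8 + .const 1) ;;
  .assign 42 (.const 0 - .var 40 * .var 41) ;;
  .assign 20 (.const 0) ;;
  zevents ;;
  sweep ;;
  zfinish

theorem zfinish_spec {n B L Y' : ℕ} {X Y : Laid n L} {s : Mem} (h : RunEnv X Y s)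
    (h40 : s.var 40 = n + 1) (h41 : s.var 41 = Y.N + 1) (hYB : Y.N + 1 ≤ B) (hXB : X.N ≤ B)
    (hle : ∀ U : ℤ, 0 ≤ U → U < X.N → (∀ W : ℕ, W < Y.N → s.arr 27 (X.pos U) ≤ X.zval Y U W) ∧
      (s.arr 27 (X.pos U) = 0 ∨ ∃ W : ℕ, W < Y.N ∧ s.arr 27 (X.pos U) = X.zval Y U W))
    (hY' : X.N + 1 ≤ Y') :
    WP B Y' zfinish s fun s' => X.Supersets Y (s'.arr 13) := by
  refine WP.forTo (Y := 1) le_rfl X.N h.v7 hXB (by decide) (by decide) (by decide)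
    (fun k s' => ∀ U : ℕ, U < k → -1 ≤ s'.arr 13 U ∧ s'.arr 13 U < Y.N ∧
      ∀ W : ℤ, 0 ≤ W → W < Y.N → (Anc Y.p (s'.arr 13 U) W ↔ X.Sub Y U W))
    (fun U hU => by omega) ?_ (by omega) ?_
  · rintro k hk s1 ha1 hx1 hI
    have e1 := h.agree ha1 (by decide) (by decide)
    have w40 : s1.var 40 = n + 1 := by rw [ha1.1 _ (by decide), h40]
    have w41 : s1.var 41 = Y.N + 1 := by rw [ha1.1 _ (by decide), h41]
    have w27 : s1.arr 27 = s.arr 27 := ha1.2 _ (by decide)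
    have p1 : s1.arr 5 k = X.pos k := e1.left.pos k (by omega) (by omega)
    have z1 : s1.arr 4 k = X.sz k := e1.left.size k (by omega) (by omega)
    obtain ⟨q1, q2⟩ := hle k (by omega) (by omega)
    set a := s.arr 27 (X.pos k) with ha
    have hid : a - a / (Y.N + 1) * (Y.N + 1) = a % (Y.N + 1) := by
      rw [Int.emod_def]; ring
    have hm1 := Int.emod_nonneg a (b := (Y.N : ℤ) + 1) (by omega)
    have hm2 := Int.emod_lt_of_pos a (b := (Y.N : ℤ) + 1) (by omega)
    refine WP.of_bdd fun hb => ?_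
    have hba : |a| ≤ B := by rw [ha, ← w27]; exact hb.2 _ _
    refine WP.seq (WP.assign le_rfl (hb.2 _ _) ?_)
    simp only [Expr.eval_get, Expr.eval_var, hx1, p1, w27, ← ha]
    have hq : |a / ((Y.N : ℤ) + 1)| ≤ B := by
      have := Int.natAbs_ediv_le_natAbs a ((Y.N : ℤ) + 1)
      rw [Int.abs_eq_natAbs] at hba ⊢
      omega
    refine WP.seq (WP.assign le_rfl (by simpa [w41] using hq) ?_)
    refine WP.seq (WP.assign le_rfl ?_ ?_)
    · simp only [Expr.eval_hsub, Expr.eval_hmul, Expr.eval_hdiv, Expr.eval_var, Mem.setVar_var,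
        Nat.reduceEqDiff, if_true, if_false, w41, hid]
      rw [abs_of_nonneg hm1]; omega
    simp only [Expr.eval_hsub, Expr.eval_hmul, Expr.eval_hdiv, Expr.eval_var, Mem.setVar_var,
        Nat.reduceEqDiff, if_true, if_false, w41, hid]
    have hgoal := fun z => X.smallest_superset Y (U := k) (a := a) (z := z) (by omega) (by omega) q1 q2
    rw [hid] at hgoal
    have hset : ∀ z : ℤ, z = (if a / (Y.N + 1) < 0 ∧
        a / (Y.N + 1) + X.sz k * (n + 1) = Y.sz (a % (Y.N + 1)) then a % (Y.N + 1) else -1) →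
        ∀ s' : Mem, s'.arr 13 = Function.update (s1.arr 13) k z →
        ∀ U : ℕ, U < k + 1 → -1 ≤ s'.arr 13 U ∧ s'.arr 13 U < Y.N ∧
          ∀ W : ℤ, 0 ≤ W → W < Y.N → (Anc Y.p (s'.arr 13 U) W ↔ X.Sub Y U W) := by
      intro z hz s' hs' U hU
      rw [hs']
      by_cases hUk : U = k
      · subst hUk
        rw [Function.update_self]
        exact hgoal z hz
      · rw [Function.update_of_ne (by exact_mod_cast hUk)]
        exact hI U (by omega)
    -- The remainder is known to be a node number only if the minimum comes from a node. A negative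
    -- quotient guarantees this; otherwise the first conjunct of the test already fails and the
    -- entry read does not matter.
    have hsz : s1.arr 9 (a % (Y.N + 1)) = Y.sz (a % (Y.N + 1)) ∨ ¬ a / ((Y.N : ℤ) + 1) < 0 := by
      by_cases hneg : a / ((Y.N : ℤ) + 1) < 0
      · left
        rcases q2 with q2 | ⟨W, hW, q2⟩
        · rw [q2] at hneg; simp at hneg
        · have : a % ((Y.N : ℤ) + 1) = W := by
            rw [q2, Laid.zval, show -((n + 1) * (Y.N + 1) : ℤ) * X.inter Y k W +
              (Y.sz W * (Y.N + 1) + W) = W + (-(n + 1) * X.inter Y k W + Y.sz W) * (Y.N + 1) by ring,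
              Int.add_mul_emod_self_right, Int.emod_eq_of_lt (by omega) (by omega)]
          rw [this]
          exact e1.right.size W (by omega) (by omega)
      · exact Or.inr hneg
    refine WP.ite le_rfl (fun hc => WP.put le_rfl ?_ (hset (a % (Y.N + 1)) ?_ _ ?_))
      (fun hc => WP.put le_rfl ?_ (hset (-1) ?_ _ ?_))
    all_goals simp only [Cond.Holds, Cond.holds_lt, Expr.eval_hadd, Expr.eval_hmul, Expr.eval_get,
      Expr.eval_const, Expr.eval_var, Mem.setVar_var, Mem.setVar_arr, Nat.reduceEqDiff, if_true,
      if_false, hx1, z1, w40] at hc ⊢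
    · rw [abs_of_nonneg hm1]; omega
    · obtain ⟨c1, c2, c3⟩ := hc
      rw [hsz.resolve_right (not_not.2 c1)] at c2 c3
      rw [if_pos ⟨c1, le_antisymm c2 c3⟩]
    · simp
    · rw [abs_neg, abs_one]; omega
    · rw [if_neg]
      rintro ⟨c1, c2⟩
      rw [hsz.resolve_right (not_not.2 c1), c2] at hc
      exact hc ⟨c1, le_rfl, le_rfl⟩
    · simp
  · intro s1 _ _ hI U h0 hU
    obtain ⟨U', rfl⟩ := Int.eq_ofNat_of_zero_le h0
    exact hI U' (by omega)

theorem zevents_spec {n B L V Y' : ℕ} {X Y : Laid n L} {s0 : Mem} (g0 : RunEnv X Y s0)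
    (v41 : s0.var 41 = Y.N + 1) (v42 : s0.var 42 = -((n + 1) * (Y.N + 1)))
    (st0 : Stored Y.N V 0 (fun _ _ => 0) s0) (hV : V = (n + 1) * (Y.N + 1)) (hVB : V ≤ B)
    (hKB : n * (4 * L ^ 4) + Y.N * 4 ≤ B) (hB : n + X.N + Y.N + L + 10 ≤ B)
    (hY' : (n + Y.N + 1) * (L + 1) ^ 4 ≤ Y') :
    WP B Y' zevents s0 (Stored Y.N V (n * (4 * L ^ 4) + Y.N * 4) (X.zsum Y)) := by
  refine WP.seq (WP.forAcc (Y := (L + 1) ^ 4) (e := 4 * L ^ 4) (K := B)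
    (Nat.one_le_pow _ _ (by omega))  g0.v0 (by omega) (by decide) (by decide) (by decide) (by decide)
    (fun v τ σ => -((n + 1) * (Y.N + 1)) *
      (cover L X.st X.en (X.home v) τ * cover L X.st X.en (X.home v) τ *
      (cover L Y.st Y.en (Y.home v) σ * cover L Y.st Y.en (Y.home v) σ)))
    st0 (by omega) ?_ ?_ ?_)
  · intro v hv s1 ha1 hx1 k' F' hk' st1
    have e1 :=  g0.agree ha1 (by decide) (by decide)
    refine addQuadAt_spec st1 hk' (by omega) e1.v5 ?_ (fun s2 ha2 => ?_) (X.home_range v hv)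
      (X.home_range v hv) (Y.home_range v hv) (Y.home_range v hv) (by omega) (by omega) e1.left
      e1.right ?_ hVB
    · rw [Expr.eval_var, ha1.1 42 (by decide), v42]
    · simp only [Expr.eval_get, Expr.eval_var, ha2.1 39 (by decide), hx1, ha2.2 3 (by decide),
        ha2.2 8 (by decide)]
      exact ⟨e1.left.home v hv, e1.left.home v hv, e1.right.home v hv, e1.right.home v hv⟩
    · rw [abs_neg, abs_of_nonneg (by positivity)]
      rw [hV]; push_cast; exact le_rfl
  · refine le_trans ?_ hY'
    gcongr; omega
  intro s1 ha1 st1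
  have e1 :=  g0.agree ha1 (by decide) (by decide)
  refine WP.forAcc (Y := 1) (e := 4) (K := B) le_rfl e1.v8 (by omega) (by decide) (by decide)
    (by decide) (by decide)
    (fun W τ σ => ind (0 ≤ τ ∧ τ < X.N) * ind (Y.pos W ≤ σ ∧ σ < Y.pos W + 1) *
      (Y.sz W * (Y.N + 1) + W)) st1 (by omega) ?_ ?_ ?_
  · intro W hW s2 ha2 hx2 k' F' hk' st2
    have e2 := e1.agree ha2 (by decide) (by decide)
    have w41 : s2.var 41 = Y.N + 1 := by rw [ha2.1 _ (by decide), ha1.1 _ (by decide), v41]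
    have p2 : s2.arr 10 W = Y.pos W := e2.right.pos W (by omega) (by omega)
    have z2 : s2.arr 9 W = Y.sz W := e2.right.size W (by omega) (by omega)
    have hp0 := Y.isLayout.pos_nonneg W (by omega) (by omega)
    have hp1 := Y.isLayout.pos_lt W (by omega) (by omega)
    have hs0 := Y.forest.sz_pos W (by omega) (by omega)
    have hs1 := Y.forest.sz_le W (by omega) (by omega)
    have hx : |Y.sz W * ((Y.N : ℤ) + 1) + W| ≤ (V : ℤ) := by
      rw [abs_of_nonneg (by positivity), hV]
      push_cast
      nlinarith
    refine WP.of_bdd fun hb2 => ?_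
    refine WP.seq (WP.assign le_rfl (by simp) ?_)
    refine WP.seq (WP.assign le_rfl (by simpa using hb2.1 7) ?_)
    refine WP.seq (WP.assign le_rfl (hb2.2 _ _) ?_)
    refine WP.seq (WP.assign le_rfl ?_ ?_)
    · simp only [Expr.eval_hadd, Expr.eval_get, Expr.eval_var, Expr.eval_const, Mem.setVar_var,
        Mem.setVar_arr, Nat.reduceEqDiff, if_true, if_false, hx2, p2]
      rw [abs_of_nonneg (by omega)]; omega
    refine WP.seq (WP.assign le_rfl ?_ ?_)
    · simp only [Expr.eval_hadd, Expr.eval_hmul, Expr.eval_get, Expr.eval_var, Expr.eval_const,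
        Mem.setVar_var, Mem.setVar_arr, Nat.reduceEqDiff, if_false, hx2, z2, w41]
      omega
    simp only [Expr.eval_hadd, Expr.eval_hmul, Expr.eval_get, Expr.eval_var, Expr.eval_const,
        Mem.setVar_var, Mem.setVar_arr, Nat.reduceEqDiff, if_true, if_false, hx2, z2, p2, w41, e2.v7]
    exact addRect_spec (st2.congr (by simp) fun _ _ _ => rfl) hk' (by simp) (by simp) (by simp)
      (by simp) (by simp) le_rfl hp0 (by omega) hx hVB
  · refine le_trans ?_ hY'
    have := Nat.one_le_pow 4 (L + 1) (by omega)
    nlinarith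
  · intro s2 _ st2
    refine st2.mono (by omega) fun τ σ => ?_
    unfold Laid.zsum
    ring

theorem supersets_spec {n B L Z Y' : ℕ} {X Y : Laid n L} {s : Mem} (h : RunEnv X Y s)
    (hz : ∀ a, 20 ≤ a → a ≤ 27 → ∀ j, s.arr a j = 0)
    (hZ : n + X.N + Y.N + 2 ^ L + 10 ≤ Z) (hZB : Z ^ 12 ≤ B) (hYL : Y.N < 2 ^ L)
    (hY' : 30 * (n + X.N + Y.N + 1) * (L + 1) ^ 5 ≤ Y') :
    WP B Y' supersets s fun s' => X.Supersets Y (s'.arr 13) := by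
  have hLlt := Nat.lt_two_pow_self (n := L)
  have hp : ∀ k : ℕ, k ≤ 12 → Z ^ k ≤ B := fun k hk =>
    (Nat.pow_le_pow_right (by omega) hk).trans hZB
  have hZB1 : Z ≤ B := by simpa using hp 1 (by norm_num)
  have hY1 : 1 ≤ Y' := le_trans (by nlinarith [Nat.one_le_pow 5 (L + 1) (by omega)]) hY'
  set V : ℕ := (n + 1) * (Y.N + 1) with hV
  have hVZ : V ≤ Z ^ 2 := by rw [hV, sq]; exact Nat.mul_le_mul (by omega) (by omega)
  have hVB : V ≤ B := hVZ.trans (hp 2 (by norm_num))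
  set K : ℕ := n * (4 * L ^ 4) + Y.N * 4 with hK
  -- The powers of `Z` are generous. With `K ≤ Z ^ 6` events of weight at most `V ≤ Z ^ 2`, all
  -- entries of the segment tree are at most `2 ^ L * K * V ≤ Z ^ 9`; the exponent `12` is needed
  -- only for `consistents_spec`.
  have hKZ : K ≤ Z ^ 6 := by
    have h1 : n * (4 * L ^ 4) ≤ Z * (4 * Z ^ 4) := by gcongr <;> omega
    have h2 : Y.N * 4 ≤ Z * (4 * Z ^ 4) := by
      refine Nat.mul_le_mul (by omega) ?_
      have := Nat.one_le_pow 4 Z (by omega); omega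
    have h3 : 10 * Z ^ 5 ≤ Z * Z ^ 5 := by gcongr; omega
    have h4 : Z ^ 6 = Z * Z ^ 5 := by ring
    have h5 : Z * (4 * Z ^ 4) = 4 * Z ^ 5 := by ring
    omega
  have hKB : K ≤ B := hKZ.trans (hp 6 (by norm_num))
  have hKY : K + X.N + Y.N + n + 2 ≤ 10 * (n + X.N + Y.N + 1) * (L + 1) ^ 4 := by
    have h1 : L ^ 4 ≤ (L + 1) ^ 4 := by gcongr; omega
    have h2 := Nat.one_le_pow 4 (L + 1) (by omega)
    have h3 : n * (4 * L ^ 4) ≤ n * (4 * (L + 1) ^ 4) := by gcongr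
    nlinarith
  refine WP.of_bdd fun hb => ?_
  refine WP.seq (WP.assign hY1 (hb.1 _) ?_)
  refine WP.seq (WP.assign hY1 ?_ ?_)
  · simp only [Expr.eval_hadd, Expr.eval_var, Expr.eval_const, Mem.setVar_var, Nat.reduceEqDiff,
      if_false, h.v0]
    rw [abs_of_nonneg (by omega)]; omega
  refine WP.seq (WP.assign hY1 ?_ ?_)
  · simp only [Expr.eval_hadd, Expr.eval_var, Expr.eval_const, Mem.setVar_var, Nat.reduceEqDiff,
      if_false, h.v8]
    rw [abs_of_nonneg (by omega)]; omega
  simp only [Expr.eval_hadd, Expr.eval_var, Expr.eval_const, Mem.setVar_var, Nat.reduceEqDiff,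
      if_false, h.v8, h.v7, h.v0]
  refine WP.seq (WP.assign hY1 ?_ ?_)
  · simp only [Expr.eval_hsub, Expr.eval_hmul, Expr.eval_var, Expr.eval_const, Mem.setVar_var,
      Nat.reduceEqDiff, if_true, if_false, zero_sub, abs_neg]
    rw [abs_of_nonneg (by positivity)]
    exact_mod_cast hVB
  simp only [Expr.eval_hsub, Expr.eval_hmul, Expr.eval_var, Expr.eval_const, Mem.setVar_var,
      Nat.reduceEqDiff, if_true, if_false, zero_sub]
  refine WP.seq (WP.assign hY1 (by simp) ?_)
  simp only [Expr.eval_const]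
  set s0 := (((((s.setVar 38 X.N).setVar 40 (n + 1)).setVar 41 (Y.N + 1)).setVar 42
    (-((n + 1) * (Y.N + 1)))).setVar 20 0) with hs0
  have g0 : RunEnv X Y s0 := ((((h.setVar (by decide)).setVar (by decide)).setVar (by decide)).setVar
    (by decide)).setVar (by decide)
  have v38 : s0.var 38 = X.N := by simp [hs0]
  have v40 : s0.var 40 = n + 1 := by simp [hs0]
  have v41 : s0.var 41 = Y.N + 1 := by simp [hs0]
  have v42 : s0.var 42 = -((n + 1) * (Y.N + 1)) := by simp [hs0]
  have st0 : Stored Y.N V 0 (fun _ _ => 0) s0 := Stored.zero (by simp [hs0])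
    fun j => hz 20 (by norm_num) (by norm_num) j
  refine WP.seq ((zevents_spec g0 v41 v42 st0 hV hVB hKB (by omega) ?_).mono fun s2 ha2 st3 => ?_)
  · refine le_trans ?_ hY'
    gcongr <;> omega
  have e2 := g0.agree ha2 (by decide) (by decide)
  have b2 : ∀ a, a = 25 ∨ a = 26 → s2.arr a = s.arr a := by
    rintro a (rfl | rfl) <;> rw [ha2.2 _ (by decide)] <;> rfl
  have c2 : ∀ x, x = 38 ∨ x = 40 ∨ x = 41 → s2.var x = s0.var x := by
    rintro a (rfl | rfl | rfl) <;> rw [ha2.1 _ (by decide)]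
  refine WP.seq ((sweep_spec st3 e2.v5 e2.v6 (by rw [c2 38 (by omega), v38]) hYL ?_ ?_ (by omega)
    (by rw [b2 25 (by omega)]; exact hz 25 (by norm_num) (by norm_num))
    (by rw [b2 26 (by omega)]; exact hz 26 (by norm_num) (by norm_num)) ?_).mono fun s3 ha3 hq => ?_)
  · calc 2 ^ L * (K * V) ≤ Z * (Z ^ 6 * Z ^ 2) := by gcongr; omega
      _ = Z ^ 9 := by ring
      _ ≤ B := hp 9 (by norm_num)
  · have := hp 2 (by norm_num); nlinarith
  · refine le_trans ?_ hY'
    calc (X.N + K + 1) * (L + 1) ≤ 10 * (n + X.N + Y.N + 1) * (L + 1) ^ 4 * (L + 1) := by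
          gcongr; omega
      _ = 10 * (n + X.N + Y.N + 1) * (L + 1) ^ 5 := by ring
      _ ≤ _ := by gcongr; omega
  · have e3 := e2.agree ha3 (by decide) (by decide)
    refine zfinish_spec e3 (by rw [ha3.1 _ (by decide), c2 40 (by omega), v40])
      (by rw [ha3.1 _ (by decide), c2 41 (by omega), v41]) (by omega) (by omega) ?_ ?_
    · intro U h0 hU
      obtain ⟨r1, r2⟩ := Laid.of_sweep (X := X) (Y := Y) hq hYL.le h0 hU
      refine ⟨fun W hW => ?_, ?_⟩
      · rw [← X.zsum_pos Y h0 hU (by omega) (by omega)]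
        exact r1 W hW
      · rcases r2 with ⟨σ, hσ, r2⟩ | ⟨W, hW, r2⟩
        · left; rw [r2, X.zsum_of_le Y _ hσ]
        · right; exact ⟨W, hW, by rw [r2, X.zsum_pos Y h0 hU (by omega) (by omega)]⟩
    · refine le_trans ?_ hY'
      have := Nat.one_le_pow 5 (L + 1) (by omega)
      nlinarith

/-! ## Consistent sets -/

/-- Weighted edges between the vertices `0, …, n - 1`. -/
structure Edges (n : ℕ) where
  m : ℕ
  src : ℕ → ℕ
  tgt : ℕ → ℕ
  wt : ℕ → ℕ
  src_lt : ∀ e < m, src e < n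
  tgt_lt : ∀ e < m, tgt e < n

/-- The total weight. -/
def Edges.total {n : ℕ} (E : Edges n) : ℕ := ∑ e ∈ Finset.range E.m, E.wt e

/-- The edges are stored in the arrays `0`, `1`, `2`. -/
structure EdgeEnv {n : ℕ} (E : Edges n) (s : Mem) : Prop where
  v1 : s.var 1 = E.m
  src : ∀ e : ℕ, e < E.m → s.arr 0 e = E.src e
  tgt : ∀ e : ℕ, e < E.m → s.arr 1 e = E.tgt e
  wt : ∀ e : ℕ, e < E.m → s.arr 2 e = E.wt e

theorem EdgeEnv.agree {n : ℕ} {E : Edges n} {s s' : Mem} {V A : List ℕ} (h : EdgeEnv E s)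
    (hs : Agree V A s s') (hV : 1 ∉ V) (hA : ∀ a ∈ A, 2 < a) : EdgeEnv E s' := by
  have ha : ∀ a ≤ 2, s'.arr a = s.arr a := fun a h => hs.2 a fun h' => by have := hA a h'; omega
  obtain ⟨h1, h2, h3, h4⟩ := h
  exact ⟨by rw [hs.1 1 hV, h1], by rwa [ha 0 (by norm_num)], by rwa [ha 1 (by norm_num)],
    by rwa [ha 2 (by norm_num)]⟩

namespace Laid

variable {n L : ℕ} (E : Edges n) (X Y : Laid n L)

/-- What the edge `e` contributes to `δ(U ∖ W) - δ(U)`. -/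
noncomputable def edgeGain (U W : ℤ) (e : ℕ) : ℤ :=
  2 * (ind (X.Mem (E.src e) U) * ind (X.Mem (E.tgt e) U)) *
      (ind (Y.Mem (E.src e) W) + ind (Y.Mem (E.tgt e) W) -
        ind (Y.Mem (E.src e) W) * ind (Y.Mem (E.tgt e) W)) -
    ind (X.Mem (E.src e) U) * ind (Y.Mem (E.src e) W) -
    ind (X.Mem (E.tgt e) U) * ind (Y.Mem (E.tgt e) W)

/-- The difference `δ(U ∖ W) - δ(U)`. -/
noncomputable def gain (U W : ℤ) : ℤ := ∑ e ∈ Finset.range E.m, E.wt e * X.edgeGain E Y U W e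

/-- The set of node `U` of `X` is consistent with the family of `Y`. -/
def Consistent (U : ℤ) : Prop :=
  ∀ W : ℕ, W < Y.N → X.inter Y U W ≠ 0 → ¬ X.Sub Y U W → 1 ≤ X.gain E Y U W

theorem ind_cases (P : Prop) : ind P = 0 ∨ ind P = 1 := by
  by_cases h : P
  · exact Or.inr (ind_true h)
  · exact Or.inl (ind_false h)

/-- Removing `W` from `U` can at worst uncut every edge once; the bound per edge is a check of the
sixteen membership patterns of its endpoints. -/
theorem neg_total_le_gain (U W : ℤ) : -(E.total : ℤ) ≤ X.gain E Y U W := by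
  unfold gain Edges.total
  push_cast
  rw [← Finset.sum_neg_distrib]
  refine Finset.sum_le_sum fun e _ => ?_
  have : -1 ≤ X.edgeGain E Y U W e := by
    unfold edgeGain
    rcases ind_cases (X.Mem (E.src e) U) with h1 | h1 <;>
    rcases ind_cases (X.Mem (E.tgt e) U) with h2 | h2 <;>
    rcases ind_cases (Y.Mem (E.src e) W) with h3 | h3 <;>
    rcases ind_cases (Y.Mem (E.tgt e) W) with h4 | h4 <;>
    rw [h1, h2, h3, h4] <;> norm_num
  nlinarith

theorem gain_of_inter_eq_zero {U W : ℤ} (h : X.inter Y U W = 0) : X.gain E Y U W = 0 := by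
  refine Finset.sum_eq_zero fun e he => ?_
  have he' := Finset.mem_range.1 he
  have key : ∀ v, v < n → ind (X.Mem v U) * ind (Y.Mem v W) = 0 := fun v hv => by
    rw [← ind_and]
    exact ind_false fun hh => (X.inter_eq_zero_iff Y).1 h v hv hh.1 hh.2
  have h1 := key _ (E.src_lt e he')
  have h2 := key _ (E.tgt_lt e he')
  unfold edgeGain
  -- Every monomial of `edgeGain` has one of the two vanishing products as a factor.
  linear_combination (E.wt e : ℤ) * (2 * ind (X.Mem (E.tgt e) U) - 1 -
      2 * ind (X.Mem (E.tgt e) U) * ind (Y.Mem (E.tgt e) W)) * h1 +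
    (E.wt e : ℤ) * (2 * ind (X.Mem (E.src e) U) - 1) * h2

/-- The weight by which the consistency of node `U` of `X` with node `W` of `Y` is tested. -/
noncomputable def cval (U W : ℤ) : ℤ :=
  -X.inter Y U W + (n + 1) * X.gain E Y U W + (n + 1) * (E.total + 1) * ind (X.Sub Y U W)

/-- Three cases on different scales. If `U ⊆ W`, the summand `(n + 1) * (E.total + 1)` outweighs the
worst gain `-E.total` and the intersection, which is at most `n`. If `U` and `W` are disjoint,
everything is `0`. Otherwise the intersection is between `1` and `n`, so the sign of `-inter + (n +
1) * gain` tells whether the gain is at least `1`. -/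
theorem cval_nonneg_iff {U W : ℤ} (h0 : 0 ≤ U) (hU : U < X.N) :
    0 ≤ X.cval E Y U W ↔ (X.inter Y U W ≠ 0 → ¬ X.Sub Y U W → 1 ≤ X.gain E Y U W) := by
  have h1 := X.inter_le_left Y h0 hU W
  have h2 := X.forest.sz_le U h0 hU
  have h3 := X.inter_nonneg Y U W
  have h4 := X.neg_total_le_gain E Y U W
  unfold cval
  by_cases hs : X.Sub Y U W
  · rw [ind_true hs]
    exact ⟨fun _ _ h => absurd hs h, fun _ => by nlinarith⟩
  · rw [ind_false hs, mul_zero, add_zero]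
    by_cases hi : X.inter Y U W = 0
    · rw [hi, X.gain_of_inter_eq_zero E Y hi]
      simp
    · constructor
      · intro h _ _
        by_contra hg
        have : ((n : ℤ) + 1) * X.gain E Y U W ≤ 0 :=
          mul_nonpos_of_nonneg_of_nonpos (by omega) (by omega)
        omega
      · intro h
        have := h hi hs
        nlinarith

/-- The sums from which consistency is read off. -/
noncomputable def csum (z : ℤ → ℤ) (τ σ : ℤ) : ℤ :=
  ∑ v ∈ Finset.range n, -1 *
    (cover L X.st X.en (X.home v) τ * cover L X.st X.en (X.home v) τ *
      (cover L Y.st Y.en (Y.home v) σ * cover L Y.st Y.en (Y.home v) σ)) +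
  ∑ e ∈ Finset.range E.m,
    (-((n + 1) * E.wt e) *
      (cover L X.st X.en (X.home (E.src e)) τ * cover L X.st X.en (X.home (E.src e)) τ *
      (cover L Y.st Y.en (Y.home (E.src e)) σ * cover L Y.st Y.en (Y.home (E.src e)) σ)) +
    -((n + 1) * E.wt e) *
      (cover L X.st X.en (X.home (E.tgt e)) τ * cover L X.st X.en (X.home (E.tgt e)) τ *
      (cover L Y.st Y.en (Y.home (E.tgt e)) σ * cover L Y.st Y.en (Y.home (E.tgt e)) σ)) +
    2 * ((n + 1) * E.wt e) *
      (cover L X.st X.en (X.home (E.src e)) τ * cover L X.st X.en (X.home (E.tgt e)) τ *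
      (cover L Y.st Y.en (Y.home (E.src e)) σ * cover L Y.st Y.en (Y.home (E.src e)) σ)) +
    2 * ((n + 1) * E.wt e) *
      (cover L X.st X.en (X.home (E.src e)) τ * cover L X.st X.en (X.home (E.tgt e)) τ *
      (cover L Y.st Y.en (Y.home (E.tgt e)) σ * cover L Y.st Y.en (Y.home (E.tgt e)) σ)) +
    -(2 * ((n + 1) * E.wt e)) *
      (cover L X.st X.en (X.home (E.src e)) τ * cover L X.st X.en (X.home (E.tgt e)) τ *
      (cover L Y.st Y.en (Y.home (E.src e)) σ * cover L Y.st Y.en (Y.home (E.tgt e)) σ))) +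
  ∑ U ∈ Finset.range X.N, ∑ t ∈ Finset.range L, ind (X.pos U ≤ τ ∧ τ < X.pos U + 1) *
    ind (Y.st (z U * L + t) ≤ σ ∧ σ < Y.en (z U * L + t)) * ((n + 1) * (E.total + 1))

/-- A surplus slot has value `0`, which passes the nonnegativity test. The minimum over all slots is
thus nonnegative iff the values at all nodes are. -/
theorem csum_of_le (z : ℤ → ℤ) (τ : ℤ) {σ : ℤ} (hσ : Y.N ≤ σ) : X.csum E Y z τ σ = 0 := by
  unfold csum
  rw [Finset.sum_eq_zero, Finset.sum_eq_zero, Finset.sum_eq_zero, add_zero, add_zero]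
  · intro U _
    refine Finset.sum_eq_zero fun t _ => ?_
    have := (Y.isLayout.en_range (z U * L + t)).2
    rw [ind_false (P := Y.st (z U * L + t) ≤ σ ∧ σ < Y.en (z U * L + t)) (by omega)]; ring
  · intro e _
    simp only [Y.cover_of_le _ hσ]; ring
  · intro v _
    simp only [Y.cover_of_le _ hσ]; ring

/-- The containment term is where the first pass enters: `U ⊆ W` iff `W` is an ancestor of `z U`, so
the indicator is the cover of the root path of `z U`, restricted to the single time `X.pos U`. -/
theorem csum_pos {z : ℤ → ℤ} (hz : X.Supersets Y z) {U W : ℤ} (h0 : 0 ≤ U) (hU : U < X.N)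
    (hW0 : 0 ≤ W) (hW : W < Y.N) : X.csum E Y z (X.pos U) (Y.pos W) = X.cval E Y U W := by
  unfold csum cval
  congr 1
  · congr 1
    · rw [inter, ← Finset.sum_neg_distrib]
      refine Finset.sum_congr rfl fun v hv => ?_
      have hv' := Finset.mem_range.1 hv
      rw [X.cover_home hv' h0 hU, Y.cover_home hv' hW0 hW, ind_mul_self, ind_mul_self]
      ring
    · rw [gain, Finset.mul_sum]
      refine Finset.sum_congr rfl fun e he => ?_
      have he' := Finset.mem_range.1 he
      rw [X.cover_home (E.src_lt e he') h0 hU, X.cover_home (E.tgt_lt e he') h0 hU,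
        Y.cover_home (E.src_lt e he') hW0 hW, Y.cover_home (E.tgt_lt e he') hW0 hW]
      simp only [ind_mul_self]
      unfold edgeGain
      ring
  · obtain ⟨z0, z1, z2⟩ := hz U h0 hU
    rw [← ind_congr (z2 W hW0 hW), ← Y.cover_pos z0 z1 hW0 hW, cover,
      mul_comm (((n : ℤ) + 1) * (E.total + 1)), Finset.sum_mul,
      ← sum_ind_eq_mul h0 hU fun u => ∑ t ∈ Finset.range L,
        ind (Y.st (z u * L + t) ≤ Y.pos W ∧ Y.pos W < Y.en (z u * L + t)) *
          ((n + 1) * (E.total + 1))]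
    refine Finset.sum_congr rfl fun u hu => ?_
    have hu' := Finset.mem_range.1 hu
    rw [Finset.mul_sum]
    refine Finset.sum_congr rfl fun t _ => ?_
    rw [mul_assoc]
    congr 1
    refine ind_congr ⟨fun h => ?_, fun h => by subst h; omega⟩
    exact X.isLayout.pos_inj _ _ h0 hU (by omega) (by omega) (by omega)

/-- `k` marks the nodes of `X` that are consistent with `Y`. -/
def Marks (k : ℤ → ℤ) : Prop :=
  ∀ U : ℕ, U < X.N → (k U = 1 ∧ X.Consistent E Y U) ∨ (k U = 0 ∧ ¬ X.Consistent E Y U)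

end Laid

/-! ### The programs that test consistency -/

def cfinish : Prog :=
  .forTo 39 7 (.ite (.le (.const 0) (.get 27 (.get 5 (.var 39))))
    (.put 14 (.var 39) (.const 1)) (.put 14 (.var 39) (.const 0)))

/-- The five monomials of `edgeGain`, expanded: with `a`, `b` for the two endpoints in `U` and `c`,
`d` for them in `W`, the quads realise `-ac`, `-bd`, `2abc`, `2abd` and `-2abcd`. Variables `46`,
`47` hold the homes of the endpoints in the first tree, `48`, `49` those in the second, and `50` the
scaled weight. -/
def cquads : Prog :=
  addQuadAt (.var 46) (.var 46) (.var 48) (.var 48) (.const 0 - .var 50) ;;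
  addQuadAt (.var 47) (.var 47) (.var 49) (.var 49) (.const 0 - .var 50) ;;
  addQuadAt (.var 46) (.var 47) (.var 48) (.var 48) (.const 2 * .var 50) ;;
  addQuadAt (.var 46) (.var 47) (.var 49) (.var 49) (.const 2 * .var 50) ;;
  addQuadAt (.var 46) (.var 47) (.var 48) (.var 49) (.const 0 - .const 2 * .var 50)

def cevents : Prog :=
  .forTo 39 0 (addQuadAt (.get 3 (.var 39)) (.get 3 (.var 39)) (.get 8 (.var 39))
    (.get 8 (.var 39)) (.const (-1))) ;;
  .forTo 39 1 (
    .assign 46 (.get 3 (.get 0 (.var 39))) ;;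
    .assign 47 (.get 3 (.get 1 (.var 39))) ;;
    .assign 48 (.get 8 (.get 0 (.var 39))) ;;
    .assign 49 (.get 8 (.get 1 (.var 39))) ;;
    .assign 50 (.var 40 * .get 2 (.var 39)) ;;
    cquads) ;;
  .forTo 39 7 (
    .assign 46 (.get 13 (.var 39)) ;;
    .assign 21 (.get 5 (.var 39)) ;;
    .assign 22 (.var 21 + .const 1) ;;
    .assign 25 (.var 45) ;;
    .forTo 51 5 (
      .assign 23 (.get 11 (.var 46 * .var 5 + .var 51)) ;;
      .assign 24 (.get 12 (.var 46 * .var 5 + .var 51)) ;;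
      addRect))

/-- Marks in array `14` the nodes of the first tree that are consistent with the second tree, whose
smallest supersets are in array `13`. -/
def consistents : Prog :=
  .assign 38 (.var 7) ;;
  .assign 40 (.var 0 + .const 1) ;;
  .assign 41 (.const 0) ;;
  .forTo 39 1 (.assign 41 (.var 41 + .get 2 (.var 39))) ;;
  .assign 45 (.var 40 * (.var 41 + .const 1)) ;;
  .assign 20 (.const 0) ;;
  cevents ;;
  sweep ;;
  cfinish

theorem cfinish_spec {n B L Y' : ℕ} {E : Edges n} {X Y : Laid n L} {s : Mem} (h : RunEnv X Y s)
    (hXB : X.N ≤ B) (hB1 : 1 ≤ B)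
    (hle : ∀ U : ℤ, 0 ≤ U → U < X.N → (0 ≤ s.arr 27 (X.pos U) ↔ X.Consistent E Y U))
    (hY' : X.N + 1 ≤ Y') :
    WP B Y' cfinish s fun s' => X.Marks E Y (s'.arr 14) := by
  refine WP.forTo (Y := 1) le_rfl X.N h.v7 hXB (by decide) (by decide) (by decide)
    (fun k s' => ∀ U : ℕ, U < k → (s'.arr 14 U = 1 ∧ X.Consistent E Y U) ∨
      (s'.arr 14 U = 0 ∧ ¬ X.Consistent E Y U))
    (fun U hU => by omega) ?_ (by omega) fun s1 _ _ hI => hI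
  rintro k hk s1 ha1 hx1 hI
  have e1 := h.agree ha1 (by decide) (by decide)
  have w27 : s1.arr 27 = s.arr 27 := ha1.2 _ (by decide)
  have p1 : s1.arr 5 k = X.pos k := e1.left.pos k (by omega) (by omega)
  have hk1 := hle k (by omega) (by omega)
  refine WP.ite le_rfl (fun hc => WP.put le_rfl (by simp; omega) fun U hU => ?_)
    (fun hc => WP.put le_rfl (by simp) fun U hU => ?_)
  all_goals simp only [Cond.Holds, Expr.eval_get, Expr.eval_const, Expr.eval_var, hx1, p1, w27] at hc
  all_goals simp only [Mem.setVar_arr, Mem.setArr_arr, if_true, Expr.eval_var, Expr.eval_const, hx1]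
  all_goals by_cases hUk : U = k
  · subst hUk
    rw [Function.update_self]
    exact Or.inl ⟨rfl, hk1.1 hc⟩
  · rw [Function.update_of_ne (by exact_mod_cast hUk)]
    exact hI U (by omega)
  · subst hUk
    rw [Function.update_self]
    exact Or.inr ⟨rfl, fun h => hc (hk1.2 h)⟩
  · rw [Function.update_of_ne (by exact_mod_cast hUk)]
    exact hI U (by omega)

theorem cquads_spec {n B L V k : ℕ} {F : ℤ → ℤ → ℤ} {X Y : Laid n L} {s : Mem} {a b a' b' x : ℤ}
    (h : RunEnv X Y s) (st : Stored Y.N V k F s) (hkB : k + 20 * L ^ 4 ≤ B) (hLB : L ≤ B)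
    (h46 : s.var 46 = a) (h47 : s.var 47 = b) (h48 : s.var 48 = a') (h49 : s.var 49 = b')
    (h50 : s.var 50 = x) (ha : -1 ≤ a ∧ a < X.N) (hb : -1 ≤ b ∧ b < X.N) (ha' : -1 ≤ a' ∧ a' < Y.N)
    (hb' : -1 ≤ b' ∧ b' < Y.N) (hXB : X.N + 1 ≤ B) (hYB : Y.N + 1 ≤ B) (hx : 0 ≤ x)
    (hV : 2 * x ≤ V) (hVB : V ≤ B) :
    WP B ((L + 1) ^ 4) cquads s (Stored Y.N V (k + 20 * L ^ 4) fun τ σ => F τ σ +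
      (-x * (cover L X.st X.en a τ * cover L X.st X.en a τ *
        (cover L Y.st Y.en a' σ * cover L Y.st Y.en a' σ)) +
      -x * (cover L X.st X.en b τ * cover L X.st X.en b τ *
        (cover L Y.st Y.en b' σ * cover L Y.st Y.en b' σ)) +
      2 * x * (cover L X.st X.en a τ * cover L X.st X.en b τ *
        (cover L Y.st Y.en a' σ * cover L Y.st Y.en a' σ)) +
      2 * x * (cover L X.st X.en a τ * cover L X.st X.en b τ *
        (cover L Y.st Y.en b' σ * cover L Y.st Y.en b' σ)) +
      -(2 * x) * (cover L X.st X.en a τ * cover L X.st X.en b τ *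
        (cover L Y.st Y.en a' σ * cover L Y.st Y.en b' σ)))) := by
  set D : Mem → Prop := fun s' => RunEnv X Y s' ∧ s'.var 46 = a ∧ s'.var 47 = b ∧ s'.var 48 = a' ∧
    s'.var 49 = b' ∧ s'.var 50 = x with hDdef
  -- What `addQuadAt` writes does not depend on its arguments, so the frame can be computed once,
  -- for a dummy instance, and used for all five calls.
  have hD : ∀ s1 s2 : Mem, Agree (addQuadAt (.var 0) (.var 0) (.var 0) (.var 0) (.var 0)).wv
      (addQuadAt (.var 0) (.var 0) (.var 0) (.var 0) (.var 0)).wa s1 s2 → D s1 → D s2 := by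
    rintro s1 s2 hs ⟨d, d46, d47, d48, d49, d50⟩
    exact ⟨d.agree hs (by decide) (by decide), by rw [hs.1 46 (by decide), d46],
      by rw [hs.1 47 (by decide), d47], by rw [hs.1 48 (by decide), d48],
      by rw [hs.1 49 (by decide), d49], by rw [hs.1 50 (by decide), d50]⟩
  have hD' : ∀ s1 s2 : Mem, Agree [25, 26, 27, 28, 29] [] s1 s2 → D s1 → D s2 := by
    rintro s1 s2 hs ⟨d, d46, d47, d48, d49, d50⟩
    exact ⟨d.agree hs (by decide) (by decide), by rw [hs.1 46 (by decide), d46],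
      by rw [hs.1 47 (by decide), d47], by rw [hs.1 48 (by decide), d48],
      by rw [hs.1 49 (by decide), d49], by rw [hs.1 50 (by decide), d50]⟩
  have quad : ∀ (p q p' q' : ℕ) (e : Expr) (zp zq zp' zq' y : ℤ) (k' : ℕ) (F' : ℤ → ℤ → ℤ)
      (s' : Mem), D s' → Stored Y.N V k' F' s' → k' + 4 * L ^ 4 ≤ B → e.eval s' = y → |y| ≤ V →
      (∀ s, D s → s.var p = zp) → (∀ s, D s → s.var q = zq) → (∀ s, D s → s.var p' = zp') →
      (∀ s, D s → s.var q' = zq') → (-1 ≤ zp ∧ zp < X.N) → (-1 ≤ zq ∧ zq < X.N) →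
      (-1 ≤ zp' ∧ zp' < Y.N) → (-1 ≤ zq' ∧ zq' < Y.N) →
      WP B ((L + 1) ^ 4) (addQuadAt (.var p) (.var q) (.var p') (.var q') e) s'
        fun s'' => D s'' ∧ Stored Y.N V (k' + 4 * L ^ 4) (fun τ σ =>
          F' τ σ + y * (cover L X.st X.en zp τ * cover L X.st X.en zq τ *
            (cover L Y.st Y.en zp' σ * cover L Y.st Y.en zq' σ))) s'' := by
    intro p q p' q' e zp zq zp' zq' y k' F' s' d st' hk' he hy hp hq hp' hq' r1 r2 r3 r4
    refine (addQuadAt_spec st' hk' hLB d.1.v5 he (fun s2 ha2 => ?_) r1 r2 r3 r4 hXB hYB d.1.left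
      d.1.right hy hVB).mono fun s3 ha3 st3 => ⟨hD _ _ ha3 d, st3⟩
    have d2 := hD' _ _ ha2 d
    exact ⟨hp _ d2, hq _ d2, hp' _ d2, hq' _ d2⟩
  have d0 : D s := ⟨h, h46, h47, h48, h49, h50⟩
  have g46 : ∀ s, D s → s.var 46 = a := fun s d => d.2.1
  have g47 : ∀ s, D s → s.var 47 = b := fun s d => d.2.2.1
  have g48 : ∀ s, D s → s.var 48 = a' := fun s d => d.2.2.2.1
  have g49 : ∀ s, D s → s.var 49 = b' := fun s d => d.2.2.2.2.1
  have g50 : ∀ s, D s → s.var 50 = x := fun s d => d.2.2.2.2.2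
  have x1 : |-x| ≤ V := by rw [abs_neg, abs_of_nonneg hx]; omega
  have x2 : |2 * x| ≤ V := by rw [abs_of_nonneg (by omega)]; omega
  have x3 : |-(2 * x)| ≤ V := by rw [abs_neg]; exact x2
  refine WP.seq ((quad _ _ _ _ _ _ _ _ _ (-x) _ _ s d0 st (by omega) (by simp [h50]) x1 g46 g46 g48
    g48 ha ha ha' ha').mono fun s1 _ ⟨d1, st1⟩ => ?_)
  refine WP.seq ((quad _ _ _ _ _ _ _ _ _ (-x) _ _ s1 d1 st1 (by omega) (by simp [g50 _ d1]) x1 g47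
    g47 g49 g49 hb hb hb' hb').mono fun s2 _ ⟨d2, st2⟩ => ?_)
  refine WP.seq ((quad _ _ _ _ _ _ _ _ _ (2 * x) _ _ s2 d2 st2 (by omega) (by simp [g50 _ d2]) x2
    g46 g47 g48 g48 ha hb ha' ha').mono fun s3 _ ⟨d3, st3⟩ => ?_)
  refine WP.seq ((quad _ _ _ _ _ _ _ _ _ (2 * x) _ _ s3 d3 st3 (by omega) (by simp [g50 _ d3]) x2
    g46 g47 g49 g49 ha hb hb' hb').mono fun s4 _ ⟨d4, st4⟩ => ?_)
  refine (quad _ _ _ _ _ _ _ _ _ (-(2 * x)) _ _ s4 d4 st4 (by omega) (by simp [g50 _ d4]) x3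
    g46 g47 g48 g49 ha hb ha' hb').mono fun s5 _ ⟨_, st5⟩ => ?_
  exact st5.mono (by omega) fun τ σ => by ring

theorem cevents_spec {n B L V Y' : ℕ} {E : Edges n} {X Y : Laid n L} {z : ℤ → ℤ} {s0 : Mem}
    (g0 : RunEnv X Y s0) (d0 : EdgeEnv E s0)
    (hz13 : ∀ U : ℤ, 0 ≤ U → U < X.N → s0.arr 13 U = z U) (v40 : s0.var 40 = n + 1)
    (v45 : s0.var 45 = (n + 1) * (E.total + 1))
    (st0 : Stored Y.N V 0 (fun _ _ => 0) s0) (hV : V = 2 * ((n + 1) * (E.total + 1))) (hVB : V ≤ B)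
    (hKB : n * (4 * L ^ 4) + E.m * (20 * L ^ 4) + X.N * (L * 4) ≤ B)
    (hB : n + E.m + X.N + Y.N + L + 10 ≤ B)
    (hY' : (n + E.m + X.N + 1) * (L + 1) ^ 4 ≤ Y') :
    WP B Y' cevents s0 (Stored Y.N V (n * (4 * L ^ 4) + E.m * (20 * L ^ 4) + X.N * (L * 4))
      (X.csum E Y z)) := by
  have hwt : ∀ e < E.m, 2 * ((n + 1) * (E.wt e : ℤ)) ≤ V := fun e he => by
    have h1 : E.wt e ≤ E.total := Finset.single_le_sum (f := E.wt) (fun _ _ => Nat.zero_le _)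
      (Finset.mem_range.2 he)
    have h2 : 2 * ((n + 1) * E.wt e) ≤ V := by rw [hV]; gcongr; omega
    exact_mod_cast h2
  have hV1 : 1 ≤ V := by rw [hV]; nlinarith
  refine WP.seq (WP.forAcc (Y := (L + 1) ^ 4) (e := 4 * L ^ 4) (K := B)
    (Nat.one_le_pow _ _ (by omega)) g0.v0 (by omega) (by decide) (by decide) (by decide) (by decide)
    (fun v τ σ => -1 *
      (cover L X.st X.en (X.home v) τ * cover L X.st X.en (X.home v) τ *
      (cover L Y.st Y.en (Y.home v) σ * cover L Y.st Y.en (Y.home v) σ)))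
    st0 (by omega) ?_ ?_ ?_)
  · intro v hv s1 ha1 hx1 k' F' hk' st1
    have e1 := g0.agree ha1 (by decide) (by decide)
    refine addQuadAt_spec st1 hk' (by omega) e1.v5 rfl (fun s2 ha2 => ?_) (X.home_range v hv)
      (X.home_range v hv) (Y.home_range v hv) (Y.home_range v hv) (by omega) (by omega) e1.left
      e1.right ?_ hVB
    · simp only [Expr.eval_get, Expr.eval_var, ha2.1 39 (by decide), hx1, ha2.2 3 (by decide),
        ha2.2 8 (by decide)]
      exact ⟨e1.left.home v hv, e1.left.home v hv, e1.right.home v hv, e1.right.home v hv⟩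
    · rw [abs_neg, abs_one]
      exact_mod_cast hV1
  · refine le_trans ?_ hY'
    gcongr; omega
  intro s1 ha1 st1
  have e1 := g0.agree ha1 (by decide) (by decide)
  have d1 := d0.agree ha1 (by decide) (by decide)
  have z1 : s1.arr 13 = s0.arr 13 := ha1.2 _ (by decide)
  have w40 : s1.var 40 = n + 1 := by rw [ha1.1 _ (by decide), v40]
  have w45 : s1.var 45 = (n + 1) * (E.total + 1) := by rw [ha1.1 _ (by decide), v45]
  refine WP.seq (WP.forAcc (Y := (L + 1) ^ 4) (e := 20 * L ^ 4) (K := B)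
    (Nat.one_le_pow _ _ (by omega)) d1.v1 (by omega) (by decide) (by decide) (by decide) (by decide)
    (fun e τ σ => -((n + 1) * E.wt e) *
      (cover L X.st X.en (X.home (E.src e)) τ * cover L X.st X.en (X.home (E.src e)) τ *
      (cover L Y.st Y.en (Y.home (E.src e)) σ * cover L Y.st Y.en (Y.home (E.src e)) σ)) +
    -((n + 1) * E.wt e) *
      (cover L X.st X.en (X.home (E.tgt e)) τ * cover L X.st X.en (X.home (E.tgt e)) τ *
      (cover L Y.st Y.en (Y.home (E.tgt e)) σ * cover L Y.st Y.en (Y.home (E.tgt e)) σ)) +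
    2 * ((n + 1) * E.wt e) *
      (cover L X.st X.en (X.home (E.src e)) τ * cover L X.st X.en (X.home (E.tgt e)) τ *
      (cover L Y.st Y.en (Y.home (E.src e)) σ * cover L Y.st Y.en (Y.home (E.src e)) σ)) +
    2 * ((n + 1) * E.wt e) *
      (cover L X.st X.en (X.home (E.src e)) τ * cover L X.st X.en (X.home (E.tgt e)) τ *
      (cover L Y.st Y.en (Y.home (E.tgt e)) σ * cover L Y.st Y.en (Y.home (E.tgt e)) σ)) +
    -(2 * ((n + 1) * E.wt e)) *
      (cover L X.st X.en (X.home (E.src e)) τ * cover L X.st X.en (X.home (E.tgt e)) τ *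
      (cover L Y.st Y.en (Y.home (E.src e)) σ * cover L Y.st Y.en (Y.home (E.tgt e)) σ)))
    st1 (by omega) ?_ ?_ ?_)
  · intro e he s2 ha2 hx2 k' F' hk' st2
    have e2 := e1.agree ha2 (by decide) (by decide)
    have d2 := d1.agree ha2 (by decide) (by decide)
    have x40 : s2.var 40 = n + 1 := by rw [ha2.1 _ (by decide), w40]
    have hY1 : 1 ≤ (L + 1) ^ 4 := Nat.one_le_pow _ _ (by omega)
    refine WP.of_bdd fun hb => ?_
    refine WP.seq (WP.assign hY1 (hb.2 _ _) ?_)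
    refine WP.seq (WP.assign hY1 (hb.2 _ _) ?_)
    refine WP.seq (WP.assign hY1 (hb.2 _ _) ?_)
    refine WP.seq (WP.assign hY1 (hb.2 _ _) ?_)
    simp only [Expr.eval_get, Expr.eval_var, Mem.setVar_var, Mem.setVar_arr, Nat.reduceEqDiff,
      if_false, hx2, d2.src e he, d2.tgt e he, e2.left.home _ (E.src_lt e he),
      e2.left.home _ (E.tgt_lt e he), e2.right.home _ (E.src_lt e he),
      e2.right.home _ (E.tgt_lt e he)]
    have hw := hwt e he
    have hw0 : 0 ≤ ((n : ℤ) + 1) * E.wt e := by positivity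
    refine WP.seq (WP.assign hY1 ?_ ?_)
    · simp only [Expr.eval_get, Expr.eval_hmul, Expr.eval_var, Mem.setVar_var, Mem.setVar_arr,
        Nat.reduceEqDiff, if_false, hx2, d2.wt e he, x40]
      rw [abs_of_nonneg hw0]
      omega
    simp only [Expr.eval_get, Expr.eval_hmul, Expr.eval_var, Mem.setVar_var, Mem.setVar_arr,
        Nat.reduceEqDiff, if_false, hx2, d2.wt e he, x40]
    exact cquads_spec (((((e2.setVar (by decide)).setVar (by decide)).setVar (by decide)).setVar
      (by decide)).setVar (by decide)) (st2.congr (by simp) fun _ _ _ => rfl) hk' (by omega) (by simp)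
      (by simp) (by simp) (by simp) (by simp) (X.home_range _ (E.src_lt e he))
      (X.home_range _ (E.tgt_lt e he)) (Y.home_range _ (E.src_lt e he))
      (Y.home_range _ (E.tgt_lt e he)) (by omega) (by omega) hw0 hw hVB
  · refine le_trans ?_ hY'
    gcongr; omega
  intro s2 ha2 st2
  have e2 := e1.agree ha2 (by decide) (by decide)
  have z2 : s2.arr 13 = s0.arr 13 := by rw [ha2.2 _ (by decide), z1]
  have x45 : s2.var 45 = (n + 1) * (E.total + 1) := by rw [ha2.1 _ (by decide), w45]
  have hBIG : |((n : ℤ) + 1) * (E.total + 1)| ≤ (V : ℤ) := by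
    rw [abs_of_nonneg (by positivity), hV]
    push_cast
    nlinarith [show (0 : ℤ) ≤ (n + 1) * (E.total + 1) by positivity]
  refine WP.forAcc (Y := L + 1) (e := L * 4) (K := B) (by omega) e2.v7 (by omega) (by decide)
    (by decide) (by decide) (by decide)
    (fun U τ σ => ∑ t ∈ Finset.range L, ind (X.pos U ≤ τ ∧ τ < X.pos U + 1) *
      ind (Y.st (z U * L + t) ≤ σ ∧ σ < Y.en (z U * L + t)) * ((n + 1) * (E.total + 1))) st2
    (by omega) ?_ ?_ ?_
  · intro U hU s3 ha3 hx3 k' F' hk' st3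
    have e3 := e2.agree ha3 (by decide) (by decide)
    have z3 : s3.arr 13 U = z U := by
      rw [ha3.2 13 (by decide), z2, hz13 U (by omega) (by omega)]
    have y45 : s3.var 45 = (n + 1) * (E.total + 1) := by rw [ha3.1 _ (by decide), x45]
    have p3 : s3.arr 5 U = X.pos U := e3.left.pos U (by omega) (by omega)
    have hp0 := X.isLayout.pos_nonneg U (by omega) (by omega)
    have hp1 := X.isLayout.pos_lt U (by omega) (by omega)
    refine WP.of_bdd fun hb => ?_
    refine WP.seq (WP.assign (by omega) (hb.2 _ _) ?_)
    refine WP.seq (WP.assign (by omega) (hb.2 _ _) ?_)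
    refine WP.seq (WP.assign (by omega) ?_ ?_)
    · simp only [Expr.eval_hadd, Expr.eval_get, Expr.eval_var, Expr.eval_const, Mem.setVar_var,
        Mem.setVar_arr, Nat.reduceEqDiff, if_true, if_false, hx3, p3]
      rw [abs_of_nonneg (by omega)]; omega
    refine WP.seq (WP.assign (by omega) (by simpa using hb.1 45) ?_)
    simp only [Expr.eval_hadd, Expr.eval_get, Expr.eval_var, Expr.eval_const, Mem.setVar_var,
        Mem.setVar_arr, Nat.reduceEqDiff, if_true, if_false, hx3, p3, z3, y45]
    set s4 := (((s3.setVar 46 (z U)).setVar 21 (X.pos U)).setVar 22 (X.pos U + 1)).setVar 25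
      ((n + 1) * (E.total + 1)) with hs4
    have e4 : RunEnv X Y s4 := (((e3.setVar (by decide)).setVar (by decide)).setVar
      (by decide)).setVar (by decide)
    refine WP.forAcc (Y := 1) (e := 4) (K := B) le_rfl e4.v5 (by omega) (by decide) (by decide)
      (by decide) (by decide) _ (st3.congr (by simp [hs4]) fun _ _ _ => rfl) hk' ?_ (by omega)
      fun s' _ h => h
    intro t ht s5 ha5 hx5 k5 F5 hk5 st5
    have e5 := e4.agree ha5 (by decide) (by decide)
    have c5 : ∀ x, x = 46 ∨ x = 21 ∨ x = 22 ∨ x = 25 → s5.var x = s4.var x := by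
      rintro x (rfl | rfl | rfl | rfl) <;> exact ha5.1 _ (by decide)
    have a11 : s5.arr 11 = Y.st := e5.right.st
    have a12 : s5.arr 12 = Y.en := e5.right.en
    refine WP.of_bdd fun hb5 => ?_
    refine WP.seq (WP.assign le_rfl (hb5.2 _ _) ?_)
    refine WP.seq (WP.assign le_rfl (hb5.2 _ _) ?_)
    have c46 : s5.var 46 = z U := by rw [c5 46 (by omega)]; simp [hs4]
    simp only [Expr.eval_hadd, Expr.eval_hmul, Expr.eval_get, Expr.eval_var, Mem.setVar_var,
        Mem.setVar_arr, Nat.reduceEqDiff, if_false, hx5, e5.v5, a11, a12, c46]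
    refine addRect_spec (st5.congr (by simp) fun _ _ _ => rfl) hk5
      (t1 := X.pos U) (t2 := X.pos U + 1) (x := (n + 1) * (E.total + 1)) ?_ ?_ (by simp)
      (by simp) ?_ hp0 (Y.isLayout.st_range _).1 (Y.isLayout.en_range _).2 hBIG hVB
    · simp only [Mem.setVar_var, Nat.reduceEqDiff, if_false, c5 21 (by omega)]; simp [hs4]
    · simp only [Mem.setVar_var, Nat.reduceEqDiff, if_false, c5 22 (by omega)]; simp [hs4]
    · simp only [Mem.setVar_var, Nat.reduceEqDiff, if_false, c5 25 (by omega)]; simp [hs4]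
  · refine le_trans ?_ hY'
    gcongr
    · omega
    · exact Nat.le_self_pow (by norm_num) _
  · intro s3 _ st3
    refine st3.mono (by omega) fun τ σ => ?_
    unfold Laid.csum
    ring

/-- A node is consistent iff none of its values is negative, so the sign of the row minimum is the
answer. -/
theorem csweep_spec {n B L V K Y' : ℕ} {E : Edges n} {X Y : Laid n L} {z : ℤ → ℤ} {s : Mem}
    (e3 : RunEnv X Y s) (v38 : s.var 38 = X.N) (hz : X.Supersets Y z)
    (st : Stored Y.N V K (X.csum E Y z) s)
    (h25 : ∀ j, s.arr 25 j = 0) (h26 : ∀ j, s.arr 26 j = 0) (hYL : Y.N < 2 ^ L)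
    (hB : 2 ^ L * (K * V) ≤ B) (hLB : 2 * 2 ^ L ≤ B) (hXB : X.N ≤ B) (hB1 : 1 ≤ B)
    (hY' : (X.N + K + 1) * (L + 1) ≤ Y') :
    WP B Y' (sweep ;; cfinish) s fun s' => X.Marks E Y (s'.arr 14) := by
  refine WP.seq ((sweep_spec st e3.v5 e3.v6 v38 hYL hB hLB hXB h25 h26 hY').mono
    fun s4 ha4 hq => ?_)
  have e4 := e3.agree ha4 (by decide) (by decide)
  refine cfinish_spec e4 hXB hB1 ?_ ?_
  · intro U hU0 hU
    obtain ⟨r1, r2⟩ := Laid.of_sweep (X := X) (Y := Y) hq hYL.le hU0 hU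
    have key : ∀ W : ℕ, W < Y.N → (0 ≤ X.csum E Y z (X.pos U) (Y.pos W) ↔
        (X.inter Y U W ≠ 0 → ¬ X.Sub Y U W → 1 ≤ X.gain E Y U W)) := fun W hW => by
      rw [X.csum_pos E Y hz hU0 hU (by omega) (by omega), X.cval_nonneg_iff E Y hU0 hU]
    constructor
    · intro hpos W hW
      exact (key W hW).1 (hpos.trans (r1 W hW))
    · intro hc
      rcases r2 with ⟨σ, hσ, r2⟩ | ⟨W, hW, r2⟩
      · rw [r2, X.csum_of_le E Y z _ hσ]
      · rw [r2]; exact (key W hW).2 (hc W hW)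
  · refine le_trans ?_ hY'
    nlinarith

set_option maxRecDepth 4000 in
theorem consistents_spec {n B L Z Y' : ℕ} {E : Edges n} {X Y : Laid n L} {z : ℤ → ℤ} {s : Mem}
    (h : RunEnv X Y s) (d : EdgeEnv E s) (hz : X.Supersets Y z)
    (hz13 : ∀ U : ℤ, 0 ≤ U → U < X.N → s.arr 13 U = z U)
    (h0 : ∀ a, 20 ≤ a → a ≤ 27 → ∀ j, s.arr a j = 0)
    (hZ : n + E.m + X.N + Y.N + 2 ^ L + 10 ≤ Z) (hw : ∀ e < E.m, E.wt e ≤ Z) (hZB : Z ^ 12 ≤ B)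
    (hYL : Y.N < 2 ^ L)
    (hY' : 30 * (n + E.m + X.N + Y.N + 1) * (L + 1) ^ 5 ≤ Y') :
    WP B Y' consistents s fun s' => X.Marks E Y (s'.arr 14) := by
  have hLlt := Nat.lt_two_pow_self (n := L)
  have hp : ∀ k : ℕ, k ≤ 12 → Z ^ k ≤ B := fun k hk =>
    (Nat.pow_le_pow_right (by omega) hk).trans hZB
  have hZB1 : Z ≤ B := by simpa using hp 1 (by norm_num)
  have hY5 := Nat.one_le_pow 5 (L + 1) (by omega)
  have hY1 : 1 ≤ Y' := le_trans (by nlinarith) hY'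
  have htot : ∀ i ≤ E.m, ∑ e ∈ Finset.range i, E.wt e ≤ E.total := fun i hi =>
    Finset.sum_le_sum_of_subset (Finset.range_subset_range.2 hi)
  have htot1 : E.total + 1 ≤ Z ^ 2 := by
    have h1 : E.total ≤ E.m * Z := by
      have := Finset.sum_le_card_nsmul (Finset.range E.m) E.wt Z fun e he =>
        hw e (Finset.mem_range.1 he)
      simpa [Edges.total] using this
    have h2 : (E.m + 1) * Z ≤ Z * Z := Nat.mul_le_mul_right _ (by omega)
    nlinarith
  set V : ℕ := 2 * ((n + 1) * (E.total + 1)) with hV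
  have hVZ : V ≤ Z ^ 4 := by
    calc V ≤ Z * (Z * Z ^ 2) := by rw [hV]; gcongr <;> omega
      _ = Z ^ 4 := by ring
  have hVB : V ≤ B := hVZ.trans (hp 4 (by norm_num))
  set K : ℕ := n * (4 * L ^ 4) + E.m * (20 * L ^ 4) + X.N * (L * 4) with hK
  have hL4 : L * 4 ≤ 20 * (L + 1) ^ 4 := by
    have := Nat.le_self_pow (n := 4) (by norm_num) (L + 1); omega
  have hKM : K ≤ 20 * (n + E.m + X.N) * (L + 1) ^ 4 := by
    have h1 : L ^ 4 ≤ (L + 1) ^ 4 := by gcongr; omega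
    have h2 : n * (4 * L ^ 4) ≤ n * (20 * (L + 1) ^ 4) := by gcongr; omega
    have h3 : E.m * (20 * L ^ 4) ≤ E.m * (20 * (L + 1) ^ 4) := by gcongr
    have h4 : X.N * (L * 4) ≤ X.N * (20 * (L + 1) ^ 4) := by gcongr
    have h5 : 20 * (n + E.m + X.N) * (L + 1) ^ 4 = n * (20 * (L + 1) ^ 4) +
      E.m * (20 * (L + 1) ^ 4) + X.N * (20 * (L + 1) ^ 4) := by ring
    omega
  have hKZ : K ≤ Z ^ 7 := by
    calc K ≤ (Z * Z) * Z * Z ^ 4 := hKM.trans (by gcongr <;> first | omega | nlinarith)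
      _ = Z ^ 7 := by ring
  have hKB : K ≤ B := hKZ.trans (hp 7 (by norm_num))
  refine WP.of_bdd fun hb => ?_
  refine WP.seq (WP.assign hY1 (hb.1 _) ?_)
  refine WP.seq (WP.assign hY1 ?_ ?_)
  · simp only [Expr.eval_hadd, Expr.eval_var, Expr.eval_const, Mem.setVar_var, Nat.reduceEqDiff,
      if_false, h.v0]
    rw [abs_of_nonneg (by omega)]; omega
  simp only [Expr.eval_hadd, Expr.eval_var, Expr.eval_const, Mem.setVar_var, Nat.reduceEqDiff,
      if_false, h.v7, h.v0]
  refine WP.seq (WP.assign hY1 (by simp) ?_)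
  simp only [Expr.eval_const]
  set s0 := ((s.setVar 38 X.N).setVar 40 (n + 1)).setVar 41 0 with hs0
  have g0 : RunEnv X Y s0 := ((h.setVar (by decide)).setVar (by decide)).setVar (by decide)
  have v1 : s0.var 1 = E.m := by simp [hs0, d.v1]
  refine WP.seq (WP.forTo (Y := 1) le_rfl E.m v1 (by omega) (by decide) (by decide) (by decide)
    (fun i s' => s'.var 41 = ((∑ e ∈ Finset.range i, E.wt e : ℕ) : ℤ)) (by simp [hs0]) ?_ ?_ ?_)
  · intro i hi s1 ha1 hx1 hI
    have w2 : s1.arr 2 i = E.wt i := by rw [ha1.2 2 (by decide)]; exact d.wt i hi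
    refine WP.assign le_rfl ?_ ?_
    · simp only [Expr.eval_hadd, Expr.eval_get, Expr.eval_var, hx1, hI, w2]
      rw [abs_of_nonneg (by positivity)]
      have h1 := htot (i + 1) hi
      rw [Finset.sum_range_succ] at h1
      have h2 : E.total + 1 ≤ B := htot1.trans (hp 2 (by norm_num))
      have h3 : (∑ e ∈ Finset.range i, E.wt e) + E.wt i ≤ B := by omega
      exact_mod_cast h3
    · simp [hx1, hI, w2, Finset.sum_range_succ]
  · refine le_trans ?_ hY'
    nlinarith
  intro s1 ha1 _ hI
  have e1 := g0.agree ha1 (by decide) (by decide)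
  have d1 : EdgeEnv E s1 := by
    refine d.agree (V := [38, 39, 40, 41]) (A := []) ⟨fun y hy => ?_, fun a _ => ?_⟩ (by decide)
      (by simp)
    · simp only [List.mem_cons, not_or, List.not_mem_nil] at hy
      rw [ha1.1 y (by simp [Prog.wv, hy])]
      simp [hs0, hy]
    · rw [ha1.2 a (by simp [Prog.wa])]; rfl
  have w41 : s1.var 41 = E.total := hI
  have w40 : s1.var 40 = n + 1 := by rw [ha1.1 _ (by decide)]; simp [hs0]
  have w38 : s1.var 38 = X.N := by rw [ha1.1 _ (by decide)]; simp [hs0]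
  have wa : ∀ a, s1.arr a = s.arr a := fun a => by rw [ha1.2 a (by simp [Prog.wa])]; rfl
  refine WP.seq (WP.assign hY1 ?_ ?_)
  · simp only [Expr.eval_hadd, Expr.eval_hmul, Expr.eval_var, Expr.eval_const, w40, w41]
    rw [abs_of_nonneg (by positivity)]
    have : (n + 1) * (E.total + 1) ≤ B := by omega
    exact_mod_cast this
  simp only [Expr.eval_hadd, Expr.eval_hmul, Expr.eval_var, Expr.eval_const, w40, w41]
  refine WP.seq (WP.assign hY1 (by simp) ?_)
  simp only [Expr.eval_const]
  set s2 := (s1.setVar 45 ((n + 1) * (E.total + 1))).setVar 20 0 with hs2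
  have e2 : RunEnv X Y s2 := (e1.setVar (by decide)).setVar (by decide)
  have d2 : EdgeEnv E s2 := by
    refine d1.agree (V := [45, 20]) (A := []) ⟨fun y hy => ?_, fun a _ => rfl⟩ (by decide) (by simp)
    simp only [List.mem_cons, not_or, List.not_mem_nil] at hy
    simp [hs2, hy]
  have st2 : Stored Y.N V 0 (fun _ _ => 0) s2 := Stored.zero (by simp [hs2]) fun j => by
    simp only [hs2, Mem.setVar_arr, wa]
    exact h0 20 (by norm_num) (by norm_num) j
  refine WP.seq ((cevents_spec (z := z) e2 d2 (fun U a b => ?_) (by simp [hs2, w40]) (by simp [hs2]) st2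
    hV hVB hKB (by omega) ?_).mono fun s3 ha3 st3 => ?_)
  · simp only [hs2, Mem.setVar_arr, wa]; exact hz13 U a b
  · refine le_trans ?_ hY'
    gcongr <;> omega
  refine csweep_spec (e2.agree ha3 (by decide) (by decide)) ?_ hz st3
    (fun j => ?_) (fun j => ?_) hYL ?_ ?_ (by omega) (by omega) ?_
  · rw [ha3.1 38 (by decide)]; simp [hs2, w38]
  · rw [ha3.2 25 (by decide)]; exact (congrFun (wa 25) j).trans (h0 25 (by norm_num) (by norm_num) j)
  · rw [ha3.2 26 (by decide)]; exact (congrFun (wa 26) j).trans (h0 26 (by norm_num) (by norm_num) j)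
  -- The bound on the segment tree entries, with `K ≤ Z ^ 7` events of weight at most `V ≤ Z ^ 4`.
  -- This product fixes the exponent `12`.
  · calc 2 ^ L * (K * V) ≤ Z * (Z ^ 7 * Z ^ 4) := by gcongr; omega
      _ = Z ^ 12 := by ring
      _ ≤ B := hZB
  · have h1 := hp 2 (by norm_num)
    have h2 : 2 * Z ≤ Z ^ 2 := by rw [sq]; exact Nat.mul_le_mul_right _ (by omega)
    omega
  · refine le_trans ?_ hY'
    have h1 := Nat.one_le_pow 4 (L + 1) (by omega)
    have h2 : 1 * (n + E.m + X.N + Y.N + 1) ≤ (L + 1) ^ 4 * (n + E.m + X.N + Y.N + 1) :=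
      Nat.mul_le_mul_right _ h1
    have h3 : 30 * (n + E.m + X.N + Y.N + 1) * (L + 1) ^ 4 = 20 * (n + E.m + X.N) * (L + 1) ^ 4 +
      20 * Y.N * (L + 1) ^ 4 + 20 * (L + 1) ^ 4 +
      10 * ((L + 1) ^ 4 * (n + E.m + X.N + Y.N + 1)) := by ring
    have h4 : X.N + K + 1 ≤ 30 * (n + E.m + X.N + Y.N + 1) * (L + 1) ^ 4 := by omega
    calc (X.N + K + 1) * (L + 1) ≤ 30 * (n + E.m + X.N + Y.N + 1) * (L + 1) ^ 4 * (L + 1) :=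
          Nat.mul_le_mul_right _ h4
      _ = _ := by ring

/-! ## Merging two trees -/

/-- `g` maps each node to its nearest ancestor with property `K`, or to `-1`. -/
def Nearest (N : ℕ) (p : ℤ → ℤ) (K : ℤ → Prop) (g : ℤ → ℤ) : Prop :=
  ∀ c : ℤ, -1 ≤ c → c < N → (g c = -1 ∧ ∀ j : ℤ, 0 ≤ j → K j → ¬ Anc p c j) ∨
    (0 ≤ g c ∧ g c < N ∧ K (g c) ∧ Anc p c (g c) ∧ ∀ j : ℤ, 0 ≤ j → K j → Anc p c j → Anc p (g c) j)

/-- Computes in array `2` the nearest ancestors flagged in array `0`; array `1` holds the parents. -/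
def nearest : Prog :=
  .mapTo 12 10 2 (.get 0 (.var 12) * .var 12 + (.const 1 - .get 0 (.var 12)) * .get 1 (.var 12)) ;;
  .put 2 (.const (-1)) (.const (-1)) ;;
  jump.rename (relabel [2, 3, 4, 5] 6)

/-- The pointers are stopped at flagged nodes: `k j * j + (1 - k j) * p j` is `j` or its parent.
After `2 ^ L ≥ n` steps every path has stopped at a flag or at the root. The summing half of `jump`
is idle, with `d = 0`. -/
theorem nearest_spec {n B N L Y' : ℕ} {p sz k : ℤ → ℤ} {s : Mem} (hF : Forest n N p sz)
    (hN : s.var 10 = N) (hL : s.var 5 = L) (hNL : n ≤ 2 ^ L) (hLB : 2 ^ L ≤ B) (hNB : N ≤ B)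
    (hk : ∀ j : ℤ, 0 ≤ j → j < N → k j = 0 ∨ k j = 1)
    (h0 : ∀ j : ℤ, 0 ≤ j → j < N → s.arr 0 j = k j)
    (h1 : ∀ j : ℤ, 0 ≤ j → j < N → s.arr 1 j = p j) (h3 : ∀ j, s.arr 3 j = 0)
    (hY : (L + 1) * (N + 1) ≤ Y') :
    WP B Y' nearest s fun s' => Nearest N p (fun j => k j = 1) (s'.arr 2) := by
  have hB1 : 1 ≤ B := le_trans Nat.one_le_two_pow hLB
  have hY1 : N + 1 ≤ Y' := le_trans (by nlinarith) hY
  set f : ℤ → ℤ := fun j => if j < 0 then -1 else k j * j + (1 - k j) * p j with hf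
  have hf1 : f (-1) = -1 := by simp [hf]
  have hfk : ∀ j : ℤ, 0 ≤ j → j < N → k j = 1 → f j = j := fun j a b c => by
    simp only [hf]; rw [if_neg (by omega), c]; ring
  have hfn : ∀ j : ℤ, 0 ≤ j → j < N → ¬ k j = 1 → f j = p j := fun j a b c => by
    simp only [hf]; rw [if_neg (by omega), (hk j a b).resolve_right c]; ring
  have hfr : ∀ j : ℤ, -1 ≤ j → j < N → -1 ≤ f j ∧ f j < N := by
    intro j a b
    by_cases h : 0 ≤ j
    · by_cases hc : k j = 1
      · rw [hfk j h b hc]; omega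
      · rw [hfn j h b hc]; exact hF.range j h b
    · obtain rfl : j = -1 := by omega
      rw [hf1]; omega
  refine WP.seq (WP.mapTo N hN hNB (by decide) f ?_ hY1 ?_)
  · intro i hi s1 ha1 hx1 _
    have e0 : s1.arr 0 i = k i := by rw [ha1.2 0 (by decide)]; exact h0 i (by omega) (by omega)
    have e1 : s1.arr 1 i = p i := by rw [ha1.2 1 (by decide)]; exact h1 i (by omega) (by omega)
    constructor
    · simp only [Expr.eval_hadd, Expr.eval_hmul, Expr.eval_hsub, Expr.eval_get, Expr.eval_var,
        Expr.eval_const, hx1, e0, e1, hf]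
      rw [if_neg (by omega)]
    · have := hfr i (by omega) (by omega)
      exact abs_le_of_range hNB hB1 this.1 this.2
  intro s1 ha1 q1
  refine WP.seq (WP.put (by omega) (by simp; omega) ?_)
  refine WP.rename (relabel_injective (by decide) (by decide))
    (jump_spec (f := f) (d := fun _ => 0) (N := N) (L := L) ?_ ?_ hLB hNB hfr hf1 (by simp) rfl
      ?_ ?_ hY) ?_
  · change s1.var 5 = L; rw [ha1.1 5 (by decide), hL]
  · change s1.var 10 = N; rw [ha1.1 10 (by decide), hN]
  · intro j a b
    change (s1.setArr 2 (-1) (-1)).arr 2 j = f j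
    by_cases h : j = -1
    · subst h; simp [hf1]
    · simp only [Mem.setArr_arr, if_true, Function.update_apply]
      rw [if_neg h, q1, if_pos ⟨by omega, b⟩]
  · intro j a b
    change (s1.setArr 2 (-1) (-1)).arr 3 j = 0
    simp only [Mem.setArr_arr, Nat.reduceEqDiff, if_false]
    rw [ha1.2 3 (by decide)]; exact h3 j
  · rintro s2 - ⟨q2, -⟩ c hc hcN
    have : s2.arr 2 c = f^[2 ^ L] c := q2 c hc hcN
    rw [this]
    exact hF.nearest hfk hfn hf1 hNL hc hcN

/-- The number of flags below `i`. -/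
noncomputable def rank (k : ℤ → ℤ) (i : ℤ) : ℤ := ∑ l ∈ Finset.range i.toNat, k l

section rank

variable {N : ℕ} {k : ℤ → ℤ}

theorem rank_nonneg (hk : ∀ j : ℕ, j < N → k j = 0 ∨ k j = 1) {i : ℤ} (hi : i ≤ N) : 0 ≤ rank k i :=
  Finset.sum_nonneg fun l hl => by
    have := hk l (by have := Finset.mem_range.1 hl; omega)
    omega

theorem rank_succ {i : ℤ} (hi : 0 ≤ i) : rank k (i + 1) = rank k i + k i := by
  unfold rank
  rw [show (i + 1).toNat = i.toNat + 1 by omega, Finset.sum_range_succ, Int.toNat_of_nonneg hi]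

theorem rank_mono (hk : ∀ j : ℕ, j < N → k j = 0 ∨ k j = 1) {i j : ℤ} (hij : i ≤ j) (hj : j ≤ N) :
    rank k i ≤ rank k j := by
  refine Finset.sum_le_sum_of_subset_of_nonneg (Finset.range_subset_range.2 (by omega))
    fun l hl _ => ?_
  have := hk l (by have := Finset.mem_range.1 hl; omega)
  omega

theorem rank_lt (hk : ∀ j : ℕ, j < N → k j = 0 ∨ k j = 1) {i j : ℤ} (h0 : 0 ≤ i) (hki : k i = 1)
    (hij : i < j) (hj : j ≤ N) : rank k i < rank k j := by
  have h1 := rank_succ (k := k) h0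
  have h2 := rank_mono hk (i := i + 1) (j := j) (by omega) hj
  omega

theorem rank_le (hk : ∀ j : ℕ, j < N → k j = 0 ∨ k j = 1) {i : ℤ} (h0 : 0 ≤ i) (hi : i ≤ N) :
    rank k i ≤ i := by
  have : rank k i ≤ ∑ l ∈ Finset.range i.toNat, 1 := Finset.sum_le_sum fun l hl => by
    have := hk l (by have := Finset.mem_range.1 hl; omega)
    omega
  simp at this
  omega

theorem rank_inj (hk : ∀ j : ℕ, j < N → k j = 0 ∨ k j = 1) {i j : ℤ} (hi : 0 ≤ i) (hiN : i < N)
    (hj : 0 ≤ j) (hjN : j < N) (hki : k i = 1) (hkj : k j = 1) (h : rank k i = rank k j) : i = j := by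
  rcases lt_trichotomy i j with h1 | h1 | h1
  · have := rank_lt hk hi hki h1 hjN.le; omega
  · exact h1
  · have := rank_lt hk hj hkj h1 hiN.le; omega

/-- Ranks start at `0` and rise by one exactly after a flagged index, so every value below the total
is the rank of a flagged index. -/
theorem exists_rank : ∀ {N : ℕ}, (∀ j : ℕ, j < N → k j = 0 ∨ k j = 1) → ∀ {r : ℤ}, 0 ≤ r →
    r < rank k N → ∃ i : ℕ, i < N ∧ k i = 1 ∧ rank k i = r
  | 0, _, r, h0, h1 => by simp [rank] at h1; omega
  | N + 1, hk, r, h0, h1 => by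
      by_cases h : r < rank k N
      · obtain ⟨i, a, b⟩ := exists_rank (fun j hj => hk j (by omega)) h0 h
        exact ⟨i, by omega, b⟩
      · have h2 := rank_succ (k := k) (i := N) (by omega)
        push_cast at h1
        have := hk N (by omega)
        exact ⟨N, by omega, by omega, by omega⟩

end rank

/-- The size of a node, and a large number for the root. -/
noncomputable def Laid.size {n L : ℕ} (X : Laid n L) (j : ℤ) : ℤ := if j < 0 then 2 * n + 2 else X.sz j

/-- The flags `kY`, switched off at the nodes of `Y` whose set is the set of a flagged node of `X`. -/
noncomputable def dedup {n L : ℕ} (X Y : Laid n L) (zY kX kY : ℤ → ℤ) (W : ℤ) : ℤ :=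
  if 0 ≤ zY W ∧ kX (zY W) = 1 ∧ X.sz (zY W) = Y.sz W then 0 else kY W

/-- The number in the merged tree of the smaller one of two nodes. -/
noncomputable def pick {n L : ℕ} (X Y : Laid n L) (kX kY : ℤ → ℤ) (c d : ℤ) : ℤ :=
  if X.size c < Y.size d then rank kX c else if d < 0 then -1 else rank kX X.N + rank kY d

/-- The arrays from `c` on hold parents, homes, sizes, smallest supersets and flags. -/
structure Side {n L : ℕ} (X : Laid n L) (M : ℕ) (z k : ℤ → ℤ) (c : ℕ) (s : Mem) : Prop where
  par : ∀ j : ℤ, 0 ≤ j → j < X.N → s.arr c j = X.p j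
  home : ∀ v : ℕ, v < n → s.arr (c + 1) v = X.home v
  size : ∀ j : ℤ, -1 ≤ j → j < X.N → s.arr (c + 2) j = X.size j
  sup : ∀ j : ℤ, 0 ≤ j → j < X.N → s.arr (c + 3) j = z j
  sup_range : ∀ j : ℤ, 0 ≤ j → j < X.N → -1 ≤ z j ∧ z j < M
  flag : ∀ j : ℤ, 0 ≤ j → j < X.N → s.arr (c + 4) j = k j
  flag_range : ∀ j : ℕ, j < X.N → k j = 0 ∨ k j = 1

theorem Side.congr {n L c M : ℕ} {X : Laid n L} {z k : ℤ → ℤ} {s s' : Mem} (h : Side X M z k c s)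
    (ha : ∀ a, c ≤ a → a ≤ c + 4 → s'.arr a = s.arr a) : Side X M z k c s' := by
  obtain ⟨h1, h2, h3, h4, h5, h6, h7⟩ := h
  refine ⟨?_, ?_, ?_, ?_, h5, ?_, h7⟩
  all_goals
    simpa only [ha c (by omega) (by omega), ha (c + 1) (by omega) (by omega),
      ha (c + 2) (by omega) (by omega), ha (c + 3) (by omega) (by omega),
      ha (c + 4) (by omega) (by omega)]

theorem Side.agree {n L c M : ℕ} {X : Laid n L} {z k : ℤ → ℤ} {s s' : Mem} {V A : List ℕ}
    (h : Side X M z k c s) (hs : Agree V A s s') (hA : ∀ a ∈ A, a < c ∨ c + 4 < a) :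
    Side X M z k c s' :=
  h.congr fun a h1 h2 => hs.2 a fun ha => by have := hA a ha; omega

def dedupFlags : Prog :=
  .forTo 39 3 (
    .assign 30 (.get 13 (.var 39)) ;;
    .ite (.conj (.le (.const 0) (.var 30)) (.conj (.le (.const 1) (.get 4 (.var 30)))
        (.conj (.le (.get 2 (.var 30)) (.get 12 (.var 39)))
          (.le (.get 12 (.var 39)) (.get 2 (.var 30))))))
      (.put 15 (.var 39) (.const 0)) (.put 15 (.var 39) (.get 14 (.var 39))))

theorem dedupFlags_spec {n L B Y' : ℕ} {X Y : Laid n L} {zX zY kX kY : ℤ → ℤ} {s : Mem}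
    (hX : Side X Y.N zX kX 0 s) (hY : Side Y X.N zY kY 10 s) (v3 : s.var 3 = Y.N) (hYB : Y.N ≤ B)
    (hY' : Y.N + 1 ≤ Y') :
    WP B Y' dedupFlags s fun s' =>
      ∀ W : ℕ, W < Y.N → s'.arr 15 W = dedup X Y zY kX kY W := by
  refine WP.forTo (Y := 1) le_rfl Y.N v3 hYB (by decide) (by decide) (by decide)
    (fun i s' => ∀ W : ℕ, W < i → s'.arr 15 W = dedup X Y zY kX kY W)
    (fun U hU => by omega) ?_ (by omega) fun s1 _ _ hI => hI
  rintro i hi s1 ha1 hx1 hI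
  have f1 := hX.agree ha1 (by decide)
  have f2 := hY.agree ha1 (by decide)
  refine WP.of_bdd fun hb => WP.seq (WP.assign le_rfl (hb.2 _ _) ?_)
  have e13 := f2.sup i (by omega) (by omega)
  have e12 := f2.size i (by omega) (by omega)
  have e14 := f2.flag i (by omega) (by omega)
  have hr := f2.sup_range i (by omega) (by omega)
  simp only [Nat.reduceAdd] at e13 e12 e14
  rw [Laid.size, if_neg (by omega)] at e12
  simp only [Expr.eval_get, Expr.eval_var, hx1, e13]
  have hcond : (0 ≤ zY i ∧ 1 ≤ s1.arr 4 (zY i) ∧ s1.arr 2 (zY i) ≤ Y.sz i ∧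
      Y.sz i ≤ s1.arr 2 (zY i)) ↔ (0 ≤ zY i ∧ kX (zY i) = 1 ∧ X.sz (zY i) = Y.sz i) := by
    refine and_congr_right fun h0 => ?_
    have e4 := f1.flag _ h0 hr.2
    have e2 := f1.size _ hr.1 hr.2
    simp only [Nat.reduceAdd] at e4 e2
    rw [Laid.size, if_neg (by omega)] at e2
    rw [e4, e2]
    obtain ⟨u, hu⟩ := Int.eq_ofNat_of_zero_le h0
    have := f1.flag_range u (by omega)
    rw [← hu] at this
    omega
  have hset : ∀ x, x = dedup X Y zY kX kY i → ∀ s' : Mem,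
      s'.arr 15 = Function.update (s1.arr 15) i x →
      ∀ W : ℕ, W < i + 1 → s'.arr 15 W = dedup X Y zY kX kY W := by
    intro x hx s' hs' W hW
    rw [hs']
    by_cases h : W = i
    · subst h; rw [Function.update_self, hx]
    · rw [Function.update_of_ne (by exact_mod_cast h)]; exact hI W (by omega)
  refine WP.ite le_rfl (fun hc => WP.put le_rfl ?_ (hset 0 ?_ _ ?_))
    (fun hc => WP.put le_rfl ?_ (hset (kY i) ?_ _ ?_))
  all_goals simp only [Cond.Holds, Expr.eval_get, Expr.eval_const, Expr.eval_var, Mem.setVar_var,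
    Mem.setVar_arr, Nat.reduceEqDiff, if_true, if_false, hx1, e12, e14] at hc ⊢
  · simp
  · rw [dedup, if_pos (hcond.1 hc)]
  · simp
  · rw [← e14]; exact hb.2 _ _
  · rw [dedup, if_neg fun h => hc (hcond.2 h)]
  · simp

/-- Writes to entry `i` of array `a` the number of the smaller one of the nodes `c` and `d`. -/
def emit (a : ℕ) (i c d : Expr) : Prog :=
  .assign 30 c ;; .assign 31 d ;;
  .ite (.lt (.get 2 (.var 30)) (.get 12 (.var 31)))
    (.put a i (.get 18 (.var 30))) (.put a i (.get 19 (.var 31)))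

def emitAll : Prog :=
  .forTo 39 2 (.ite (.le (.const 1) (.get 4 (.var 39)))
    (emit 5 (.get 18 (.var 39)) (.get 16 (.get 0 (.var 39))) (.get 17 (.get 3 (.var 39)))) .skip) ;;
  .forTo 39 3 (.ite (.le (.const 1) (.get 15 (.var 39)))
    (emit 5 (.get 19 (.var 39)) (.get 16 (.get 13 (.var 39))) (.get 17 (.get 10 (.var 39)))) .skip) ;;
  .forTo 39 0 (emit 6 (.var 39) (.get 16 (.get 1 (.var 39))) (.get 17 (.get 11 (.var 39))))

/-- Merges the flagged nodes of two trees into one tree, with parents in array `5` and homes in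
array `6`. -/
def merge : Prog :=
  dedupFlags ;;
  .assign 10 (.var 2) ;;
  nearest.rename (relabel [4, 0, 16, 20, 21, 22] 30) ;;
  .assign 10 (.var 3) ;;
  nearest.rename (relabel [15, 10, 17, 23, 24, 25] 30) ;;
  .scanTo 39 2 18 (.get 4 (.var 39)) ;;
  -- The numbering of the nodes of the second tree starts where that of the first tree ends.
  .put 19 (.const 0) (.get 18 (.var 2)) ;;
  .scanTo 39 3 19 (.get 15 (.var 39)) ;;
  .assign 4 (.get 19 (.var 3)) ;;
  -- This is the code of the root, read by `emit` when both candidates are the root. A root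
  -- candidate on the left never wins the strict comparison, since no size exceeds that of the root.
  .put 19 (.const (-1)) (.const (-1)) ;;
  emitAll

/-- The memory before the nodes of the merged tree are written. -/
structure MergeEnv {n L : ℕ} (X Y : Laid n L) (zX zY kX kY gX gY : ℤ → ℤ) (s : Mem) : Prop where
  left : Side X Y.N zX kX 0 s
  right : Side Y X.N zY kY 10 s
  v0 : s.var 0 = n
  v2 : s.var 2 = X.N
  v3 : s.var 3 = Y.N
  flagY : ∀ W : ℕ, W < Y.N → s.arr 15 W = dedup X Y zY kX kY W
  nearX : ∀ c : ℤ, -1 ≤ c → c < X.N → s.arr 16 c = gX c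
  nearY : ∀ c : ℤ, -1 ≤ c → c < Y.N → s.arr 17 c = gY c
  rangeX : ∀ c : ℤ, -1 ≤ c → c < X.N → -1 ≤ gX c ∧ gX c < X.N
  rangeY : ∀ c : ℤ, -1 ≤ c → c < Y.N → -1 ≤ gY c ∧ gY c < Y.N
  rankX : ∀ c : ℤ, 0 ≤ c → c < X.N → s.arr 18 c = rank kX c
  rankY : ∀ c : ℤ, 0 ≤ c → c < Y.N → s.arr 19 c = rank kX X.N + rank (dedup X Y zY kX kY) c
  rootY : s.arr 19 (-1) = -1

theorem MergeEnv.agree {n L : ℕ} {X Y : Laid n L} {zX zY kX kY gX gY : ℤ → ℤ} {s s' : Mem}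
    {V A : List ℕ} (h : MergeEnv X Y zX zY kX kY gX gY s) (hs : Agree V A s s')
    (hV : ∀ x ∈ [0, 2, 3], x ∉ V) (hA : ∀ a ∈ A, 4 < a ∧ (a < 10 ∨ 19 < a)) :
    MergeEnv X Y zX zY kX kY gX gY s' := by
  have ha : ∀ a, a ≤ 4 ∨ (10 ≤ a ∧ a ≤ 19) → s'.arr a = s.arr a := fun a h => hs.2 a fun h' => by
    have := hA a h'; omega
  obtain ⟨h1, h2, h3, h4, h5, h6, h7, h8, h9, h10, h11, h12, h13⟩ := h
  exact ⟨h1.congr fun a b c => ha a (by omega), h2.congr fun a b c => ha a (by omega),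
    by rw [hs.1 0 (hV 0 (by decide)), h3], by rw [hs.1 2 (hV 2 (by decide)), h4],
    by rw [hs.1 3 (hV 3 (by decide)), h5], by rwa [ha 15 (by norm_num)],
    by rwa [ha 16 (by norm_num)], by rwa [ha 17 (by norm_num)], h9, h10,
    by rwa [ha 18 (by norm_num)], by rwa [ha 19 (by norm_num)], by rwa [ha 19 (by norm_num)]⟩

theorem emit_spec {n L B a : ℕ} {X Y : Laid n L} {zX zY kX kY gX gY : ℤ → ℤ} {s : Mem}
    {i c d : Expr} {x y r : ℤ} (h : MergeEnv X Y zX zY kX kY gX gY s) (hXB : X.N + 1 ≤ B)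
    (hYB : Y.N + 1 ≤ B)
    (hc : c.eval s = x) (hx : -1 ≤ x ∧ x < X.N) (hy : -1 ≤ y ∧ y < Y.N)
    (hst : ∀ s', Agree [30, 31] [] s s' → d.eval s' = y ∧ i.eval s' = r) :
    WP B 1 (emit a i c d) s fun s' => s'.arr a =
      Function.update (s.arr a) r (pick X Y kX (dedup X Y zY kX kY) x y) := by
  refine WP.of_bdd fun hb => ?_
  refine WP.seq (WP.assign le_rfl (by
    rw [hc]; exact abs_le_of_range (by omega) (by omega) hx.1 hx.2) ?_)
  rw [hc]
  have g1 : Agree [30, 31] [] s (s.setVar 30 x) :=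
    ⟨fun y hy => by simp at hy; simp [hy], fun _ _ => rfl⟩
  have e1 := (hst _ g1).1
  refine WP.seq (WP.assign le_rfl (by
    rw [e1]; exact abs_le_of_range (by omega) (by omega) hy.1 hy.2) ?_)
  rw [e1]
  have g2 : Agree [30, 31] [] s ((s.setVar 30 x).setVar 31 y) :=
    ⟨fun y hy => by simp at hy; simp [hy], fun _ _ => rfl⟩
  have e2 := (hst _ g2).2
  have sx := h.left.size x hx.1 hx.2
  have sy := h.right.size y hy.1 hy.2
  simp only [Nat.reduceAdd] at sx sy
  refine WP.ite le_rfl (fun hcond => WP.put le_rfl (hb.2 _ _) ?_)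
    (fun hcond => WP.put le_rfl (hb.2 _ _) ?_)
  all_goals
    simp only [Cond.holds_lt, Expr.eval_get, Expr.eval_var, Mem.setVar_var, Mem.setVar_arr,
      Nat.reduceEqDiff, if_true, if_false, sx, sy] at hcond
    simp only [Expr.eval_get, Expr.eval_var, Mem.setVar_var, Mem.setVar_arr, Mem.setArr_arr,
      Nat.reduceEqDiff, if_true, if_false, e2]
    congr 1
  · rw [pick, if_pos hcond]
    refine h.rankX x ?_ hx.2
    by_contra hneg
    have : Y.size y ≤ 2 * n + 2 := by
      unfold Laid.size
      split
      · exact le_rfl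
      · have := Y.forest.sz_le y (by omega) hy.2; omega
    rw [Laid.size, if_pos (by omega)] at hcond
    omega
  · rw [pick, if_neg hcond]
    split
    · rw [show y = -1 by omega]; exact h.rootY
    · exact h.rankY y (by omega) hy.2

/-- The arrays `5` and `6` and the variable `4` hold the merged tree. -/
def Merged {n L : ℕ} (X Y : Laid n L) (zX zY kX kY gX gY : ℤ → ℤ) (s : Mem) : Prop :=
  (∀ U : ℕ, U < X.N → kX U = 1 → s.arr 5 (rank kX U) =
    pick X Y kX (dedup X Y zY kX kY) (gX (X.p U)) (gY (zX U))) ∧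
  (∀ W : ℕ, W < Y.N → dedup X Y zY kX kY W = 1 →
    s.arr 5 (rank kX X.N + rank (dedup X Y zY kX kY) W) =
      pick X Y kX (dedup X Y zY kX kY) (gX (zY W)) (gY (Y.p W))) ∧
  ∀ v : ℕ, v < n → s.arr 6 v =
    pick X Y kX (dedup X Y zY kX kY) (gX (X.home v)) (gY (Y.home v))

theorem dedup_range {n L : ℕ} {X Y : Laid n L} {zY kX kY : ℤ → ℤ}
    (hk : ∀ j : ℕ, j < Y.N → kY j = 0 ∨ kY j = 1) (j : ℕ) (hj : j < Y.N) :
    dedup X Y zY kX kY j = 0 ∨ dedup X Y zY kX kY j = 1 := by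
  unfold dedup
  split
  · exact Or.inl rfl
  · exact hk j hj

/-- No entry of array `5` is overwritten with a wrong value: ranks of flagged nodes are strictly
increasing, and the numbers used for the second tree all lie above those of the first. -/
theorem emitAll_spec {n L B Y' : ℕ} {X Y : Laid n L} {zX zY kX kY gX gY : ℤ → ℤ} {s : Mem}
    (h : MergeEnv X Y zX zY kX kY gX gY s) (hB : n + X.N + Y.N + 1 ≤ B)
    (hY' : n + X.N + Y.N + 1 ≤ Y') :
    WP B Y' emitAll s (Merged X Y zX zY kX kY gX gY) := by
  have hkX := h.left.flag_range
  have hkY := dedup_range (X := X) (zY := zY) (kX := kX) h.right.flag_range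
  set k' := dedup X Y zY kX kY with hk'
  refine WP.seq (WP.forTo (Y := 1) le_rfl X.N h.v2 (by omega) (by decide) (by decide) (by decide)
    (fun i s' => ∀ U : ℕ, U < i → kX U = 1 →
      s'.arr 5 (rank kX U) = pick X Y kX k' (gX (X.p U)) (gY (zX U)))
    (fun U hU => by omega) ?_ (by omega) ?_)
  · intro i hi s1 ha1 hx1 hI
    have e1 := h.agree ha1 (by decide) (by decide)
    have f4 : s1.arr 4 i = kX i := e1.left.flag i (by omega) (by omega)
    have f0 : s1.arr 0 i = X.p i := e1.left.par i (by omega) (by omega)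
    have f3 : s1.arr 3 i = zX i := e1.left.sup i (by omega) (by omega)
    have hp := X.forest.range i (by omega) (by omega)
    have hz := e1.left.sup_range i (by omega) (by omega)
    refine WP.ite le_rfl (fun hc => ?_) (fun hc => WP.skip le_rfl fun U hU hk => ?_)
    · refine (emit_spec (x := gX (X.p i)) (y := gY (zX i)) (r := rank kX i) e1 (by omega) (by omega)
        ?_ (e1.rangeX _ hp.1 hp.2) (e1.rangeY _ hz.1 hz.2) fun s2 hs2 => ?_).mono
        fun s2 _ hs2 U hU hk => ?_
      · simp only [Expr.eval_get, Expr.eval_var, hx1, f0, e1.nearX _ hp.1 hp.2]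
      · simp only [Expr.eval_get, Expr.eval_var, hs2.1 39 (by decide), hs2.2 3 (by decide),
          hs2.2 17 (by decide), hs2.2 18 (by decide), hx1, f3, e1.nearY _ hz.1 hz.2,
          e1.rankX i (by omega) (by omega), and_self]
      · rw [Mem.setVar_arr, hs2]
        by_cases hUi : U = i
        · subst hUi; rw [Function.update_self]
        · rw [Function.update_of_ne]
          · exact hI U (by omega) hk
          · have := rank_lt hkX (i := U) (j := i) (by omega) hk (by omega) (by omega)
            omega
    · have hUi : U ≠ i := by
        rintro rfl
        simp only [Cond.Holds, Expr.eval_get, Expr.eval_const, Expr.eval_var, hx1, f4] at hc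
        omega
      exact hI U (by omega) hk
  intro s1 ha1 _ q1
  have e1 := h.agree ha1 (by decide) (by decide)
  refine WP.seq (WP.forTo (Y := 1) le_rfl Y.N e1.v3 (by omega) (by decide) (by decide) (by decide)
    (fun i s' => (∀ U : ℕ, U < X.N → kX U = 1 →
      s'.arr 5 (rank kX U) = pick X Y kX k' (gX (X.p U)) (gY (zX U))) ∧
      ∀ W : ℕ, W < i → k' W = 1 → s'.arr 5 (rank kX X.N + rank k' W) =
        pick X Y kX k' (gX (zY W)) (gY (Y.p W)))
    ⟨q1, fun U hU => by omega⟩ ?_ (by omega) ?_)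
  · rintro i hi s2 ha2 hx2 ⟨hI0, hI⟩
    have e2 := e1.agree ha2 (by decide) (by decide)
    have f15 : s2.arr 15 i = k' i := e2.flagY i hi
    have f10 : s2.arr 10 i = Y.p i := e2.right.par i (by omega) (by omega)
    have f13 : s2.arr 13 i = zY i := e2.right.sup i (by omega) (by omega)
    have hp := Y.forest.range i (by omega) (by omega)
    have hz := e2.right.sup_range i (by omega) (by omega)
    refine WP.ite le_rfl (fun hc => ?_) (fun hc => WP.skip le_rfl ⟨hI0, fun W hW hk => ?_⟩)
    · refine (emit_spec (x := gX (zY i)) (y := gY (Y.p i)) (r := rank kX X.N + rank k' i) e2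
        (by omega) (by omega) ?_ (e2.rangeX _ hz.1 hz.2) (e2.rangeY _ hp.1 hp.2)
        fun s3 hs3 => ?_).mono fun s3 _ hs3 => ⟨fun U hU hk => ?_, fun W hW hk => ?_⟩
      · simp only [Expr.eval_get, Expr.eval_var, hx2, f13, e2.nearX _ hz.1 hz.2]
      · simp only [Expr.eval_get, Expr.eval_var, hs3.1 39 (by decide), hs3.2 10 (by decide),
          hs3.2 17 (by decide), hs3.2 19 (by decide), hx2, f10, e2.nearY _ hp.1 hp.2,
          e2.rankY i (by omega) (by omega), ← hk', and_self]
      · rw [Mem.setVar_arr, hs3, Function.update_of_ne]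
        · exact hI0 U hU hk
        · have h1 := rank_lt hkX (i := U) (j := X.N) (by omega) hk (by omega) (by omega)
          have h2 := rank_nonneg hkY (i := i) (by omega)
          omega
      · rw [Mem.setVar_arr, hs3]
        by_cases hWi : W = i
        · subst hWi; rw [Function.update_self]
        · rw [Function.update_of_ne]
          · exact hI W (by omega) hk
          · have := rank_lt hkY (i := W) (j := i) (by omega) hk (by omega) (by omega)
            omega
    · have hWi : W ≠ i := by
        rintro rfl
        simp only [Cond.Holds, Expr.eval_get, Expr.eval_const, Expr.eval_var, hx2, f15] at hc
        omega
      exact hI W (by omega) hk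
  rintro s2 ha2 _ ⟨q2, q3⟩
  have e2 := e1.agree ha2 (by decide) (by decide)
  refine WP.forTo (Y := 1) le_rfl n e2.v0 (by omega) (by decide) (by decide) (by decide)
    (fun i s' => ∀ v : ℕ, v < i → s'.arr 6 v = pick X Y kX k' (gX (X.home v)) (gY (Y.home v)))
    (fun U hU => by omega) ?_ (by omega) ?_
  · intro v hv s3 ha3 hx3 hI
    have e3 := e2.agree ha3 (by decide) (by decide)
    have hp := X.home_range v hv
    have hz := Y.home_range v hv
    refine (emit_spec (x := gX (X.home v)) (y := gY (Y.home v)) (r := v) e3 (by omega) (by omega)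
        ?_ (e3.rangeX _ hp.1 hp.2) (e3.rangeY _ hz.1 hz.2) fun s4 hs4 => ?_).mono
        fun s4 _ hs4 w hw => ?_
    · have := e3.left.home v hv
      simp only [Nat.reduceAdd] at this
      simp only [Expr.eval_get, Expr.eval_var, hx3, this, e3.nearX _ hp.1 hp.2]
    · have := e3.right.home v hv
      simp only [Nat.reduceAdd] at this
      simp only [Expr.eval_get, Expr.eval_var, hs4.1 39 (by decide), hs4.2 11 (by decide),
        hs4.2 17 (by decide), hx3, this, e3.nearY _ hz.1 hz.2, and_self]
    · rw [Mem.setVar_arr, hs4]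
      by_cases hwv : w = v
      · subst hwv; rw [Function.update_self]
      · rw [Function.update_of_ne (by exact_mod_cast hwv)]; exact hI w (by omega)
  · intro s3 ha3 _ q4
    have a5 : s3.arr 5 = s2.arr 5 := ha3.2 5 (by decide)
    exact ⟨by rw [a5]; exact q2, by rw [a5]; exact q3, q4⟩

theorem Nearest.range {N : ℕ} {p : ℤ → ℤ} {K : ℤ → Prop} {g : ℤ → ℤ} (h : Nearest N p K g) (c : ℤ)
    (h0 : -1 ≤ c) (h1 : c < N) : -1 ≤ g c ∧ g c < N := by
  rcases h c h0 h1 with h | h <;> omega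

theorem merge_spec {n L B Y' : ℕ} {X Y : Laid n L} {zX zY kX kY : ℤ → ℤ} {s : Mem}
    (hX : Side X Y.N zX kX 0 s) (hY : Side Y X.N zY kY 10 s) (v0 : s.var 0 = n)
    (v2 : s.var 2 = X.N) (v3 : s.var 3 = Y.N) (v5 : s.var 5 = L) (hn : n ≤ 2 ^ L)
    (hz : ∀ a ∈ [18, 20, 23], ∀ j, s.arr a j = 0)
    (hB : n + X.N + Y.N + 2 ^ L + 1 ≤ B) (hY' : (n + X.N + Y.N + 1) * (L + 1) ≤ Y') :
    WP B Y' merge s fun s' => ∃ gX gY, Nearest X.N X.p (fun j => kX j = 1) gX ∧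
      Nearest Y.N Y.p (fun j => dedup X Y zY kX kY j = 1) gY ∧
      s'.var 4 = rank kX X.N + rank (dedup X Y zY kX kY) Y.N ∧
      Merged X Y zX zY kX kY gX gY s' := by
  have hkX := hX.flag_range
  have hkY := dedup_range (X := X) (zY := zY) (kX := kX) hY.flag_range
  have hM : n + X.N + Y.N + 1 ≤ Y' := le_trans (Nat.le_mul_of_pos_right _ (by omega)) hY'
  have hL1 : (L + 1) * (X.N + 1) ≤ Y' := by
    rw [mul_comm]; exact le_trans (Nat.mul_le_mul_right _ (by omega)) hY'
  have hL2 : (L + 1) * (Y.N + 1) ≤ Y' := by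
    rw [mul_comm]; exact le_trans (Nat.mul_le_mul_right _ (by omega)) hY'
  refine WP.seq ((dedupFlags_spec hX hY v3 (by omega) (by omega)).mono fun s1 ha1 q15 => ?_)
  set k' := dedup X Y zY kX kY with hk'
  have hX1 := hX.agree ha1 (by decide)
  have hY1 := hY.agree ha1 (by decide)
  refine WP.seq (WP.assign (by omega) ?_ ?_)
  · rw [Expr.eval_var, ha1.1 2 (by decide), v2]; simp; omega
  rw [Expr.eval_var, ha1.1 2 (by decide), v2]
  refine WP.seq (WP.rename (relabel_injective (by decide) (by decide))
    (nearest_spec (k := kX) (L := L) X.forest ?_ ?_ hn (by omega) (by omega)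
      (fun j a b => ?_) ?_ ?_ ?_ hL1) fun s2 ha2 qX => ?_)
  · rfl
  · change s1.var 5 = L; rw [ha1.1 5 (by decide), v5]
  · obtain ⟨j', rfl⟩ := Int.eq_ofNat_of_zero_le a
    exact hkX j' (by omega)
  · exact fun j a b => hX1.flag j a b
  · exact fun j a b => hX1.par j a b
  · intro j; change s1.arr 20 j = 0; rw [ha1.2 20 (by decide)]; exact hz 20 (by decide) j
  change Nearest X.N X.p _ (s2.arr 16) at qX
  have hX2 := (hX1.congr (s' := s1.setVar 10 X.N) fun _ _ _ => rfl).agree ha2 (by decide)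
  have hY2 := (hY1.congr (s' := s1.setVar 10 X.N) fun _ _ _ => rfl).agree ha2 (by decide)
  have r15 : ∀ W : ℕ, W < Y.N → s2.arr 15 W = k' W := by rw [ha2.2 15 (by decide)]; exact q15
  refine WP.seq (WP.assign (by omega) ?_ ?_)
  · rw [Expr.eval_var, ha2.1 3 (by decide)]; simp; rw [ha1.1 3 (by decide), v3]; simp; omega
  rw [Expr.eval_var, ha2.1 3 (by decide), show (s1.setVar 10 X.N).var 3 = Y.N by
    simp; rw [ha1.1 3 (by decide), v3]]
  refine WP.seq (WP.rename (relabel_injective (by decide) (by decide))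
    (nearest_spec (k := k') (L := L) Y.forest ?_ ?_ hn (by omega) (by omega)
      (fun j a b => ?_) ?_ ?_ ?_ hL2) fun s3 ha3 qY => ?_)
  · rfl
  · change s2.var 5 = L
    rw [ha2.1 5 (by decide)]; change s1.var 5 = L; rw [ha1.1 5 (by decide), v5]
  · obtain ⟨j', rfl⟩ := Int.eq_ofNat_of_zero_le a
    exact hkY j' (by omega)
  · intro j a b
    obtain ⟨j', rfl⟩ := Int.eq_ofNat_of_zero_le a
    exact r15 j' (by omega)
  · exact fun j a b => hY2.par j a b
  · intro j; change s2.arr 23 j = 0; rw [ha2.2 23 (by decide)]; change s1.arr 23 j = 0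
    rw [ha1.2 23 (by decide)]; exact hz 23 (by decide) j
  change Nearest Y.N Y.p _ (s3.arr 17) at qY
  have hX3 := (hX2.congr (s' := s2.setVar 10 Y.N) fun _ _ _ => rfl).agree ha3 (by decide)
  have hY3 := (hY2.congr (s' := s2.setVar 10 Y.N) fun _ _ _ => rfl).agree ha3 (by decide)
  have t15 : ∀ W : ℕ, W < Y.N → s3.arr 15 W = k' W := by rw [ha3.2 15 (by decide)]; exact r15
  have t16 : s3.arr 16 = s2.arr 16 := by rw [ha3.2 16 (by decide)]; rfl
  have t18 : ∀ j, s3.arr 18 j = 0 := fun j => by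
    rw [ha3.2 18 (by decide)]; change s2.arr 18 j = 0
    rw [ha2.2 18 (by decide)]; change s1.arr 18 j = 0
    rw [ha1.2 18 (by decide)]; exact hz 18 (by decide) j
  have w : ∀ x, x = 0 ∨ x = 2 ∨ x = 3 → s3.var x = s.var x := by
    rintro x (rfl | rfl | rfl) <;>
    · rw [ha3.1 _ (by decide), Mem.setVar_var, if_neg (by decide), ha2.1 _ (by decide),
        Mem.setVar_var, if_neg (by decide), ha1.1 _ (by decide)]
  have hrX : ∀ k ≤ X.N, ∑ l ∈ Finset.range k, kX l = rank kX k := fun k _ => by simp [rank]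
  have hrY : ∀ k ≤ Y.N, ∑ l ∈ Finset.range k, k' l = rank k' k := fun k _ => by simp [rank]
  have bX : ∀ k : ℕ, k ≤ X.N → 0 ≤ rank kX k ∧ rank kX k ≤ X.N := fun k hk =>
    ⟨rank_nonneg hkX (by omega), (rank_le hkX (by omega) (by omega)).trans (by omega)⟩
  have bY : ∀ k : ℕ, k ≤ Y.N → 0 ≤ rank k' k ∧ rank k' k ≤ Y.N := fun k hk =>
    ⟨rank_nonneg hkY (by omega), (rank_le hkY (by omega) (by omega)).trans (by omega)⟩
  refine WP.seq (WP.scanTo X.N ((w 2 (by omega)).trans v2) (by omega) (by decide) (fun l => kX l)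
    (fun k hk s' hs' hx => ?_) (fun k hk => ?_) (by omega) fun s4 ha4 q18 _ => ?_)
  · rw [Expr.eval_get, Expr.eval_var, hx, hs'.2 4 (by decide)]
    exact hX3.flag k (by omega) (by omega)
  · rw [t18, zero_add, hrX k hk, abs_of_nonneg (bX k hk).1]
    have := bX k hk; omega
  have u18 : ∀ k : ℕ, k ≤ X.N → s4.arr 18 k = rank kX k := fun k hk => by
    rw [q18 k hk, t18, zero_add, hrX k hk]
  have w4 : ∀ x, x = 0 ∨ x = 2 ∨ x = 3 → s4.var x = s.var x := by
    rintro x (rfl | rfl | rfl) <;> rw [ha4.1 _ (by decide)] <;> exact w _ (by omega)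
  have eN : s4.arr 18 (s4.var 2) = rank kX X.N := by rw [w4 2 (by omega), v2, u18 _ le_rfl]
  refine WP.seq (WP.put (by omega) ?_ ?_)
  · rw [Expr.eval_get, Expr.eval_var, eN, abs_of_nonneg (bX _ le_rfl).1]
    have := (bX _ le_rfl).2; omega
  rw [Expr.eval_get, Expr.eval_var, eN, Expr.eval_const]
  refine WP.seq (WP.scanTo Y.N ((w4 3 (by omega)).trans v3) (by omega) (by decide) (fun l => k' l)
    (fun k hk s' hs' hx => ?_) (fun k hk => ?_) (by omega) fun s5 ha5 q19 _ => ?_)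
  · rw [Expr.eval_get, Expr.eval_var, hx, hs'.2 15 (by decide), Mem.setArr_arr, if_neg (by decide),
      ha4.2 15 (by decide)]
    exact t15 k hk
  · rw [Mem.setArr_arr, if_pos rfl, Function.update_self, hrY k hk, abs_of_nonneg
      (by have := bY k hk; have := bX _ le_rfl; omega)]
    have := bY k hk; have := bX _ le_rfl; omega
  have u19 : ∀ k : ℕ, k ≤ Y.N → s5.arr 19 k = rank kX X.N + rank k' k := fun k hk => by
    rw [q19 k hk, Mem.setArr_arr, if_pos rfl, Function.update_self, hrY k hk]
  have w5 : ∀ x, x = 0 ∨ x = 2 ∨ x = 3 → s5.var x = s.var x := by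
    rintro x (rfl | rfl | rfl) <;> rw [ha5.1 _ (by decide)] <;> exact w4 _ (by omega)
  have eM : s5.arr 19 (s5.var 3) = rank kX X.N + rank k' Y.N := by
    rw [w5 3 (by omega), v3, u19 _ le_rfl]
  refine WP.seq (WP.assign (by omega) ?_ ?_)
  · rw [Expr.eval_get, Expr.eval_var, eM, abs_of_nonneg
      (by have := bY _ le_rfl; have := bX _ le_rfl; omega)]
    have := bY _ le_rfl; have := bX _ le_rfl; omega
  rw [Expr.eval_get, Expr.eval_var, eM]
  refine WP.seq (WP.put (by omega) (by simp; omega) ?_)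
  simp only [Expr.eval_const]
  have a5 : ∀ a, a ≠ 18 → a ≠ 19 → s5.arr a = s3.arr a := fun a h1 h2 => by
    rw [ha5.2 a (by simpa using h2), Mem.setArr_arr, if_neg h2, ha4.2 a (by simpa using h1)]
  set s6 := (s5.setVar 4 (rank kX X.N + rank k' Y.N)).setArr 19 (-1) (-1) with hs6
  have a6 : ∀ a, a ≠ 18 → a ≠ 19 → s6.arr a = s3.arr a := fun a h1 h2 => by
    rw [hs6, Mem.setArr_arr, if_neg h2]; exact a5 a h1 h2
  have env : MergeEnv X Y zX zY kX kY (s2.arr 16) (s3.arr 17) s6 := by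
    refine ⟨hX3.congr fun a _ _ => a6 a (by omega) (by omega),
      hY3.congr fun a _ _ => a6 a (by omega) (by omega), ?_, ?_, ?_, ?_, ?_, ?_, qX.range, qY.range,
      ?_, ?_, ?_⟩
    · simp [hs6, w5 0, v0]
    · simp [hs6, w5 2, v2]
    · simp [hs6, w5 3, v3]
    · rw [a6 15 (by decide) (by decide)]; exact t15
    · intro c _ _; rw [a6 16 (by decide) (by decide), t16]
    · intro c _ _; rw [a6 17 (by decide) (by decide)]
    · intro c h0 h1
      obtain ⟨c', rfl⟩ := Int.eq_ofNat_of_zero_le h0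
      rw [hs6, Mem.setArr_arr, if_neg (by decide), Mem.setVar_arr, ha5.2 18 (by decide),
        Mem.setArr_arr, if_neg (by decide)]
      exact u18 c' (by omega)
    · intro c h0 h1
      obtain ⟨c', rfl⟩ := Int.eq_ofNat_of_zero_le h0
      rw [hs6, Mem.setArr_arr, if_pos rfl, Function.update_of_ne (by omega), Mem.setVar_arr]
      exact u19 c' (by omega)
    · simp [hs6]
  refine (emitAll_spec env (by omega) hM).mono fun s7 ha7 q7 => ⟨_, _, qX, qY, ?_, q7⟩
  rw [ha7.1 4 (by decide), hs6]
  simp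

/-! ## The merged tree -/

/-- A tree whose pointers lead to the smallest sets of a family represents the family. -/
theorem LTree.nodeSet_eq_of_smallest {n : ℕ} {R : LTree n} {A : Fin R.size → Finset (Fin n)}
    (hinj : Function.Injective A)
    (hroot : ∀ i, R.parent i = none → ∀ j, ¬ A i ⊂ A j)
    (hpar : ∀ i j, R.parent i = some j → A i ⊂ A j ∧ ∀ k, A i ⊂ A k → A j ⊆ A k)
    (hout : ∀ v, R.home v = none → ∀ i, v ∉ A i)
    (hhome : ∀ v i, R.home v = some i → v ∈ A i ∧ ∀ k, v ∈ A k → A i ⊆ A k) :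
    (∀ i, ¬ Relation.TransGen (fun a b => R.parent a = some b) i i) ∧ ∀ i, R.nodeSet i = A i := by
  have hsub : ∀ i j, R.Below i j → A i ⊆ A j := by
    intro i j h
    induction h with
    | refl => exact subset_rfl
    | tail _ h ih => exact ih.trans (hpar _ _ h).1.subset
  -- Climbing from `i`: the parent carries the smallest proper superset, so it stays inside `A j`,
  -- and the gap in cardinality shrinks until the sets, and hence the nodes, coincide.
  have hbelow : ∀ d : ℕ, ∀ i j, A i ⊆ A j → (A j).card - (A i).card = d → R.Below i j := by
    intro d
    induction d using Nat.strong_induction_on with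
    | _ d ih =>
      intro i j hij hd
      rcases eq_or_ne (A i) (A j) with h | h
      · rw [hinj h]; exact Relation.ReflTransGen.refl
      · have hss : A i ⊂ A j := hij.ssubset_of_ne h
        cases hp : R.parent i with
        | none => exact absurd hss (hroot i hp j)
        | some k =>
            obtain ⟨h1, h2⟩ := hpar i k hp
            have h3 := Finset.card_lt_card h1
            have h4 := Finset.card_le_card (h2 j hss)
            exact Relation.ReflTransGen.head hp (ih _ (by omega) k j (h2 j hss) rfl)
  constructor
  · intro i h
    have : ∀ j, Relation.TransGen (fun a b => R.parent a = some b) i j → A i ⊂ A j := by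
      intro j h
      induction h with
      | single h => exact (hpar _ _ h).1
      | tail _ h ih => exact ih.trans (hpar _ _ h).1
    exact (this i h).ne rfl
  · intro i
    ext v
    simp only [LTree.nodeSet, Finset.mem_filter, Finset.mem_univ, true_and]
    constructor
    · rintro ⟨a, ha, hb⟩
      exact hsub a i hb (hhome v a ha).1
    · intro hv
      cases hh : R.home v with
      | none => exact absurd hv (hout v hh i)
      | some a => exact ⟨a, rfl, hbelow _ a i ((hhome v a hh).2 i hv) rfl⟩

namespace Laid

variable {n L : ℕ} (X Y : Laid n L)

open Classical in
/-- The set of a node. -/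
noncomputable def set (j : ℤ) : Finset (Fin n) := Finset.univ.filter fun v => X.Mem v j

theorem mem_set {v : Fin n} {j : ℤ} : v ∈ X.set j ↔ X.Mem v j := by simp [set]

theorem sub_iff {U W : ℤ} : X.Sub Y U W ↔ X.set U ⊆ Y.set W := by
  constructor
  · intro h v hv
    rw [mem_set] at hv ⊢
    exact h v v.2 hv
  · intro h v hv hU
    have := @h ⟨v, hv⟩ (X.mem_set.2 hU)
    exact Y.mem_set.1 this

theorem card_set {j : ℤ} (h0 : 0 ≤ j) (hN : j < X.N) : ((X.set j).card : ℤ) = X.sz j := by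
  classical
  rw [X.sz_eq j h0 hN, set, Finset.card_filter, Finset.sum_range, Nat.cast_sum]
  refine Finset.sum_congr rfl fun v _ => ?_
  change _ = ind (X.Mem v j)
  unfold ind
  split <;> rfl

theorem set_nonempty {j : ℤ} (h0 : 0 ≤ j) (hN : j < X.N) : (X.set j).Nonempty := by
  obtain ⟨v, hv, h⟩ := X.exists_mem h0 hN
  exact ⟨⟨v, hv⟩, X.mem_set.2 h⟩

/-- Sets of nodes are nonempty, so inclusion gives a common vertex and thereby comparability; strict
growth of sizes along paths excludes the wrong order. -/
theorem anc_iff_subset {i j : ℤ} (h0 : 0 ≤ i) (hN : i < X.N) (h0' : 0 ≤ j) (hN' : j < X.N) :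
    Anc X.p i j ↔ X.set i ⊆ X.set j := by
  constructor
  · intro h v hv
    rw [mem_set] at hv ⊢
    exact hv.anc h
  · intro h
    obtain ⟨v, hv⟩ := X.set_nonempty h0 hN
    have hi := X.mem_set.1 hv
    have hj := X.mem_set.1 (h hv)
    rcases Anc.comparable hi hj with h1 | h1
    · exact h1
    · by_cases hij : j = i
      · subst hij; exact h1
      · have h2 := X.forest.anc_sz_lt (by omega) hN' h0 h1 hij
        rw [← X.card_set h0 hN, ← X.card_set h0' hN'] at h2
        have := Finset.card_le_card h
        omega

theorem set_inj {i j : ℤ} (h0 : 0 ≤ i) (hN : i < X.N) (h0' : 0 ≤ j) (hN' : j < X.N)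
    (h : X.set i = X.set j) : i = j := by
  by_contra hij
  have h1 := (X.anc_iff_subset h0 hN h0' hN').2 h.subset
  have h2 := X.forest.anc_sz_lt (by omega) hN h0' h1 hij
  rw [← X.card_set h0 hN, ← X.card_set h0' hN', h] at h2
  omega

theorem anc_parent_iff {i j : ℤ} (h0 : 0 ≤ i) (hN : i < X.N) (h0' : 0 ≤ j) (hN' : j < X.N) :
    Anc X.p (X.p i) j ↔ X.set i ⊂ X.set j := by
  have h1 := anc_iff (p := X.p) (i := i) (j := j)
  have hr := X.forest.range i h0 hN
  constructor
  · intro h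
    refine ((X.anc_iff_subset h0 hN h0' hN').1 (h1.2 (Or.inr h))).ssubset_of_ne fun he => ?_
    have := X.set_inj h0 hN h0' hN' he
    subst this
    have hp : 0 ≤ X.p i := by
      by_contra hp
      rw [show X.p i = -1 by omega] at h
      have := X.forest.anc_root h
      omega
    have h2 := X.forest.sz_lt i h0 hN hp
    have h3 := X.forest.anc_sz (by omega) hr.2 h0 h
    omega
  · intro h
    refine (h1.1 ((X.anc_iff_subset h0 hN h0' hN').2 h.subset)).resolve_left ?_
    rintro rfl
    exact h.ne rfl

end Laid

/-! ### Numbering and pointers of the merged tree -/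

section MergedTree

variable {n L : ℕ} (X Y : Laid n L) (zY kX kY : ℤ → ℤ)

/-- `B` is the set of the node with number `i` of the merged tree. -/
def IsNode (i : ℤ) (B : Finset (Fin n)) : Prop :=
  (∃ U : ℕ, U < X.N ∧ kX U = 1 ∧ i = rank kX U ∧ B = X.set U) ∨
    ∃ W : ℕ, W < Y.N ∧ dedup X Y zY kX kY W = 1 ∧
      i = rank kX X.N + rank (dedup X Y zY kX kY) W ∧ B = Y.set W

/-- The number of nodes of the merged tree. -/
noncomputable def mergedSize : ℤ := rank kX X.N + rank (dedup X Y zY kX kY) Y.N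

variable {X Y zY kX kY} (hkX : ∀ j : ℕ, j < X.N → kX j = 0 ∨ kX j = 1)
  (hkY : ∀ j : ℕ, j < Y.N → kY j = 0 ∨ kY j = 1)

include hkX hkY

theorem IsNode.range {i : ℤ} {B : Finset (Fin n)} (h : IsNode X Y zY kX kY i B) :
    0 ≤ i ∧ i < mergedSize X Y zY kX kY := by
  have hk' := dedup_range (X := X) (zY := zY) (kX := kX) hkY
  unfold mergedSize
  rcases h with ⟨U, hU, hk, rfl, -⟩ | ⟨W, hW, hk, rfl, -⟩
  · have h1 := rank_nonneg hkX (i := U) (by omega)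
    have h2 := rank_lt hkX (i := U) (j := X.N) (by omega) hk (by omega) le_rfl
    have h3 := rank_nonneg hk' (i := Y.N) le_rfl
    omega
  · have h1 := rank_nonneg hk' (i := W) (by omega)
    have h2 := rank_lt hk' (i := W) (j := Y.N) (by omega) hk (by omega) le_rfl
    have h3 := rank_nonneg hkX (i := X.N) le_rfl
    omega

theorem exists_isNode {i : ℤ} (h0 : 0 ≤ i) (h1 : i < mergedSize X Y zY kX kY) :
    ∃ B, IsNode X Y zY kX kY i B := by
  have hk' := dedup_range (X := X) (zY := zY) (kX := kX) hkY
  unfold mergedSize at h1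
  by_cases h : i < rank kX X.N
  · obtain ⟨U, a, b, c⟩ := exists_rank hkX h0 h
    exact ⟨_, Or.inl ⟨U, a, b, c.symm, rfl⟩⟩
  · obtain ⟨W, a, b, c⟩ := exists_rank hk' (r := i - rank kX X.N) (by omega) (by omega)
    exact ⟨_, Or.inr ⟨W, a, b, by omega, rfl⟩⟩

theorem IsNode.unique {i : ℤ} {B B' : Finset (Fin n)} (h : IsNode X Y zY kX kY i B)
    (h' : IsNode X Y zY kX kY i B') : B = B' := by
  have hk' := dedup_range (X := X) (zY := zY) (kX := kX) hkY
  rcases h with ⟨U, hU, hk, rfl, rfl⟩ | ⟨W, hW, hk, rfl, rfl⟩ <;>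
  rcases h' with ⟨U', hU', hk2, he, rfl⟩ | ⟨W', hW', hk2, he, rfl⟩
  · rw [rank_inj hkX (by omega) (by omega) (by omega) (by omega) hk hk2 he]
  · have h2 := rank_lt hkX (i := U) (j := X.N) (by omega) hk (by omega) le_rfl
    have h3 := rank_nonneg hk' (i := W') (by omega)
    omega
  · have h2 := rank_lt hkX (i := U') (j := X.N) (by omega) hk2 (by omega) le_rfl
    have h3 := rank_nonneg hk' (i := W) (by omega)
    omega
  · rw [rank_inj hk' (by omega) (by omega) (by omega) (by omega) hk hk2 (by omega)]

-- If the two sets were equal, the smallest superset of `W` in `X` would be `U` itself, flagged and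
-- of the same size, and `dedup` would have switched `W` off.
omit hkX hkY in
theorem dedup_ne (hzY : Y.Supersets X zY) {U W : ℕ} (hU : U < X.N) (hW : W < Y.N) (hkU : kX U = 1)
    (hkW : dedup X Y zY kX kY W = 1) : X.set U ≠ Y.set W := by
  intro h
  obtain ⟨z0, z1, z2⟩ := hzY W (by omega) (by omega)
  have h1 := (z2 U (by omega) (by omega)).2 ((Y.sub_iff X).2 h.symm.subset)
  have h2 : 0 ≤ zY W := by
    by_contra hn
    rw [show zY W = -1 by omega] at h1
    have := X.forest.anc_root h1
    omega
  have h3 := (X.anc_iff_subset h2 z1 (by omega) (by omega)).1 h1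
  have h4 := (Y.sub_iff X).1 ((z2 _ h2 z1).1 (Anc.refl _ _))
  have h5 : X.set (zY W) = X.set U := h3.antisymm (h ▸ h4)
  have h6 := X.set_inj h2 z1 (by omega) (by omega) h5
  rw [dedup, if_pos] at hkW
  · omega
  · refine ⟨h2, by rw [h6, hkU], ?_⟩
    rw [h6, ← X.card_set (by omega) (by omega), ← Y.card_set (by omega) (by omega), h]

omit hkX hkY in
theorem IsNode.inj (hzY : Y.Supersets X zY) {i j : ℤ} {B : Finset (Fin n)}
    (h : IsNode X Y zY kX kY i B) (h' : IsNode X Y zY kX kY j B) : i = j := by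
  rcases h with ⟨U, hU, hk, rfl, rfl⟩ | ⟨W, hW, hk, rfl, rfl⟩ <;>
  rcases h' with ⟨U', hU', hk2, rfl, he⟩ | ⟨W', hW', hk2, rfl, he⟩
  · rw [X.set_inj (by omega) (by omega) (by omega) (by omega) he]
  · exact absurd he (dedup_ne hzY hU hW' hk hk2)
  · exact absurd he.symm (dedup_ne hzY hU' hW hk2 hk)
  · rw [Y.set_inj (by omega) (by omega) (by omega) (by omega) he]

omit hkX hkY in
/-- The pointer chosen by `pick` leads to the smallest set with property `Q`. -/
theorem pick_smallest {gX gY : ℤ → ℤ} (hgX : Nearest X.N X.p (fun j => kX j = 1) gX)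
    (hgY : Nearest Y.N Y.p (fun j => dedup X Y zY kX kY j = 1) gY)
    (hlam : ∀ U W : ℕ, U < X.N → W < Y.N → kX U = 1 → dedup X Y zY kX kY W = 1 → ∀ v ∈ X.set U,
      v ∈ Y.set W → X.set U ⊆ Y.set W ∨ Y.set W ⊆ X.set U)
    {c d : ℤ} (hc : -1 ≤ c ∧ c < X.N) (hd : -1 ≤ d ∧ d < Y.N) {v : Fin n} {Q : Finset (Fin n) → Prop}
    (hQ : ∀ B, Q B → v ∈ B)
    (hcQ : ∀ U : ℕ, U < X.N → kX U = 1 → (Anc X.p c U ↔ Q (X.set U)))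
    (hdQ : ∀ W : ℕ, W < Y.N → dedup X Y zY kX kY W = 1 → (Anc Y.p d W ↔ Q (Y.set W))) :
    (pick X Y kX (dedup X Y zY kX kY) (gX c) (gY d) = -1 ∧
      ∀ i B, IsNode X Y zY kX kY i B → ¬ Q B) ∨
    ∃ B, IsNode X Y zY kX kY (pick X Y kX (dedup X Y zY kX kY) (gX c) (gY d)) B ∧ Q B ∧
      ∀ i B', IsNode X Y zY kX kY i B' → Q B' → B ⊆ B' := by
  have sX : ∀ j : ℤ, 0 ≤ j → j < X.N → X.size j = (X.set j).card := fun j a b => by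
    rw [X.card_set a b, Laid.size, if_neg (by omega)]
  have sY : ∀ j : ℤ, 0 ≤ j → j < Y.N → Y.size j = (Y.set j).card := fun j a b => by
    rw [Y.card_set a b, Laid.size, if_neg (by omega)]
  have hcard : ∀ B : Finset (Fin n), B.card ≤ n := fun B => (Finset.card_le_univ B).trans (by simp)
  have nX : X.size (-1) = 2 * n + 2 := by simp [Laid.size]
  have nY : Y.size (-1) = 2 * n + 2 := by simp [Laid.size]
  unfold pick
  rcases hgX c hc.1 hc.2 with ⟨ex, hx⟩ | ⟨x0, x1, xk, xa, hx⟩ <;>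
  rcases hgY d hd.1 hd.2 with ⟨ey, hy⟩ | ⟨y0, y1, yk, ya, hy⟩
  · left
    rw [ex, ey, nX, nY, if_neg (by omega), if_pos (by omega)]
    refine ⟨rfl, ?_⟩
    rintro i B (⟨U, hU, hk, rfl, rfl⟩ | ⟨W, hW, hk, rfl, rfl⟩) hB
    · exact hx U (by omega) hk ((hcQ U hU hk).2 hB)
    · exact hy W (by omega) hk ((hdQ W hW hk).2 hB)
  · right
    obtain ⟨y, ey⟩ := Int.eq_ofNat_of_zero_le y0
    rw [ey] at y0 y1 yk ya hy ⊢
    have := hcard (Y.set y)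
    rw [ex, nX, sY y y0 y1, if_neg (by omega), if_neg (by omega)]
    refine ⟨Y.set y, Or.inr ⟨y, by omega, yk, rfl, rfl⟩, (hdQ y (by omega) yk).1 ya, ?_⟩
    rintro i B (⟨U, hU, hk, rfl, rfl⟩ | ⟨W, hW, hk, rfl, rfl⟩) hB
    · exact absurd ((hcQ U hU hk).2 hB) (hx U (by omega) hk)
    · exact (Y.anc_iff_subset y0 y1 (by omega) (by omega)).1
        (hy W (by omega) hk ((hdQ W hW hk).2 hB))
  · right
    obtain ⟨x, ex⟩ := Int.eq_ofNat_of_zero_le x0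
    rw [ex] at x0 x1 xk xa hx ⊢
    have := hcard (X.set x)
    rw [ey, nY, sX x x0 x1, if_pos (by omega)]
    refine ⟨X.set x, Or.inl ⟨x, by omega, xk, rfl, rfl⟩, (hcQ x (by omega) xk).1 xa, ?_⟩
    rintro i B (⟨U, hU, hk, rfl, rfl⟩ | ⟨W, hW, hk, rfl, rfl⟩) hB
    · exact (X.anc_iff_subset x0 x1 (by omega) (by omega)).1
        (hx U (by omega) hk ((hcQ U hU hk).2 hB))
    · exact absurd ((hdQ W hW hk).2 hB) (hy W (by omega) hk)
  · right
    obtain ⟨x, ex⟩ := Int.eq_ofNat_of_zero_le x0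
    obtain ⟨y, ey⟩ := Int.eq_ofNat_of_zero_le y0
    rw [ex] at x0 x1 xk xa hx ⊢
    rw [ey] at y0 y1 yk ya hy ⊢
    have Qx := (hcQ x (by omega) xk).1 xa
    have Qy := (hdQ y (by omega) yk).1 ya
    have hX' : ∀ U : ℕ, U < X.N → kX U = 1 → Q (X.set U) → X.set x ⊆ X.set U := fun U hU hk hB =>
      (X.anc_iff_subset x0 x1 (by omega) (by omega)).1 (hx U (by omega) hk ((hcQ U hU hk).2 hB))
    have hY' : ∀ W : ℕ, W < Y.N → dedup X Y zY kX kY W = 1 → Q (Y.set W) → Y.set y ⊆ Y.set W :=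
      fun W hW hk hB => (Y.anc_iff_subset y0 y1 (by omega) (by omega)).1
        (hy W (by omega) hk ((hdQ W hW hk).2 hB))
    -- Both candidates contain `v`, so they are nested, and comparing cardinalities tells which lies
    -- inside which. The smaller one is contained in every admissible set of its own tree and,
    -- through the other candidate, in those of the other tree.
    have hnest := hlam x y (by omega) (by omega) xk yk v (hQ _ Qx) (hQ _ Qy)
    rw [sX x x0 x1, sY y y0 y1]
    by_cases hlt : ((X.set x).card : ℤ) < (Y.set y).card
    · have hxy : X.set x ⊆ Y.set y := hnest.resolve_right fun h => by
        have := Finset.card_le_card h; omega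
      rw [if_pos hlt]
      refine ⟨X.set x, Or.inl ⟨x, by omega, xk, rfl, rfl⟩, Qx, ?_⟩
      rintro i B (⟨U, hU, hk, rfl, rfl⟩ | ⟨W, hW, hk, rfl, rfl⟩) hB
      · exact hX' U hU hk hB
      · exact hxy.trans (hY' W hW hk hB)
    · have hyx : Y.set y ⊆ X.set x := by
        rcases hnest with h | h
        · rw [Finset.eq_of_subset_of_card_le h (by omega)]
        · exact h
      rw [if_neg hlt, if_neg (by omega)]
      refine ⟨Y.set y, Or.inr ⟨y, by omega, yk, rfl, rfl⟩, Qy, ?_⟩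
      rintro i B (⟨U, hU, hk, rfl, rfl⟩ | ⟨W, hW, hk, rfl, rfl⟩) hB
      · exact hyx.trans (hX' U hU hk hB)
      · exact hY' W hW hk hB

end MergedTree

/-- The node with a given code. -/
def decode (k : ℕ) (z : ℤ) : Option (Fin k) :=
  if h : 0 ≤ z ∧ z < k then some ⟨z.toNat, by omega⟩ else none

theorem code_decode {k : ℕ} {z : ℤ} (h0 : -1 ≤ z) (h1 : z < k) : code (decode k z) = z := by
  unfold decode
  split
  · simp only [code]; omega
  · simp only [code]; omega

theorem decode_eq_some {k : ℕ} {z : ℤ} {i : Fin k} : decode k z = some i ↔ z = ((i : ℕ) : ℤ) := by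
  unfold decode
  have := i.2
  split
  · rw [Option.some_inj, Fin.ext_iff]
    simp only
    omega
  · constructor
    · intro h; cases h
    · intro h; omega

/-- Both kinds of pointers are instances of `pick_smallest`: for a parent the property is to be a
proper superset of the set of the node, for a home it is to contain the vertex. Then
`nodeSet_eq_of_smallest` identifies the sets of the nodes. -/
theorem exists_tree_of_merged {n L : ℕ} {X Y : Laid n L} {zX zY kX kY gX gY : ℤ → ℤ} {s : Mem}
    (hkX : ∀ j : ℕ, j < X.N → kX j = 0 ∨ kX j = 1) (hkY : ∀ j : ℕ, j < Y.N → kY j = 0 ∨ kY j = 1)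
    (hzX : X.Supersets Y zX) (hzY : Y.Supersets X zY)
    (hgX : Nearest X.N X.p (fun j => kX j = 1) gX)
    (hgY : Nearest Y.N Y.p (fun j => dedup X Y zY kX kY j = 1) gY)
    (hlam : ∀ U W : ℕ, U < X.N → W < Y.N → kX U = 1 → kY W = 1 → ∀ v ∈ X.set U,
      v ∈ Y.set W → X.set U ⊆ Y.set W ∨ Y.set W ⊆ X.set U)
    (hv : s.var 4 = rank kX X.N + rank (dedup X Y zY kX kY) Y.N)
    (hm : Merged X Y zX zY kX kY gX gY s) {F : Finset (Finset (Fin n))}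
    (hF : ∀ B, B ∈ F ↔ (∃ U : ℕ, U < X.N ∧ kX U = 1 ∧ X.set U = B) ∨
      ∃ W : ℕ, W < Y.N ∧ kY W = 1 ∧ Y.set W = B) :
    ∃ R : LTree n, s.var 4 = R.size ∧ (∀ i : Fin R.size, s.arr 5 ((i : ℕ) : ℤ) = code (R.parent i)) ∧
      (∀ v : Fin n, s.arr 6 ((v : ℕ) : ℤ) = code (R.home v)) ∧ R.Represents F := by
  have hk' := dedup_range (X := X) (zY := zY) (kX := kX) hkY
  have hded : ∀ W : ℕ, dedup X Y zY kX kY W = 1 → kY W = 1 := by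
    intro W h; unfold dedup at h; split at h
    · omega
    · exact h
  obtain ⟨m5, m5', m6⟩ := hm
  set k : ℕ := (mergedSize X Y zY kX kY).toNat with hk
  have hk0 : (k : ℤ) = mergedSize X Y zY kX kY := by
    have h1 := rank_nonneg hkX (i := X.N) le_rfl
    have h2 := rank_nonneg hk' (i := Y.N) le_rfl
    unfold mergedSize at hk ⊢
    omega
  have hlam' : ∀ U W : ℕ, U < X.N → W < Y.N → kX U = 1 → dedup X Y zY kX kY W = 1 → ∀ v ∈ X.set U,
      v ∈ Y.set W → X.set U ⊆ Y.set W ∨ Y.set W ⊆ X.set U :=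
    fun U W a b c d => hlam U W a b c (hded W d)
  let R : LTree n := ⟨k, fun i => decode k (s.arr 5 ((i : ℕ) : ℤ)), fun v => decode k (s.arr 6 ((v : ℕ) : ℤ))⟩
  have hex : ∀ i : Fin k, ∃ B, IsNode X Y zY kX kY ((i : ℕ) : ℤ) B := fun i =>
    exists_isNode hkX hkY (by omega) (by have := i.2; omega)
  choose A hA using hex
  have hA' : ∀ (i : ℤ) B, IsNode X Y zY kX kY i B → ∃ j : Fin k, ((j : ℕ) : ℤ) = i ∧ A j = B := by
    intro i B h
    have hr := h.range hkX hkY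
    refine ⟨⟨i.toNat, by omega⟩, by simp [hr.1], ?_⟩
    refine IsNode.unique hkX hkY (hA _) ?_
    simpa [hr.1] using h
  have hpar : ∀ i : Fin k, (s.arr 5 ((i : ℕ) : ℤ) = -1 ∧
      ∀ j B, IsNode X Y zY kX kY j B → ¬ A i ⊂ B) ∨
      ∃ B, IsNode X Y zY kX kY (s.arr 5 ((i : ℕ) : ℤ)) B ∧ A i ⊂ B ∧
        ∀ j B', IsNode X Y zY kX kY j B' → A i ⊂ B' → B ⊆ B' := by
    intro i
    rcases hA i with ⟨U, hU, hkU, hi, he⟩ | ⟨W, hW, hkW, hi, he⟩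
    · rw [hi, m5 U hU hkU, he]
      -- Any vertex of the set lies in all its supersets; it serves to show that the candidates from
      -- the two trees meet.
      obtain ⟨v, hv⟩ := X.set_nonempty (j := U) (by omega) (by omega)
      obtain ⟨z0, z1, z2⟩ := hzX U (by omega) (by omega)
      refine pick_smallest hgX hgY hlam' (X.forest.range U (by omega) (by omega)) ⟨z0, z1⟩ (v := v)
        (fun B hB => hB.subset hv) (fun U' hU' hk' => ?_) fun W hW hkW => ?_
      · exact X.anc_parent_iff (by omega) (by omega) (by omega) (by omega)
      · rw [z2 W (by omega) (by omega), X.sub_iff Y]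
        exact ⟨fun h => h.ssubset_of_ne (dedup_ne hzY hU hW hkU hkW), fun h => h.subset⟩
    · rw [hi, m5' W hW hkW, he]
      obtain ⟨v, hv⟩ := Y.set_nonempty (j := W) (by omega) (by omega)
      obtain ⟨z0, z1, z2⟩ := hzY W (by omega) (by omega)
      refine pick_smallest hgX hgY hlam' ⟨z0, z1⟩ (Y.forest.range W (by omega) (by omega)) (v := v)
        (fun B hB => hB.subset hv) (fun U hU hkU => ?_) fun U' hU' hk' => ?_
      · rw [z2 U (by omega) (by omega), Y.sub_iff X]
        exact ⟨fun h => h.ssubset_of_ne (dedup_ne hzY hU hW hkU hkW).symm, fun h => h.subset⟩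
      · exact Y.anc_parent_iff (by omega) (by omega) (by omega) (by omega)
  have hhome : ∀ v : Fin n, (s.arr 6 ((v : ℕ) : ℤ) = -1 ∧
      ∀ j B, IsNode X Y zY kX kY j B → ¬ v ∈ B) ∨
      ∃ B, IsNode X Y zY kX kY (s.arr 6 ((v : ℕ) : ℤ)) B ∧ v ∈ B ∧
        ∀ j B', IsNode X Y zY kX kY j B' → v ∈ B' → B ⊆ B' := by
    intro v
    rw [m6 v v.2]
    exact pick_smallest hgX hgY hlam' (X.home_range v v.2) (Y.home_range v v.2) (v := v)
      (fun B hB => hB) (fun U _ _ => X.mem_set.symm) fun W _ _ => Y.mem_set.symm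
  have hrange : ∀ z : ℤ, (z = -1 ∨ ∃ B, IsNode X Y zY kX kY z B) → -1 ≤ z ∧ z < k := by
    rintro z (rfl | ⟨B, hB⟩)
    · omega
    · have := hB.range hkX hkY; omega
  have hr5 : ∀ i : Fin k, -1 ≤ s.arr 5 ((i : ℕ) : ℤ) ∧ s.arr 5 ((i : ℕ) : ℤ) < k := fun i =>
    hrange _ ((hpar i).imp (fun h => h.1) fun ⟨B, h, _⟩ => ⟨B, h⟩)
  have hr6 : ∀ v : Fin n, -1 ≤ s.arr 6 ((v : ℕ) : ℤ) ∧ s.arr 6 ((v : ℕ) : ℤ) < k := fun v =>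
    hrange _ ((hhome v).imp (fun h => h.1) fun ⟨B, h, _⟩ => ⟨B, h⟩)
  obtain ⟨hacyc, hset⟩ := LTree.nodeSet_eq_of_smallest (R := R) (A := A)
    (fun i j hij => Fin.ext (by
      have := IsNode.inj hzY (hA i) (hij ▸ hA j); exact_mod_cast this))
    (fun i hi j => by
      rcases hpar i with ⟨_, h⟩ | ⟨B, hB, _⟩
      · exact h _ _ (hA j)
      · obtain ⟨j', hj', -⟩ := hA' _ _ hB
        have h2 := decode_eq_some.2 hj'.symm
        rw [show decode k (s.arr 5 ((i : ℕ) : ℤ)) = none from hi] at h2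
        cases h2)
    (fun i j hij => by
      have hij' := decode_eq_some.1 hij
      rcases hpar i with ⟨h, _⟩ | ⟨B, hB, h1, h2⟩
      · omega
      · rw [hij'] at hB
        obtain rfl := IsNode.unique hkX hkY (hA j) hB
        exact ⟨h1, fun l hl => h2 _ _ (hA l) hl⟩)
    (fun v hvn i => by
      rcases hhome v with ⟨_, h⟩ | ⟨B, hB, _⟩
      · exact h _ _ (hA i)
      · obtain ⟨j', hj', -⟩ := hA' _ _ hB
        have h2 := decode_eq_some.2 hj'.symm
        rw [show decode k (s.arr 6 ((v : ℕ) : ℤ)) = none from hvn] at h2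
        cases h2)
    (fun v j hij => by
      have hij' := decode_eq_some.1 hij
      rcases hhome v with ⟨h, _⟩ | ⟨B, hB, h1, h2⟩
      · omega
      · rw [hij'] at hB
        obtain rfl := IsNode.unique hkX hkY (hA j) hB
        exact ⟨h1, fun l hl => h2 _ _ (hA l) hl⟩)
  refine ⟨R, by rw [hv]; exact hk0.symm, fun i => (code_decode (hr5 i).1 (hr5 i).2).symm,
    fun v => (code_decode (hr6 v).1 (hr6 v).2).symm, hacyc, fun i j hij => ?_, ?_⟩
  · rw [hset, hset] at hij
    exact Fin.ext (by have := IsNode.inj hzY (hA i) (hij ▸ hA j); exact_mod_cast this)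
  · ext B
    simp only [Set.mem_range, Finset.mem_coe, hF, hset]
    constructor
    · rintro ⟨i, rfl⟩
      rcases hA i with ⟨U, hU, hkU, hi, he⟩ | ⟨W, hW, hkW, hi, he⟩
      · exact Or.inl ⟨U, hU, hkU, he.symm⟩
      · exact Or.inr ⟨W, hW, hded W hkW, he.symm⟩
    · rintro (⟨U, hU, hkU, rfl⟩ | ⟨W, hW, hkW, rfl⟩)
      · obtain ⟨j, -, h⟩ := hA' _ _ (Or.inl ⟨U, hU, hkU, rfl, rfl⟩)
        exact ⟨j, h⟩
      · by_cases hd : dedup X Y zY kX kY W = 1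
        · obtain ⟨j, -, h⟩ := hA' _ _ (Or.inr ⟨W, hW, hd, rfl, rfl⟩)
          exact ⟨j, h⟩
        -- A node dropped by `dedup` is not lost: its superset `zY W` is flagged in `X` and has the
        -- same size, hence the same set.
        · have hd2 : 0 ≤ zY W ∧ kX (zY W) = 1 ∧ X.sz (zY W) = Y.sz W := by
            by_contra hc
            rw [dedup, if_neg hc] at hd
            exact hd hkW
          obtain ⟨h0, h1, h2⟩ := hd2
          obtain ⟨z0, z1, z2⟩ := hzY W (by omega) (by omega)
          have h4 := (Y.sub_iff X).1 ((z2 _ h0 z1).1 (Anc.refl _ _))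
          rw [← X.card_set h0 z1, ← Y.card_set (by omega) (by omega)] at h2
          have h5 := Finset.eq_of_subset_of_card_le h4 (by omega)
          obtain ⟨u, hu⟩ := Int.eq_ofNat_of_zero_le h0
          rw [hu] at h1 h5 z1
          obtain ⟨j, -, h⟩ := hA' _ _ (Or.inl ⟨u, by omega, h1, rfl, rfl⟩)
          exact ⟨j, h.trans h5.symm⟩

/-! ## Cuts and the set-level algorithm -/

namespace WGraph

variable {n : ℕ} (G : WGraph n)

/-- What the edge `e` contributes to the cut value of `S`. -/
def cutTerm (S : Finset (Fin n)) (e : WEdge n) : ℕ :=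
  if (e.src ∈ S ∧ e.tgt ∉ S) ∨ (e.src ∉ S ∧ e.tgt ∈ S) then e.wt else 0

theorem cut_eq_sum (S : Finset (Fin n)) : G.cut S = (G.edges.map (cutTerm S)).sum := by
  unfold cut
  induction G.edges with
  | nil => simp
  | cons e l ih =>
    by_cases h : (e.src ∈ S ∧ e.tgt ∉ S) ∨ (e.src ∉ S ∧ e.tgt ∈ S)
    · rw [List.filter_cons_of_pos (by simpa using h)]
      simp only [List.map_cons, List.sum_cons, ih]
      rw [cutTerm, if_pos h]
    · rw [List.filter_cons_of_neg (by simpa using h)]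
      simp only [List.map_cons, List.sum_cons, ih]
      rw [cutTerm, if_neg h, zero_add]

/-- Posimodularity of the cut function. It holds for each edge separately, by the sixteen cases for
the positions of the endpoints relative to `U` and `W`. -/
theorem cut_sdiff_add_cut_sdiff_le (U W : Finset (Fin n)) :
    G.cut (U \ W) + G.cut (W \ U) ≤ G.cut U + G.cut W := by
  simp only [cut_eq_sum]
  induction G.edges with
  | nil => simp
  | cons e l ih =>
    simp only [List.map_cons, List.sum_cons]
    suffices h : cutTerm (U \ W) e + cutTerm (W \ U) e ≤ cutTerm U e + cutTerm W e by omega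
    simp only [cutTerm, Finset.mem_sdiff]
    by_cases h1 : e.src ∈ U <;> by_cases h2 : e.src ∈ W <;> by_cases h3 : e.tgt ∈ U <;>
      by_cases h4 : e.tgt ∈ W <;> simp [h1, h2, h3, h4]

/-- If neither set contained the other, each would refute the other unless both strict inequalities
held, and their sum contradicts posimodularity. -/
theorem subset_or_subset_of_consistent {X Y : Finset (Finset (Fin n))} {U W : Finset (Fin n)}
    (hU : U ∈ X) (hW : W ∈ Y) (cU : G.Consistent U Y) (cW : G.Consistent W X)
    (h : (U ∩ W).Nonempty) : U ⊆ W ∨ W ⊆ U := by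
  by_contra! hc
  have h1 := cU W hW h (Finset.sdiff_nonempty.2 hc.1)
  have h2 := cW U hU (by rwa [Finset.inter_comm]) (Finset.sdiff_nonempty.2 hc.2)
  have := G.cut_sdiff_add_cut_sdiff_le U W
  omega

theorem verify_subset (X Y : Finset (Finset (Fin n))) : G.verify X Y ⊆ X := Finset.filter_subset _ _

theorem mem_verify {X Y : Finset (Finset (Fin n))} {U : Finset (Fin n)} :
    U ∈ G.verify X Y ↔ U ∈ X ∧ G.Consistent U Y := Finset.mem_filter

theorem isLaminar_verify_union {X Y : Finset (Finset (Fin n))} (hX : IsLaminar X)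
    (hY : IsLaminar Y) : IsLaminar (G.verify X Y ∪ G.verify Y X) := by
  have key : ∀ U ∈ G.verify X Y, ∀ W ∈ G.verify Y X, Disjoint U W ∨ U ⊆ W ∨ W ⊆ U := by
    intro U hU W hW
    rw [mem_verify] at hU hW
    by_cases h : Disjoint U W
    · exact Or.inl h
    · exact Or.inr (G.subset_or_subset_of_consistent hU.1 hW.1 hU.2 hW.2
        (Finset.not_disjoint_iff_nonempty_inter.1 h))
  refine ⟨fun A hA => ?_, fun A hA B hB => ?_⟩
  · rcases Finset.mem_union.1 hA with h | h
    · exact hX.1 A (G.verify_subset X Y h)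
    · exact hY.1 A (G.verify_subset Y X h)
  · rcases Finset.mem_union.1 hA with h | h <;> rcases Finset.mem_union.1 hB with h' | h'
    · exact hX.2 A (G.verify_subset X Y h) B (G.verify_subset X Y h')
    · exact key A h B h'
    · rcases key B h' A h with h1 | h1 | h1
      · exact Or.inl h1.symm
      · exact Or.inr (Or.inr h1)
      · exact Or.inr (Or.inl h1)
    · exact hY.2 A (G.verify_subset Y X h) B (G.verify_subset Y X h')

/-- The set `U ∖ W` is a nonempty proper subset of `U`, so extremeness applies to it directly. A
singleton cannot both meet `W` and stick out of it. -/
theorem IsExtreme.consistent {G : WGraph n} {U : Finset (Fin n)} (h : G.IsExtreme U)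
    (Y : Finset (Finset (Fin n))) : G.Consistent U Y := by
  intro W _ h1 h2
  rcases h with h | h
  · obtain ⟨a, ha⟩ := h1
    obtain ⟨b, hb⟩ := h2
    rw [Finset.mem_inter] at ha
    rw [Finset.mem_sdiff] at hb
    have := Finset.card_le_one.1 h.le a ha.1 b hb.1
    exact absurd (this ▸ ha.2) hb.2
  · refine h.2.2 _ h2 ⟨Finset.sdiff_subset, fun hs => ?_⟩
    obtain ⟨a, ha⟩ := h1
    rw [Finset.mem_inter] at ha
    exact (Finset.mem_sdiff.1 (hs ha.1)).2 ha.2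

theorem mem_verify_union_of_isExtreme {X Y : Finset (Finset (Fin n))} {U : Finset (Fin n)}
    (hU : U ∈ X ∪ Y) (h : G.IsExtreme U) : U ∈ G.verify X Y ∪ G.verify Y X := by
  rw [Finset.mem_union, mem_verify, mem_verify]
  rcases Finset.mem_union.1 hU with h' | h'
  · exact Or.inl ⟨h', h.consistent Y⟩
  · exact Or.inr ⟨h', h.consistent X⟩

end WGraph

/-! ### Order independence of `Verify` and the size of laminar families -/

section Boughs

variable {n : ℕ}

theorem IsBough.subset {F B : Finset (Finset (Fin n))} (h : IsBough F B) : B ⊆ F := by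
  obtain ⟨L, -, -, rfl⟩ := h
  exact Finset.filter_subset _ _

theorem IsBough.nonempty {F B : Finset (Finset (Fin n))} (h : IsBough F B) : B.Nonempty := by
  obtain ⟨L, hL, hc, rfl⟩ := h
  refine ⟨L, Finset.mem_filter.2 ⟨hL, subset_rfl, fun Z _ h1 h2 => ?_⟩⟩
  rw [Finset.Subset.antisymm h2 h1, hc]
  simp

/-- A member of least cardinality is a leaf, and every leaf starts a bough. -/
theorem exists_isBough {F : Finset (Finset (Fin n))} (h : F.Nonempty) : ∃ B, IsBough F B := by
  obtain ⟨L, hL, hmin⟩ := F.exists_min_image Finset.card h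
  refine ⟨_, L, hL, ?_, rfl⟩
  refine Finset.filter_eq_empty_iff.2 fun Z hZ hc => ?_
  have := Finset.card_lt_card hc.1
  have := hmin Z hZ
  omega

/-- Membership in the output depends only on `U` and the fixed family `Y`, so processing a bough
merely moves its consistent members from the waiting side to the output. The shape of a bough
matters only for termination. -/
theorem WGraph.verifyStep_invariant {G : WGraph n} {Y : Finset (Finset (Fin n))}
    {p q : Finset (Finset (Fin n)) × Finset (Finset (Fin n))} (h : G.VerifyStep Y p q) :
    q.2 ∪ G.verify q.1 Y = p.2 ∪ G.verify p.1 Y := by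
  obtain ⟨B, hB, h1, h2⟩ := h
  have hs := hB.subset
  ext U
  simp only [h1, h2, Finset.mem_union, mem_verify, Finset.mem_filter, Finset.mem_sdiff]
  have := @hs U
  tauto

theorem WGraph.exists_verifyReturns (G : WGraph n) (Y : Finset (Finset (Fin n))) :
    ∀ (k : ℕ) (X O : Finset (Finset (Fin n))), X.card ≤ k →
      ∃ A, Relation.ReflTransGen (G.VerifyStep Y) (X, O) (∅, A) := by
  intro k
  induction k with
  | zero =>
    intro X O h
    rw [Nat.le_zero, Finset.card_eq_zero] at h
    exact ⟨O, by rw [h]⟩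
  | succ k ih =>
    intro X O h
    rcases X.eq_empty_or_nonempty with rfl | hX
    · exact ⟨O, Relation.ReflTransGen.refl⟩
    obtain ⟨B, hB⟩ := exists_isBough hX
    have hlt : (X \ B).card < X.card := Finset.card_lt_card
      (Finset.sdiff_ssubset hB.subset hB.nonempty)
    obtain ⟨A, hA⟩ := ih (X \ B) (O ∪ B.filter (fun U => G.Consistent U Y)) (by omega)
    exact ⟨A, Relation.ReflTransGen.head ⟨B, hB, rfl, rfl⟩ hA⟩

theorem WGraph.verifyReturns_iff (G : WGraph n) (X Y A : Finset (Finset (Fin n))) :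
    G.VerifyReturns X Y A ↔ A = G.verify X Y := by
  have key : ∀ A, G.VerifyReturns X Y A → A = G.verify X Y := by
    intro A h
    have hinv : ∀ q, Relation.ReflTransGen (G.VerifyStep Y) (X, ∅) q →
        q.2 ∪ G.verify q.1 Y = G.verify X Y := by
      intro q hq
      induction hq with
      | refl => simp
      | tail _ hs ih => rw [verifyStep_invariant hs, ih]
    have := hinv _ h
    simpa [verify] using this
  refine ⟨key A, ?_⟩
  rintro rfl
  -- Some run exists, and by the first implication its output is already the prescribed set.
  obtain ⟨A, hA⟩ := G.exists_verifyReturns Y X.card X ∅ le_rfl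
  exact key A hA ▸ hA

/-- Induction on the ground set: delete a vertex `v` from all members. The family stays laminar and
loses at most two members, namely `{v}`, which becomes empty, and a set that collapses onto another
member. -/
theorem IsLaminar.card_le_of_subset (S : Finset (Fin n)) : ∀ F : Finset (Finset (Fin n)),
    IsLaminar F → (∀ A ∈ F, A ⊆ S) → F.card ≤ 2 * S.card := by
  induction S using Finset.induction_on with
  | empty =>
    intro F hF h
    rw [Finset.card_empty, mul_zero, Nat.le_zero, Finset.card_eq_zero]
    exact Finset.eq_empty_of_forall_notMem fun A hA =>
      (hF.1 A hA).ne_empty (Finset.subset_empty.1 (h A hA))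
  | insert v S hv ih =>
    intro F hF h
    set D := F.filter fun A => v ∈ A ∧ A.erase v ∈ F with hD
    set H := F.filter fun A => A ≠ {v} ∧ ¬ (v ∈ A ∧ A.erase v ∈ F) with hH
    -- Members of `D` share `v`, so they are nested. If `A ⊆ B` are both in `D`, the member `B.erase
    -- v` meets `A` and does not contain it, because `v ∈ A`; by laminarity `B.erase v ⊆ A`, and so
    -- `A = B`.
    have hD1 : D.card ≤ 1 := by
      have key : ∀ A ∈ D, ∀ B ∈ D, A ⊆ B → A = B := by
        intro A hA B hB hs
        rw [hD, Finset.mem_filter] at hA hB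
        obtain ⟨a, ha⟩ := hF.1 _ hA.2.2
        have ha' := Finset.mem_erase.1 ha
        rcases hF.2 A hA.1 _ hB.2.2 with h1 | h1 | h1
        · exact absurd (Finset.mem_erase.2 ⟨ha'.1, hs ha'.2⟩) (Finset.disjoint_left.1 h1 ha'.2)
        · exact absurd (h1 hA.2.1) (Finset.notMem_erase v B)
        · refine hs.antisymm fun x hx => ?_
          by_cases hxv : x = v
          · rw [hxv]; exact hA.2.1
          · exact h1 (Finset.mem_erase.2 ⟨hxv, hx⟩)
      refine Finset.card_le_one.2 fun A hA B hB => ?_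
      have hA' := Finset.mem_filter.1 hA
      have hB' := Finset.mem_filter.1 hB
      rcases hF.2 A hA'.1 B hB'.1 with h1 | h1 | h1
      · exact absurd hB'.2.1 (Finset.disjoint_left.1 h1 hA'.2.1)
      · exact key A hA B hB h1
      · exact (key B hB A hA h1).symm
    have hcard : F.card ≤ H.card + 2 := by
      have hs : F ⊆ H ∪ ({{v}} ∪ D) := by
        intro A hA
        simp only [hH, hD, Finset.mem_union, Finset.mem_filter, Finset.mem_singleton]
        tauto
      have h1 := Finset.card_le_card hs
      have h2 := Finset.card_union_le H ({{v}} ∪ D)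
      have h3 := Finset.card_union_le {{v}} D
      rw [Finset.card_singleton] at h3
      omega
    -- Two members of `H` with the same image can differ only in `v`; then one would be the other
    -- with `v` erased, and `H` excludes such sets.
    have hinj : Set.InjOn (fun A : Finset (Fin n) => A.erase v) H := by
      have key : ∀ A ∈ H, ∀ B ∈ H, A.erase v = B.erase v → v ∈ A → v ∈ B := by
        intro A hA B hB hAB hvA
        rw [hH, Finset.mem_filter] at hA hB
        by_contra hvB
        rw [Finset.erase_eq_of_notMem hvB] at hAB
        exact hA.2.2 ⟨hvA, hAB ▸ hB.1⟩
      intro A hA B hB hAB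
      have h1 := key A hA B hB hAB
      have h2 := key B hB A hA hAB.symm
      by_cases hvA : v ∈ A
      · rw [← Finset.insert_erase hvA, ← Finset.insert_erase (h1 hvA)]
        exact congrArg (insert v) hAB
      · have hvB : v ∉ B := fun hc => hvA (h2 hc)
        simpa [Finset.erase_eq_of_notMem hvA, Finset.erase_eq_of_notMem hvB] using hAB
    have hHF : ∀ A ∈ H, A ∈ F := fun A hA => (Finset.mem_filter.1 hA).1
    have := ih (H.image fun A => A.erase v) ⟨fun A hA => ?_, fun A hA B hB => ?_⟩ fun A hA => ?_
    · rw [Finset.card_image_of_injOn hinj] at this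
      rw [Finset.card_insert_of_notMem hv]
      omega
    · obtain ⟨A, hA', rfl⟩ := Finset.mem_image.1 hA
      rw [Finset.nonempty_iff_ne_empty, Ne, Finset.erase_eq_empty_iff, not_or]
      exact ⟨(hF.1 A (hHF A hA')).ne_empty, (Finset.mem_filter.1 hA').2.1⟩
    · obtain ⟨A, hA', rfl⟩ := Finset.mem_image.1 hA
      obtain ⟨B, hB', rfl⟩ := Finset.mem_image.1 hB
      rcases hF.2 A (hHF A hA') B (hHF B hB') with h1 | h1 | h1
      · exact Or.inl (Finset.disjoint_of_subset_left (Finset.erase_subset _ _)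
          (Finset.disjoint_of_subset_right (Finset.erase_subset _ _) h1))
      · exact Or.inr (Or.inl (Finset.erase_subset_erase v h1))
      · exact Or.inr (Or.inr (Finset.erase_subset_erase v h1))
    · obtain ⟨A, hA', rfl⟩ := Finset.mem_image.1 hA
      exact Finset.subset_insert_iff.1 (h A (hHF A hA'))

/-- A laminar family of nonempty sets is at most twice as large as the vertex set. -/
theorem IsLaminar.card_le {F : Finset (Finset (Fin n))} (hF : IsLaminar F) : F.card ≤ 2 * n := by
  simpa using IsLaminar.card_le_of_subset Finset.univ F hF fun A _ => Finset.subset_univ A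

end Boughs

/-! ## Trees as pointer arrays -/

theorem arrayOf_ofFn {k : ℕ} (f : Fin k → ℤ) (i : Fin k) :
    arrayOf (List.ofFn f) ((i : ℕ) : ℤ) = f i := by
  unfold arrayOf
  rw [if_pos (by omega)]
  simp

theorem code_range {k : ℕ} (o : Option (Fin k)) : -1 ≤ code o ∧ code o < k := by
  rcases o with _ | i
  · exact ⟨le_rfl, by simp only [code]; omega⟩
  · have := i.isLt
    simp only [code]; omega

namespace LTree

variable {n : ℕ} (T : LTree n)

/-- The parent pointers as a function on the integers. -/
def par (j : ℤ) : ℤ :=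
  if h : 0 ≤ j ∧ j < T.size then code (T.parent ⟨j.toNat, by omega⟩) else -1

/-- The home pointers as a function on the integers. -/
def homeCode (v : ℤ) : ℤ :=
  if h : 0 ≤ v ∧ v < n then code (T.home ⟨v.toNat, by omega⟩) else -1

theorem par_coe (i : Fin T.size) : T.par ((i : ℕ) : ℤ) = code (T.parent i) := by
  have := i.isLt
  rw [par, dif_pos ⟨by omega, by omega⟩]
  rfl

theorem homeCode_coe (v : Fin n) : T.homeCode ((v : ℕ) : ℤ) = code (T.home v) := by
  have := v.isLt
  rw [homeCode, dif_pos ⟨by omega, by omega⟩]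
  rfl

theorem par_neg_one : T.par (-1) = -1 := by rw [par, dif_neg (by omega)]

theorem anc_coe_iff {i j : Fin T.size} :
    Anc T.par ((i : ℕ) : ℤ) ((j : ℕ) : ℤ) ↔ T.Below i j := by
  constructor
  · rintro ⟨k, hk⟩
    induction k generalizing i with
    | zero =>
      have : i = j := by
        rw [Function.iterate_zero, id, Nat.cast_inj] at hk
        exact Fin.ext hk
      rw [this]
      exact Relation.ReflTransGen.refl
    | succ k ih =>
      rw [Function.iterate_succ_apply, par_coe] at hk
      rcases h : T.parent i with _ | a
      · rw [h, code, Function.iterate_fixed T.par_neg_one] at hk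
        omega
      · rw [h, code] at hk
        exact Relation.ReflTransGen.head h (ih hk)
  · intro h
    induction h using Relation.ReflTransGen.head_induction_on with
    | refl => exact Anc.refl _ _
    | head h _ ih =>
      refine anc_iff.2 (Or.inr ?_)
      rwa [par_coe, h]

theorem mem_nodeSet {v : Fin n} {j : Fin T.size} :
    v ∈ T.nodeSet j ↔ Anc T.par (T.homeCode ((v : ℕ) : ℤ)) ((j : ℕ) : ℤ) := by
  simp only [nodeSet, Finset.mem_filter, Finset.mem_univ, true_and, homeCode_coe]
  rcases h : T.home v with _ | a
  · constructor
    · rintro ⟨a, h', -⟩; cases h'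
    · rintro ⟨k, hk⟩
      rw [code, Function.iterate_fixed T.par_neg_one] at hk
      omega
  · simp only [code, anc_coe_iff]
    constructor
    · rintro ⟨b, hb, h'⟩; cases hb; exact h'
    · exact fun h' => ⟨a, rfl, h'⟩

/-- The number of vertices of a node. -/
noncomputable def count (j : ℤ) : ℤ :=
  ∑ v ∈ Finset.range n, ind (Anc T.par (T.homeCode v) j)

theorem count_coe (j : Fin T.size) : T.count ((j : ℕ) : ℤ) = (T.nodeSet j).card := by
  unfold count
  rw [Finset.sum_range fun v : ℕ => ind (Anc T.par (T.homeCode v) ((j : ℕ) : ℤ)),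
    Finset.card_eq_sum_ones, Nat.cast_sum, ← Finset.sum_subset (Finset.subset_univ (T.nodeSet j))]
  · exact Finset.sum_congr rfl fun v hv => by rw [ind_true (T.mem_nodeSet.1 hv), Nat.cast_one]
  · exact fun v _ hv => ind_false fun h => hv (T.mem_nodeSet.2 h)

variable {T}

theorem nodeSet_subset {i j : Fin T.size} (h : T.parent i = some j) :
    T.nodeSet i ⊆ T.nodeSet j := by
  intro v hv
  rw [mem_nodeSet] at hv ⊢
  refine hv.trans (T.anc_coe_iff.2 (Relation.ReflTransGen.single h))

namespace Represents

variable {F : Finset (Finset (Fin n))}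

theorem nodeSet_mem (hT : T.Represents F) (i : Fin T.size) : T.nodeSet i ∈ F := by
  have : T.nodeSet i ∈ Set.range T.nodeSet := ⟨i, rfl⟩
  rw [hT.range_eq] at this
  exact this

theorem mem_iff (hT : T.Represents F) {A : Finset (Fin n)} : A ∈ F ↔ ∃ i, T.nodeSet i = A := by
  rw [← Finset.mem_coe, ← hT.range_eq, Set.mem_range]

theorem size_eq (hT : T.Represents F) : T.size = F.card := by
  have h : F = Finset.univ.image T.nodeSet := by
    ext A
    simp [hT.mem_iff]
  rw [h, Finset.card_image_of_injective _ hT.injective, Finset.card_univ, Fintype.card_fin]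

/-- A common vertex would make the siblings comparable, and a node below its own sibling closes a
cycle through their common parent. -/
theorem disjoint_nodeSet (hT : T.Represents F) {i j k : Fin T.size} (hij : i ≠ j) (hi : T.parent i = some k)
    (hj : T.parent j = some k) : Disjoint (T.nodeSet i) (T.nodeSet j) := by
  have key : ∀ i j : Fin T.size, i ≠ j → T.parent i = some k → T.parent j = some k →
      ¬ T.Below i j := by
    intro i j hij hi hj h
    rcases Relation.ReflTransGen.cases_head h with h | ⟨c, hc, h⟩
    · exact hij h
    · rw [hi, Option.some.injEq] at hc
      subst hc
      exact hT.acyclic j (Relation.TransGen.head' hj h)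
  rw [Finset.disjoint_left]
  intro v hv hv'
  rcases (T.mem_nodeSet.1 hv).comparable (T.mem_nodeSet.1 hv') with h | h
  · exact key i j hij hi hj (T.anc_coe_iff.1 h)
  · exact key j i hij.symm hj hi (T.anc_coe_iff.1 h)

/-- Injectivity of `nodeSet` makes sizes strictly increasing from child to parent, disjointness of
siblings gives additivity, and nonemptiness of the members gives positive sizes. -/
theorem forest (hT : T.Represents F) (hF : IsLaminar F) : Forest n T.size T.par T.count := by
  have lift : ∀ i : ℤ, 0 ≤ i → i < T.size → ∃ a : Fin T.size, i = ((a : ℕ) : ℤ) := fun i h0 h1 =>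
    ⟨⟨i.toNat, by omega⟩, by simp only; omega⟩
  have parent : ∀ a : Fin T.size, 0 ≤ T.par ((a : ℕ) : ℤ) → ∃ b, T.parent a = some b := by
    intro a h
    rcases hb : T.parent a with _ | b
    · rw [par_coe, hb, code] at h; omega
    · exact ⟨b, rfl⟩
  refine ⟨T.par_neg_one, ?_, ?_, ?_, ?_, ?_⟩
  · intro i h0 h1
    obtain ⟨a, rfl⟩ := lift i h0 h1
    rw [par_coe]
    exact code_range _
  · intro i h0 h1
    obtain ⟨a, rfl⟩ := lift i h0 h1
    rw [count_coe]
    exact_mod_cast (hF.1 _ (hT.nodeSet_mem a)).card_pos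
  · intro i h0 h1
    obtain ⟨a, rfl⟩ := lift i h0 h1
    rw [count_coe]
    exact_mod_cast (Finset.card_le_univ _).trans_eq (Fintype.card_fin n)
  · intro i h0 h1 h
    obtain ⟨a, rfl⟩ := lift i h0 h1
    obtain ⟨b, hb⟩ := parent a h
    rw [par_coe, hb, code, count_coe, count_coe]
    refine Nat.cast_lt.2 (Finset.card_lt_card ((nodeSet_subset hb).ssubset_of_ne fun h' => ?_))
    have := hT.injective h'
    subst this
    exact hT.acyclic a (Relation.TransGen.single hb)
  · intro i j h0 h1 h0' h1' hij he h
    obtain ⟨a, rfl⟩ := lift i h0 h1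
    obtain ⟨a', rfl⟩ := lift j h0' h1'
    obtain ⟨b, hb⟩ := parent a h
    obtain ⟨b', hb'⟩ := parent a' (he ▸ h)
    rw [par_coe, par_coe, hb, hb', code, code, Nat.cast_inj] at he
    obtain rfl := Fin.ext he
    rw [par_coe, hb, code, count_coe, count_coe, count_coe, ← Nat.cast_add,
      ← Finset.card_union_of_disjoint (hT.disjoint_nodeSet (fun h => hij (by rw [h])) hb hb')]
    exact Nat.cast_le.2 (Finset.card_le_card
      (Finset.union_subset (nodeSet_subset hb) (nodeSet_subset hb')))

end Represents

theorem homeCode_range (v : ℕ) (hv : v < n) : -1 ≤ T.homeCode v ∧ T.homeCode v < T.size := by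
  rw [T.homeCode_coe ⟨v, hv⟩]
  exact code_range _

/-- A tree with a layout. -/
noncomputable def laid {L : ℕ} {F : Finset (Finset (Fin n))} (hT : T.Represents F)
    (hF : IsLaminar F) {pos st en : ℤ → ℤ} (h : IsLayout T.size L T.par pos st en) : Laid n L where
  N := T.size
  p := T.par
  sz := T.count
  home := T.homeCode
  pos := pos
  st := st
  en := en
  forest := hT.forest hF
  home_range := homeCode_range
  sz_eq _ _ _ := rfl
  isLayout := h

theorem set_laid {L : ℕ} {F : Finset (Finset (Fin n))} (hT : T.Represents F) (hF : IsLaminar F)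
    {pos st en : ℤ → ℤ} (h : IsLayout T.size L T.par pos st en) (i : Fin T.size) :
    (laid hT hF h).set ((i : ℕ) : ℤ) = T.nodeSet i := by
  ext v
  rw [Laid.mem_set, mem_nodeSet]
  rfl

theorem mem_iff_exists_set_laid {L : ℕ} {F : Finset (Finset (Fin n))} (hT : T.Represents F)
    (hF : IsLaminar F) {pos st en : ℤ → ℤ} (h : IsLayout T.size L T.par pos st en)
    (A : Finset (Fin n)) :
    A ∈ F ↔ ∃ i : ℕ, i < (laid hT hF h).N ∧ (laid hT hF h).set i = A := by
  rw [hT.mem_iff]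
  constructor
  · rintro ⟨i, rfl⟩
    exact ⟨i, i.isLt, set_laid hT hF h i⟩
  · rintro ⟨i, hi, rfl⟩
    exact ⟨⟨i, hi⟩, (set_laid hT hF h ⟨i, hi⟩).symm⟩

end LTree

/-! ## Cut differences -/

namespace WGraph

variable {n : ℕ} (G : WGraph n)

/-- The edge list as functions of the index. -/
def toEdges : Edges n where
  m := G.m
  src e := if h : e < G.edges.length then G.edges[e].src else 0
  tgt e := if h : e < G.edges.length then G.edges[e].tgt else 0
  wt e := if h : e < G.edges.length then G.edges[e].wt else 0
  src_lt e h := by rw [dif_pos (show e < G.edges.length from h)]; exact Fin.isLt _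
  tgt_lt e h := by rw [dif_pos (show e < G.edges.length from h)]; exact Fin.isLt _

theorem src_toEdges {e : ℕ} (h : e < G.edges.length) : G.toEdges.src e = (G.edges[e].src : ℕ) :=
  dif_pos h

theorem tgt_toEdges {e : ℕ} (h : e < G.edges.length) : G.toEdges.tgt e = (G.edges[e].tgt : ℕ) :=
  dif_pos h

theorem wt_toEdges {e : ℕ} (h : e < G.edges.length) : G.toEdges.wt e = G.edges[e].wt :=
  dif_pos h

/-- The polynomial is an interpolation: it is `1` if both endpoints lie in `U` and exactly one in
`W`, it is `-1` if exactly one endpoint lies in `U` and that endpoint is in `W`, and it is `0`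
otherwise. -/
theorem wt_mul_gain {L : ℕ} (X Y : Laid n L) (U W : ℤ) (e : WEdge n) :
    e.wt * (2 * (ind (X.Mem e.src U) * ind (X.Mem e.tgt U)) *
      (ind (Y.Mem e.src W) + ind (Y.Mem e.tgt W) - ind (Y.Mem e.src W) * ind (Y.Mem e.tgt W)) -
      ind (X.Mem e.src U) * ind (Y.Mem e.src W) - ind (X.Mem e.tgt U) * ind (Y.Mem e.tgt W)) =
    (cutTerm (X.set U \ Y.set W) e : ℤ) - cutTerm (X.set U) e := by
  simp only [cutTerm, Finset.mem_sdiff, ← Laid.mem_set]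
  by_cases a : e.src ∈ X.set U <;> by_cases b : e.tgt ∈ X.set U <;>
    by_cases c : e.src ∈ Y.set W <;> by_cases d : e.tgt ∈ Y.set W <;>
    simp [a, b, c, d, ind_true, ind_false]

theorem gain_toEdges {L : ℕ} (X Y : Laid n L) (U W : ℤ) :
    X.gain G.toEdges Y U W = (G.cut (X.set U \ Y.set W) : ℤ) - G.cut (X.set U) := by
  have hcut : ∀ S, (G.cut S : ℤ) = ∑ i : Fin G.edges.length, (cutTerm S G.edges[i] : ℤ) := by
    intro S
    rw [cut_eq_sum, ← Fin.sum_univ_fun_getElem, Nat.cast_sum]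
    rfl
  rw [hcut, hcut, ← Finset.sum_sub_distrib, Laid.gain]
  rw [show G.toEdges.m = G.edges.length from rfl, Finset.sum_range]
  refine Finset.sum_congr rfl fun e _ => ?_
  rw [Laid.edgeGain, G.src_toEdges e.isLt, G.tgt_toEdges e.isLt, G.wt_toEdges e.isLt]
  exact wt_mul_gain X Y U W _

theorem consistent_toEdges_iff {L : ℕ} {X Y : Laid n L} {F : Finset (Finset (Fin n))}
    (hY : ∀ A, A ∈ F ↔ ∃ i : ℕ, i < Y.N ∧ Y.set i = A) (U : ℤ) :
    X.Consistent G.toEdges Y U ↔ G.Consistent (X.set U) F := by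
  have h1 : ∀ W : ℤ, X.inter Y U W ≠ 0 ↔ (X.set U ∩ Y.set W).Nonempty := by
    intro W
    rw [Ne, Laid.inter_eq_zero_iff]
    push Not
    constructor
    · rintro ⟨v, hv, h1, h2⟩
      exact ⟨⟨v, hv⟩, Finset.mem_inter.2 ⟨(X.mem_set).2 h1, (Y.mem_set).2 h2⟩⟩
    · rintro ⟨v, hv⟩
      rw [Finset.mem_inter, X.mem_set, Y.mem_set] at hv
      exact ⟨v, v.isLt, hv.1, hv.2⟩
  simp only [Laid.Consistent, WGraph.Consistent, h1, Laid.sub_iff, gain_toEdges,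
    ← Finset.sdiff_nonempty]
  constructor
  · intro h W hW h2 h3
    obtain ⟨i, hi, rfl⟩ := (hY W).1 hW
    have := h i hi h2 h3
    omega
  · intro h W hW h2 h3
    have := h (Y.set W) ((hY _).2 ⟨W, hW, rfl⟩) h2 h3
    omega

theorem marks_iff {L : ℕ} {X Y : Laid n L} {FX FY : Finset (Finset (Fin n))} {k : ℤ → ℤ}
    (hX : ∀ A, A ∈ FX ↔ ∃ i : ℕ, i < X.N ∧ X.set i = A)
    (hY : ∀ A, A ∈ FY ↔ ∃ i : ℕ, i < Y.N ∧ Y.set i = A) (hk : X.Marks G.toEdges Y k)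
    (A : Finset (Fin n)) :
    A ∈ G.verify FX FY ↔ ∃ U : ℕ, U < X.N ∧ k U = 1 ∧ X.set U = A := by
  rw [mem_verify, hX]
  constructor
  · rintro ⟨⟨i, hi, rfl⟩, hc⟩
    rw [← G.consistent_toEdges_iff hY] at hc
    rcases hk i hi with h | h
    · exact ⟨i, hi, h.1, rfl⟩
    · exact absurd hc h.2
  · rintro ⟨i, hi, h1, rfl⟩
    refine ⟨⟨i, hi, rfl⟩, ?_⟩
    rw [← G.consistent_toEdges_iff hY]
    rcases hk i hi with h | h
    · exact h.2
    · omega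

theorem edgeEnv_inputMem (S T : LTree n) : EdgeEnv G.toEdges (inputMem G S T) := by
  have key : ∀ (f : WEdge n → ℤ) (e : ℕ) (h : e < G.edges.length),
      arrayOf (G.edges.map f) e = f G.edges[e] := by
    intro f e h
    unfold arrayOf
    rw [if_pos (by omega)]
    simp [h]
  refine ⟨rfl, fun e he => ?_, fun e he => ?_, fun e he => ?_⟩
  · rw [G.src_toEdges he]; exact key _ e he
  · rw [G.tgt_toEdges he]; exact key _ e he
  · rw [G.wt_toEdges he]; exact key _ e he

end WGraph

/-! ## The program -/

/-- Sets variable `5` to the length in binary of `M`, the sum of the variables `0`, `2`, `3`, and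
variable `6` to the corresponding power of two. -/
def logarithm : Prog :=
  .assign 5 (.const 0) ;;
  .assign 6 (.const 1) ;;
  .loop (.le (.var 6) (.var 0 + .var 2 + .var 3))
    (.assign 5 (.var 5 + .const 1) ;; .assign 6 (.const 2 * .var 6))

/-- The measure `M + 1 - 2 ^ l` is crude: it admits linearly many rounds although logarithmically
many occur. The available budget is linear anyway. -/
theorem logarithm_spec {B Y' M a b c : ℕ} {s : Mem} (h0 : s.var 0 = a) (h2 : s.var 2 = b)
    (h3 : s.var 3 = c) (hM : a + b + c = M) (hB : 2 ^ M.size + M + 2 ≤ B) (hY : M + 2 ≤ Y') :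
    WP B Y' logarithm s fun s' => s'.var 5 = M.size ∧ s'.var 6 = 2 ^ M.size := by
  have hY1 : 1 ≤ Y' := by omega
  have hpow : ∀ l ≤ M.size, (2 : ℕ) ^ l + M + 2 ≤ B := fun l hl => by
    have := Nat.pow_le_pow_right (n := 2) (by norm_num) hl; omega
  have hsz := Nat.lt_size_self M
  have hsz' : M.size ≤ M := Nat.size_le.2 Nat.lt_two_pow_self
  refine WP.seq (WP.assign hY1 (by simp) (WP.seq (WP.assign hY1 (by simp; omega) ?_)))
  refine WP.loop (Y := 1) le_rfl
    (fun s' => ∃ l : ℕ, l ≤ M.size ∧ s'.var 5 = l ∧ s'.var 6 = ((2 ^ l : ℕ) : ℤ) ∧ s'.var 0 = a ∧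
      s'.var 2 = b ∧ s'.var 3 = c) (fun s' => M + 1 - (s'.var 6).toNat)
    ⟨0, by omega, by simp, by simp, by simpa using h0, by simpa using h2, by simpa using h3⟩ ?_ ?_ ?_
  · rintro s' - ⟨l, hl, e5, e6, e0, e2, e3⟩ hc
    simp only [Cond.Holds, Expr.eval_hadd, Expr.eval_var, e6, e0, e2, e3] at hc
    have hl' : 2 ^ l ≤ M := by omega
    have hlt := Nat.lt_size.2 hl'
    have hp := hpow (l + 1) hlt
    rw [pow_succ] at hp
    have hpos := Nat.one_le_two_pow (n := l)
    refine WP.seq (WP.assign le_rfl ?_ (WP.assign le_rfl ?_ ?_))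
    · simp only [Expr.eval_hadd, Expr.eval_var, Expr.eval_const, e5]
      rw [abs_le]; omega
    · simp only [Expr.eval_hmul, Expr.eval_var, Expr.eval_const, Mem.setVar_var, e6]
      norm_num
      have : ((2 ^ l : ℕ) : ℤ) = 2 ^ l := by push_cast; rfl
      omega
    · refine ⟨⟨l + 1, hlt, by simp [e5], ?_, by simp [e0], by simp [e2], by simp [e3]⟩, ?_⟩
      · simp [e6, pow_succ, mul_comm]
      · simp only [Expr.eval_hmul, Expr.eval_var, Expr.eval_const, Mem.setVar_var, e6]
        norm_num
        have : ((2 ^ l : ℕ) : ℤ) = 2 ^ l := by push_cast; rfl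
        omega
  · simp; omega
  · rintro s' ⟨l, hl, e5, e6, e0, e2, e3⟩ hc
    simp only [Cond.Holds, Expr.eval_hadd, Expr.eval_var, e6, e0, e2, e3] at hc
    have : ¬ l < M.size := fun h => hc (by have := Nat.lt_size.1 h; omega)
    obtain rfl : l = M.size := by omega
    exact ⟨e5, by rw [e6]; push_cast; rfl⟩

theorem relabel_of_length_le {l : List ℕ} {c a : ℕ} (h : l.length ≤ a) : relabel l c a = a + c :=
  dif_neg (by omega)

/-- The tree `X` in memory: parents in array `a`, homes in array `b`, and the tables computed by
`layout` in the arrays from `c` on. -/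
structure StoredTree {n L : ℕ} (X : Laid n L) (a b c : ℕ) (s : Mem) : Prop where
  par : ∀ j : ℤ, 0 ≤ j → j < X.N → s.arr a j = X.p j
  home : ∀ v : ℕ, v < n → s.arr b v = X.home v
  size : ∀ j : ℤ, -1 ≤ j → j < X.N → s.arr (4 + c) j = X.size j
  pos : s.arr (12 + c) = X.pos
  st : s.arr (13 + c) = X.st
  en : s.arr (14 + c) = X.en

theorem StoredTree.agree {n L a b c : ℕ} {X : Laid n L} {s s' : Mem} {V A : List ℕ}
    (h : StoredTree X a b c s) (hs : Agree V A s s')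
    (hA : ∀ x ∈ [a, b, 4 + c, 12 + c, 13 + c, 14 + c], x ∉ A) : StoredTree X a b c s' := by
  obtain ⟨h1, h2, h3, h4, h5, h6⟩ := h
  constructor
  · rwa [hs.2 a (hA a (by simp))]
  · rwa [hs.2 b (hA b (by simp))]
  · rwa [hs.2 _ (hA _ (by simp))]
  · rwa [hs.2 _ (hA _ (by simp))]
  · rwa [hs.2 _ (hA _ (by simp))]
  · rwa [hs.2 _ (hA _ (by simp))]

theorem StoredTree.setVar {n L a b c : ℕ} {X : Laid n L} {s : Mem} (h : StoredTree X a b c s) (x : ℕ)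
    (z : ℤ) : StoredTree X a b c (s.setVar x z) :=
  ⟨h.par, h.home, h.size, h.pos, h.st, h.en⟩

theorem StoredTree.loaded {n L a b c k : ℕ} {X : Laid n L} {s : Mem} (h : StoredTree X a b c s)
    {ρ : ℕ → ℕ} (hρ : [k, k + 1, k + 2, k + 3, k + 4].map ρ = [b, 4 + c, 12 + c, 13 + c, 14 + c]) :
    Loaded X k (s.view ρ) := by
  simp only [List.map_cons, List.map_nil, List.cons.injEq, and_true] at hρ
  obtain ⟨e0, e1, e2, e3, e4⟩ := hρ
  constructor
  · simpa only [Mem.view, e0] using h.home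
  · intro j h0 h1
    have := h.size j (by omega) h1
    rw [Laid.size, if_neg (by omega)] at this
    simpa only [Mem.view, e1] using this
  · intro j _ _
    simp only [Mem.view, e2, h.pos]
  · simp only [Mem.view, e3, h.st]
  · simp only [Mem.view, e4, h.en]

theorem StoredTree.side {n L a b c k M : ℕ} {X : Laid n L} {s : Mem} (h : StoredTree X a b c s)
    {ρ : ℕ → ℕ} {d e : ℕ} {z f : ℤ → ℤ}
    (hρ : [k, k + 1, k + 2, k + 3, k + 4].map ρ = [a, b, 4 + c, d, e])
    (hz : ∀ j : ℤ, 0 ≤ j → j < X.N → s.arr d j = z j)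
    (hz' : ∀ j : ℤ, 0 ≤ j → j < X.N → -1 ≤ z j ∧ z j < M)
    (hf : s.arr e = f) (hf' : ∀ j : ℕ, j < X.N → f j = 0 ∨ f j = 1) :
    Side X M z f k (s.view ρ) := by
  simp only [List.map_cons, List.map_nil, List.cons.injEq, and_true] at hρ
  obtain ⟨e0, e1, e2, e3, e4⟩ := hρ
  refine ⟨?_, ?_, ?_, ?_, hz', ?_, hf'⟩
  · simpa only [Mem.view, e0] using h.par
  · simpa only [Mem.view, e1] using h.home
  · simpa only [Mem.view, e2] using h.size
  · simpa only [Mem.view, e3] using hz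
  · intro j _ _
    simp only [Mem.view, e4, hf]

/-- The program `layout` writes only arrays with names from `2` on, so the renaming to `a`, `b` and
a shift by `c` leaves the input pointers in place and puts all tables into a fresh block. -/
theorem layout_rename_spec {n L Z B Y' a b c : ℕ} {T : LTree n} {F : Finset (Finset (Fin n))}
    {s : Mem} (hT : T.Represents F) (hF : IsLaminar F) (hab : a ≠ b) (hac : a < c) (hbc : b < c)
    (h0 : s.var 0 = n) (h5 : s.var 5 = L) (h10 : s.var 10 = T.size)
    (ha : ∀ i : Fin T.size, s.arr a ((i : ℕ) : ℤ) = code (T.parent i))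
    (hb : ∀ v : Fin n, s.arr b ((v : ℕ) : ℤ) = code (T.home v))
    (hc : ∀ k, 2 ≤ k → k ≤ 14 → ∀ j, s.arr (k + c) j = 0)
    (hnL : n < 2 ^ L) (hZ : n + T.size + 2 ^ L + 10 ≤ Z) (hZB : Z ^ 2 ≤ B)
    (hY : (n + T.size + 2) * (L + 2) ≤ Y') :
    WP B Y' (layout.rename (relabel [a, b] c)) s fun s' => ∃ X : Laid n L, X.N = T.size ∧
      (∀ A, A ∈ F ↔ ∃ i : ℕ, i < X.N ∧ X.set i = A) ∧ StoredTree X a b c s' := by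
  have hinj : Function.Injective (relabel [a, b] c) :=
    relabel_injective (by simp [hab]) (by simp [hac, hbc])
  have hview : ∀ (s : Mem) k, 2 ≤ k → (s.view (relabel [a, b] c)).arr k = s.arr (k + c) := by
    intro s k hk
    exact congrArg s.arr (relabel_of_length_le hk)
  have hpar : ∀ j : ℤ, 0 ≤ j → j < T.size → s.arr a j = T.par j := by
    intro j h0 h1
    obtain ⟨i, rfl⟩ := Int.eq_ofNat_of_zero_le h0
    exact (ha ⟨i, by omega⟩).trans (T.par_coe ⟨i, by omega⟩).symm
  have hhome : ∀ v : ℕ, v < n → s.arr b v = T.homeCode v := fun v hv =>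
    (hb ⟨v, hv⟩).trans (T.homeCode_coe ⟨v, hv⟩).symm
  refine WP.rename hinj (layout_spec (hT.forest hF) h0 h10 h5 hnL hZ hZB LTree.homeCode_range
    (fun _ _ _ => rfl) hpar hhome
    (fun k h h' j => by rw [hview s k h]; exact hc k h h' j) hY) ?_
  rintro s' hag ⟨-, q4, q4', hl⟩
  have hwa : ∀ x ∈ layout.wa, 2 ≤ x := by decide
  have hkeep : ∀ x < c, s'.arr x = s.arr x := by
    refine fun x hx => hag.2 x fun h => ?_
    obtain ⟨y, hy, rfl⟩ := List.mem_map.1 h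
    have := hwa y hy
    rw [relabel_of_length_le (show [a, b].length ≤ y from this)] at hx
    omega
  refine ⟨LTree.laid hT hF hl, rfl, LTree.mem_iff_exists_set_laid hT hF hl, ?_, ?_, ?_, ?_, ?_, ?_⟩
  · rw [hkeep a hac]; exact hpar
  · rw [hkeep b hbc]; exact hhome
  · intro j hj0 hj1
    rw [← hview s' 4 (by norm_num), Laid.size]
    split
    · obtain rfl : j = -1 := by omega
      exact q4'
    · exact q4 j (by omega) hj1
  · exact (hview s' 12 (by norm_num)).symm
  · exact (hview s' 13 (by norm_num)).symm
  · exact (hview s' 14 (by norm_num)).symm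

/-- The passes that find the smallest supersets and the consistent sets of one tree. -/
theorem passes_spec {n L Z B Y' : ℕ} {E : Edges n} {X Y : Laid n L} {s : Mem} {ρ σ : ℕ → ℕ}
    (hρ : Function.Injective ρ) (hσ : Function.Injective σ) (hρσ : ∀ a ≤ 13, ρ a = σ a)
    (hdisj : ∀ a ∈ supersets.wa, ∀ b, 20 ≤ b → b ≤ 27 → ρ a ≠ σ b)
    (h : RunEnv X Y (s.view ρ)) (d : EdgeEnv E (s.view σ))
    (hzρ : ∀ a, 20 ≤ a → a ≤ 27 → ∀ j, s.arr (ρ a) j = 0)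
    (hzσ : ∀ a, 20 ≤ a → a ≤ 27 → ∀ j, s.arr (σ a) j = 0)
    (hZ : n + E.m + X.N + Y.N + 2 ^ L + 10 ≤ Z) (hw : ∀ e < E.m, E.wt e ≤ Z) (hZB : Z ^ 12 ≤ B)
    (hYL : Y.N < 2 ^ L) (hY' : 30 * (n + E.m + X.N + Y.N + 1) * (L + 1) ^ 5 ≤ Y') :
    WP B Y' (supersets.rename ρ ;; consistents.rename σ) s fun s' =>
      ∃ z, X.Supersets Y z ∧ s'.arr (ρ 13) = z ∧ X.Marks E Y (s'.arr (σ 14)) := by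
  have hwa : ∀ a ∈ supersets.wa, 13 ≤ a := by decide
  have hY1 : 30 * (n + X.N + Y.N + 1) * (L + 1) ^ 5 ≤ Y' :=
    le_trans (Nat.mul_le_mul_right _ (by omega)) hY'
  refine WP.seq (WP.rename hρ (supersets_spec h hzρ (by omega) hZB hYL hY1)
    fun s1 ha1 (q1 : X.Supersets Y (s1.arr (ρ 13))) => ?_)
  -- The first pass writes no array named below `13`, and the two renamings agree up to `13`; so the
  -- second pass finds the same inputs, with the smallest supersets added.
  have hkeep : ∀ a ≤ 12, s1.arr (σ a) = s.arr (ρ a) := by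
    intro a ha
    rw [← hρσ a (by omega)]
    refine ha1.2 _ fun hm => ?_
    obtain ⟨b, hb, he⟩ := List.mem_map.1 hm
    have := hwa b hb
    have := hρ he
    omega
  have hL : ∀ a ≤ 12, (s1.view σ).arr a = (s.view ρ).arr a := hkeep
  have hv : ∀ x ∈ [0, 1, 5, 6, 7, 8], s1.var x = s.var x := by
    have : ∀ x ∈ [0, 1, 5, 6, 7, 8], x ∉ supersets.wv := by decide
    exact fun x hx => ha1.1 x (this x hx)
  have henv : RunEnv X Y (s1.view σ) := by
    obtain ⟨h0, h5, h6, h7, h8, hl, hr⟩ := h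
    exact ⟨(hv 0 (by decide)).trans h0, (hv 5 (by decide)).trans h5, (hv 6 (by decide)).trans h6,
      (hv 7 (by decide)).trans h7, (hv 8 (by decide)).trans h8,
      hl.congr fun a _ _ => hL a (by omega), hr.congr fun a _ _ => hL a (by omega)⟩
  have hedge : EdgeEnv E (s1.view σ) := by
    obtain ⟨h1, h2, h3, h4⟩ := d
    have hk : ∀ a ≤ 2, (s1.view σ).arr a = (s.view σ).arr a := fun a ha => by
      rw [hL a (by omega)]
      exact congrArg s.arr (hρσ a (by omega))
    exact ⟨(hv 1 (by decide)).trans h1, by rwa [hk 0 (by norm_num)], by rwa [hk 1 (by norm_num)],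
      by rwa [hk 2 (by norm_num)]⟩
  refine WP.rename hσ (consistents_spec henv hedge q1
    (fun U _ _ => congrArg (fun a => s1.arr a U) (hρσ 13 le_rfl).symm) (fun a h1 h2 j => ?_)
    hZ hw hZB hYL hY') ?_
  · change s1.arr (σ a) j = 0
    rw [ha1.2 (σ a) fun hm => ?_, hzσ a h1 h2]
    obtain ⟨b, hb, he⟩ := List.mem_map.1 hm
    exact hdisj b hb a h1 h2 he
  · intro s2 ha2 q2
    refine ⟨s1.arr (ρ 13), q1, ha2.2 _ fun hm => ?_, q2⟩
    obtain ⟨b, hb, he⟩ := List.mem_map.1 hm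
    rw [hρσ 13 le_rfl] at he
    have := hσ he
    subst this
    revert hb
    decide

end LaminarMerge

namespace LaminarMerge

/-! ## Merging two laminar families -/

/-- Computes the layouts of both trees. -/
def prepare : Prog :=
  logarithm ;;
  .assign 10 (.var 2) ;;
  layout.rename (relabel [3, 4] 100) ;;
  .assign 10 (.var 3) ;;
  layout.rename (relabel [5, 6] 200)

/-- The lists name the edge arrays, then homes, sizes, positions and intervals of the tree under
test and of the other tree, and finally the results: `300` for the smallest supersets, `301` for the
marks. All scratch arrays are shifted into blocks that are still zero. -/
def passesLeft : Prog :=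
  .assign 7 (.var 2) ;;
  .assign 8 (.var 3) ;;
  supersets.rename (relabel [0, 1, 2, 4, 104, 112, 113, 114, 6, 204, 212, 213, 214, 300] 400) ;;
  consistents.rename
    (relabel [0, 1, 2, 4, 104, 112, 113, 114, 6, 204, 212, 213, 214, 300, 301] 500)

/-- The same passes with the roles of the trees exchanged; the results go to `310` and `311`, and
the scratch arrays to new blocks. -/
def passesRight : Prog :=
  .assign 7 (.var 3) ;;
  .assign 8 (.var 2) ;;
  supersets.rename (relabel [0, 1, 2, 6, 204, 212, 213, 214, 4, 104, 112, 113, 114, 310] 600) ;;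
  consistents.rename
    (relabel [0, 1, 2, 6, 204, 212, 213, 214, 4, 104, 112, 113, 114, 310, 311] 700)

/-- Computes a tree for the sets of either tree that are consistent with the other tree. -/
def mergeLaminar : Prog :=
  prepare ;;
  passesLeft ;;
  passesRight ;;
  -- Names `0` to `4` and `10` to `14` of `merge` become the two sides. Names `5` and `6` become the
  -- output arrays `7` and `8`, and `7` to `9` merely fill the gap.
  merge.rename (relabel [3, 4, 104, 300, 301, 7, 8, 800, 801, 802, 5, 6, 204, 310, 311] 900)

/-- The input, the layouts of both trees, and unused arrays from `400` on. -/
structure Prepared {n L : ℕ} (E : Edges n) (X Y : Laid n L) (s : Mem) : Prop where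
  v0 : s.var 0 = n
  v2 : s.var 2 = X.N
  v3 : s.var 3 = Y.N
  v5 : s.var 5 = L
  v6 : s.var 6 = 2 ^ L
  edges : EdgeEnv E s
  left : StoredTree X 3 4 100 s
  right : StoredTree Y 5 6 200 s

theorem Prepared.agree {n L : ℕ} {E : Edges n} {X Y : Laid n L} {s s' : Mem} {V A : List ℕ}
    (h : Prepared E X Y s) (hs : Agree V A s s') (hV : ∀ x ∈ [0, 1, 2, 3, 5, 6], x ∉ V)
    (hA : ∀ a ∈ A, 300 ≤ a) : Prepared E X Y s' := by
  obtain ⟨h0, h2, h3, h5, h6, he, hl, hr⟩ := h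
  have hA' : ∀ a < 300, a ∉ A := fun a ha h => by have := hA a h; omega
  refine ⟨?_, ?_, ?_, ?_, ?_, he.agree hs (hV 1 (by decide)) fun a ha => ?_, hl.agree hs ?_,
    hr.agree hs ?_⟩
  · rw [hs.1 0 (hV 0 (by decide)), h0]
  · rw [hs.1 2 (hV 2 (by decide)), h2]
  · rw [hs.1 3 (hV 3 (by decide)), h3]
  · rw [hs.1 5 (hV 5 (by decide)), h5]
  · rw [hs.1 6 (hV 6 (by decide)), h6]
  · have := hA a ha; omega
  · exact fun x hx => hA' x (by revert x; decide)
  · exact fun x hx => hA' x (by revert x; decide)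

variable {n Z B Y' L : ℕ}

theorem prepare_spec {G : WGraph n} {S T : LTree n} {FX FY : Finset (Finset (Fin n))}
    (hX : IsLaminar FX) (hY : IsLaminar FY) (hS : S.Represents FX) (hT : T.Represents FY)
    (hL : L = (n + S.size + T.size).size)
    (hZ : n + S.size + T.size + 2 ^ L + 10 ≤ Z) (hZB : Z ^ 2 ≤ B)
    (hY' : (n + S.size + T.size + 2) * (L + 2) ≤ Y') :
    WP B Y' prepare (inputMem G S T) fun s => ∃ X Y : Laid n L, X.N = S.size ∧ Y.N = T.size ∧
      (∀ A, A ∈ FX ↔ ∃ i : ℕ, i < X.N ∧ X.set i = A) ∧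
      (∀ A, A ∈ FY ↔ ∃ i : ℕ, i < Y.N ∧ Y.set i = A) ∧ Prepared G.toEdges X Y s := by
  have hZB' : Z ≤ B := by nlinarith
  have hY1 : n + S.size + T.size + 2 ≤ Y' := le_trans (Nat.le_mul_of_pos_right _ (by omega)) hY'
  have hlt : n + S.size + T.size < 2 ^ L := hL ▸ Nat.lt_size_self _
  set s0 := inputMem G S T with hs0
  refine WP.seq ((logarithm_spec (M := n + S.size + T.size) (a := n) (b := S.size) (c := T.size)
    rfl rfl rfl rfl (by rw [← hL]; omega) hY1).mono fun s1 ha1 q1 => ?_)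
  rw [← hL] at q1
  have v1 : ∀ x < 4, s1.var x = s0.var x := fun x hx => ha1.1 x (by revert x; decide)
  have a1 : ∀ a, s1.arr a = s0.arr a := fun a => ha1.2 a (by simp [logarithm, Prog.wa])
  have e2 : s1.var 2 = S.size := v1 2 (by norm_num)
  have e3 : s1.var 3 = T.size := v1 3 (by norm_num)
  refine WP.seq (WP.assign (by omega) (by rw [Expr.eval_var, e2, abs_le]; omega) ?_)
  rw [Expr.eval_var, e2]
  refine WP.seq ((layout_rename_spec (s := s1.setVar 10 S.size) hS hX (by norm_num) (by norm_num)
    (by norm_num) (v1 0 (by norm_num)) q1.1 rfl (fun i => ?_) (fun v => ?_) (fun k _ _ j => ?_)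
    (by omega) (by omega) hZB (le_trans (Nat.mul_le_mul_right _ (by omega)) hY')).mono
    fun s2 ha2 q2 => ?_)
  · exact (congrFun (a1 3) _).trans (arrayOf_ofFn _ i)
  · exact (congrFun (a1 4) _).trans (arrayOf_ofFn _ v)
  · change s1.arr (k + 100) j = 0
    rw [a1]; rfl
  obtain ⟨X, hXN, hXF, hXs⟩ := q2
  have v2 : ∀ x < 7, s2.var x = s1.var x := fun x hx => by
    rw [ha2.1 x (by revert x; decide), Mem.setVar_var, if_neg (by omega)]
  have hwa : ∀ a ∈ (layout.rename (relabel [3, 4] 100)).wa, 102 ≤ a ∧ a ≤ 114 := by decide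
  have a2 : ∀ a, a < 102 ∨ 114 < a → s2.arr a = s0.arr a := fun a h => by
    rw [ha2.2 a (fun hm => by have := hwa a hm; omega)]
    exact a1 a
  have f3 : s2.var 3 = T.size := (v2 3 (by norm_num)).trans e3
  refine WP.seq (WP.assign (by omega) (by rw [Expr.eval_var, f3, abs_le]; omega) ?_)
  rw [Expr.eval_var, f3]
  refine (layout_rename_spec (s := s2.setVar 10 T.size) hT hY (by norm_num) (by norm_num)
    (by norm_num) ((v2 0 (by norm_num)).trans (v1 0 (by norm_num)))
    ((v2 5 (by norm_num)).trans q1.1) rfl (fun i => ?_) (fun v => ?_) (fun k _ _ j => ?_)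
    (by omega) (by omega) hZB (le_trans (Nat.mul_le_mul_right _ (by omega)) hY')).mono
    fun s3 ha3 q3 => ?_
  · exact (congrFun (a2 5 (by norm_num)) _).trans (arrayOf_ofFn _ i)
  · exact (congrFun (a2 6 (by norm_num)) _).trans (arrayOf_ofFn _ v)
  · change s2.arr (k + 200) j = 0
    rw [a2 _ (by omega)]; rfl
  obtain ⟨Y, hYN, hYF, hYs⟩ := q3
  have v3 : ∀ x < 7, s3.var x = s2.var x := fun x hx => by
    rw [ha3.1 x (by revert x; decide), Mem.setVar_var, if_neg (by omega)]
  have hwa' : ∀ a ∈ (layout.rename (relabel [5, 6] 200)).wa, 202 ≤ a := by decide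
  have a3 : ∀ a < 202, s3.arr a = s2.arr a := fun a h =>
    ha3.2 a fun hm => by have := hwa' a hm; omega
  have w : ∀ x < 4, s3.var x = s0.var x := fun x hx => by
    rw [v3 x (by omega), v2 x (by omega), v1 x hx]
  have hE := G.edgeEnv_inputMem S T
  refine ⟨X, Y, hXN, hYN, hXF, hYF, w 0 (by norm_num), ?_, ?_, ?_, ?_, ?_, ?_, hYs⟩
  · rw [w 2 (by norm_num), hXN]; rfl
  · rw [w 3 (by norm_num), hYN]; rfl
  · rw [v3 5 (by norm_num), v2 5 (by norm_num), q1.1]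
  · rw [v3 6 (by norm_num), v2 6 (by norm_num), q1.2]
  · have h : ∀ a ≤ 2, s3.arr a = s0.arr a := fun a ha => by
      rw [a3 a (by omega), a2 a (by omega)]
    obtain ⟨h1, h2, h3, h4⟩ := hE
    exact ⟨(w 1 (by norm_num)).trans h1, by rwa [h 0 (by norm_num)], by rwa [h 1 (by norm_num)],
      by rwa [h 2 (by norm_num)]⟩
  · refine hXs.agree (s := s2) (V := (layout.rename (relabel [5, 6] 200)).wv ++ [10])
      (A := (layout.rename (relabel [5, 6] 200)).wa) ⟨fun x hx => ?_, fun a ha => ?_⟩ (by decide)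
    · rw [List.mem_append, not_or, List.mem_singleton] at hx
      rw [ha3.1 x hx.1, Mem.setVar_var, if_neg hx.2]
    · exact ha3.2 a ha

theorem passesLeft_spec {E : Edges n} {X Y : Laid n L} {s : Mem} (h : Prepared E X Y s)
    (hz : ∀ a, 400 ≤ a → ∀ j, s.arr a j = 0)
    (hZ : n + E.m + X.N + Y.N + 2 ^ L + 10 ≤ Z) (hw : ∀ e < E.m, E.wt e ≤ Z) (hZB : Z ^ 12 ≤ B)
    (hYL : Y.N < 2 ^ L) (hY' : 30 * (n + E.m + X.N + Y.N + 1) * (L + 1) ^ 5 ≤ Y') :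
    WP B Y' passesLeft s fun s' =>
      ∃ z, X.Supersets Y z ∧ s'.arr 300 = z ∧ X.Marks E Y (s'.arr 301) := by
  have hZB' : Z ≤ B := le_trans (Nat.le_self_pow (by norm_num) _) hZB
  have hY1 : 1 ≤ Y' := le_trans (Nat.mul_pos (by omega) (by positivity)) hY'
  obtain ⟨v0, v2, v3, v5, v6, he, hl, hr⟩ := h
  refine WP.seq (WP.assign hY1 (by rw [Expr.eval_var, v2, abs_le]; omega) ?_)
  refine WP.seq (WP.assign hY1 (by simp [v3]; omega) ?_)
  refine passes_spec (relabel_injective (by decide) (by decide))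
    (relabel_injective (by decide) (by decide)) (by decide) ?_ ?_ ?_ ?_ ?_ hZ hw hZB hYL hY'
  · intro a ha b h1 h2
    rw [relabel_of_length_le (a := b) (by simp; omega)]
    have : relabel [0, 1, 2, 4, 104, 112, 113, 114, 6, 204, 212, 213, 214, 300] 400 a < 500 := by
      revert a; decide
    omega
  · exact ⟨v0, v5, v6, by simp [Mem.view, v2], by simp [Mem.view, v3],
      ((hl.setVar _ _).setVar _ _).loaded rfl, ((hr.setVar _ _).setVar _ _).loaded rfl⟩
  · obtain ⟨e1, e2, e3, e4⟩ := he
    exact ⟨e1, e2, e3, e4⟩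
  · intro a h1 h2
    rw [relabel_of_length_le (by simp; omega)]
    exact hz _ (by omega)
  · intro a h1 h2
    rw [relabel_of_length_le (by simp; omega)]
    exact hz _ (by omega)

theorem passesRight_spec {E : Edges n} {X Y : Laid n L} {s : Mem} (h : Prepared E X Y s)
    (hz : ∀ a, 600 ≤ a → ∀ j, s.arr a j = 0)
    (hZ : n + E.m + Y.N + X.N + 2 ^ L + 10 ≤ Z) (hw : ∀ e < E.m, E.wt e ≤ Z) (hZB : Z ^ 12 ≤ B)
    (hYL : X.N < 2 ^ L) (hY' : 30 * (n + E.m + Y.N + X.N + 1) * (L + 1) ^ 5 ≤ Y') :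
    WP B Y' passesRight s fun s' =>
      ∃ z, Y.Supersets X z ∧ s'.arr 310 = z ∧ Y.Marks E X (s'.arr 311) := by
  have hZB' : Z ≤ B := le_trans (Nat.le_self_pow (by norm_num) _) hZB
  have hY1 : 1 ≤ Y' := le_trans (Nat.mul_pos (by omega) (by positivity)) hY'
  obtain ⟨v0, v2, v3, v5, v6, he, hl, hr⟩ := h
  refine WP.seq (WP.assign hY1 (by rw [Expr.eval_var, v3, abs_le]; omega) ?_)
  refine WP.seq (WP.assign hY1 (by simp [v2]; omega) ?_)
  refine passes_spec (relabel_injective (by decide) (by decide))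
    (relabel_injective (by decide) (by decide)) (by decide) ?_ ?_ ?_ ?_ ?_ hZ hw hZB hYL hY'
  · intro a ha b h1 h2
    rw [relabel_of_length_le (a := b) (by simp; omega)]
    have : relabel [0, 1, 2, 6, 204, 212, 213, 214, 4, 104, 112, 113, 114, 310] 600 a < 700 := by
      revert a; decide
    omega
  · exact ⟨v0, v5, v6, by simp [Mem.view, v3], by simp [Mem.view, v2],
      ((hr.setVar _ _).setVar _ _).loaded rfl, ((hl.setVar _ _).setVar _ _).loaded rfl⟩
  · obtain ⟨e1, e2, e3, e4⟩ := he
    exact ⟨e1, e2, e3, e4⟩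
  · intro a h1 h2
    rw [relabel_of_length_le (by simp; omega)]
    exact hz _ (by omega)
  · intro a h1 h2
    rw [relabel_of_length_le (by simp; omega)]
    exact hz _ (by omega)

end LaminarMerge

namespace LaminarMerge

theorem Laid.Marks.flag {n L : ℕ} {E : Edges n} {X Y : Laid n L} {k : ℤ → ℤ} (h : X.Marks E Y k)
    (j : ℕ) (hj : j < X.N) : k j = 0 ∨ k j = 1 := by
  rcases h j hj with h | h
  · exact Or.inr h.1
  · exact Or.inl h.1

set_option maxRecDepth 4000 in
theorem mergeLaminar_spec {n Z B Y' L : ℕ} {G : WGraph n} {S T : LTree n}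
    {FX FY : Finset (Finset (Fin n))} (hX : IsLaminar FX) (hY : IsLaminar FY)
    (hS : S.Represents FX) (hT : T.Represents FY) (hL : L = (n + S.size + T.size).size)
    (hZ : n + G.m + S.size + T.size + 2 ^ L + 10 ≤ Z) (hw : ∀ e ∈ G.edges, e.wt ≤ Z)
    (hZB : Z ^ 12 ≤ B) (hY' : 30 * (n + G.m + S.size + T.size + 1) * (L + 1) ^ 5 ≤ Y') :
    WP B Y' mergeLaminar (inputMem G S T) fun s => ∃ R : LTree n, HasOutput s R ∧
      R.Represents (G.verify FX FY ∪ G.verify FY FX) := by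
  have hZB' : Z ≤ B := le_trans (Nat.le_self_pow (by norm_num) _) hZB
  have h2L := Nat.one_le_two_pow (n := L)
  have hZB2 : Z ^ 2 ≤ B := le_trans (Nat.pow_le_pow_right (n := Z) (by omega) (by norm_num)) hZB
  have hlt : n + S.size + T.size < 2 ^ L := hL ▸ Nat.lt_size_self _
  have hL5 : L + 1 ≤ (L + 1) ^ 5 := Nat.le_self_pow (by norm_num) _
  have hw' : ∀ e < G.toEdges.m, G.toEdges.wt e ≤ Z := fun e he => by
    rw [G.wt_toEdges he]; exact hw _ (List.getElem_mem he)
  have hYp : (n + S.size + T.size + 2) * (L + 2) ≤ Y' := by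
    refine le_trans ?_ hY'
    calc (n + S.size + T.size + 2) * (L + 2)
        ≤ 30 * (n + G.m + S.size + T.size + 1) * (L + 1) := by
          have : (n + S.size + T.size + 2) * (L + 2) ≤
              (2 * (n + G.m + S.size + T.size + 1)) * (2 * (L + 1)) := by gcongr <;> omega
          nlinarith
      _ ≤ _ := by gcongr
  have hYm : (n + S.size + T.size + 1) * (L + 1) ≤ Y' := by
    refine le_trans ?_ hYp
    gcongr <;> omega
  refine WP.seq ((prepare_spec hX hY hS hT hL (by omega) hZB2 hYp).mono fun s1 ha1 q1 => ?_)
  obtain ⟨X, Y, hXN, hYN, hXF, hYF, p1⟩ := q1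
  rw [← hXN, ← hYN] at hZ hY' hYm hlt
  have z1 : ∀ a, 300 ≤ a → ∀ j, s1.arr a j = 0 := by
    have hwa : ∀ a ∈ prepare.wa, a < 300 := by decide
    intro a ha j
    rw [ha1.2 a fun hm => by have := hwa a hm; omega]
    have : ∀ k, (inputMem G S T).arr (k + 7) j = 0 := fun k => rfl
    obtain ⟨k, rfl⟩ : ∃ k, a = k + 7 := ⟨a - 7, by omega⟩
    exact this k
  refine WP.seq ((passesLeft_spec p1 (fun a ha => z1 a (by omega)) hZ hw' hZB (by omega) hY').mono
    fun s2 ha2 q2 => ?_)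
  obtain ⟨zX, hzX, e300, mX⟩ := q2
  have hwaL : ∀ a ∈ passesLeft.wa, 300 ≤ a ∧ a < 600 ∧ a ≠ 310 ∧ a ≠ 311 := by decide
  have p2 := p1.agree ha2 (by decide) fun a ha => (hwaL a ha).1
  have z2 : ∀ a, 600 ≤ a → ∀ j, s2.arr a j = 0 := fun a ha j => by
    rw [ha2.2 a fun hm => by have := hwaL a hm; omega]; exact z1 a (by omega) j
  have hsw : n + G.m + Y.N + X.N = n + G.m + X.N + Y.N := by omega
  refine WP.seq ((passesRight_spec p2 z2 (by change n + G.m + Y.N + X.N + 2 ^ L + 10 ≤ Z; omega)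
    hw' hZB (by omega) (by
      change 30 * (n + G.m + Y.N + X.N + 1) * (L + 1) ^ 5 ≤ Y'; rwa [hsw])).mono
    fun s3 ha3 q3 => ?_)
  obtain ⟨zY, hzY, e310, mY⟩ := q3
  have hwaR : ∀ a ∈ passesRight.wa, 302 ≤ a ∧ a < 800 := by decide
  have p3 := p2.agree ha3 (by decide) fun a ha => by have := hwaR a ha; omega
  have k3 : ∀ a < 302, s3.arr a = s2.arr a := fun a ha =>
    ha3.2 a fun hm => by have := hwaR a hm; omega
  have z3 : ∀ a, 800 ≤ a → ∀ j, s3.arr a j = 0 := fun a ha j => by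
    rw [ha3.2 a fun hm => by have := hwaR a hm; omega]; exact z2 a (by omega) j
  have sX : Side X Y.N zX (s2.arr 301) 0 (s3.view (relabel
      [3, 4, 104, 300, 301, 7, 8, 800, 801, 802, 5, 6, 204, 310, 311] 900)) :=
    p3.left.side rfl (fun j _ _ => congrFun ((k3 300 (by norm_num)).trans e300) j)
      (fun j h0 h1 => ⟨(hzX j h0 h1).1, (hzX j h0 h1).2.1⟩) (k3 301 (by norm_num)) mX.flag
  have sY : Side Y X.N zY (s3.arr 311) 10 (s3.view (relabel
      [3, 4, 104, 300, 301, 7, 8, 800, 801, 802, 5, 6, 204, 310, 311] 900)) :=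
    p3.right.side rfl (fun j _ _ => congrFun e310 j)
      (fun j h0 h1 => ⟨(hzY j h0 h1).1, (hzY j h0 h1).2.1⟩) rfl mY.flag
  refine WP.rename (relabel_injective (by decide) (by decide)) (merge_spec sX sY p3.v0 p3.v2 p3.v3
    p3.v5 (by omega) (fun a ha j => ?_) (by omega) hYm) ?_
  · refine z3 _ ?_ j
    revert a
    decide
  rintro s4 - ⟨gX, gY, hgX, hgY, hv, hm⟩
  have iX := G.marks_iff hXF hYF mX
  have iY := G.marks_iff hYF hXF mY
  -- The only place where the program needs the uncrossing argument: surviving sets of different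
  -- trees that meet are nested.
  have hlam : ∀ U W : ℕ, U < X.N → W < Y.N → s2.arr 301 U = 1 → s3.arr 311 W = 1 →
      ∀ v ∈ X.set U, v ∈ Y.set W → X.set U ⊆ Y.set W ∨ Y.set W ⊆ X.set U := by
    intro U W hU hW h1 h2 v hvU hvW
    have a1 := G.mem_verify.1 ((iX _).2 ⟨U, hU, h1, rfl⟩)
    have a2 := G.mem_verify.1 ((iY _).2 ⟨W, hW, h2, rfl⟩)
    exact G.subset_or_subset_of_consistent a1.1 a2.1 a1.2 a2.2 ⟨v, Finset.mem_inter.2 ⟨hvU, hvW⟩⟩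
  obtain ⟨R, r1, r2, r3, r4⟩ := exists_tree_of_merged (F := G.verify FX FY ∪ G.verify FY FX)
    mX.flag mY.flag hzX hzY hgX hgY hlam hv hm fun A => by rw [Finset.mem_union, iX, iY]
  exact ⟨R, ⟨r1, r2, r3⟩, r4⟩

/-! ### Bounds on the input and on the running time -/

theorem abs_arrayOf_le {B : ℕ} {l : List ℤ} (h : ∀ z ∈ l, |z| ≤ (B : ℤ)) (i : ℤ) :
    |arrayOf l i| ≤ (B : ℤ) := by
  unfold arrayOf
  split
  · rw [List.getD_eq_getElem?_getD]
    rcases hx : l[i.toNat]? with _ | z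
    · simp
    · exact h z (List.mem_of_getElem? hx)
  · simp

theorem bdd_inputMem {n B w : ℕ} {G : WGraph n} {S T : LTree n} (hw : ∀ e ∈ G.edges, e.wt ≤ w)
    (hB : n + G.m + S.size + T.size + w + 1 ≤ B) : Bdd B (inputMem G S T) := by
  have hc : ∀ {k : ℕ} (o : Option (Fin k)), k ≤ B → |code o| ≤ (B : ℤ) := fun o hk => by
    have := code_range o
    rw [abs_le]; omega
  constructor
  · intro x
    simp only [inputMem]
    split <;> rw [abs_le] <;> omega
  · intro a i
    simp only [inputMem]
    split
    · refine abs_arrayOf_le (fun z hz => ?_) i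
      obtain ⟨e, he, rfl⟩ := List.mem_map.1 hz
      have := e.src.isLt
      rw [abs_le]; omega
    · refine abs_arrayOf_le (fun z hz => ?_) i
      obtain ⟨e, he, rfl⟩ := List.mem_map.1 hz
      have := e.tgt.isLt
      rw [abs_le]; omega
    · refine abs_arrayOf_le (fun z hz => ?_) i
      obtain ⟨e, he, rfl⟩ := List.mem_map.1 hz
      have := hw e he
      rw [abs_le]; omega
    · refine abs_arrayOf_le (fun z hz => ?_) i
      obtain ⟨v, rfl⟩ := (List.mem_ofFn' _ _).1 hz
      exact hc _ (by omega)
    · refine abs_arrayOf_le (fun z hz => ?_) i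
      obtain ⟨v, rfl⟩ := (List.mem_ofFn' _ _).1 hz
      exact hc _ (by omega)
    · refine abs_arrayOf_le (fun z hz => ?_) i
      obtain ⟨v, rfl⟩ := (List.mem_ofFn' _ _).1 hz
      exact hc _ (by omega)
    · refine abs_arrayOf_le (fun z hz => ?_) i
      obtain ⟨v, rfl⟩ := (List.mem_ofFn' _ _).1 hz
      exact hc _ (by omega)
    · simp

/-- The program runs in near-linear time. -/
theorem time_le {n m a b w l L Z : ℕ} (ha : a ≤ 2 * n) (hb : b ≤ 2 * n)
    (hl : l = Nat.log 2 (n + m + w + 2)) (hL : L = (n + a + b).size)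
    (hZ : Z = n + m + a + b + 2 ^ L + 10 + w) (c : ℕ) :
    c * (30 * (n + m + a + b + 1) * (L + 1) ^ 5) * bitBound (Z ^ 12) ≤
      c * (30 * 5 * 6 ^ 5 * 73) * (n + m + 1) * l ^ 6 := by
  have hl1 : 1 ≤ l := by rw [hl]; exact Nat.log_pos (by norm_num) (by omega)
  have hlog : n + m + w + 2 < 2 ^ (l + 1) := by rw [hl]; exact Nat.lt_pow_succ_log_self (by norm_num) _
  have hp : 2 ^ (l + 5) = 16 * 2 ^ (l + 1) := by rw [pow_add, pow_add]; ring
  have h2L : 2 ^ L ≤ 2 * (n + a + b) + 1 := by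
    rcases Nat.eq_zero_or_pos L with h | h
    · rw [h]; omega
    · obtain ⟨k, rfl⟩ : ∃ k, L = k + 1 := ⟨L - 1, by omega⟩
      have := Nat.lt_size.1 ((Nat.lt_succ_self k).trans_eq hL)
      rw [pow_succ]; omega
  -- With `a` and `b` at most `2n` one has `2 ^ L ≤ 10 n + 1`, which is below `16 * 2 ^ (l + 1)`. As
  -- `l ≥ 1`, this gives `L + 1 ≤ 6 l`.
  have hLl : L < l + 5 := (Nat.pow_lt_pow_iff_right (by norm_num : 1 < 2)).1 (by omega)
  have hZl : Z < 2 ^ (l + 5) := by omega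
  -- The constant `73` arises from `12 * (l + 5) + 2 ≤ 73 * l + 1` for `l ≥ 1`.
  have hbit : bitBound (Z ^ 12) ≤ 73 * l := by
    have : (Z ^ 12).size ≤ (l + 5) * 12 := by
      rw [Nat.size_le, pow_mul]
      exact Nat.pow_lt_pow_left hZl (by norm_num)
    unfold bitBound
    omega
  calc c * (30 * (n + m + a + b + 1) * (L + 1) ^ 5) * bitBound (Z ^ 12)
      ≤ c * (30 * (5 * (n + m + 1)) * (6 * l) ^ 5) * (73 * l) := by gcongr <;> omega
    _ = _ := by ring

end LaminarMerge
open LaminarMerge in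
theorem mainTheorem5 :
    ∃ (P : Prog) (C k : ℕ),
      ∀ (n : ℕ) (G : WGraph n) (X Y : Finset (Finset (Fin n))),
        IsLaminar X → IsLaminar Y →
        (∀ A, G.VerifyReturns X Y A ↔ A = G.verify X Y) ∧
        (∀ A, G.VerifyReturns Y X A ↔ A = G.verify Y X) ∧
        IsLaminar (G.verify X Y ∪ G.verify Y X) ∧
        G.verify X Y ∪ G.verify Y X ⊆ X ∪ Y ∧
        (∀ U ∈ X ∪ Y, G.IsExtreme U → U ∈ G.verify X Y ∪ G.verify Y X) ∧
        ∀ (S T : LTree n), S.Represents X → T.Represents Y →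
          ∀ wmax : ℕ, (∀ e ∈ G.edges, e.wt ≤ wmax) →
            ∃ (R : LTree n) (s : Mem) (t : ℕ),
              Exec P (inputMem G S T) s t ∧
              t ≤ C * (n + G.m + 1) * Nat.log 2 (n + G.m + wmax + 2) ^ k ∧
              HasOutput s R ∧
              R.Represents (G.verify X Y ∪ G.verify Y X) := by
  refine ⟨mergeLaminar, mergeLaminar.ct * (30 * 5 * 6 ^ 5 * 73), 6, fun n G X Y hX hY =>
    ⟨G.verifyReturns_iff X Y, G.verifyReturns_iff Y X, G.isLaminar_verify_union hX hY,
      Finset.union_subset_union (G.verify_subset X Y) (G.verify_subset Y X),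
      fun U hU h => G.mem_verify_union_of_isExtreme hU h, fun S T hS hT wmax hw => ?_⟩⟩
  -- A representing tree has as many proper nodes as the family has members, so laminarity makes the
  -- tree sizes linear in `n`.
  have hSn : S.size ≤ 2 * n := hS.size_eq.trans_le hX.card_le
  have hTn : T.size ≤ 2 * n := hT.size_eq.trans_le hY.card_le
  obtain ⟨L, hL⟩ : ∃ L, L = (n + S.size + T.size).size := ⟨_, rfl⟩
  obtain ⟨Z, hZ⟩ : ∃ Z, Z = n + G.m + S.size + T.size + 2 ^ L + 10 + wmax := ⟨_, rfl⟩
  have h2L := Nat.one_le_two_pow (n := L)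
  have hZB : Z ≤ Z ^ 12 := Nat.le_self_pow (by norm_num) _
  -- The uniform bound on stored integers is taken to be exactly `Z ^ 12`, and the iteration budget
  -- is the left-hand side of its own hypothesis; both are fixed by the two `le_rfl`.
  obtain ⟨s, t, he, ht, -, R, hR, hR'⟩ := mergeLaminar_spec (Z := Z) hX hY hS hT hL (by omega)
    (fun e h => (hw e h).trans (by omega)) le_rfl le_rfl (bdd_inputMem hw (by omega))
  exact ⟨R, s, t, he, ht.trans (time_le hSn hTn rfl hL hZ _), hR, hR'⟩
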